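/- Let $(\Omega,\mathcal F,\mathbb P)$ be a probability space with a filtration $\mathbb F=(\mathcal F_t)_{t\ge 0}$ satisfying the usual hypotheses, and let $W_1,W_2$ be two independent Brownian motions with respect to $\mathbb F$ (adapted, with the increments of the pair $(W_1,W_2)$ independent of the past). Let $B\ge 0$, $R>0$ with $R\ge B$, $\beta_1,\beta_2>0$, $\rho\in(0,1)$, $\gamma\in[0,1)$, $\sigma>1$, $\theta>0$, and put $M=\max\{2,\tfrac{1}{\gamma(\sigma-1)}\}$ if $\gamma>0$, $M=2$ if $\gamma=0$. Assume that $$\theta>(\sigma-1)\Big(-\gamma\rho-\tfrac12(\gamma\beta_2^2-\beta_1^2)+M(\sigma-1)(\beta_1^2+\gamma^2\beta_2^2)\Big)\quad\text{if }\rho+\tfrac12(\beta_2^2-\beta_1^2)\le 0,$$ $$\theta>(\sigma-1)\Big(\tfrac12\beta_1^2(1-\gamma)+M(\sigma-1)(\beta_1^2+\gamma^2\beta_2^2)\Big)\quad\text{if }\rho+\tfrac12(\beta_2^2-\beta_1^2)>0.$$ For $k_0,h_0>0$, let $\mathcal A(k_0,h_0)$ be the set of progressively measurable processes $c=(c_t)_{t\ge0}$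 with almost surely locally integrable trajectories and $c>0$ $\mathbb P\otimes\mathrm dt$-a.e., such that the (unique) solutions $k,h$ of $$\mathrm dk_t=(Bk_t-c_t)\,\mathrm dt+\beta_1k_t\,\mathrm dW_{1,t},\qquad \mathrm dh_t=\rho(c_t-h_t)\,\mathrm dt+\beta_2h_t\,\mathrm dW_{2,t}$$ starting from $k_0$ and $h_0$ satisfy: almost surely, $k_t>0$ and $h_t>0$ for all $t\ge 0$; and $c\le Rk$ $\mathbb P\otimes\mathrm dt$-a.e. Let $$V(k_0,h_0)=\sup_{c\in\mathcal A(k_0,h_0)}\mathbb E\bigg[\int_0^\infty\frac{e^{-\theta t}}{1-\sigma}\Big(\frac{c_t}{h_t^{\gamma}}\Big)^{1-\sigma}\mathrm dt\bigg]\in[-\infty,0].$$ Suppose that $\gamma(\sigma-1)\le 1$. Then $V$ satisfies the dynamic programming principle: for every $(k_0,h_0)\in(0,\infty)^2$ and every $\mathbb F$-stopping time $\tau$ with values in $[0,\infty]$, which may depend on the control (that is, for every family $\tau=\tau^c$ of stopping times, $c\in\mathcal A(k_0,h_0)$), $$V(k_0,h_0)=\sup_{c\in\mathcal A(k_0,h_0)}\mathbb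 E\bigg[\int_0^{\tau}\frac{e^{-\theta t}}{1-\sigma}\Big(\frac{h_t^{\gamma}}{c_t}\Big)^{\sigma-1}\mathrm dt+e^{-\theta\tau}V(k_\tau,h_\tau)\bigg],$$ where $k,h$ are the solutions controlled by $c$ starting from $(k_0,h_0)$, and $e^{-\theta\tau}V(k_\tau,h_\tau)$ is read as $0$ where $\tau=\infty$. -/

import Mathlib

open MeasureTheory ProbabilityTheory Filter
open scoped NNReal ENNReal

namespace HabitModel

noncomputable section

/-- The real parameters of the consumption model with habit formation. -/
structure Params where
  /-- growth rate of the capital -/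
  B : ℝ
  /-- upper bound on the ratio between consumption and capital -/
  R : ℝ
  /-- volatility of the capital -/
  β₁ : ℝ
  /-- volatility of the habit -/
  β₂ : ℝ
  /-- adjustment speed of the habit -/
  ρ : ℝ
  /-- weight of the habit in the utility -/
  γ : ℝ
  /-- risk aversion -/
  σ : ℝ
  /-- discount rate -/
  θ : ℝ

/-- The standing assumptions on the parameters. If `γ = 0`, Lean's convention `1 / 0 = 0` makes
the maxima below equal to `2`. -/
structure Params.Standing (p : Params) : Prop where
  B_nonneg : 0 ≤ p.B
  R_pos : 0 < p.R
  B_le_R : p.B ≤ p.R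
  β₁_pos : 0 < p.β₁
  β₂_pos : 0 < p.β₂
  ρ_pos : 0 < p.ρ
  ρ_lt_one : p.ρ < 1
  γ_nonneg : 0 ≤ p.γ
  γ_lt_one : p.γ < 1
  one_lt_σ : 1 < p.σ
  θ_pos : 0 < p.θ
  discount_of_nonpos : p.ρ + (p.β₂ ^ 2 - p.β₁ ^ 2) / 2 ≤ 0 →
    (p.σ - 1) * (-(p.γ * p.ρ) - (p.γ * p.β₂ ^ 2 - p.β₁ ^ 2) / 2
      + max 2 (1 / (p.γ * (p.σ - 1))) * (p.σ - 1) * (p.β₁ ^ 2 + p.γ ^ 2 * p.β₂ ^ 2)) < p.θ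
  discount_of_pos : 0 < p.ρ + (p.β₂ ^ 2 - p.β₁ ^ 2) / 2 →
    (p.σ - 1) * (p.β₁ ^ 2 * (1 - p.γ) / 2
      + max 2 (1 / (p.γ * (p.σ - 1))) * (p.σ - 1) * (p.β₁ ^ 2 + p.γ ^ 2 * p.β₂ ^ 2)) < p.θ

/-- Lebesgue measure on the time axis `[0, ∞)`. -/
def timeMeasure : Measure ℝ≥0 := Measure.comap ((↑) : ℝ≥0 → ℝ) volume

variable {Ω : Type*} {mΩ : MeasurableSpace Ω}

/-- The usual hypotheses: the filtration is right-continuous, and every `P`-null subset of `Ω`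
belongs to the initial σ-algebra. -/
structure UsualHypotheses (ℱ : Filtration ℝ≥0 mΩ) (P : Measure Ω) : Prop where
  rightContinuous : ℱ.IsRightContinuous
  complete : ∀ s : Set Ω, P s = 0 → MeasurableSet[ℱ 0] s

/-- `W₁` and `W₂` are independent Brownian motions with respect to the filtration `ℱ`: they are
adapted, and the increments of the pair are independent of the past. -/
structure IsBrownianPair (ℱ : Filtration ℝ≥0 mΩ) (P : Measure Ω) (W₁ W₂ : ℝ≥0 → Ω → ℝ) :
    Prop where
  adapted₁ : Adapted ℱ W₁
  adapted₂ : Adapted ℱ W₂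
  brownian₁ : IsBrownianReal W₁ P
  brownian₂ : IsBrownianReal W₂ P
  indep : IndepFun (fun ω t => W₁ t ω) (fun ω t => W₂ t ω) P
  indep_past : ∀ s t : ℝ≥0, s ≤ t →
    Indep (MeasurableSpace.comap (fun ω => (W₁ t ω - W₁ s ω, W₂ t ω - W₂ s ω)) inferInstance)
      (ℱ s) P

/-- `I` is the Itô integral process `I t = ∫₀ᵗ H dW` of the integrand `H` (adapted, with almost
surely continuous paths): for every `t`, the left-endpoint sums over the partition of `[0, t]`
into `n` equal intervals converge to `I t` in probability as `n → ∞`. -/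
def IsItoIntegral (P : Measure Ω) (H W I : ℝ≥0 → Ω → ℝ) : Prop :=
  ∀ t : ℝ≥0, TendstoInMeasure P
    (fun (n : ℕ) (ω : Ω) => ∑ i ∈ Finset.range n,
      H (t * ((i : ℝ≥0) / (n : ℝ≥0))) ω *
        (W (t * (((i : ℝ≥0) + 1) / (n : ℝ≥0))) ω - W (t * ((i : ℝ≥0) / (n : ℝ≥0))) ω))
    atTop (I t)

/-- `X` is a (strong) solution of `dX = b dt + β X dW`, `X 0 = x₀`: an adapted process with almost
surely continuous paths such that, almost surely, for all `t`,
`X t = x₀ + ∫₀ᵗ b ds + β ∫₀ᵗ X dW`. -/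
structure SolvesSDE (ℱ : Filtration ℝ≥0 mΩ) (P : Measure Ω) (W : ℝ≥0 → Ω → ℝ) (x₀ β : ℝ)
    (b X : ℝ≥0 → Ω → ℝ) : Prop where
  adapted : Adapted ℱ X
  continuous_paths : ∀ᵐ ω ∂P, Continuous (fun t => X t ω)
  locallyIntegrable_drift : ∀ᵐ ω ∂P, LocallyIntegrable (fun t => b t ω) timeMeasure
  equation : ∃ I : ℝ≥0 → Ω → ℝ, IsItoIntegral P X W I ∧
    ∀ᵐ ω ∂P, ∀ t : ℝ≥0, X t ω = x₀ + (∫ s in Set.Icc 0 t, b s ω ∂timeMeasure) + β * I t ω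

/-- `c` is an admissible control for the initial state `(k₀, h₀)`, and `k`, `h` are the capital and
the habit controlled by `c` that start from `k₀`, `h₀`:
`dk = (B k - c) dt + β₁ k dW₁` and `dh = ρ (c - h) dt + β₂ h dW₂`. -/
structure IsAdmissible (p : Params) (ℱ : Filtration ℝ≥0 mΩ) (P : Measure Ω)
    (W₁ W₂ : ℝ≥0 → Ω → ℝ) (k₀ h₀ : ℝ) (c k h : ℝ≥0 → Ω → ℝ) : Prop where
  progressive : IsProgressive ℱ c
  locallyIntegrable : ∀ᵐ ω ∂P, LocallyIntegrable (fun t => c t ω) timeMeasure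
  control_pos : ∀ᵐ q ∂(P.prod timeMeasure), 0 < c q.2 q.1
  capital : SolvesSDE ℱ P W₁ k₀ p.β₁ (fun t ω => p.B * k t ω - c t ω) k
  habit : SolvesSDE ℱ P W₂ h₀ p.β₂ (fun t ω => p.ρ * (c t ω - h t ω)) h
  state_pos : ∀ᵐ ω ∂P, ∀ t : ℝ≥0, 0 < k t ω ∧ 0 < h t ω
  control_le : ∀ᵐ q ∂(P.prod timeMeasure), c q.2 q.1 ≤ p.R * k q.2 q.1

/-- The set `𝒜(k₀, h₀)` of admissible controls. -/
def admissibleControls (p : Params) (ℱ : Filtration ℝ≥0 mΩ) (P : Measure Ω)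
    (W₁ W₂ : ℝ≥0 → Ω → ℝ) (k₀ h₀ : ℝ) : Set (ℝ≥0 → Ω → ℝ) :=
  {c | ∃ k h : ℝ≥0 → Ω → ℝ, IsAdmissible p ℱ P W₁ W₂ k₀ h₀ c k h}

/-- The discounted running utility `(1 - σ)⁻¹ (c / h ^ γ) ^ (1 - σ) e ^ (-θ t)`; it is nonpositive
as `σ > 1`. -/
def discountedUtility (p : Params) (c h : ℝ≥0 → Ω → ℝ) (t : ℝ≥0) (ω : Ω) : ℝ :=
  1 / (1 - p.σ) * (c t ω / h t ω ^ p.γ) ^ (1 - p.σ) * Real.exp (-p.θ * t)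

/-- The objective `J = 𝔼[∫₀^∞ discounted utility dt] ∈ [-∞, 0]`. The integral of a nonpositive
function is minus the Lebesgue integral of its opposite. -/
def J (p : Params) (P : Measure Ω) (c h : ℝ≥0 → Ω → ℝ) : EReal :=
  -((∫⁻ ω, (∫⁻ t, ENNReal.ofReal (-discountedUtility p c h t ω) ∂timeMeasure) ∂P : ℝ≥0∞) : EReal)

/-- The value function `V(k₀, h₀) ∈ [-∞, 0]`: the supremum of `J` over the admissible controls.
(The state processes are determined by the control up to indistinguishability.) -/
def V (p : Params) (ℱ : Filtration ℝ≥0 mΩ) (P : Measure Ω) (W₁ W₂ : ℝ≥0 → Ω → ℝ)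
    (k₀ h₀ : ℝ) : EReal :=
  ⨆ (c : ℝ≥0 → Ω → ℝ) (k : ℝ≥0 → Ω → ℝ) (h : ℝ≥0 → Ω → ℝ)
    (_ : IsAdmissible p ℱ P W₁ W₂ k₀ h₀ c k h), J p P c h

/-- Minus the discounted terminal value, `-e ^ (-θ τ) v(k_τ, h_τ) ∈ [0, ∞]`, for a function `v`
with values in `[-∞, 0]`; it is zero where `τ = ∞`. -/
def discountedTerminalLoss (p : Params) (v : ℝ → ℝ → EReal) (τ : Ω → WithTop ℝ≥0)
    (k h : ℝ≥0 → Ω → ℝ) (ω : Ω) : ℝ≥0∞ :=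
  if hτ : τ ω = ⊤ then 0
  else
    ENNReal.ofReal (Real.exp (-p.θ * ((τ ω).untop hτ : ℝ≥0))) *
      (-v (k ((τ ω).untop hτ) ω) (h ((τ ω).untop hτ) ω)).toENNReal

/-- `𝔼[∫₀^τ discounted utility dt + e ^ (-θ τ) v(k_τ, h_τ)] ∈ [-∞, 0]`, for a function `v` with
values in `[-∞, 0]`. As in `J`, this is minus the Lebesgue integral of the opposite. -/
def stoppedPayoff (p : Params) (P : Measure Ω) (v : ℝ → ℝ → EReal) (τ : Ω → WithTop ℝ≥0)
    (c k h : ℝ≥0 → Ω → ℝ) : EReal :=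
  -((∫⁻ ω, ((∫⁻ t in {t : ℝ≥0 | (t : WithTop ℝ≥0) ≤ τ ω},
        ENNReal.ofReal (-discountedUtility p c h t ω) ∂timeMeasure)
      + discountedTerminalLoss p v τ k h ω) ∂P : ℝ≥0∞) : EReal)

end

end HabitModel

namespace HabitModel

noncomputable section

variable {Ω : Type*} {mΩ : MeasurableSpace Ω}

/-! ### The time axis -/

/-! Writing consumption as `c = α k` with a ratio `0 < α ≤ R` makes both state equations linear. The
capital is then a stochastic exponential times `exp (-∫ α)`, and the habit follows by variation of
constants. So the state is an explicit functional `statePath` of the initial state, the ratio and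
the driving path, with a flow property that holds path by path. Since Itô integrals are only given
as limits in probability of left-endpoint sums, this needs two facts: the explicit processes solve
the equations (`IsRealBM.isItoIntegral_stochExp_mul`), and linear equations have one solution
(`IsRealBM.eq_zero_of_isItoIntegral`: truncation, Itô isometry, Gronwall).
`IsAdmissible.exists_control` and `IsControl.exists_admissible` translate between the two
descriptions.

The utility is negative, so the problem is to minimize an expected loss. The usual obstacles to
dynamic programming are the measurability of the value and the measurable choice of nearly optimal
controls. Both are avoided by the candidate `infVal`: the countable infimum, over a mesh `1 / (n +
1)` and a number `N` of steps, of the values of problems in which the ratio is constant on the mesh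
and lies in a finite grid. The terminal loss of these problems is a multiple of a weight `psi` of
the state that dominates the loss of consuming at a small constant ratio forever. These values come
from a backward recursion with minima over finite sets, hence are measurable with measurable
minimizers. The law of the driving path is the same for all Brownian motions and independent of the
initial σ-algebra, and the strong Markov property `IsBM.shift` makes the path after a stopping time
such a Brownian motion. For this reason the estimates allow random initial states and weights `ζ`
measurable at time zero; the weights stand in for conditional expectations.

Two estimates tie the loss to `psi`. By the condition on `θ` and by `γ (σ - 1) ≤ 1`, a small
constant ratio has a finite discounted loss, at most a multiple of `psi`
(`BaseRate.lintegral_runCost_le`); the second condition lets a power of the habit be bounded by its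
tangent, and the moments of the habit itself are explicit. Conversely, every control loses within
one unit of time at least a multiple of `psi` (`exists_lower_bound`). Hence finite losses force the
discounted weight of the state at late times to vanish, being dominated by the tail of the losses.

It follows that `infVal` is minus the value function (`V_eq`). No control beats it
(`lintegral_infVal_le`): raise the ratio to a small floor, switch to the constant ratio at a late
stopping time, discretize, and pass to the limit. And it is nearly attained
(`exists_control_infVal`): select the first nearly optimal level as a function of the initial state.

For the dynamic programming principle, one inequality compares, for each control, the loss after `τ`
with `infVal` at `τ` (`lintegral_stopped_le`). For the other (`infVal_le_lintegral_stopped`), the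
control is followed until `τ ∧ n` and continued nearly optimally; the error on `{τ > n}` is at most
a multiple of the discounted weight at time `n`, and `exists_tail_bound` makes it vanish. -/

lemma measurableEmbedding_coe_nnreal : MeasurableEmbedding ((↑) : ℝ≥0 → ℝ) :=
  MeasurableEmbedding.subtype_coe (measurableSet_Ici (a := (0 : ℝ)))

lemma map_coe_timeMeasure :
    timeMeasure.map ((↑) : ℝ≥0 → ℝ) = volume.restrict (Set.Ici 0) := by
  rw [timeMeasure, measurableEmbedding_coe_nnreal.map_comap]
  congr 1
  ext x
  simp only [Set.mem_range, Set.mem_Ici]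
  exact ⟨fun ⟨y, hy⟩ => hy ▸ y.2, fun h => ⟨⟨x, h⟩, rfl⟩⟩

lemma timeMeasure_apply (s : Set ℝ≥0) :
    timeMeasure s = volume (((↑) : ℝ≥0 → ℝ) '' s) :=
  measurableEmbedding_coe_nnreal.comap_apply _ _

lemma timeMeasure_Icc (a b : ℝ≥0) : timeMeasure (Set.Icc a b) = ENNReal.ofReal (b - a) := by
  rw [timeMeasure_apply, ← Real.volume_Icc]
  congr 1
  ext x
  simp only [Set.mem_image, Set.mem_Icc]
  constructor
  · rintro ⟨y, hy, rfl⟩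
    exact ⟨by exact_mod_cast hy.1, by exact_mod_cast hy.2⟩
  · intro h
    exact ⟨⟨x, a.2.trans h.1⟩, ⟨by exact_mod_cast h.1, by exact_mod_cast h.2⟩, rfl⟩

instance : NullSingletonClass timeMeasure where
  measure_singleton x := by
    rw [← Set.Icc_self, timeMeasure_Icc]; simp

instance : IsLocallyFiniteMeasure timeMeasure where
  finiteAtNhds x := by
    refine ⟨Set.Icc 0 (x + 1), ?_, ?_⟩
    · refine Filter.mem_of_superset (Iio_mem_nhds (lt_add_one x)) ?_
      intro y hy
      exact ⟨zero_le, le_of_lt hy⟩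
    · rw [timeMeasure_Icc]; exact ENNReal.ofReal_lt_top

lemma integrableOn_const_Icc (c : ℝ) (t : ℝ≥0) :
    IntegrableOn (fun _ : ℝ≥0 => c) (Set.Icc 0 t) timeMeasure := by
  refine integrableOn_const ?_
  rw [timeMeasure_Icc]; exact ENNReal.ofReal_ne_top

/-- Translation of the time axis. -/
lemma map_add_left_timeMeasure (a : ℝ≥0) :
    timeMeasure.map (a + ·) = timeMeasure.restrict (Set.Ici a) := by
  have he := measurableEmbedding_coe_nnreal
  have h1 : Measurable (fun x : ℝ≥0 => a + x) := by fun_prop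
  ext s hs
  rw [Measure.map_apply h1 hs, Measure.restrict_apply hs, timeMeasure_apply, timeMeasure_apply]
  have : ((↑) : ℝ≥0 → ℝ) '' (s ∩ Set.Ici a)
      = (fun x : ℝ => (a : ℝ) + x) '' (((↑) : ℝ≥0 → ℝ) '' ((a + ·) ⁻¹' s)) := by
    ext x
    simp only [Set.mem_image, Set.mem_inter_iff, Set.mem_Ici, Set.mem_preimage]
    constructor
    · rintro ⟨y, ⟨hy, hay⟩, rfl⟩
      refine ⟨((y - a : ℝ≥0) : ℝ), ⟨y - a, ?_, rfl⟩, ?_⟩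
      · rwa [add_tsub_cancel_of_le hay]
      · rw [NNReal.coe_sub hay]; ring
    · rintro ⟨_, ⟨y, hy, rfl⟩, rfl⟩
      exact ⟨a + y, ⟨hy, le_self_add⟩, by push_cast; ring⟩
  rw [this, Set.image_add_left, measure_preimage_add]

lemma setLIntegral_Ici_timeMeasure (a : ℝ≥0) (f : ℝ≥0 → ℝ≥0∞) :
    ∫⁻ t in Set.Ici a, f t ∂timeMeasure = ∫⁻ s, f (a + s) ∂timeMeasure := by
  rw [← map_add_left_timeMeasure, MeasurableEmbedding.lintegral_map]
  exact (by fun_prop : Continuous (a + · : ℝ≥0 → ℝ≥0)).measurableEmbedding (add_right_injective a)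

/-! ### Primitives on the time axis -/

/-- The integral `∫₀ᵗ f ds` over the time axis. -/
def cumul (f : ℝ≥0 → ℝ) (t : ℝ≥0) : ℝ := ∫ s in Set.Icc 0 t, f s ∂timeMeasure

/-- Integrability on all the intervals `[0, t]`. -/
def LocInt (f : ℝ≥0 → ℝ) : Prop := ∀ t : ℝ≥0, IntegrableOn f (Set.Icc 0 t) timeMeasure

lemma locInt_of_locallyIntegrable {f : ℝ≥0 → ℝ} (hf : LocallyIntegrable f timeMeasure) :
    LocInt f := fun _ => hf.integrableOn_isCompact isCompact_Icc

lemma LocInt.locallyIntegrable {f : ℝ≥0 → ℝ} (hf : LocInt f) :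
    LocallyIntegrable f timeMeasure := by
  intro x
  refine ⟨Set.Icc 0 (x + 1), ?_, hf _⟩
  refine Filter.mem_of_superset (Iio_mem_nhds (lt_add_one x)) ?_
  intro y hy
  exact ⟨zero_le, le_of_lt hy⟩

lemma LocInt.add {f g : ℝ≥0 → ℝ} (hf : LocInt f) (hg : LocInt g) :
    LocInt (fun s => f s + g s) := fun t => (hf t).add (hg t)

lemma LocInt.sub {f g : ℝ≥0 → ℝ} (hf : LocInt f) (hg : LocInt g) :
    LocInt (fun s => f s - g s) := fun t => (hf t).sub (hg t)

lemma LocInt.const_mul {f : ℝ≥0 → ℝ} (hf : LocInt f) (c : ℝ) :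
    LocInt (fun s => c * f s) := fun t => (hf t).const_mul c

lemma _root_.Continuous.locInt {f : ℝ≥0 → ℝ} (hf : Continuous f) : LocInt f :=
  locInt_of_locallyIntegrable hf.locallyIntegrable

lemma LocInt.continuous_mul {f g : ℝ≥0 → ℝ} (hf : LocInt f) (hg : Continuous g) :
    LocInt (fun s => g s * f s) :=
  fun t => (hf t).continuousOn_mul hg.continuousOn isCompact_Icc

lemma locInt_of_bounded {f : ℝ≥0 → ℝ} (hf : Measurable f) {C : ℝ} (hC : ∀ t, |f t| ≤ C) :
    LocInt f := fun t =>
  (integrableOn_const_Icc C t).mono' hf.aestronglyMeasurable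
    (.of_forall fun s => by simpa using hC s)

lemma integrableOn_Icc_iff (f : ℝ≥0 → ℝ) (t : ℝ≥0) :
    IntegrableOn f (Set.Icc 0 t) timeMeasure ↔
      IntervalIntegrable (fun x : ℝ => f x.toNNReal) volume 0 t := by
  have he := measurableEmbedding_coe_nnreal
  have h2 : (fun x : ℝ => f x.toNNReal) ∘ ((↑) : ℝ≥0 → ℝ) = f := by
    ext x; simp
  rw [intervalIntegrable_iff_integrableOn_Icc_of_le (NNReal.coe_nonneg t) (by simp)]
  have h3 : (Set.Icc (0 : ℝ≥0) t) = ((↑) : ℝ≥0 → ℝ) ⁻¹' (Set.Icc 0 (t : ℝ)) := by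
    ext x; simp
  have h4 : IntegrableOn (fun x : ℝ => f x.toNNReal) (Set.Icc 0 (t : ℝ)) volume ↔
      IntegrableOn (fun x : ℝ => f x.toNNReal) (Set.Icc 0 (t : ℝ))
        (timeMeasure.map ((↑) : ℝ≥0 → ℝ)) := by
    rw [map_coe_timeMeasure, IntegrableOn, IntegrableOn,
      Measure.restrict_restrict_of_subset (Set.Icc_subset_Ici_self)]
  rw [h4, he.integrableOn_map_iff, h2, h3]

lemma cumul_eq_intervalIntegral (f : ℝ≥0 → ℝ) (t : ℝ≥0) :
    cumul f t = ∫ x in (0 : ℝ)..t, f x.toNNReal := by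
  have he := measurableEmbedding_coe_nnreal
  have h3 : (Set.Icc (0 : ℝ≥0) t) = ((↑) : ℝ≥0 → ℝ) ⁻¹' (Set.Icc 0 (t : ℝ)) := by
    ext x; simp
  rw [intervalIntegral.integral_of_le (NNReal.coe_nonneg t), ← integral_Icc_eq_integral_Ioc,
    ← Measure.restrict_restrict_of_subset (Set.Icc_subset_Ici_self : Set.Icc (0 : ℝ) t ⊆ Set.Ici 0),
    ← map_coe_timeMeasure, he.setIntegral_map, ← h3, cumul]
  simp

lemma cumul_zero (f : ℝ≥0 → ℝ) : cumul f 0 = 0 := by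
  rw [cumul_eq_intervalIntegral]; simp

lemma cumul_const (c : ℝ) (t : ℝ≥0) : cumul (fun _ => c) t = c * t := by
  rw [cumul_eq_intervalIntegral]; simp [mul_comm]

lemma cumul_const_mul (c : ℝ) (f : ℝ≥0 → ℝ) (t : ℝ≥0) :
    cumul (fun s => c * f s) t = c * cumul f t := integral_const_mul _ _

lemma cumul_add {f g : ℝ≥0 → ℝ} (hf : LocInt f) (hg : LocInt g) (t : ℝ≥0) :
    cumul (fun s => f s + g s) t = cumul f t + cumul g t := integral_add (hf t) (hg t)

lemma cumul_sub {f g : ℝ≥0 → ℝ} (hf : LocInt f) (hg : LocInt g) (t : ℝ≥0) :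
    cumul (fun s => f s - g s) t = cumul f t - cumul g t := integral_sub (hf t) (hg t)

lemma cumul_congr_ae {f g : ℝ≥0 → ℝ} (h : ∀ᵐ s ∂timeMeasure, f s = g s) (t : ℝ≥0) :
    cumul f t = cumul g t :=
  integral_congr_ae (ae_restrict_of_ae h)

lemma cumul_mono {f g : ℝ≥0 → ℝ} (hf : LocInt f) (hg : LocInt g) (t : ℝ≥0)
    (h : ∀ s ≤ t, f s ≤ g s) : cumul f t ≤ cumul g t :=
  setIntegral_mono_on (hf t) (hg t) measurableSet_Icc fun s hs => h s hs.2

lemma cumul_congr {f g : ℝ≥0 → ℝ} {t : ℝ≥0} (h : ∀ s ≤ t, f s = g s) : cumul f t = cumul g t :=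
  setIntegral_congr_fun measurableSet_Icc fun s hs => h s hs.2

lemma cumul_nonneg {f : ℝ≥0 → ℝ} (t : ℝ≥0) (h : ∀ s ≤ t, 0 ≤ f s) : 0 ≤ cumul f t :=
  setIntegral_nonneg measurableSet_Icc fun s hs => h s hs.2

lemma LocInt.shift {f : ℝ≥0 → ℝ} (hf : LocInt f) (a : ℝ≥0) : LocInt (fun s => f (a + s)) := by
  intro t
  have he := (by fun_prop : Continuous (a + · : ℝ≥0 → ℝ≥0)).measurableEmbedding
    (add_right_injective a)
  have := (he.integrableOn_map_iff (f := f) (μ := timeMeasure) (s := Set.Icc 0 (a + t))).1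
    (by
      rw [map_add_left_timeMeasure]
      exact (hf (a + t)).mono_measure Measure.restrict_le_self)
  refine this.mono_set ?_
  intro s hs
  exact ⟨zero_le, add_le_add le_rfl hs.2⟩

lemma cumul_shift {f : ℝ≥0 → ℝ} (hf : LocInt f) (a s : ℝ≥0) :
    cumul f (a + s) = cumul f a + cumul (fun u => f (a + u)) s := by
  have he := (by fun_prop : Continuous (a + · : ℝ≥0 → ℝ≥0)).measurableEmbedding
    (add_right_injective a)
  have h1 : cumul (fun u => f (a + u)) s = ∫ u in Set.Ioc a (a + s), f u ∂timeMeasure := by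
    have h2 : Set.Icc 0 s = (a + ·) ⁻¹' (Set.Icc a (a + s)) := by
      ext x; simp
    rw [cumul, h2, ← he.setIntegral_map, map_add_left_timeMeasure,
      Measure.restrict_restrict_of_subset Set.Icc_subset_Ici_self, integral_Icc_eq_integral_Ioc]
  rw [h1, cumul, cumul, ← setIntegral_union _ measurableSet_Ioc (hf a)
    ((hf (a + s)).mono_set fun x hx => ⟨zero_le, hx.2⟩)]
  · rw [Set.Icc_union_Ioc_eq_Icc zero_le le_self_add]
  · rw [Set.disjoint_left]
    intro x hx hx'
    exact absurd hx.2 (not_le.2 hx'.1)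

lemma continuous_cumul {f : ℝ≥0 → ℝ} (hf : LocInt f) : Continuous (cumul f) := by
  have h : ∀ T : ℝ≥0, ContinuousOn (cumul f) (Set.Icc 0 T) := by
    intro T
    have h1 := (integrableOn_Icc_iff f T).1 (hf T)
    have h2 := intervalIntegral.continuousOn_primitive_interval
      (f := fun x : ℝ => f x.toNNReal) (μ := volume) (a := 0) (b := T)
      (by rw [Set.uIcc_of_le (NNReal.coe_nonneg T)]
          exact (intervalIntegrable_iff_integrableOn_Icc_of_le (NNReal.coe_nonneg T) (by simp)).1 h1)
    have h3 : cumul f = (fun x : ℝ => ∫ t in (0 : ℝ)..x, f t.toNNReal) ∘ ((↑) : ℝ≥0 → ℝ) := by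
      ext t; exact cumul_eq_intervalIntegral f t
    rw [h3]
    refine h2.comp (by fun_prop) ?_
    intro x hx
    rw [Set.uIcc_of_le (NNReal.coe_nonneg T)]
    exact ⟨x.2, by exact_mod_cast hx.2⟩
  rw [continuous_iff_continuousAt]
  intro t
  refine (h (t + 1)).continuousAt (Filter.mem_of_superset (Iio_mem_nhds (lt_add_one t)) ?_)
  intro y hy
  exact ⟨zero_le, le_of_lt hy⟩

/-- The primitive of a locally integrable function has difference quotients converging a.e. -/
lemma ae_hasDerivAt_cumul {f : ℝ≥0 → ℝ} (hf : LocInt f) :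
    ∀ᵐ t ∂timeMeasure, HasDerivAt (fun x : ℝ => ∫ s in (0 : ℝ)..x, f s.toNNReal) (f t) t := by
  have he := measurableEmbedding_coe_nnreal
  -- Extended by zero to negative times, `f` is locally integrable on `ℝ`, so Lebesgue
  -- differentiation applies there. Near a positive time the extension changes nothing, and time
  -- zero is a null set.
  have h1 : LocallyIntegrable (fun x : ℝ => (Set.Ici (0 : ℝ)).indicator
      (fun x => f x.toNNReal) x) volume := by
    rw [locallyIntegrable_iff]
    intro K hK
    obtain ⟨C, hC⟩ := hK.isBounded.bddAbove
    have h2 := (integrableOn_Icc_iff f C.toNNReal).1 (hf _)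
    rw [intervalIntegrable_iff_integrableOn_Icc_of_le (NNReal.coe_nonneg _) (by simp)] at h2
    have h3 : IntegrableOn ((Set.Ici (0 : ℝ)).indicator (fun x => f x.toNNReal)) K volume := by
      rw [IntegrableOn, integrable_indicator_iff measurableSet_Ici, IntegrableOn,
        Measure.restrict_restrict measurableSet_Ici]
      refine h2.mono_set ?_
      intro x hx
      refine ⟨hx.1, ?_⟩
      rw [Real.coe_toNNReal']
      exact le_max_of_le_left (hC hx.2)
    exact h3
  have h2 := _root_.LocallyIntegrable.ae_hasDerivAt_integral h1
  have h3 : ∀ᵐ x ∂(timeMeasure.map ((↑) : ℝ≥0 → ℝ)), ∀ c, HasDerivAt (fun x => ∫ (t : ℝ) in c..x,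
      (Set.Ici (0 : ℝ)).indicator (fun x => f x.toNNReal) t)
      ((Set.Ici (0 : ℝ)).indicator (fun x => f x.toNNReal) x) x := by
    rw [map_coe_timeMeasure]
    exact ae_restrict_of_ae h2
  have h4 := (he.ae_map_iff).1 h3
  have h5 : ∀ᵐ t ∂timeMeasure, t ≠ 0 := by
    simp [ae_iff]
  filter_upwards [h4, h5] with t ht ht0
  have h6 := ht 0
  rw [Set.indicator_of_mem (by exact t.2)] at h6
  simp only [Real.toNNReal_coe] at h6
  refine h6.congr_of_eventuallyEq ?_
  filter_upwards [Ioi_mem_nhds (show (0 : ℝ) < t from NNReal.coe_pos.2 (pos_iff_ne_zero.2 ht0))]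
    with x hx
  refine intervalIntegral.integral_congr fun s hs => ?_
  rw [Set.uIcc_of_le (le_of_lt hx)] at hs
  rw [Set.indicator_of_mem (by exact hs.1)]

/-! ### Chain rule for absolutely continuous functions -/

lemma _root_.LipschitzOnWith.comp_absolutelyContinuousOnInterval {φ f : ℝ → ℝ} {K : ℝ≥0}
    {S : Set ℝ} {a b : ℝ} (hφ : LipschitzOnWith K φ S) (hf : AbsolutelyContinuousOnInterval f a b)
    (hS : ∀ x ∈ Set.uIcc a b, f x ∈ S) :
    AbsolutelyContinuousOnInterval (fun x => φ (f x)) a b := by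
  rw [absolutelyContinuousOnInterval_iff] at hf ⊢
  intro ε hε
  -- Dividing by `K + 1` covers `K = 0` and makes the final inequality strict.
  obtain ⟨δ, hδ, h⟩ := hf (ε / (K + 1)) (by positivity)
  refine ⟨δ, hδ, fun E hE hE2 => ?_⟩
  have h1 := h E hE hE2
  have hK : (0 : ℝ) ≤ K := K.2
  calc ∑ i ∈ Finset.range E.1, dist (φ (f (E.2 i).1)) (φ (f (E.2 i).2))
      ≤ ∑ i ∈ Finset.range E.1, K * dist (f (E.2 i).1) (f (E.2 i).2) := by
        refine Finset.sum_le_sum fun i hi => ?_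
        exact hφ.dist_le_mul _ (hS _ (hE.1 i hi).1) _ (hS _ (hE.1 i hi).2)
    _ = K * ∑ i ∈ Finset.range E.1, dist (f (E.2 i).1) (f (E.2 i).2) := by rw [Finset.mul_sum]
    _ ≤ K * (ε / (K + 1)) := by gcongr
    _ < (K + 1) * (ε / (K + 1)) := by gcongr; linarith
    _ = ε := by field_simp

/-- Chain rule for `φ (c + ∫₀ᵗ g)`, where `φ` is of class `C¹` on an interval that contains the
values of the inner function. -/
lemma cumul_chain {φ φ' : ℝ → ℝ} {S : Set ℝ} (hS : S.OrdConnected)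
    (hφ : ∀ x ∈ S, HasDerivAt φ (φ' x) x) (hφ' : ContinuousOn φ' S) {g : ℝ≥0 → ℝ}
    (hg : LocInt g) {c : ℝ} {t : ℝ≥0} (hmem : ∀ s ≤ t, c + cumul g s ∈ S) :
    φ (c + cumul g t) = φ c + cumul (fun s => φ' (c + cumul g s) * g s) t := by
  set G : ℝ → ℝ := fun x => g x.toNNReal with hG
  set F : ℝ → ℝ := fun x => c + ∫ u in (0 : ℝ)..x, G u with hF
  have ht : (0 : ℝ) ≤ t := NNReal.coe_nonneg t
  have hFc : ∀ s : ℝ≥0, F s = c + cumul g s := fun s => by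
    rw [cumul_eq_intervalIntegral]
  have hGi : IntervalIntegrable G volume 0 t := (integrableOn_Icc_iff g t).1 (hg t)
  have hac0 : AbsolutelyContinuousOnInterval (fun x => ∫ u in (0 : ℝ)..x, G u) 0 t :=
    hGi.absolutelyContinuousOnInterval_intervalIntegral (by simp)
  have hcac : AbsolutelyContinuousOnInterval (fun _ : ℝ => c) 0 t :=
    (LipschitzWith.const c).lipschitzOnWith.absolutelyContinuousOnInterval (K := 0)
  have hac : AbsolutelyContinuousOnInterval F 0 t := hcac.add hac0
  have hFS : ∀ x ∈ Set.uIcc (0 : ℝ) t, F x ∈ S := by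
    intro x hx
    rw [Set.uIcc_of_le ht] at hx
    have := hmem x.toNNReal (Real.toNNReal_le_iff_le_coe.2 hx.2)
    rwa [← hFc, Real.coe_toNNReal x hx.1] at this
  -- the image of the interval is a compact interval
  have hFcont := hac.continuousOn
  obtain ⟨xm, hxm, hmin⟩ := isCompact_uIcc.exists_isMinOn Set.nonempty_uIcc hFcont
  obtain ⟨xM, hxM, hmax⟩ := isCompact_uIcc.exists_isMaxOn Set.nonempty_uIcc hFcont
  have hIS : Set.Icc (F xm) (F xM) ⊆ S := hS.out (hFS _ hxm) (hFS _ hxM)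
  obtain ⟨K, hK⟩ := (isCompact_Icc (a := F xm) (b := F xM)).exists_bound_of_continuousOn
    (hφ'.mono hIS)
  -- `φ` need not be Lipschitz on `S`, but it is on the compact range of the inner function. The
  -- composition is therefore absolutely continuous, and an almost everywhere derivative suffices
  -- for the fundamental theorem of calculus.
  have hLip : LipschitzOnWith K.toNNReal φ (Set.Icc (F xm) (F xM)) := by
    refine (convex_Icc _ _).lipschitzOnWith_of_nnnorm_hasDerivWithin_le (f' := φ')
      (fun x hx => (hφ x (hIS hx)).hasDerivWithinAt) fun x hx => ?_
    rw [← NNReal.coe_le_coe, coe_nnnorm, Real.coe_toNNReal']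
    exact le_max_of_le_left (hK x hx)
  have hcomp := hLip.comp_absolutelyContinuousOnInterval hac
    (fun x hx => ⟨hmin hx, hmax hx⟩)
  have hft := hcomp.integral_deriv_eq_sub
  have hF0 : F 0 = c := by simp [hF]
  rw [hF0, hFc] at hft
  have h2 : cumul (fun s => φ' (c + cumul g s) * g s) t
      = ∫ x in (0 : ℝ)..t, φ' (F x) * G x := by
    rw [cumul_eq_intervalIntegral]
    refine intervalIntegral.integral_congr fun x hx => ?_
    rw [Set.uIcc_of_le ht] at hx
    have : F x = c + cumul g x.toNNReal := by
      rw [← hFc, Real.coe_toNNReal x hx.1]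
    simp only [this, hG]
  rw [h2]
  have h3 : ∫ x in (0 : ℝ)..t, φ' (F x) * G x = ∫ x in (0 : ℝ)..t, deriv (fun x => φ (F x)) x := by
    refine intervalIntegral.integral_congr_ae ?_
    filter_upwards [hGi.ae_hasDerivAt_integral] with x hx hx2
    have hx3 := Set.uIoc_subset_uIcc hx2
    have h4 : HasDerivAt F (G x) x := by
      exact (hx hx3 0 (by simp)).const_add c
    exact ((hφ _ (hFS x hx3)).comp x h4).deriv.symm
  rw [h3, hft]; ring

/-- Gronwall's lemma for a bounded function. -/
lemma gronwall_zero {φ : ℝ≥0 → ℝ} (hφ : LocInt φ) {M C : ℝ} (hC : 0 ≤ C) {t : ℝ≥0}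
    (hM : ∀ s ≤ t, φ s ≤ M) (h0 : 0 ≤ φ t)
    (h : ∀ s ≤ t, φ s ≤ C * cumul φ s) : φ t = 0 := by
  -- Iterating the inequality bounds `φ` by the `n`-th term of an exponential series, which tends to
  -- zero. Continuity of `φ` plays no role.
  have key : ∀ n : ℕ, ∀ s ≤ t, φ s ≤ M * (C * s) ^ n / n.factorial := by
    intro n
    induction n with
    | zero => intro s hs; simpa using hM s hs
    | succ n ih =>
      intro s hs
      refine (h s hs).trans ?_
      have hc : LocInt (fun u : ℝ≥0 => M * (C * u) ^ n / n.factorial) :=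
        Continuous.locInt (by fun_prop)
      have h1 := cumul_mono hφ hc s fun u hu => ih u (hu.trans hs)
      have h2 : cumul (fun u : ℝ≥0 => M * (C * u) ^ n / n.factorial) s
          = M * C ^ n / n.factorial * (s ^ (n + 1) / (n + 1)) := by
        rw [cumul_eq_intervalIntegral]
        have : ∀ x ∈ Set.uIcc (0 : ℝ) s, M * (C * (x.toNNReal : ℝ)) ^ n / n.factorial
            = M * C ^ n / n.factorial * x ^ n := by
          intro x hx
          rw [Set.uIcc_of_le (NNReal.coe_nonneg s)] at hx
          rw [Real.coe_toNNReal x hx.1, mul_pow]; ring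
        rw [intervalIntegral.integral_congr this, intervalIntegral.integral_const_mul,
          integral_pow]
        simp
      calc C * cumul φ s
          ≤ C * (M * C ^ n / n.factorial * (s ^ (n + 1) / (n + 1))) := by
            rw [← h2]; gcongr
        _ = M * (C * s) ^ (n + 1) / (n + 1).factorial := by
            rw [Nat.factorial_succ]; push_cast; field_simp; ring
  have hlim : Tendsto (fun n : ℕ => M * ((C * t) ^ n / n.factorial)) atTop (nhds 0) := by
    simpa using (FloorSemiring.tendsto_pow_div_factorial_atTop (C * t)).const_mul M
  refine le_antisymm (ge_of_tendsto' hlim fun n => ?_) h0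
  rw [← mul_div_assoc]
  exact key n t le_rfl

/-- Gronwall's lemma for a linear integral equation with bounded coefficient. -/
lemma eq_zero_of_eq_cumul {D : ℝ≥0 → ℝ} (hD : Continuous D) {C : ℝ} (hC : 0 ≤ C)
    (h : ∀ t, |D t| ≤ C * cumul (fun s => |D s|) t) (t : ℝ≥0) : D t = 0 := by
  have := gronwall_zero (φ := fun s => |D s|) hD.abs.locInt hC (t := t)
    (M := sSup ((fun s => |D s|) '' Set.Icc 0 t))
    (fun s hs => le_csSup (isCompact_Icc.image hD.abs).bddAbove ⟨s, ⟨zero_le, hs⟩, rfl⟩)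
    (abs_nonneg _) (fun s _ => h s)
  exact abs_eq_zero.1 this

lemma exp_neg_cumul {f : ℝ≥0 → ℝ} (hf : LocInt f) (t : ℝ≥0) :
    Real.exp (-cumul f t) = 1 - cumul (fun s => f s * Real.exp (-cumul f s)) t := by
  have h := cumul_chain (φ := fun x => Real.exp (-x)) (φ' := fun x => -Real.exp (-x))
    (S := Set.univ) Set.ordConnected_univ
    (fun x _ => by simpa using (hasDerivAt_neg x).exp) (by fun_prop) hf (c := 0) (t := t)
    (fun _ _ => trivial)
  simp only [zero_add, neg_zero, Real.exp_zero] at h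
  rw [h, sub_eq_add_neg]
  congr 1
  rw [← neg_one_mul, ← cumul_const_mul]
  refine cumul_congr fun s _ => by ring

/-- The integral equation `Y = y - ∫ f Y` with bounded `f` has the solution `y exp (-∫ f)` only. -/
lemma eq_exp_neg_cumul {f Y : ℝ≥0 → ℝ} (hf : Measurable f) {C : ℝ} (hC : ∀ t, |f t| ≤ C)
    (hY : Continuous Y) {y : ℝ} (h : ∀ t, Y t = y - cumul (fun s => f s * Y s) t) (t : ℝ≥0) :
    Y t = y * Real.exp (-cumul f t) := by
  have hfi := locInt_of_bounded hf hC
  have hcf := continuous_cumul hfi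
  set Z : ℝ≥0 → ℝ := fun t => y * Real.exp (-cumul f t) with hZ
  have hZc : Continuous Z := by fun_prop
  have hZe : ∀ t, Z t = y - cumul (fun s => f s * Z s) t := by
    intro t
    have : cumul (fun s => f s * Z s) t = y * cumul (fun s => f s * Real.exp (-cumul f s)) t := by
      rw [← cumul_const_mul]
      exact cumul_congr fun s _ => by rw [hZ]; ring
    rw [this, hZ]
    simp only
    rw [exp_neg_cumul hfi]; ring
  have hi : ∀ X : ℝ≥0 → ℝ, Continuous X → LocInt (fun s => f s * X s) := fun X hX t => by
    have := hfi.continuous_mul hX t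
    simpa [mul_comm] using this
  have := eq_zero_of_eq_cumul (D := fun t => Y t - Z t) (hY.sub hZc)
    ((abs_nonneg _).trans (hC 0)) (fun t => ?_) t
  · exact sub_eq_zero.1 this
  · rw [h t, hZe t, ← cumul_const_mul]
    have h1 : y - cumul (fun s => f s * Y s) t - (y - cumul (fun s => f s * Z s) t)
        = - cumul (fun s => f s * (Y s - Z s)) t := by
      have := cumul_sub (hi Y hY) (hi Z hZc) t
      have h2 : cumul (fun s => f s * (Y s - Z s)) t
          = cumul (fun s => f s * Y s - f s * Z s) t := cumul_congr fun s _ => by ring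
      rw [h2, this]; ring
    rw [h1, abs_neg]
    have hDc : Continuous fun s => Y s - Z s := hY.sub hZc
    refine (abs_integral_le_integral_abs).trans ?_
    refine cumul_mono (fun t => (hi _ hDc t).abs)
      ((hDc.abs.locInt).const_mul C) t fun s _ => ?_
    rw [abs_mul]
    exact mul_le_mul_of_nonneg_right (hC s) (abs_nonneg _)

/-! ### Brownian motions with continuous paths -/

/-- The standard planar Gaussian law with variance `u`. -/
def gauss (u : ℝ≥0) : Measure (ℝ × ℝ) := (gaussianReal 0 u).prod (gaussianReal 0 u)

instance (u : ℝ≥0) : IsProbabilityMeasure (gauss u) := by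
  unfold gauss; infer_instance

/-- A planar Brownian motion with respect to `𝒢`, all of whose paths are continuous and start
from `0`. -/
structure IsBM (𝒢 : Filtration ℝ≥0 mΩ) (P : Measure Ω) (W : ℝ≥0 → Ω → ℝ × ℝ) : Prop where
  adapted : ∀ t, Measurable[𝒢 t] (W t)
  continuous : ∀ ω, Continuous fun t => W t ω
  zero : ∀ ω, W 0 ω = 0
  incr : ∀ (s u : ℝ≥0) (D : Set Ω), MeasurableSet[𝒢 s] D → ∀ S : Set (ℝ × ℝ), MeasurableSet S →
    P (D ∩ {ω | W (s + u) ω - W s ω ∈ S}) = P D * gauss u S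

/-- A real Brownian motion with respect to `𝒢`, all of whose paths are continuous. -/
structure IsRealBM (𝒢 : Filtration ℝ≥0 mΩ) (P : Measure Ω) (w : ℝ≥0 → Ω → ℝ) : Prop where
  adapted : ∀ t, Measurable[𝒢 t] (w t)
  continuous : ∀ ω, Continuous fun t => w t ω
  zero : ∀ ω, w 0 ω = 0
  incr : ∀ (s u : ℝ≥0) (D : Set Ω), MeasurableSet[𝒢 s] D → ∀ S : Set ℝ, MeasurableSet S →
    P (D ∩ {ω | w (s + u) ω - w s ω ∈ S}) = P D * gaussianReal 0 u S

lemma IsBM.fst {𝒢 : Filtration ℝ≥0 mΩ} {P : Measure Ω} {W : ℝ≥0 → Ω → ℝ × ℝ}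
    (h : IsBM 𝒢 P W) : IsRealBM 𝒢 P (fun t ω => (W t ω).1) where
  adapted t := measurable_fst.comp (h.adapted t)
  continuous ω := continuous_fst.comp (h.continuous ω)
  zero ω := by rw [h.zero]; rfl
  incr s u D hD S hS := by
    have := h.incr s u D hD (S ×ˢ Set.univ) (hS.prod MeasurableSet.univ)
    rw [gauss, Measure.prod_prod, measure_univ, mul_one] at this
    rw [← this]
    congr 1
    ext ω
    simp

lemma IsBM.snd {𝒢 : Filtration ℝ≥0 mΩ} {P : Measure Ω} {W : ℝ≥0 → Ω → ℝ × ℝ}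
    (h : IsBM 𝒢 P W) : IsRealBM 𝒢 P (fun t ω => (W t ω).2) where
  adapted t := measurable_snd.comp (h.adapted t)
  continuous ω := continuous_snd.comp (h.continuous ω)
  zero ω := by rw [h.zero]; rfl
  incr s u D hD S hS := by
    have := h.incr s u D hD (Set.univ ×ˢ S) (MeasurableSet.univ.prod hS)
    rw [gauss, Measure.prod_prod, measure_univ, one_mul] at this
    rw [← this]
    congr 1
    ext ω
    simp

/-- Under the usual hypotheses, a pair of Brownian motions has a version with continuous paths. -/
lemma IsBrownianPair.exists_isBM {P : Measure Ω} [IsProbabilityMeasure P]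
    {ℱ : Filtration ℝ≥0 mΩ} (hℱ : UsualHypotheses ℱ P) {W₁ W₂ : ℝ≥0 → Ω → ℝ}
    (hW : IsBrownianPair ℱ P W₁ W₂) :
    ∃ W : ℝ≥0 → Ω → ℝ × ℝ, IsBM ℱ P W ∧ ∀ᵐ ω ∂P, ∀ t, W t ω = (W₁ t ω, W₂ t ω) := by
  classical
  set N : Set Ω := {ω | Continuous (W₁ · ω) ∧ Continuous (W₂ · ω) ∧ W₁ 0 ω = 0 ∧ W₂ 0 ω = 0}
    with hN
  have hNae : ∀ᵐ ω ∂P, ω ∈ N := by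
    filter_upwards [hW.brownian₁.cont, hW.brownian₂.cont, hW.brownian₁.eval_zero_ae_eq_zero,
      hW.brownian₂.eval_zero_ae_eq_zero] with ω h1 h2 h3 h4
    exact ⟨h1, h2, h3, h4⟩
  -- Completeness puts the exceptional null set into every `ℱ t`, so setting the paths to zero on it
  -- keeps them adapted.
  have hN0 : MeasurableSet[ℱ 0] N := by
    have := (hℱ.complete Nᶜ hNae).compl
    rwa [compl_compl] at this
  set W : ℝ≥0 → Ω → ℝ × ℝ := fun t ω => if ω ∈ N then (W₁ t ω, W₂ t ω) else 0 with hWdef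
  have hae : ∀ᵐ ω ∂P, ∀ t, W t ω = (W₁ t ω, W₂ t ω) := by
    filter_upwards [hNae] with ω hω t
    simp [hWdef, hω]
  refine ⟨W, ⟨fun t => ?_, fun ω => ?_, fun ω => ?_, fun s u D hD S hS => ?_⟩, hae⟩
  · exact Measurable.ite (ℱ.mono zero_le _ hN0)
      ((hW.adapted₁ t).prodMk (hW.adapted₂ t)) measurable_const
  · by_cases hω : ω ∈ N
    · simp only [hWdef, hω, if_true]
      exact hω.1.prodMk hω.2.1
    · simp only [hWdef, hω, if_false]
      exact continuous_const
  · by_cases hω : ω ∈ N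
    · simp only [hWdef, hω, if_true]
      rw [hω.2.2.1, hω.2.2.2]; rfl
    · simp only [hWdef, hω, if_false]
  · have hsu : s ≤ s + u := le_self_add
    have h1 : P (D ∩ {ω | W (s + u) ω - W s ω ∈ S})
        = P (D ∩ {ω | (W₁ (s + u) ω - W₁ s ω, W₂ (s + u) ω - W₂ s ω) ∈ S}) := by
      refine measure_congr ?_
      filter_upwards [hae] with ω hω
      have : (ω ∈ {ω | W (s + u) ω - W s ω ∈ S}) =
          (ω ∈ {ω | (W₁ (s + u) ω - W₁ s ω, W₂ (s + u) ω - W₂ s ω) ∈ S}) := by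
        simp only [Set.mem_ofPred_eq, hω]; rfl
      exact congrArg (fun q => ω ∈ D ∧ q) this
    have hm₁ : ∀ t, Measurable (W₁ t) := fun t => (hW.adapted₁ t).mono (ℱ.le t) le_rfl
    have hm₂ : ∀ t, Measurable (W₂ t) := fun t => (hW.adapted₂ t).mono (ℱ.le t) le_rfl
    have hind := (hW.indep_past s (s + u) hsu).symm
    have hI := (Indep_iff _ _ P).1 hind D _ hD ⟨S, hS, rfl⟩
    rw [h1]
    refine hI.trans ?_
    congr 1
    have hm : Measurable (fun ω => (W₁ (s + u) ω - W₁ s ω, W₂ (s + u) ω - W₂ s ω)) :=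
      ((hm₁ _).sub (hm₁ _)).prodMk ((hm₂ _).sub (hm₂ _))
    have h2 : P.map (fun ω => (W₁ (s + u) ω - W₁ s ω, W₂ (s + u) ω - W₂ s ω)) = gauss u := by
      have hi : IndepFun (fun ω => W₁ (s + u) ω - W₁ s ω) (fun ω => W₂ (s + u) ω - W₂ s ω) P :=
        hW.indep.comp (φ := fun f : ℝ≥0 → ℝ => f (s + u) - f s)
          (ψ := fun f : ℝ≥0 → ℝ => f (s + u) - f s) (by fun_prop) (by fun_prop)
      have hd : nndist ((s + u : ℝ≥0) : ℝ) (s : ℝ) = u := by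
        rw [← NNReal.coe_inj, coe_nndist, Real.dist_eq]
        push_cast
        rw [add_sub_cancel_left, abs_of_nonneg (NNReal.coe_nonneg u)]
      have l1 := (hW.brownian₁.hasLaw_sub (s + u) s).map_eq
      have l2 := (hW.brownian₂.hasLaw_sub (s + u) s).map_eq
      have hd' : nndist (s + u).1 s.1 = u := hd
      rw [hd'] at l1 l2
      have hprod := (indepFun_iff_map_prod_eq_prod_map_map
        (((hm₁ (s + u)).sub (hm₁ s)).aemeasurable (μ := P))
        (((hm₂ (s + u)).sub (hm₂ s)).aemeasurable (μ := P))).1 hi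
      rw [l1, l2] at hprod
      exact hprod
    rw [← h2, Measure.map_apply hm hS]

/-! ### Stochastic exponentials solve linear equations -/

lemma tendstoInMeasure_add_zero {P : Measure Ω} {f g : ℕ → Ω → ℝ}
    (hf : TendstoInMeasure P f atTop (fun _ => 0)) (hg : TendstoInMeasure P g atTop (fun _ => 0)) :
    TendstoInMeasure P (fun n ω => f n ω + g n ω) atTop (fun _ => 0) := by
  rw [tendstoInMeasure_iff_norm] at hf hg ⊢
  intro ε hε
  have h := (hf (ε / 2) (by linarith)).add (hg (ε / 2) (by linarith))
  rw [add_zero] at h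
  refine tendsto_of_tendsto_of_tendsto_of_le_of_le tendsto_const_nhds h (fun _ => zero_le)
    fun n => ?_
  refine le_trans (measure_mono ?_) (measure_union_le _ _)
  intro ω hω
  simp only [sub_zero, Set.mem_union, Set.mem_ofPred_eq] at hω ⊢
  by_contra hcon
  push Not at hcon
  have := norm_add_le (f n ω) (g n ω)
  linarith

namespace IsRealBM

variable {𝒢 : Filtration ℝ≥0 mΩ} {P : Measure Ω} {w : ℝ≥0 → Ω → ℝ}

lemma measurable (h : IsRealBM 𝒢 P w) (t : ℝ≥0) : Measurable (w t) :=
  (h.adapted t).mono (𝒢.le t) le_rfl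

lemma measurable_incr (h : IsRealBM 𝒢 P w) (s u : ℝ≥0) :
    Measurable (fun ω => w (s + u) ω - w s ω) := (h.measurable _).sub (h.measurable _)

variable [IsProbabilityMeasure P]

lemma map_incr (h : IsRealBM 𝒢 P w) (s u : ℝ≥0) :
    P.map (fun ω => w (s + u) ω - w s ω) = gaussianReal 0 u := by
  ext S hS
  rw [Measure.map_apply (h.measurable_incr s u) hS]
  have := h.incr s u Set.univ MeasurableSet.univ S hS
  rw [Set.univ_inter, measure_univ, one_mul] at this
  exact this

lemma indep_incr (h : IsRealBM 𝒢 P w) (s u : ℝ≥0) :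
    Indep (𝒢 s) (MeasurableSpace.comap (fun ω => w (s + u) ω - w s ω) inferInstance) P := by
  rw [Indep_iff]
  rintro D _ hD ⟨S, hS, rfl⟩
  have h1 := h.incr s u D hD S hS
  have h2 := h.incr s u Set.univ MeasurableSet.univ S hS
  rw [Set.univ_inter, measure_univ, one_mul] at h2
  rw [← h2] at h1
  exact h1

lemma indepFun_incr (h : IsRealBM 𝒢 P w) (s u : ℝ≥0) {X : Ω → ℝ} (hX : Measurable[𝒢 s] X)
    {f : ℝ → ℝ} (hf : Measurable f) :
    IndepFun X (fun ω => f (w (s + u) ω - w s ω)) P := by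
  rw [IndepFun_iff_Indep]
  refine indep_of_indep_of_le_left (indep_of_indep_of_le_right (h.indep_incr s u) ?_) ?_
  · rintro _ ⟨S, hS, rfl⟩
    exact ⟨f ⁻¹' S, hf hS, rfl⟩
  · exact hX.comap_le

end IsRealBM

/-- Orthogonality of the increments of a martingale transform. -/
lemma integral_sq_sum_of_indep {P : Measure Ω} [IsProbabilityMeasure P]
    {m : ℕ → MeasurableSpace Ω} (hmono : Monotone m) {ξ η : ℕ → Ω → ℝ}
    (hξ : ∀ i, Measurable[m i] (ξ i)) (hη : ∀ i, Measurable[m (i + 1)] (η i))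
    (hξ2 : ∀ i, MemLp (ξ i) 2 P) (hη2 : ∀ i, MemLp (η i) 2 P) (hη0 : ∀ i, ∫ ω, η i ω ∂P = 0)
    (hind : ∀ i, ∀ X : Ω → ℝ, Measurable[m i] X → IndepFun X (η i) P) (n : ℕ) :
    Measurable[m n] (fun ω => ∑ i ∈ Finset.range n, ξ i ω * η i ω) ∧
    MemLp (fun ω => ∑ i ∈ Finset.range n, ξ i ω * η i ω) 2 P ∧
    ∫ ω, (∑ i ∈ Finset.range n, ξ i ω * η i ω) ^ 2 ∂P
      = ∑ i ∈ Finset.range n, (∫ ω, ξ i ω ^ 2 ∂P) * ∫ ω, η i ω ^ 2 ∂P := by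
  induction n with
  | zero => simp [measurable_const]
  | succ n ih =>
    obtain ⟨ih1, ih2, ih3⟩ := ih
    set M : Ω → ℝ := fun ω => ∑ i ∈ Finset.range n, ξ i ω * η i ω with hM
    have hsq : IndepFun (fun ω => ξ n ω ^ 2) (fun ω => η n ω ^ 2) P :=
      (hind n (ξ n) (hξ n)).comp (φ := fun x => x ^ 2) (ψ := fun x => x ^ 2)
        (by fun_prop) (by fun_prop)
    -- The partial sum and `ξ n` are both known before the centred increment `η n`, so the cross
    -- term vanishes. For this the induction also carries measurability and square integrability.
    have hMξ : IndepFun (fun ω => M ω * ξ n ω) (η n) P := hind n _ (ih1.mul (hξ n))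
    have hMξi : Integrable (fun ω => M ω * ξ n ω) P := ih2.integrable_mul (hξ2 n)
    have hη1 : Integrable (η n) P := (hη2 n).integrable one_le_two
    have i2 : Integrable (fun ω => ξ n ω ^ 2 * η n ω ^ 2) P :=
      hsq.integrable_mul (hξ2 n).integrable_sq (hη2 n).integrable_sq
    have i3 : Integrable (fun ω => M ω * ξ n ω * η n ω) P := hMξ.integrable_mul hMξi hη1
    have hprod2 : MemLp (fun ω => ξ n ω * η n ω) 2 P := by
      have hae : AEStronglyMeasurable (fun ω => ξ n ω * η n ω) P :=
        (hξ2 n).aestronglyMeasurable.mul (hη2 n).aestronglyMeasurable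
      rw [memLp_two_iff_integrable_sq hae]
      simpa [mul_pow] using i2
    refine ⟨?_, ?_, ?_⟩
    · simp only [Finset.sum_range_succ]
      exact (ih1.mono (hmono n.le_succ) le_rfl).add
        (((hξ n).mono (hmono n.le_succ) le_rfl).mul (hη n))
    · simp only [Finset.sum_range_succ]
      exact ih2.add hprod2
    · simp only [Finset.sum_range_succ]
      rw [← ih3]
      have h1 : ∀ ω, (M ω + ξ n ω * η n ω) ^ 2
          = M ω ^ 2 + (2 * (M ω * ξ n ω * η n ω) + ξ n ω ^ 2 * η n ω ^ 2) := fun ω => by ring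
      have h2 : ∫ ω, (M ω + ξ n ω * η n ω) ^ 2 ∂P
          = ∫ ω, (M ω ^ 2 + (2 * (M ω * ξ n ω * η n ω) + ξ n ω ^ 2 * η n ω ^ 2)) ∂P :=
        integral_congr_ae (.of_forall h1)
      refine h2.trans ?_
      have h5 : ∫ ω, (M ω ^ 2 + (2 * (M ω * ξ n ω * η n ω) + ξ n ω ^ 2 * η n ω ^ 2)) ∂P
          = ∫ ω, M ω ^ 2 ∂P + ∫ ω, (2 * (M ω * ξ n ω * η n ω) + ξ n ω ^ 2 * η n ω ^ 2) ∂P :=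
        integral_add ih2.integrable_sq ((i3.const_mul 2).add i2)
      rw [h5, integral_add (i3.const_mul 2) i2, integral_const_mul]
      have h3 : ∫ ω, M ω * ξ n ω * η n ω ∂P = 0 := by
        have := hMξ.integral_fun_mul_eq_mul_integral hMξi.aestronglyMeasurable
          hη1.aestronglyMeasurable
        rw [this, hη0, mul_zero]
      have h4 : ∫ ω, ξ n ω ^ 2 * η n ω ^ 2 ∂P = (∫ ω, ξ n ω ^ 2 ∂P) * ∫ ω, η n ω ^ 2 ∂P :=
        hsq.integral_fun_mul_eq_mul_integral (hξ2 n).integrable_sq.aestronglyMeasurable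
          (hη2 n).integrable_sq.aestronglyMeasurable
      rw [h3, h4]; ring

/-- Riemann–Stieltjes sums `∑ g(tᵢ₊₁) ∫_{tᵢ}^{tᵢ₊₁} y` converge to `∫ g y`. -/
lemma tendsto_sum_cumul {g y : ℝ≥0 → ℝ} (hg : Continuous g) (hy : LocInt y) (t : ℝ≥0)
    (e : ℕ) (he : e ≤ 1) :
    Tendsto (fun n : ℕ => ∑ i ∈ Finset.range n, g (t * (((i + e : ℕ) : ℝ≥0) / n)) *
      (cumul y (t * (((i + 1 : ℕ) : ℝ≥0) / n)) - cumul y (t * ((i : ℝ≥0) / n))))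
      atTop (nhds (cumul (fun s => g s * y s) t)) := by
  have hgy : LocInt (fun s => g s * y s) := hy.continuous_mul hg
  have habs : LocInt (fun s => |y s|) := fun s => (hy s).abs
  rw [Metric.tendsto_atTop]
  intro ε hε
  set A := cumul (fun s => |y s|) t with hA
  have hA0 : 0 ≤ A := cumul_nonneg t fun s _ => abs_nonneg _
  have huc : UniformContinuousOn g (Set.Icc 0 t) :=
    isCompact_Icc.uniformContinuousOn_of_continuous hg.continuousOn
  rw [Metric.uniformContinuousOn_iff] at huc
  obtain ⟨δ, hδ, huc⟩ := huc (ε / (A + 1)) (by positivity)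
  obtain ⟨N, hN⟩ := exists_nat_gt ((t : ℝ) / δ)
  refine ⟨N + 1, fun n hn => ?_⟩
  have hn0 : (0 : ℝ) < n := by
    have : 0 < n := by omega
    exact_mod_cast this
  have htn : (t : ℝ) / n < δ := by
    have : (t : ℝ) / δ < n := hN.trans_le (by
      have : N ≤ n := by omega
      exact_mod_cast this)
    rw [div_lt_iff₀ hδ] at this
    rw [div_lt_iff₀ hn0]; linarith [mul_comm (n : ℝ) δ]
  set p : ℕ → ℝ≥0 := fun i => t * ((i : ℝ≥0) / n) with hp
  have hpR : ∀ i, (p i : ℝ) = t * i / n := fun i => by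
    simp only [hp]; push_cast; ring
  have hpmono : ∀ {i j : ℕ}, i ≤ j → p i ≤ p j := fun {i j} hij => by
    rw [← NNReal.coe_le_coe, hpR, hpR]
    have : (i : ℝ) ≤ j := by exact_mod_cast hij
    gcongr
  have hpn : p n = t := by
    rw [← NNReal.coe_inj, hpR]; field_simp
  have hp0 : p 0 = 0 := by simp [hp]
  have tele : ∀ f : ℝ≥0 → ℝ, cumul f t
      = ∑ i ∈ Finset.range n, (cumul f (p (i + 1)) - cumul f (p i)) := fun f => by
    rw [Finset.sum_range_sub (fun i => cumul f (p i)), hpn, hp0, cumul_zero, sub_zero]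
  have hsub : ∀ {f : ℝ≥0 → ℝ}, LocInt f → ∀ i, cumul f (p (i + 1)) - cumul f (p i)
      = ∫ s in Set.Ioc (p i) (p (i + 1)), f s ∂timeMeasure := fun {f} hf i => by
    rw [sub_eq_iff_eq_add', cumul, cumul, ← setIntegral_union _ measurableSet_Ioc
      (hf _) ((hf (p (i + 1))).mono_set fun x hx => ⟨zero_le, hx.2⟩),
      Set.Icc_union_Ioc_eq_Icc zero_le (hpmono i.le_succ)]
    rw [Set.disjoint_left]
    intro x hx hx'
    exact absurd hx.2 (not_le.2 hx'.1)
  have hiO : ∀ {f : ℝ≥0 → ℝ}, LocInt f → ∀ i,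
      IntegrableOn f (Set.Ioc (p i) (p (i + 1))) timeMeasure := fun {f} hf i =>
    (hf (p (i + 1))).mono_set fun x hx => ⟨zero_le, hx.2⟩
  rw [Real.dist_eq, tele (fun s => g s * y s), ← Finset.sum_sub_distrib]
  calc |∑ i ∈ Finset.range n, (g (p (i + e)) * (cumul y (p (i + 1)) - cumul y (p i)) -
        (cumul (fun s => g s * y s) (p (i + 1)) - cumul (fun s => g s * y s) (p i)))|
      ≤ ∑ i ∈ Finset.range n, |g (p (i + e)) * (cumul y (p (i + 1)) - cumul y (p i)) -
        (cumul (fun s => g s * y s) (p (i + 1)) - cumul (fun s => g s * y s) (p i))| :=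
        Finset.abs_sum_le_sum_abs _ _
    _ ≤ ∑ i ∈ Finset.range n, ε / (A + 1) *
          (cumul (fun s => |y s|) (p (i + 1)) - cumul (fun s => |y s|) (p i)) := by
        refine Finset.sum_le_sum fun i hi => ?_
        have hin : i + 1 ≤ n := Finset.mem_range.1 hi
        rw [hsub hy, hsub hgy, hsub habs, ← integral_const_mul, ← integral_const_mul,
          ← integral_sub ((hiO hy i).const_mul _) (hiO hgy i)]
        refine (abs_integral_le_integral_abs).trans ?_
        refine setIntegral_mono_on (((hiO hy i).const_mul _).sub (hiO hgy i)).abs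
          ((hiO habs i).const_mul _) measurableSet_Ioc fun s hs => ?_
        rw [← sub_mul, abs_mul]
        refine mul_le_mul_of_nonneg_right ?_ (abs_nonneg _)
        have hs1 : s ≤ t := hs.2.trans (by rw [← hpn]; exact hpmono hin)
        have hp1 : p (i + e) ≤ t := by rw [← hpn]; exact hpmono (by omega)
        -- As `e ≤ 1`, the evaluation point is one of the two ends of the interval that contains
        -- `s`, hence within the mesh `t / n` of `s`.
        have hd := huc (p (i + e)) ⟨zero_le, hp1⟩ s ⟨zero_le, hs1⟩ ?_
        · rw [Real.dist_eq] at hd; exact hd.le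
        · rw [NNReal.dist_eq]
          refine lt_of_le_of_lt ?_ htn
          have e1 : p i ≤ p (i + e) := hpmono (by omega)
          have e2 : p (i + e) ≤ p (i + 1) := hpmono (by omega)
          have e1' : (p i : ℝ) ≤ p (i + e) := e1
          have e2' : (p (i + e) : ℝ) ≤ p (i + 1) := e2
          have e3 : (p i : ℝ) < s := hs.1
          have e4 : (s : ℝ) ≤ p (i + 1) := hs.2
          have e5 : (p (i + 1) : ℝ) = p i + t / n := by
            rw [hpR, hpR]; push_cast; ring
          rw [abs_le]; constructor <;> linarith
    _ = ε / (A + 1) * A := by rw [← Finset.mul_sum, ← tele]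
    _ < ε / (A + 1) * (A + 1) := by
        have : 0 < ε / (A + 1) := by positivity
        nlinarith
    _ = ε := by field_simp

/-! ### Gaussian integrals for the remainder of the stochastic exponential -/

lemma integral_exp_gaussianReal (b : ℝ) (v : ℝ≥0) :
    ∫ x, Real.exp (b * x) ∂(gaussianReal 0 v) = Real.exp (v * b ^ 2 / 2) := by
  have := congrFun (mgf_id_gaussianReal (μ := 0) (v := v)) b
  simpa [mgf] using this

lemma integrable_mul_exp_gaussianReal (b : ℝ) (v : ℝ≥0) :
    Integrable (fun x => x * Real.exp (b * x)) (gaussianReal 0 v) := by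
  have := integrable_pow_mul_exp_of_mem_interior_integrableExpSet (X := id)
    (μ := gaussianReal 0 v) (v := b) (by rw [integrableExpSet_id_gaussianReal]; simp) 1
  simpa using this

lemma integral_mul_exp_gaussianReal (b : ℝ) (v : ℝ≥0) :
    ∫ x, x * Real.exp (b * x) ∂(gaussianReal 0 v) = v * b * Real.exp (v * b ^ 2 / 2) := by
  have h := deriv_mgf (X := id) (μ := gaussianReal 0 v) (t := b)
    (by rw [integrableExpSet_id_gaussianReal]; simp)
  rw [mgf_id_gaussianReal] at h
  simp only [id] at h
  rw [← h]
  have h1 : HasDerivAt (fun t : ℝ => Real.exp (0 * t + v * t ^ 2 / 2))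
      (Real.exp (0 * b + v * b ^ 2 / 2) * (0 * 1 + v * (2 * b) / 2)) b := by
    refine HasDerivAt.exp (HasDerivAt.add ((hasDerivAt_id b).const_mul 0) ?_)
    have := ((hasDerivAt_pow 2 b).const_mul (v : ℝ)).div_const 2
    simpa using this
  rw [h1.deriv]
  simp only [zero_mul, zero_add]
  ring

lemma integral_sq_gaussianReal (v : ℝ≥0) : ∫ x, x ^ 2 ∂(gaussianReal 0 v) = v := by
  have h := variance_id_gaussianReal (μ := 0) (v := v)
  rw [variance_eq_integral (by fun_prop)] at h
  simpa using h

lemma integrable_sq_gaussianReal (v : ℝ≥0) : Integrable (fun x => x ^ 2) (gaussianReal 0 v) :=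
  (memLp_id_gaussianReal (μ := 0) (v := v) 2).integrable_sq

/-- The increment of the stochastic exponential minus its linear part. -/
def expRem (b : ℝ) (v : ℝ≥0) (x : ℝ) : ℝ := Real.exp (b * x - b ^ 2 * v / 2) - 1 - b * x

lemma measurable_expRem (b : ℝ) (v : ℝ≥0) : Measurable (expRem b v) := by
  unfold expRem; fun_prop

lemma expRem_eq (b : ℝ) (v : ℝ≥0) (x : ℝ) :
    expRem b v x = Real.exp (-(b ^ 2 * v / 2)) * Real.exp (b * x) - 1 - b * x := by
  rw [expRem, ← Real.exp_add]; congr 3; ring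

lemma expRem_sq_eq (b : ℝ) (v : ℝ≥0) (x : ℝ) :
    expRem b v x ^ 2 = Real.exp (-(b ^ 2 * v)) * Real.exp (2 * b * x) + 1 + b ^ 2 * x ^ 2
      - 2 * Real.exp (-(b ^ 2 * v / 2)) * Real.exp (b * x)
      - 2 * b * Real.exp (-(b ^ 2 * v / 2)) * (x * Real.exp (b * x)) + 2 * b * x := by
  rw [expRem_eq]
  have h1 : Real.exp (-(b ^ 2 * v)) = Real.exp (-(b ^ 2 * v / 2)) ^ 2 := by
    rw [← Real.exp_nat_mul]; congr 1; push_cast; ring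
  have h2 : Real.exp (2 * b * x) = Real.exp (b * x) ^ 2 := by
    rw [← Real.exp_nat_mul]; congr 1; push_cast; ring
  rw [h1, h2]; ring

lemma integrable_id_gaussianReal' (v : ℝ≥0) : Integrable (fun x => x) (gaussianReal 0 v) :=
  (memLp_id_gaussianReal (μ := 0) (v := v) 1).integrable (by simp)

lemma integral_expRem (b : ℝ) (v : ℝ≥0) : ∫ x, expRem b v x ∂(gaussianReal 0 v) = 0 := by
  simp_rw [expRem_eq]
  have i1 := (integrable_exp_mul_gaussianReal (μ := 0) (v := v) b).const_mul
    (Real.exp (-(b ^ 2 * v / 2)))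
  have i2 := (integrable_id_gaussianReal' v).const_mul b
  have i3 := integrable_const (μ := gaussianReal 0 v) (1 : ℝ)
  have i4 : Integrable (fun x => Real.exp (-(b ^ 2 * v / 2)) * Real.exp (b * x) - 1)
    (gaussianReal 0 v) := i1.sub i3
  rw [integral_sub i4 i2, integral_sub i1 i3, integral_const_mul, integral_const_mul,
    integral_exp_gaussianReal, integral_id_gaussianReal, ← Real.exp_add]
  have : -(b ^ 2 * (v : ℝ) / 2) + v * b ^ 2 / 2 = 0 := by ring
  rw [this]; simp

lemma integrable_expRem_sq (b : ℝ) (v : ℝ≥0) :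
    Integrable (fun x => expRem b v x ^ 2) (gaussianReal 0 v) := by
  simp_rw [expRem_sq_eq]
  exact ((((((integrable_exp_mul_gaussianReal (2 * b)).const_mul _).add
    (integrable_const _)).add ((integrable_sq_gaussianReal v).const_mul _)).sub
    ((integrable_exp_mul_gaussianReal b).const_mul _)).sub
    ((integrable_mul_exp_gaussianReal b v).const_mul _)).add
    ((integrable_id_gaussianReal' v).const_mul _)

/-- The value is of second order in `v`: over `n` intervals of length `t / n` the remainders have
total second moment of order `1 / n`. Together with the vanishing mean this makes weighted sums of
them negligible. -/
lemma integral_expRem_sq (b : ℝ) (v : ℝ≥0) :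
    ∫ x, expRem b v x ^ 2 ∂(gaussianReal 0 v) = Real.exp (b ^ 2 * v) - 1 - b ^ 2 * v := by
  simp_rw [expRem_sq_eq]
  have i1 := (integrable_exp_mul_gaussianReal (μ := 0) (v := v) (2 * b)).const_mul
    (Real.exp (-(b ^ 2 * v)))
  have i2 := integrable_const (μ := gaussianReal 0 v) (1 : ℝ)
  have i3 := (integrable_sq_gaussianReal v).const_mul (b ^ 2)
  have i4 := (integrable_exp_mul_gaussianReal (μ := 0) (v := v) b).const_mul
    (2 * Real.exp (-(b ^ 2 * v / 2)))
  have i5 := (integrable_mul_exp_gaussianReal b v).const_mul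
    (2 * b * Real.exp (-(b ^ 2 * v / 2)))
  have i6 := (integrable_id_gaussianReal' v).const_mul (2 * b)
  have j2 : Integrable (fun x => Real.exp (-(b ^ 2 * v)) * Real.exp (2 * b * x) + 1)
    (gaussianReal 0 v) := i1.add i2
  have j3 : Integrable (fun x => Real.exp (-(b ^ 2 * v)) * Real.exp (2 * b * x) + 1
    + b ^ 2 * x ^ 2) (gaussianReal 0 v) := j2.add i3
  have j4 : Integrable (fun x => Real.exp (-(b ^ 2 * v)) * Real.exp (2 * b * x) + 1
    + b ^ 2 * x ^ 2 - 2 * Real.exp (-(b ^ 2 * v / 2)) * Real.exp (b * x))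
    (gaussianReal 0 v) := j3.sub i4
  have j5 : Integrable (fun x => Real.exp (-(b ^ 2 * v)) * Real.exp (2 * b * x) + 1
    + b ^ 2 * x ^ 2 - 2 * Real.exp (-(b ^ 2 * v / 2)) * Real.exp (b * x)
    - 2 * b * Real.exp (-(b ^ 2 * v / 2)) * (x * Real.exp (b * x)))
    (gaussianReal 0 v) := j4.sub i5
  rw [integral_add j5 i6, integral_sub j4 i5, integral_sub j3 i4, integral_add j2 i3,
    integral_add i1 i2]
  simp only [integral_const_mul, integral_exp_gaussianReal, integral_sq_gaussianReal,
    integral_mul_exp_gaussianReal]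
  have h1 : Real.exp (-(b ^ 2 * (v : ℝ))) * Real.exp (v * (2 * b) ^ 2 / 2)
      = Real.exp (b ^ 2 * v) := by
    rw [← Real.exp_add]; congr 1; ring
  have h2 : Real.exp (-(b ^ 2 * (v : ℝ) / 2)) * Real.exp (v * b ^ 2 / 2) = 1 := by
    rw [← Real.exp_add, ← Real.exp_zero]; congr 1; ring
  simp only [integral_const, probReal_univ, smul_eq_mul]
  have h3 : ∫ x, 2 * b * x ∂(gaussianReal 0 v) = 0 := by
    rw [integral_const_mul, integral_id_gaussianReal, mul_zero]
  linear_combination h1 - (2 + 2 * b ^ 2 * v) * h2 + h3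

lemma IsRealBM.integral_incr {𝒢 : Filtration ℝ≥0 mΩ} {P : Measure Ω} [IsProbabilityMeasure P]
    {w : ℝ≥0 → Ω → ℝ} (h : IsRealBM 𝒢 P w) (s u : ℝ≥0) {f : ℝ → ℝ} (hf : Measurable f) :
    ∫ ω, f (w (s + u) ω - w s ω) ∂P = ∫ x, f x ∂(gaussianReal 0 u) := by
  rw [← h.map_incr s u, integral_map (h.measurable_incr s u).aemeasurable
    hf.aestronglyMeasurable]

lemma IsRealBM.integrable_incr {𝒢 : Filtration ℝ≥0 mΩ} {P : Measure Ω} [IsProbabilityMeasure P]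
    {w : ℝ≥0 → Ω → ℝ} (h : IsRealBM 𝒢 P w) (s u : ℝ≥0) {f : ℝ → ℝ}
    (hi : Integrable f (gaussianReal 0 u)) :
    Integrable (fun ω => f (w (s + u) ω - w s ω)) P := by
  rw [← h.map_incr s u] at hi
  exact hi.comp_measurable (h.measurable_incr s u)

/-- The stochastic exponential `exp (β wₜ - β² t / 2)`. -/
def stochExp (β : ℝ) (w : ℝ≥0 → Ω → ℝ) (t : ℝ≥0) (ω : Ω) : ℝ :=
  Real.exp (β * w t ω - β ^ 2 * t / 2)

lemma stochExp_pos (β : ℝ) (w : ℝ≥0 → Ω → ℝ) (t : ℝ≥0) (ω : Ω) : 0 < stochExp β w t ω :=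
  Real.exp_pos _

lemma IsRealBM.measurable_stochExp {𝒢 : Filtration ℝ≥0 mΩ} {P : Measure Ω}
    {w : ℝ≥0 → Ω → ℝ} (h : IsRealBM 𝒢 P w) (β : ℝ) (t : ℝ≥0) :
    Measurable[𝒢 t] (stochExp β w t) :=
  Real.measurable_exp.comp (((h.adapted t).const_mul β).sub_const _)

lemma IsRealBM.continuous_stochExp {𝒢 : Filtration ℝ≥0 mΩ} {P : Measure Ω}
    {w : ℝ≥0 → Ω → ℝ} (h : IsRealBM 𝒢 P w) (β : ℝ) (ω : Ω) :
    Continuous fun t => stochExp β w t ω := by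
  have := h.continuous ω
  unfold stochExp
  fun_prop

/-- The discrete form of Itô's formula: the first term produces the Itô sums, and the second is
centred because `expRem` contains the compensator `β² u / 2`. -/
lemma stochExp_add (β : ℝ) (w : ℝ≥0 → Ω → ℝ) (s u : ℝ≥0) (ω : Ω) :
    stochExp β w (s + u) ω - stochExp β w s ω
      = stochExp β w s ω * (β * (w (s + u) ω - w s ω))
        + stochExp β w s ω * expRem β u (w (s + u) ω - w s ω) := by
  have : stochExp β w (s + u) ω = stochExp β w s ω *
      Real.exp (β * (w (s + u) ω - w s ω) - β ^ 2 * u / 2) := by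
    rw [stochExp, stochExp, ← Real.exp_add]; congr 1; push_cast; ring
  rw [this, expRem]; ring

lemma IsRealBM.integrable_stochExp_sq {𝒢 : Filtration ℝ≥0 mΩ} {P : Measure Ω}
    [IsProbabilityMeasure P] {w : ℝ≥0 → Ω → ℝ} (h : IsRealBM 𝒢 P w) (β : ℝ) (t : ℝ≥0) :
    Integrable (fun ω => stochExp β w t ω ^ 2) P ∧
      ∫ ω, stochExp β w t ω ^ 2 ∂P = Real.exp (β ^ 2 * t) := by
  have h1 : ∀ ω, stochExp β w t ω ^ 2
      = Real.exp (-(β ^ 2 * t)) * Real.exp (2 * β * (w (0 + t) ω - w 0 ω)) := fun ω => by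
    rw [stochExp, ← Real.exp_nat_mul, ← Real.exp_add, h.zero, zero_add]
    congr 1; push_cast; ring
  simp_rw [h1]
  have hf : Measurable fun x : ℝ => Real.exp (2 * β * x) := by fun_prop
  refine ⟨(h.integrable_incr 0 t (integrable_exp_mul_gaussianReal _)).const_mul _, ?_⟩
  rw [integral_const_mul, h.integral_incr 0 t hf, integral_exp_gaussianReal, ← Real.exp_add]
  congr 1; ring

/-- The sums of `Yᵢ` against the remainders of the stochastic exponential are negligible. -/
lemma IsRealBM.tendstoInMeasure_sum_expRem {𝒢 : Filtration ℝ≥0 mΩ} {P : Measure Ω}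
    [IsProbabilityMeasure P] {w : ℝ≥0 → Ω → ℝ} (h : IsRealBM 𝒢 P w) (β : ℝ)
    {Y : ℝ≥0 → Ω → ℝ} (hYm : ∀ t, Measurable[𝒢 t] (Y t)) (hYc : ∀ ω, Continuous fun t => Y t ω)
    (t : ℝ≥0) (p : ℕ → ℕ → ℝ≥0) (hp : ∀ n i, p n i = t * ((i : ℝ≥0) / n)) :
    TendstoInMeasure P (fun (n : ℕ) ω => ∑ i ∈ Finset.range n, Y (p n i) ω *
      stochExp β w (p n i) ω * expRem β (t / n) (w (p n (i + 1)) ω - w (p n i) ω))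
      atTop (fun _ => 0) := by
  have hYm' : ∀ t, Measurable (Y t) := fun t => (hYm t).mono (𝒢.le t) le_rfl
  have hpa : ∀ n i, p n (i + 1) = p n i + t / n := fun n i => by
    rw [hp, hp]; push_cast; ring
  have hple : ∀ n i, i ≤ n → p n i ≤ t := fun n i hi => by
    rw [hp]
    refine mul_le_of_le_one_right zero_le (div_le_one_of_le₀ ?_ zero_le)
    exact_mod_cast hi
  -- `Y` has continuous paths but no moments. Clipping at level `m` gives square integrable weights,
  -- and it changes nothing outside an event whose probability vanishes as `m` grows.
  set clip : ℕ → ℝ → ℝ := fun m x => max (-m) (min x m) with hclip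
  have hclipm : ∀ m, Measurable (clip m) := fun m => by
    simp only [hclip]; fun_prop
  have hclipb : ∀ (m : ℕ) x, |clip m x| ≤ m := fun m x => by
    have : (0 : ℝ) ≤ m := Nat.cast_nonneg m
    rw [abs_le]
    exact ⟨le_max_left _ _, max_le (by linarith) (min_le_right _ _)⟩
  set S : ℕ → ℕ → Ω → ℝ := fun m n ω => ∑ i ∈ Finset.range n, (clip m (Y (p n i) ω) *
      stochExp β w (p n i) ω) * expRem β (t / n) (w (p n (i + 1)) ω - w (p n i) ω) with hS
  -- second moments of the truncated sums
  have hL2 : ∀ m n : ℕ, MemLp (S m n) 2 P ∧ ∫ ω, S m n ω ^ 2 ∂P ≤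
      n * (m ^ 2 * Real.exp (β ^ 2 * t) *
        (Real.exp (β ^ 2 * (t / n : ℝ≥0)) - 1 - β ^ 2 * (t / n : ℝ≥0))) := by
    intro m n
    have hξ : ∀ i, Measurable[𝒢 (p n i)] (fun ω => clip m (Y (p n i) ω) *
        stochExp β w (p n i) ω) := fun i =>
      ((hclipm m).comp (hYm _)).mul (h.measurable_stochExp β _)
    have hE : ∀ i, MemLp (stochExp β w (p n i)) 2 P := fun i => by
      rw [memLp_two_iff_integrable_sq
        ((h.measurable_stochExp β _).mono (𝒢.le _) le_rfl).aestronglyMeasurable]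
      exact (h.integrable_stochExp_sq β _).1
    have hξ2 : ∀ i, MemLp (fun ω => clip m (Y (p n i) ω) * stochExp β w (p n i) ω) 2 P := by
      intro i
      refine ((hE i).const_mul (m : ℝ)).mono
        ((hξ i).mono (𝒢.le _) le_rfl).aestronglyMeasurable (.of_forall fun ω => ?_)
      rw [norm_mul, norm_mul]
      refine mul_le_mul_of_nonneg_right ?_ (norm_nonneg _)
      rw [Real.norm_eq_abs, Real.norm_eq_abs, Nat.abs_cast]
      exact hclipb m _
    have hη : ∀ i, Measurable[𝒢 (p n (i + 1))]
        (fun ω => expRem β (t / n) (w (p n (i + 1)) ω - w (p n i) ω)) := fun i =>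
      (measurable_expRem β _).comp ((h.adapted _).sub ((h.adapted _).mono
        (𝒢.mono (by rw [hpa]; exact le_self_add)) le_rfl))
    have hη2 : ∀ i, MemLp (fun ω => expRem β (t / n) (w (p n (i + 1)) ω - w (p n i) ω)) 2 P := by
      intro i
      rw [memLp_two_iff_integrable_sq ((hη i).mono (𝒢.le _) le_rfl).aestronglyMeasurable, hpa]
      exact h.integrable_incr _ _ (integrable_expRem_sq β _)
    have horth := integral_sq_sum_of_indep (P := P) (m := fun i => 𝒢 (p n i))
      (fun i j hij => 𝒢.mono (by rw [hp, hp]; gcongr)) hξ hη hξ2 hη2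
      (fun i => by
        rw [hpa, h.integral_incr _ _ (measurable_expRem β _), integral_expRem])
      (fun i X hX => by
        rw [hpa]; exact h.indepFun_incr _ _ hX (measurable_expRem β _)) n
    refine ⟨horth.2.1, ?_⟩
    rw [hS]
    simp only
    rw [horth.2.2]
    have hterm : ∀ i ∈ Finset.range n,
        (∫ ω, (clip m (Y (p n i) ω) * stochExp β w (p n i) ω) ^ 2 ∂P) *
          ∫ ω, expRem β (t / n) (w (p n (i + 1)) ω - w (p n i) ω) ^ 2 ∂P
        ≤ m ^ 2 * Real.exp (β ^ 2 * t) *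
          (Real.exp (β ^ 2 * (t / n : ℝ≥0)) - 1 - β ^ 2 * (t / n : ℝ≥0)) := by
      intro i hi
      have e1 : ∫ ω, expRem β (t / n) (w (p n (i + 1)) ω - w (p n i) ω) ^ 2 ∂P
          = Real.exp (β ^ 2 * (t / n : ℝ≥0)) - 1 - β ^ 2 * (t / n : ℝ≥0) := by
        rw [hpa, h.integral_incr _ _ ((measurable_expRem β _).pow_const 2), integral_expRem_sq]
      rw [e1]
      refine mul_le_mul_of_nonneg_right ?_ (by
        have := Real.add_one_le_exp (β ^ 2 * ((t / n : ℝ≥0) : ℝ)); linarith)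
      calc ∫ ω, (clip m (Y (p n i) ω) * stochExp β w (p n i) ω) ^ 2 ∂P
          ≤ ∫ ω, (m : ℝ) ^ 2 * stochExp β w (p n i) ω ^ 2 ∂P := by
            refine integral_mono (hξ2 i).integrable_sq
              ((h.integrable_stochExp_sq β _).1.const_mul _) fun ω => ?_
            simp only [mul_pow]
            refine mul_le_mul_of_nonneg_right ?_ (sq_nonneg _)
            rw [← sq_abs]
            exact pow_le_pow_left₀ (abs_nonneg _) (hclipb m _) 2
        _ = m ^ 2 * Real.exp (β ^ 2 * p n i) := by
            rw [integral_const_mul, (h.integrable_stochExp_sq β _).2]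
        _ ≤ m ^ 2 * Real.exp (β ^ 2 * t) := by
            have : (p n i : ℝ) ≤ t := hple n i (Finset.mem_range.1 hi).le
            gcongr
    refine (Finset.sum_le_sum hterm).trans ?_
    rw [Finset.sum_const, Finset.card_range, nsmul_eq_mul]
  -- the bad events
  set Bad : ℕ → Set Ω := fun m => ⋃ n : ℕ, ⋃ i : ℕ, ⋃ _ : i ≤ n, {ω | (m : ℝ) < |Y (p n i) ω|}
    with hBad
  have hBadm : ∀ m, MeasurableSet (Bad m) := fun m => by
    refine MeasurableSet.iUnion fun n => MeasurableSet.iUnion fun i => MeasurableSet.iUnion fun _ =>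
      measurableSet_lt measurable_const (hYm' _).abs
  have hBadanti : Antitone Bad := by
    intro m m' hmm ω hω
    simp only [hBad, Set.mem_iUnion, Set.mem_ofPred_eq] at hω ⊢
    obtain ⟨n, i, hi, hlt⟩ := hω
    have : (m : ℝ) ≤ m' := by exact_mod_cast hmm
    exact ⟨n, i, hi, this.trans_lt hlt⟩
  have hBadempty : ⋂ m, Bad m = ∅ := by
    ext ω
    simp only [Set.mem_iInter, Set.mem_empty_iff_false, iff_false, not_forall]
    obtain ⟨C, hC⟩ := (isCompact_Icc (a := (0 : ℝ≥0)) (b := t)).exists_bound_of_continuousOn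
      (hYc ω).continuousOn
    obtain ⟨m, hm⟩ := exists_nat_gt C
    refine ⟨m, fun hω => ?_⟩
    simp only [hBad, Set.mem_iUnion, Set.mem_ofPred_eq] at hω
    obtain ⟨n, i, hi, hlt⟩ := hω
    have := hC (p n i) ⟨zero_le, hple n i hi⟩
    rw [Real.norm_eq_abs] at this
    linarith
  have hBadlim : Tendsto (fun m => P (Bad m)) atTop (nhds 0) := by
    have := tendsto_measure_iInter_atTop (μ := P) (s := Bad)
      (fun m => (hBadm m).nullMeasurableSet) hBadanti ⟨0, measure_ne_top _ _⟩
    rwa [hBadempty, measure_empty] at this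
  -- conclusion
  rw [tendstoInMeasure_iff_norm]
  intro ε hε
  rw [ENNReal.tendsto_nhds_zero]
  intro κ hκ
  have hκ2 : (0 : ℝ≥0∞) < κ / 2 := ENNReal.half_pos hκ.ne'
  obtain ⟨m, hm⟩ := ((ENNReal.tendsto_nhds_zero.1 hBadlim) (κ / 2) hκ2).exists
  have hlim : Tendsto (fun n : ℕ => ENNReal.ofReal ((n * (m ^ 2 * Real.exp (β ^ 2 * t) *
        (Real.exp (β ^ 2 * (t / n : ℝ≥0)) - 1 - β ^ 2 * (t / n : ℝ≥0)))) / ε ^ 2))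
      atTop (nhds 0) := by
    rw [← ENNReal.ofReal_zero]
    refine ENNReal.tendsto_ofReal ?_
    set K : ℝ := m ^ 2 * Real.exp (β ^ 2 * t) with hK
    have hK0 : 0 ≤ K := by positivity
    -- This bound sums `n` terms of order `n⁻²`. It comes from `|exp x - 1 - x| ≤ x²` for `|x| ≤ 1`,
    -- so it holds once `n` exceeds `β² t`.
    have hb : Tendsto (fun n : ℕ => (K * (β ^ 2 * t) ^ 2 / ε ^ 2) * (1 / (n : ℝ)))
        atTop (nhds 0) := by
      simpa using tendsto_one_div_atTop_nhds_zero_nat.const_mul (K * (β ^ 2 * t) ^ 2 / ε ^ 2)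
    refine squeeze_zero' (.of_forall fun n => ?_) ?_ hb
    · have := Real.add_one_le_exp (β ^ 2 * ((t / n : ℝ≥0) : ℝ))
      have h0 : 0 ≤ Real.exp (β ^ 2 * (t / n : ℝ≥0)) - 1 - β ^ 2 * (t / n : ℝ≥0) := by linarith
      positivity
    · obtain ⟨N, hN⟩ := exists_nat_gt (β ^ 2 * (t : ℝ))
      filter_upwards [eventually_ge_atTop (N + 1)] with n hn
      have hn0 : (0 : ℝ) < n := by
        have : 0 < n := by omega
        exact_mod_cast this
      have hx : ((t / n : ℝ≥0) : ℝ) = t / n := by push_cast; rfl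
      have hx0 : 0 ≤ β ^ 2 * ((t / n : ℝ≥0) : ℝ) := by positivity
      have hx1 : |β ^ 2 * ((t / n : ℝ≥0) : ℝ)| ≤ 1 := by
        rw [abs_of_nonneg hx0, hx, ← mul_div_assoc, div_le_one hn0]
        have : (N : ℝ) ≤ n := by
          have : N ≤ n := by omega
          exact_mod_cast this
        linarith
      have hq := (le_abs_self _).trans (Real.abs_exp_sub_one_sub_id_le hx1)
      calc (n * (K * (Real.exp (β ^ 2 * (t / n : ℝ≥0)) - 1 - β ^ 2 * (t / n : ℝ≥0)))) / ε ^ 2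
          ≤ (n * (K * (β ^ 2 * (t / n : ℝ≥0)) ^ 2)) / ε ^ 2 := by gcongr
        _ = (K * (β ^ 2 * t) ^ 2 / ε ^ 2) * (1 / (n : ℝ)) := by
            rw [hx]; field_simp
  filter_upwards [(ENNReal.tendsto_nhds_zero.1 hlim) (κ / 2) hκ2] with n hn
  have hsub : {ω | ε ≤ ‖∑ i ∈ Finset.range n, Y (p n i) ω * stochExp β w (p n i) ω *
      expRem β (t / n) (w (p n (i + 1)) ω - w (p n i) ω) - 0‖}
      ⊆ Bad m ∪ {ω | ε ^ 2 ≤ S m n ω ^ 2} := by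
    intro ω hω
    by_cases hb : ω ∈ Bad m
    · exact Or.inl hb
    · refine Or.inr ?_
      have heq : S m n ω = ∑ i ∈ Finset.range n, Y (p n i) ω * stochExp β w (p n i) ω *
          expRem β (t / n) (w (p n (i + 1)) ω - w (p n i) ω) := by
        refine Finset.sum_congr rfl fun i hi => ?_
        have : |Y (p n i) ω| ≤ m := by
          by_contra hcon
          refine hb ?_
          simp only [hBad, Set.mem_iUnion, Set.mem_ofPred_eq]
          exact ⟨n, i, (Finset.mem_range.1 hi).le, not_le.1 hcon⟩
        rw [abs_le] at this
        simp only [hclip]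
        rw [min_eq_left this.2, max_eq_right this.1]
      simp only [Set.mem_ofPred_eq, sub_zero] at hω ⊢
      rw [heq, ← sq_abs (∑ i ∈ _, _), ← Real.norm_eq_abs]
      exact pow_le_pow_left₀ hε.le hω 2
  have hcheb : P {ω | ε ^ 2 ≤ S m n ω ^ 2} ≤ κ / 2 := by
    refine le_trans ?_ hn
    have h1 := mul_meas_ge_le_integral_of_nonneg
      (.of_forall fun ω => sq_nonneg (S m n ω)) (hL2 m n).1.integrable_sq (ε ^ 2)
    rw [← ENNReal.ofReal_toReal (measure_ne_top P _)]
    refine ENNReal.ofReal_le_ofReal ?_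
    rw [le_div_iff₀ (by positivity), mul_comm]
    exact h1.trans (hL2 m n).2
  calc P _ ≤ P (Bad m ∪ {ω | ε ^ 2 ≤ S m n ω ^ 2}) := measure_mono hsub
    _ ≤ P (Bad m) + P {ω | ε ^ 2 ≤ S m n ω ^ 2} := measure_union_le _ _
    _ ≤ κ / 2 + κ / 2 := add_le_add hm hcheb
    _ = κ := ENNReal.add_halves κ

/-- If `dY = y dt`, then `E Y` solves `d(E Y) = E y dt + β E Y dw`, where `E` is the stochastic
exponential of `β w`. -/
theorem IsRealBM.isItoIntegral_stochExp_mul {𝒢 : Filtration ℝ≥0 mΩ} {P : Measure Ω}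
    [IsProbabilityMeasure P] {w : ℝ≥0 → Ω → ℝ} (h : IsRealBM 𝒢 P w) {β : ℝ} (hβ : β ≠ 0)
    {Y y : ℝ≥0 → Ω → ℝ} (hYm : ∀ t, Measurable[𝒢 t] (Y t))
    (hy : ∀ ω, LocInt fun s => y s ω) {x : ℝ}
    (hY : ∀ ω t, Y t ω = x + cumul (y · ω) t) :
    IsItoIntegral P (fun t ω => stochExp β w t ω * Y t ω) w
      (fun t ω => (stochExp β w t ω * Y t ω - x
        - cumul (fun s => stochExp β w s ω * y s ω) t) / β) := by
  intro t
  have hYc : ∀ ω, Continuous fun t => Y t ω := fun ω => by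
    simp only [hY]
    exact continuous_const.add (continuous_cumul (hy ω))
  have hYm' : ∀ t, Measurable (Y t) := fun t => (hYm t).mono (𝒢.le t) le_rfl
  have hEm : ∀ t, Measurable (stochExp β w t) := fun t =>
    (h.measurable_stochExp β t).mono (𝒢.le t) le_rfl
  set p : ℕ → ℕ → ℝ≥0 := fun n i => t * ((i : ℝ≥0) / n) with hp
  -- Summation by parts: the increments of `E Y` split into `E` at the right end times the increment
  -- of `Y`, the Itô sum times `β`, and the remainders. The sum `a n` collects the first kind and
  -- converges to `∫ E y`.
  set a : ℕ → Ω → ℝ := fun n ω => ∑ i ∈ Finset.range n, stochExp β w (p n (i + 1)) ω *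
    (cumul (y · ω) (p n (i + 1)) - cumul (y · ω) (p n i)) with ha
  have ham : ∀ n, Measurable (a n) := fun n => by
    have : a n = fun ω => ∑ i ∈ Finset.range n, stochExp β w (p n (i + 1)) ω *
        (Y (p n (i + 1)) ω - Y (p n i) ω) := by
      ext ω
      refine Finset.sum_congr rfl fun i _ => ?_
      rw [hY, hY]; ring
    rw [this]
    exact Finset.measurable_sum _ fun i _ => (hEm _).mul ((hYm' _).sub (hYm' _))
  have hlim : ∀ ω, Tendsto (fun n => a n ω) atTop
      (nhds (cumul (fun s => stochExp β w s ω * y s ω) t)) := fun ω =>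
    tendsto_sum_cumul (h.continuous_stochExp β ω) (hy ω) t 1 le_rfl
  -- No measurability of `y` in `ω` is assumed; the integral inherits it from the sums `a n`, which
  -- can be written in terms of `Y`.
  have hcm : Measurable fun ω => cumul (fun s => stochExp β w s ω * y s ω) t :=
    measurable_of_tendsto_metrizable ham (tendsto_pi_nhds.2 hlim)
  have hA : TendstoInMeasure P (fun n ω => cumul (fun s => stochExp β w s ω * y s ω) t - a n ω)
      atTop (fun _ => 0) := by
    refine tendstoInMeasure_of_tendsto_ae
      (fun n => (hcm.sub (ham n)).aestronglyMeasurable) (.of_forall fun ω => ?_)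
    have := (hlim ω).const_sub (cumul (fun s => stochExp β w s ω * y s ω) t)
    rwa [sub_self] at this
  have hB := h.tendstoInMeasure_sum_expRem β hYm hYc t p fun n i => rfl
  have hB' : TendstoInMeasure P (fun (n : ℕ) ω => -∑ i ∈ Finset.range n, Y (p n i) ω *
      stochExp β w (p n i) ω * expRem β (t / n) (w (p n (i + 1)) ω - w (p n i) ω))
      atTop (fun _ => 0) := by
    rw [tendstoInMeasure_iff_norm] at hB ⊢
    simpa using hB
  have hAB := tendstoInMeasure_add_zero hA hB'
  rw [tendstoInMeasure_iff_norm] at hAB ⊢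
  intro ε hε
  refine (hAB (ε * |β|) (mul_pos hε (abs_pos.2 hβ))).congr' ?_
  filter_upwards [eventually_ge_atTop 1] with n hn
  have hn0 : (n : ℝ≥0) ≠ 0 := by
    have : n ≠ 0 := by omega
    exact_mod_cast this
  congr 1
  ext ω
  simp only [Set.mem_ofPred_eq, sub_zero]
  have hpn : p n n = t := by simp only [hp]; rw [div_self hn0, mul_one]
  have hp0 : p n 0 = 0 := by simp [hp]
  have hpa : ∀ i, p n (i + 1) = p n i + t / n := fun i => by
    simp only [hp]; push_cast; ring
  have hpc : ∀ i : ℕ, t * (((i : ℝ≥0) + 1) / (n : ℝ≥0)) = p n (i + 1) := fun i => by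
    simp only [hp]; push_cast; rfl
  have hE0 : stochExp β w 0 ω = 1 := by simp [stochExp, h.zero]
  have htele : stochExp β w t ω * Y t ω - x
      = ∑ i ∈ Finset.range n, (stochExp β w (p n (i + 1)) ω * Y (p n (i + 1)) ω
        - stochExp β w (p n i) ω * Y (p n i) ω) := by
    rw [Finset.sum_range_sub (fun i => stochExp β w (p n i) ω * Y (p n i) ω), hpn, hp0, hE0,
      hY ω 0, cumul_zero, one_mul, add_zero]
  have key : (∑ i ∈ Finset.range n, stochExp β w (p n i) ω * Y (p n i) ω *
        (w (p n (i + 1)) ω - w (p n i) ω)) - (stochExp β w t ω * Y t ω - x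
        - cumul (fun s => stochExp β w s ω * y s ω) t) / β
      = (cumul (fun s => stochExp β w s ω * y s ω) t - a n ω
        + -∑ i ∈ Finset.range n, Y (p n i) ω * stochExp β w (p n i) ω *
          expRem β (t / n) (w (p n (i + 1)) ω - w (p n i) ω)) / β := by
    rw [eq_div_iff hβ, sub_mul, div_mul_cancel₀ _ hβ, htele, ha]
    have : ∀ i, stochExp β w (p n (i + 1)) ω = stochExp β w (p n i) ω
        + (stochExp β w (p n i) ω * (β * (w (p n (i + 1)) ω - w (p n i) ω))
        + stochExp β w (p n i) ω * expRem β (t / n) (w (p n (i + 1)) ω - w (p n i) ω)) := fun i => by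
      have := stochExp_add β w (p n i) (t / n) ω
      rw [hpa]; linarith
    rw [Finset.sum_mul]
    have e : ∀ i, stochExp β w (p n i) ω * Y (p n i) ω * (w (p n (i + 1)) ω - w (p n i) ω) * β
        = (stochExp β w (p n (i + 1)) ω * Y (p n (i + 1)) ω
          - stochExp β w (p n i) ω * Y (p n i) ω)
        - stochExp β w (p n (i + 1)) ω *
          (cumul (y · ω) (p n (i + 1)) - cumul (y · ω) (p n i))
        - Y (p n i) ω * stochExp β w (p n i) ω *
          expRem β (t / n) (w (p n (i + 1)) ω - w (p n i) ω) := fun i => by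
      have h1 : cumul (y · ω) (p n (i + 1)) - cumul (y · ω) (p n i)
          = Y (p n (i + 1)) ω - Y (p n i) ω := by rw [hY, hY]; ring
      rw [h1]
      have h2 := this i
      linear_combination -Y (p n i) ω * h2
    simp only [e, Finset.sum_sub_distrib]
    ring
  simp only [hpc]
  rw [show (∑ i ∈ Finset.range n, stochExp β w (t * ((i : ℝ≥0) / n)) ω *
      Y (t * ((i : ℝ≥0) / n)) ω * (w (p n (i + 1)) ω - w (t * ((i : ℝ≥0) / n)) ω))
      = ∑ i ∈ Finset.range n, stochExp β w (p n i) ω * Y (p n i) ω *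
        (w (p n (i + 1)) ω - w (p n i) ω) from rfl, key, norm_div, Real.norm_eq_abs β,
    le_div_iff₀ (abs_pos.2 hβ)]

/-! ### Uniqueness for linear stochastic equations -/

/-- The integral of `(f - c) ^ 2` is nonnegative, where `c` is the mean of `f` over `[0, t]`. -/
lemma sq_cumul_le {f : ℝ≥0 → ℝ} (hf : Continuous f) (t : ℝ≥0) :
    cumul f t ^ 2 ≤ t * cumul (fun s => f s ^ 2) t := by
  rcases eq_or_ne t 0 with rfl | ht
  · simp [cumul_zero]
  have ht0 : (0 : ℝ) < t := NNReal.coe_pos.2 (pos_iff_ne_zero.2 ht)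
  set c : ℝ := cumul f t / t with hc
  have h0 : 0 ≤ cumul (fun s => (f s - c) ^ 2) t := cumul_nonneg t fun s _ => sq_nonneg _
  have h1 : cumul (fun s => (f s - c) ^ 2) t
      = cumul (fun s => f s ^ 2) t - 2 * c * cumul f t + c ^ 2 * t := by
    have e : ∀ s, (f s - c) ^ 2 = (f s ^ 2 - 2 * c * f s) + c ^ 2 := fun s => by ring
    simp_rw [e]
    have i1 : LocInt (fun s => f s ^ 2) := (hf.pow 2).locInt
    have i2 : LocInt (fun s => 2 * c * f s) := hf.locInt.const_mul _
    have i3 : LocInt (fun _ : ℝ≥0 => c ^ 2) := continuous_const.locInt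
    rw [cumul_add (i1.sub i2) i3, cumul_sub i1 i2, cumul_const_mul, cumul_const]
  rw [h1] at h0
  have h2 : c * t = cumul f t := by rw [hc]; field_simp
  have h3 : cumul f t ^ 2 = t * (2 * c * cumul f t - c ^ 2 * t) := by
    rw [← h2]; ring
  rw [h3]
  exact mul_le_mul_of_nonneg_left (by linarith) ht0.le

/-! ### Partitions of time and a truncated Itô isometry -/

/-- The left end point of the interval of the partition of `[0, t]` into `n` parts containing
`s`. -/
def gridFloor (t : ℝ≥0) (n : ℕ) (s : ℝ≥0) : ℝ≥0 := t * ((⌊s * n / t⌋₊ : ℝ≥0) / n)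

lemma tendsto_gridFloor {t : ℝ≥0} (ht : t ≠ 0) (s : ℝ≥0) :
    Tendsto (fun n : ℕ => gridFloor t n s) atTop (nhds s) := by
  rw [← NNReal.tendsto_coe]
  have h1 : ∀ n : ℕ, n ≠ 0 → (s : ℝ) - t / n ≤ gridFloor t n s ∧ (gridFloor t n s : ℝ) ≤ s := by
    intro n hn
    have hn0 : (0 : ℝ) < n := by positivity
    have ht0 : (0 : ℝ) < t := NNReal.coe_pos.2 (pos_iff_ne_zero.2 ht)
    have e1 : ((⌊s * n / t⌋₊ : ℝ≥0) : ℝ) ≤ s * n / t := by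
      have := Nat.floor_le (a := s * n / t) zero_le
      exact_mod_cast this
    have e2 : (s : ℝ) * n / t < (⌊s * n / t⌋₊ : ℝ≥0) + 1 := by
      have := Nat.lt_floor_add_one (s * n / t)
      exact_mod_cast this
    have e3 : (gridFloor t n s : ℝ) = t * (((⌊s * n / t⌋₊ : ℝ≥0) : ℝ) / n) := by
      unfold gridFloor; push_cast; rfl
    rw [e3]
    constructor
    · have : (s : ℝ) - t / n = t * ((s * n / t - 1) / n) := by field_simp
      rw [this]
      have e4 : (s : ℝ) * n / t - 1 ≤ ((⌊s * n / t⌋₊ : ℝ≥0) : ℝ) := by linarith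
      gcongr
    · calc (t : ℝ) * (((⌊s * n / t⌋₊ : ℝ≥0) : ℝ) / n) ≤ t * ((s * n / t) / n) := by gcongr
        _ = s := by field_simp
  have h2 : Tendsto (fun n : ℕ => (s : ℝ) - t / n) atTop (nhds s) := by
    simpa using (tendsto_const_div_atTop_nhds_zero_nat (t : ℝ)).const_sub (s : ℝ)
  refine tendsto_of_tendsto_of_tendsto_of_le_of_le' h2 tendsto_const_nhds ?_ ?_
  · filter_upwards [eventually_ge_atTop 1] with n hn using (h1 n (by omega)).1
  · filter_upwards [eventually_ge_atTop 1] with n hn using (h1 n (by omega)).2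

lemma timeMeasure_Ico (a b : ℝ≥0) : timeMeasure (Set.Ico a b) = ENNReal.ofReal (b - a) := by
  rw [← timeMeasure_Icc]
  exact measure_congr Ico_ae_eq_Icc

/-- Integrals of functions that are constant on the intervals of a partition. -/
lemma lintegral_grid {t : ℝ≥0} (ht : t ≠ 0) {n : ℕ} (hn : n ≠ 0) (f : ℕ → ℝ≥0∞) :
    ∫⁻ s in Set.Iio t, f ⌊s * n / t⌋₊ ∂timeMeasure
      = ∑ i ∈ Finset.range n, f i * ENNReal.ofReal (t / n) := by
  have ht0 : (0 : ℝ≥0) < t := pos_iff_ne_zero.2 ht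
  have hn0 : (0 : ℝ≥0) < n := by positivity
  have hfl : ∀ (s : ℝ≥0) (i : ℕ), ⌊s * n / t⌋₊ = i ↔
      s ∈ Set.Ico (t * (i / n)) (t * ((i + 1 : ℕ) / n)) := by
    intro s i
    have e1 : t * ((i : ℝ≥0) / n) ≤ s ↔ (i : ℝ≥0) ≤ s * n / t := by
      rw [le_div_iff₀ ht0, mul_comm t, div_mul_eq_mul_div, div_le_iff₀ hn0]
    have e2 : s < t * (((i + 1 : ℕ) : ℝ≥0) / n) ↔ s * n / t < ((i + 1 : ℕ) : ℝ≥0) := by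
      rw [div_lt_iff₀ ht0, mul_comm t, div_mul_eq_mul_div, lt_div_iff₀ hn0]
    rw [Set.mem_Ico, e1, e2, Nat.floor_eq_iff zero_le]
    push_cast
    rfl
  have hU : Set.Iio t = ⋃ i ∈ Finset.range n, Set.Ico (t * ((i : ℝ≥0) / n))
      (t * (((i + 1 : ℕ) : ℝ≥0) / n)) := by
    ext s
    simp only [Set.mem_Iio, Finset.mem_range, Set.mem_iUnion]
    constructor
    · intro hs
      refine ⟨⌊s * n / t⌋₊, ?_, (hfl s _).1 rfl⟩
      rw [Nat.floor_lt zero_le, div_lt_iff₀ ht0, mul_comm]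
      gcongr
    · rintro ⟨i, hi, hs⟩
      refine hs.2.trans_le (mul_le_of_le_one_right zero_le (div_le_one_of_le₀ ?_ zero_le))
      exact_mod_cast hi
  rw [hU, lintegral_biUnion_finset]
  · refine Finset.sum_congr rfl fun i _ => ?_
    have : ∫⁻ s in Set.Ico (t * ((i : ℝ≥0) / n)) (t * (((i + 1 : ℕ) : ℝ≥0) / n)),
        f ⌊s * n / t⌋₊ ∂timeMeasure
        = ∫⁻ s in Set.Ico (t * ((i : ℝ≥0) / n)) (t * (((i + 1 : ℕ) : ℝ≥0) / n)),
          f i ∂timeMeasure :=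
      setLIntegral_congr_fun measurableSet_Ico fun s hs => by rw [(hfl s i).2 hs]
    rw [this, setLIntegral_const, timeMeasure_Ico]
    congr 2
    push_cast
    ring
  · intro i _ j _ hij
    refine Set.disjoint_left.2 fun s hi hj => hij ?_
    rw [← (hfl s i).2 hi, (hfl s j).2 hj]
  · exact fun i _ => measurableSet_Ico

/-- The running bound `|D| ≤ m` on `[0, s]`. -/
def runBdd (D : ℝ≥0 → Ω → ℝ) (m : ℝ) : Set (ℝ≥0 × Ω) := {q | ∀ r ≤ q.1, |D r q.2| ≤ m}

lemma measurable_uncurry_of_continuous_paths {E : Type*} [TopologicalSpace E]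
    [TopologicalSpace.PseudoMetrizableSpace E] [MeasurableSpace E] [BorelSpace E]
    {D : ℝ≥0 → Ω → E} (hDm : ∀ t, Measurable (D t)) (hDc : ∀ ω, Continuous fun t => D t ω) :
    Measurable (fun q : ℝ≥0 × Ω => D q.1 q.2) :=
  measurable_uncurry_of_continuous_of_measurable (u := D) hDc hDm

/-- By continuity of the paths, the bound need only be tested at the time `s` itself and at those
times of a dense sequence that precede `s`. -/
lemma measurableSet_runBdd {D : ℝ≥0 → Ω → ℝ} (hDm : ∀ t, Measurable (D t))
    (hDc : ∀ ω, Continuous fun t => D t ω) (m : ℝ) : MeasurableSet (runBdd D m) := by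
  have hD2 := measurable_uncurry_of_continuous_paths hDm hDc
  have : runBdd D m = {q | |D q.1 q.2| ≤ m} ∩
      ⋂ n : ℕ, {q : ℝ≥0 × Ω | TopologicalSpace.denseSeq ℝ≥0 n < q.1 →
        |D (TopologicalSpace.denseSeq ℝ≥0 n) q.2| ≤ m} := by
    ext ⟨s, ω⟩
    simp only [runBdd, Set.mem_ofPred_eq, Set.mem_inter_iff, Set.mem_iInter]
    refine ⟨fun h => ⟨h s le_rfl, fun n hn => h _ hn.le⟩, fun h r hr => ?_⟩
    rcases hr.eq_or_lt with rfl | hr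
    · exact h.1
    by_contra hcon
    have ho : IsOpen {r : ℝ≥0 | r < s ∧ m < |D r ω|} :=
      (isOpen_Iio).inter (isOpen_lt continuous_const (hDc ω).abs)
    obtain ⟨n, hn⟩ := (TopologicalSpace.denseRange_denseSeq ℝ≥0).exists_mem_open ho
      ⟨r, hr, not_le.1 hcon⟩
    exact absurd (h.2 n hn.1) (not_le.2 hn.2)
  rw [this]
  refine (measurableSet_le hD2.abs measurable_const).inter (MeasurableSet.iInter fun n => ?_)
  have : {q : ℝ≥0 × Ω | TopologicalSpace.denseSeq ℝ≥0 n < q.1 →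
        |D (TopologicalSpace.denseSeq ℝ≥0 n) q.2| ≤ m}
      = {q : ℝ≥0 × Ω | q.1 ≤ TopologicalSpace.denseSeq ℝ≥0 n} ∪
        {q : ℝ≥0 × Ω | |D (TopologicalSpace.denseSeq ℝ≥0 n) q.2| ≤ m} := by
    ext q
    simp only [Set.mem_ofPred_eq, Set.mem_union]
    rw [imp_iff_not_or, not_lt]
  rw [this]
  exact (measurableSet_le measurable_fst measurable_const).union
    (measurableSet_le ((hDm _).comp measurable_snd).abs measurable_const)

/-- Itô's isometry, as an inequality, for the truncated integrand. -/
lemma IsRealBM.lintegral_sq_ito_le {𝒢 : Filtration ℝ≥0 mΩ} {P : Measure Ω}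
    [IsProbabilityMeasure P] {w : ℝ≥0 → Ω → ℝ} (h : IsRealBM 𝒢 P w)
    {D J : ℝ≥0 → Ω → ℝ} (hDm : ∀ t, Measurable[𝒢 t] (D t))
    (hDc : ∀ ω, Continuous fun t => D t ω) (hJ : IsItoIntegral P D w J) (m : ℕ) {t : ℝ≥0}
    (ht : t ≠ 0) :
    ∫⁻ ω in {ω | (t, ω) ∈ runBdd D m}, ENNReal.ofReal (J t ω ^ 2) ∂P ≤
      ∫⁻ q, (runBdd D m).indicator (fun q => ENNReal.ofReal (D q.1 q.2 ^ 2)) q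
        ∂((timeMeasure.restrict (Set.Iio t)).prod P) := by
  classical
  have hDm' : ∀ t, Measurable (D t) := fun t => (hDm t).mono (𝒢.le t) le_rfl
  set p : ℕ → ℕ → ℝ≥0 := fun n i => t * ((i : ℝ≥0) / n) with hp
  have hpa : ∀ n i, p n (i + 1) = p n i + t / n := fun n i => by
    simp only [hp]; push_cast; ring
  have hpmono : ∀ n {i j : ℕ}, i ≤ j → p n i ≤ p n j := fun n {i j} hij => by
    simp only [hp]; gcongr
  have hple : ∀ n i, i ≤ n → p n i ≤ t := fun n i hi =>
    mul_le_of_le_one_right zero_le (div_le_one_of_le₀ (by exact_mod_cast hi) zero_le)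
  -- The integrand is set to zero once a grid value has exceeded `m`, an event decided at the left
  -- end of the interval. The weights are then bounded and nonanticipating, and on `runBdd D m` the
  -- sums are the original ones.
  set A : ℕ → ℕ → Set Ω := fun n i => {ω | ∀ j ≤ i, |D (p n j) ω| ≤ m} with hA
  have hAm : ∀ n i, MeasurableSet[𝒢 (p n i)] (A n i) := fun n i => by
    have : A n i = ⋂ j : ℕ, ⋂ _ : j ≤ i, {ω | |D (p n j) ω| ≤ m} := by
      ext ω; simp [hA]
    rw [this]
    refine MeasurableSet.iInter fun j => MeasurableSet.iInter fun hj => ?_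
    exact 𝒢.mono (hpmono n hj) _
      (measurableSet_le (measurable_abs.comp (hDm (p n j))) measurable_const)
  set ξ : ℕ → ℕ → Ω → ℝ := fun n i => (A n i).indicator (D (p n i)) with hξ
  set S : ℕ → Ω → ℝ := fun n ω => ∑ i ∈ Finset.range n, ξ n i ω *
    (w (p n (i + 1)) ω - w (p n i) ω) with hS
  have hξm : ∀ n i, Measurable[𝒢 (p n i)] (ξ n i) := fun n i => (hDm _).indicator (hAm n i)
  have hξb : ∀ n i ω, |ξ n i ω| ≤ m := fun n i ω => by
    simp only [hξ, Set.indicator_apply]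
    split_ifs with hω
    · exact hω i le_rfl
    · simp
  have hS2 : ∀ n : ℕ, n ≠ 0 → Measurable (S n) ∧ ∫⁻ ω, ENNReal.ofReal (S n ω ^ 2) ∂P
      = ∑ i ∈ Finset.range n, (∫⁻ ω, ENNReal.ofReal (ξ n i ω ^ 2) ∂P) *
        ENNReal.ofReal (t / n) := by
    intro n hn
    have hξL : ∀ i, MemLp (ξ n i) 2 P := fun i =>
      MemLp.of_bound ((hξm n i).mono (𝒢.le _) le_rfl).aestronglyMeasurable m
        (.of_forall fun ω => by rw [Real.norm_eq_abs]; exact hξb n i ω)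
    have hη : ∀ i, Measurable[𝒢 (p n (i + 1))] (fun ω => w (p n (i + 1)) ω - w (p n i) ω) :=
      fun i => (h.adapted _).sub ((h.adapted _).mono (𝒢.mono (hpmono n i.le_succ)) le_rfl)
    have hη2 : ∀ i, MemLp (fun ω => w (p n (i + 1)) ω - w (p n i) ω) 2 P := fun i => by
      rw [memLp_two_iff_integrable_sq ((hη i).mono (𝒢.le _) le_rfl).aestronglyMeasurable, hpa]
      exact h.integrable_incr _ _ (integrable_sq_gaussianReal _)
    have horth := integral_sq_sum_of_indep (P := P) (m := fun i => 𝒢 (p n i))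
      (fun i j hij => 𝒢.mono (hpmono n hij)) (hξm n) hη hξL hη2
      (fun i => by
        rw [hpa, h.integral_incr _ _ measurable_id (f := fun x => x), integral_id_gaussianReal])
      (fun i X hX => by
        rw [hpa]; exact h.indepFun_incr _ _ hX measurable_id) n
    refine ⟨horth.1.mono (𝒢.le _) le_rfl, ?_⟩
    rw [← ofReal_integral_eq_lintegral_ofReal horth.2.1.integrable_sq
      (.of_forall fun ω => sq_nonneg _), horth.2.2,
      ENNReal.ofReal_sum_of_nonneg (fun i _ => mul_nonneg (integral_nonneg fun ω => sq_nonneg _)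
        (integral_nonneg fun ω => sq_nonneg _))]
    refine Finset.sum_congr rfl fun i _ => ?_
    rw [ENNReal.ofReal_mul (integral_nonneg fun ω => sq_nonneg _),
      ofReal_integral_eq_lintegral_ofReal (hξL i).integrable_sq
      (.of_forall fun ω => sq_nonneg _), hpa,
      h.integral_incr _ _ (f := fun x => x ^ 2) (by fun_prop), integral_sq_gaussianReal]
    push_cast
    rfl
  -- the sums as integrals over time
  set F : ℕ → ℝ≥0 × Ω → ℝ≥0∞ := fun n q => ENNReal.ofReal (ξ n ⌊q.1 * n / t⌋₊ q.2 ^ 2) with hF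
  have hFm : ∀ n, Measurable (F n) := fun n => by
    have h1 : Measurable (fun q : ℕ × Ω => ξ n q.1 q.2) :=
      measurable_from_prod_countable_right fun i => (hξm n i).mono (𝒢.le _) le_rfl
    have h2 : Measurable (fun q : ℝ≥0 × Ω => (⌊q.1 * n / t⌋₊, q.2)) := by
      refine Measurable.prodMk ?_ measurable_snd
      exact Nat.measurable_floor.comp (by fun_prop)
    exact ((h1.comp h2).pow_const 2).ennreal_ofReal
  have hSF : ∀ n : ℕ, n ≠ 0 → ∫⁻ ω, ENNReal.ofReal (S n ω ^ 2) ∂P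
      = ∫⁻ q, F n q ∂((timeMeasure.restrict (Set.Iio t)).prod P) := fun n hn => by
    rw [lintegral_prod _ (hFm n).aemeasurable, (hS2 n hn).2, ← lintegral_grid ht hn]
  -- Fatou's lemma on the left
  obtain ⟨ns, hns, hae⟩ := (hJ t).exists_seq_tendsto_ae
  have hGt : MeasurableSet {ω | (t, ω) ∈ runBdd D m} :=
    measurable_prodMk_left (measurableSet_runBdd hDm' hDc m)
  have hfatou : ∫⁻ ω in {ω | (t, ω) ∈ runBdd D m}, ENNReal.ofReal (J t ω ^ 2) ∂P
      ≤ liminf (fun k => ∫⁻ ω, ENNReal.ofReal (S (ns (k + 1)) ω ^ 2) ∂P) atTop := by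
    have hne : ∀ k, ns (k + 1) ≠ 0 := fun k =>
      Nat.pos_iff_ne_zero.1 (lt_of_le_of_lt (Nat.zero_le _) (hns (Nat.lt_succ_self k)))
    calc ∫⁻ ω in {ω | (t, ω) ∈ runBdd D m}, ENNReal.ofReal (J t ω ^ 2) ∂P
        ≤ ∫⁻ ω in {ω | (t, ω) ∈ runBdd D m},
            liminf (fun k => ENNReal.ofReal (S (ns (k + 1)) ω ^ 2)) atTop ∂P := by
          refine lintegral_mono_ae ?_
          rw [ae_restrict_iff' hGt]
          filter_upwards [hae] with ω hω hG
          have h1 : Tendsto (fun k => S (ns (k + 1)) ω) atTop (nhds (J t ω)) := by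
            have h2 := hω.comp (tendsto_add_atTop_nat 1)
            refine h2.congr fun k => ?_
            simp only [Function.comp_apply, hS]
            refine Finset.sum_congr rfl fun i hi => ?_
            have hi' := (Finset.mem_range.1 hi).le
            have hmem : ω ∈ A (ns (k + 1)) i := fun j hj => hG _ (hple _ _ (hj.trans hi'))
            simp only [hξ, Set.indicator_of_mem hmem, hp]
            push_cast
            rfl
          exact ((ENNReal.tendsto_ofReal (h1.pow 2)).liminf_eq).ge
      _ ≤ ∫⁻ ω, liminf (fun k => ENNReal.ofReal (S (ns (k + 1)) ω ^ 2)) atTop ∂P :=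
          setLIntegral_le_lintegral _ _
      _ ≤ _ := lintegral_liminf_le fun k => (((hS2 _ (hne k)).1).pow_const 2).ennreal_ofReal
  refine hfatou.trans ?_
  have hne : ∀ k, ns (k + 1) ≠ 0 := fun k =>
    Nat.pos_iff_ne_zero.1 (lt_of_le_of_lt (Nat.zero_le _) (hns (Nat.lt_succ_self k)))
  have hlim0 : (fun k => ∫⁻ ω, ENNReal.ofReal (S (ns (k + 1)) ω ^ 2) ∂P)
      = fun k => ∫⁻ q, F (ns (k + 1)) q ∂((timeMeasure.restrict (Set.Iio t)).prod P) :=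
    funext fun k => hSF _ (hne k)
  rw [hlim0]
  -- Reverse Fatou with the constant bound `m²`. Pointwise, the limit superior is at most the
  -- truncated integrand: if the path has exceeded `m` at some `r ≤ s`, then so do, eventually, its
  -- values at the grid points to the left of `r`, and the weight at `s` is zero.
  refine (liminf_le_limsup).trans ?_
  have hfinm : timeMeasure (Set.Iio t) ≠ ∞ := by
    have : timeMeasure (Set.Iio t) ≤ timeMeasure (Set.Icc 0 t) :=
      measure_mono fun x hx => ⟨zero_le, le_of_lt hx⟩
    rw [timeMeasure_Icc] at this
    exact ne_top_of_le_ne_top ENNReal.ofReal_ne_top this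
  refine (limsup_lintegral_le (fun _ => ENNReal.ofReal ((m : ℝ) ^ 2)) (fun k => hFm _)
    (fun k => .of_forall fun q => ?_) ?_).trans ?_
  · refine ENNReal.ofReal_le_ofReal ?_
    rw [← sq_abs]
    exact pow_le_pow_left₀ (abs_nonneg _) (hξb _ _ _) 2
  · rw [lintegral_const, ← Set.univ_prod_univ, Measure.prod_prod, Measure.restrict_apply_univ,
      measure_univ, mul_one]
    exact ENNReal.mul_ne_top ENNReal.ofReal_ne_top hfinm
  · refine lintegral_mono fun q => ?_
    obtain ⟨s, ω⟩ := q
    have hgrid : ∀ r, Tendsto (fun k => gridFloor t (ns (k + 1)) r) atTop (nhds r) := fun r =>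
      (tendsto_gridFloor ht r).comp (hns.tendsto_atTop.comp (tendsto_add_atTop_nat 1))
    by_cases hsω : (s, ω) ∈ runBdd D m
    · rw [Set.indicator_of_mem hsω]
      have h1 : Tendsto (fun k => ENNReal.ofReal (D (gridFloor t (ns (k + 1)) s) ω ^ 2)) atTop
          (nhds (ENNReal.ofReal (D s ω ^ 2))) :=
        ENNReal.tendsto_ofReal ((((hDc ω).tendsto s).comp (hgrid s)).pow 2)
      rw [← h1.limsup_eq]
      refine limsup_le_limsup (.of_forall fun k => ?_)
      refine ENNReal.ofReal_le_ofReal ?_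
      simp only [hξ, Set.indicator_apply]
      split_ifs
      · exact le_rfl
      · rw [zero_pow two_ne_zero]; exact sq_nonneg _
    · rw [Set.indicator_of_notMem hsω]
      simp only [runBdd, Set.mem_ofPred_eq, not_forall, not_le] at hsω
      obtain ⟨r, hr, hrm⟩ := hsω
      have h1 : Tendsto (fun k => |D (gridFloor t (ns (k + 1)) r) ω|) atTop (nhds |D r ω|) :=
        (((hDc ω).tendsto r).comp (hgrid r)).abs
      have h2 : (fun k => F (ns (k + 1)) (s, ω)) =ᶠ[atTop] fun _ => 0 := by
        filter_upwards [h1.eventually (lt_mem_nhds hrm)] with k hk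
        simp only [hF, hξ]
        rw [Set.indicator_of_notMem, zero_pow two_ne_zero, ENNReal.ofReal_zero]
        intro hmem
        refine absurd (hmem ⌊r * ns (k + 1) / t⌋₊ ?_) (not_le.2 hk)
        exact Nat.floor_le_floor (by gcongr)
      rw [limsup_congr h2, limsup_const]

/-- All approximating sums vanish at time zero, and limits in probability are unique almost surely.
-/
lemma IsItoIntegral.zero_ae_eq {P : Measure Ω} {H W I : ℝ≥0 → Ω → ℝ}
    (hI : IsItoIntegral P H W I) : ∀ᵐ ω ∂P, I 0 ω = 0 := by
  have h0 := hI 0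
  have h1 : TendstoInMeasure P (fun (_ : ℕ) (_ : Ω) => (0 : ℝ)) atTop (I 0) := by
    refine h0.congr_left fun n => .of_forall fun ω => ?_
    simp
  have h2 : TendstoInMeasure P (fun (_ : ℕ) (_ : Ω) => (0 : ℝ)) atTop (fun _ => (0 : ℝ)) := by
    intro ε hε
    have : {x : Ω | ε ≤ edist (0 : ℝ) 0} = ∅ := by
      ext x; simp [hε.ne']
    simp only [this, measure_empty]
    exact tendsto_const_nhds
  exact tendstoInMeasure_ae_unique h1 h2

/-- By `(x + y)² ≤ 2x² + 2y²`, with Cauchy–Schwarz for the drift and the truncated isometry for the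
stochastic integral. The truncation keeps the expectations finite, as Gronwall's lemma requires. -/
lemma lintegral_sq_le_of_ito {P : Measure Ω} {𝒢 : Filtration ℝ≥0 mΩ}
    [IsProbabilityMeasure P] {w : ℝ≥0 → Ω → ℝ} (h : IsRealBM 𝒢 P w)
    {D J : ℝ≥0 → Ω → ℝ} (hDm : ∀ t, Measurable[𝒢 t] (D t))
    (hDc : ∀ ω, Continuous fun t => D t ω) (hJ : IsItoIntegral P D w J) {μ β : ℝ}
    (hD : ∀ t, ∀ᵐ ω ∂P, D t ω = μ * cumul (D · ω) t + β * J t ω) (m : ℕ) {t : ℝ≥0}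
    (ht : t ≠ 0) :
    ∫⁻ ω, (runBdd D m).indicator (fun q => ENNReal.ofReal (D q.1 q.2 ^ 2)) (t, ω) ∂P ≤
      ENNReal.ofReal (2 * μ ^ 2 * t + 2 * β ^ 2) *
      ∫⁻ q, (runBdd D m).indicator (fun q => ENNReal.ofReal (D q.1 q.2 ^ 2)) q
        ∂((timeMeasure.restrict (Set.Iio t)).prod P) := by
  have hDm' : ∀ t, Measurable (D t) := fun t => (hDm t).mono (𝒢.le t) le_rfl
  have hR := measurableSet_runBdd hDm' hDc m
  have hDu := measurable_uncurry_of_continuous_paths hDm' hDc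
  set G : Set Ω := {ω | (t, ω) ∈ runBdd D m} with hG
  have hGm : MeasurableSet G := measurable_prodMk_left hR
  set g : ℝ≥0 × Ω → ℝ≥0∞ := (runBdd D m).indicator (fun q => ENNReal.ofReal (D q.1 q.2 ^ 2))
    with hg
  have hgm : Measurable g := ((hDu.pow_const 2).ennreal_ofReal).indicator hR
  set X := ∫⁻ q, g q ∂((timeMeasure.restrict (Set.Iio t)).prod P) with hX
  have e0 : ∫⁻ ω, g (t, ω) ∂P = ∫⁻ ω in G, ENNReal.ofReal (D t ω ^ 2) ∂P := by
    rw [← lintegral_indicator hGm]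
    rfl
  rw [e0]
  have hI := h.lintegral_sq_ito_le hDm hDc hJ m ht
  have hC : ∫⁻ ω in G, (∫⁻ s in Set.Iio t, ENNReal.ofReal (D s ω ^ 2) ∂timeMeasure) ∂P ≤ X := by
    rw [hX, lintegral_prod_symm _ hgm.aemeasurable]
    rw [← lintegral_indicator hGm]
    refine lintegral_mono fun ω => ?_
    by_cases hω : ω ∈ G
    · rw [Set.indicator_of_mem hω]
      refine setLIntegral_mono' measurableSet_Iio fun s hs => ?_
      have : (s, ω) ∈ runBdd D m := fun r hr => hω r (hr.trans (le_of_lt hs))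
      rw [hg, Set.indicator_of_mem this]
    · rw [Set.indicator_of_notMem hω]; exact zero_le
  have hcm : Measurable fun ω => ∫⁻ s in Set.Iio t, ENNReal.ofReal (D s ω ^ 2) ∂timeMeasure :=
    ((hDu.pow_const 2).ennreal_ofReal).lintegral_prod_left'
  calc ∫⁻ ω in G, ENNReal.ofReal (D t ω ^ 2) ∂P
      ≤ ∫⁻ ω in G, (ENNReal.ofReal (2 * μ ^ 2 * t) *
          (∫⁻ s in Set.Iio t, ENNReal.ofReal (D s ω ^ 2) ∂timeMeasure) +
          ENNReal.ofReal (2 * β ^ 2) * ENNReal.ofReal (J t ω ^ 2)) ∂P := by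
        refine lintegral_mono_ae (ae_restrict_of_ae ?_)
        filter_upwards [hD t] with ω hω
        have h1 : ∫⁻ s in Set.Iio t, ENNReal.ofReal (D s ω ^ 2) ∂timeMeasure
            = ENNReal.ofReal (cumul (fun s => D s ω ^ 2) t) := by
          have hi : LocInt fun s => D s ω ^ 2 := ((hDc ω).pow 2).locInt
          unfold cumul
          rw [ofReal_integral_eq_lintegral_ofReal (hi t) (.of_forall fun s => sq_nonneg _)]
          refine setLIntegral_congr ?_
          rw [show Set.Icc (0 : ℝ≥0) t = Set.Iic t from by ext; simp]
          exact Iio_ae_eq_Iic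
        have h2 : 0 ≤ cumul (fun s => D s ω ^ 2) t := cumul_nonneg t fun s _ => sq_nonneg _
        rw [h1, ← ENNReal.ofReal_mul (by positivity), ← ENNReal.ofReal_mul (by positivity),
          ← ENNReal.ofReal_add (by positivity) (by positivity)]
        refine ENNReal.ofReal_le_ofReal ?_
        have h3 := sq_cumul_le (hDc ω) t
        rw [hω]
        nlinarith [sq_nonneg (μ * cumul (D · ω) t - β * J t ω), sq_nonneg μ,
          mul_le_mul_of_nonneg_left h3 (sq_nonneg μ)]
    _ = ENNReal.ofReal (2 * μ ^ 2 * t) *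
          (∫⁻ ω in G, (∫⁻ s in Set.Iio t, ENNReal.ofReal (D s ω ^ 2) ∂timeMeasure) ∂P) +
          ENNReal.ofReal (2 * β ^ 2) * ∫⁻ ω in G, ENNReal.ofReal (J t ω ^ 2) ∂P := by
        rw [lintegral_add_left (hcm.const_mul _), lintegral_const_mul _ hcm,
          lintegral_const_mul' _ _ ENNReal.ofReal_ne_top]
    _ ≤ ENNReal.ofReal (2 * μ ^ 2 * t) * X + ENNReal.ofReal (2 * β ^ 2) * X := by gcongr
    _ = _ := by
        rw [← add_mul, ← ENNReal.ofReal_add (by positivity) (by positivity)]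

/-- Gronwall's lemma applies to the second moment of `D` at time `s` on the event that `|D| ≤ m` on
`[0, s]`, which is at most `m²`. Continuous paths are bounded on compact intervals, so all `m`
together give `D t = 0`, and a dense sequence of times makes this simultaneous in `t`. -/
theorem IsRealBM.eq_zero_of_isItoIntegral {P : Measure Ω} {𝒢 : Filtration ℝ≥0 mΩ}
    [IsProbabilityMeasure P] {w : ℝ≥0 → Ω → ℝ} (h : IsRealBM 𝒢 P w)
    {D J : ℝ≥0 → Ω → ℝ} (hDm : ∀ t, Measurable[𝒢 t] (D t))
    (hDc : ∀ ω, Continuous fun t => D t ω) (hJ : IsItoIntegral P D w J) {μ β : ℝ}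
    (hD : ∀ t, ∀ᵐ ω ∂P, D t ω = μ * cumul (D · ω) t + β * J t ω) :
    ∀ᵐ ω ∂P, ∀ t, D t ω = 0 := by
  have hDm' : ∀ t, Measurable (D t) := fun t => (hDm t).mono (𝒢.le t) le_rfl
  have hDu := measurable_uncurry_of_continuous_paths hDm' hDc
  have hae : ∀ t, ∀ᵐ ω ∂P, D t ω = 0 := by
    intro t
    rcases eq_or_ne t 0 with rfl | ht
    · filter_upwards [hD 0, hJ.zero_ae_eq] with ω h1 h2
      rw [h1, h2, cumul_zero]; simp
    have key : ∀ m : ℕ, ∀ᵐ ω ∂P,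
        (runBdd D m).indicator (fun q => ENNReal.ofReal (D q.1 q.2 ^ 2)) (t, ω) = 0 := by
      intro m
      have hR := measurableSet_runBdd hDm' hDc m
      set g : ℝ≥0 × Ω → ℝ≥0∞ := (runBdd D m).indicator (fun q => ENNReal.ofReal (D q.1 q.2 ^ 2))
        with hg
      have hgm : Measurable g := ((hDu.pow_const 2).ennreal_ofReal).indicator hR
      have hgb : ∀ q, g q ≤ ENNReal.ofReal ((m : ℝ) ^ 2) := fun q => by
        by_cases hq : q ∈ runBdd D m
        · rw [hg, Set.indicator_of_mem hq]
          refine ENNReal.ofReal_le_ofReal ?_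
          rw [← sq_abs]
          exact pow_le_pow_left₀ (abs_nonneg _) (hq _ le_rfl) 2
        · rw [hg, Set.indicator_of_notMem hq]; exact zero_le
      set Φ : ℝ≥0 → ℝ≥0∞ := fun s => ∫⁻ ω, g (s, ω) ∂P with hΦ
      have hΦm : Measurable Φ := hgm.lintegral_prod_right'
      have hΦb : ∀ s, Φ s ≤ ENNReal.ofReal ((m : ℝ) ^ 2) := fun s => by
        calc Φ s ≤ ∫⁻ _, ENNReal.ofReal ((m : ℝ) ^ 2) ∂P := lintegral_mono fun ω => hgb _
          _ = _ := by simp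
      have hΦt : ∀ s, Φ s ≠ ∞ := fun s => ne_top_of_le_ne_top ENNReal.ofReal_ne_top (hΦb s)
      have hφm : Measurable fun s => (Φ s).toReal := hΦm.ennreal_toReal
      have hφb : ∀ s, (Φ s).toReal ≤ (m : ℝ) ^ 2 := fun s =>
        ENNReal.toReal_le_of_le_ofReal (by positivity) (hΦb s)
      have hφi : LocInt fun s => (Φ s).toReal := locInt_of_bounded hφm (C := (m : ℝ) ^ 2) fun s => by
        rw [abs_of_nonneg ENNReal.toReal_nonneg]; exact hφb s
      have hineq : ∀ s ≤ t, (Φ s).toReal ≤ (2 * μ ^ 2 * t + 2 * β ^ 2) *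
          cumul (fun s => (Φ s).toReal) s := by
        intro s hs
        rcases eq_or_ne s 0 with rfl | hs0
        · have : Φ 0 = 0 := by
            rw [hΦ]
            simp only
            refine lintegral_eq_zero_of_ae_eq_zero ?_
            filter_upwards [hD 0, hJ.zero_ae_eq] with ω h1 h2
            have : D 0 ω = 0 := by rw [h1, h2, cumul_zero]; simp
            simp [hg, this]
          simp [this, cumul_zero]
        have h1 := lintegral_sq_le_of_ito h hDm hDc hJ hD m hs0
        have h2 : ∫⁻ q, g q ∂((timeMeasure.restrict (Set.Iio s)).prod P)
            = ENNReal.ofReal (cumul (fun s => (Φ s).toReal) s) := by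
          rw [lintegral_prod _ hgm.aemeasurable]
          unfold cumul
          rw [ofReal_integral_eq_lintegral_ofReal (hφi s)
            (.of_forall fun s => ENNReal.toReal_nonneg)]
          have : ∀ r, ENNReal.ofReal (Φ r).toReal = Φ r := fun r => ENNReal.ofReal_toReal (hΦt r)
          simp_rw [this]
          refine setLIntegral_congr ?_
          rw [show Set.Icc (0 : ℝ≥0) s = Set.Iic s from by ext; simp]
          exact Iio_ae_eq_Iic
        have h3 : 0 ≤ cumul (fun s => (Φ s).toReal) s :=
          cumul_nonneg s fun _ _ => ENNReal.toReal_nonneg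
        rw [h2, ← ENNReal.ofReal_mul (by positivity)] at h1
        refine ENNReal.toReal_le_of_le_ofReal (by positivity) (h1.trans (ENNReal.ofReal_le_ofReal ?_))
        gcongr
      have h0 := gronwall_zero hφi (M := (m : ℝ) ^ 2) (C := 2 * μ ^ 2 * t + 2 * β ^ 2)
        (by positivity) (fun s _ => hφb s) ENNReal.toReal_nonneg hineq
      have h1 : Φ t = 0 := by
        rcases (ENNReal.toReal_eq_zero_iff _).1 h0 with h2 | h2
        · exact h2
        · exact absurd h2 (hΦt t)
      exact (lintegral_eq_zero_iff (hgm.comp measurable_prodMk_left)).1 h1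
    filter_upwards [ae_all_iff.2 key] with ω hω
    obtain ⟨M, hM⟩ := (isCompact_Icc (a := (0 : ℝ≥0)) (b := t)).exists_bound_of_continuousOn
      (hDc ω).continuousOn
    obtain ⟨m, hm⟩ := exists_nat_ge M
    have h1 := hω m
    rw [Set.indicator_of_mem (show (t, ω) ∈ runBdd D m from
      fun r hr => (hM r ⟨zero_le, hr⟩).trans hm), ENNReal.ofReal_eq_zero] at h1
    exact pow_eq_zero_iff two_ne_zero |>.1 (le_antisymm h1 (sq_nonneg _))
  filter_upwards [ae_all_iff.2 fun n : ℕ => hae (TopologicalSpace.denseSeq ℝ≥0 n)] with ω hω t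
  have := (TopologicalSpace.denseRange_denseSeq ℝ≥0).equalizer (hDc ω) continuous_const
    (funext hω)
  exact congrFun this t

section

/-! ### Explicit solutions of the state equations -/

/-- The logarithm of the growth of the capital, for the ratio `α` between consumption and
capital. -/
def logCap (p : Params) (α : ℝ≥0 → ℝ) (w : ℝ≥0 → ℝ × ℝ) (t : ℝ≥0) : ℝ :=
  (p.B - p.β₁ ^ 2 / 2) * t - cumul α t + p.β₁ * (w t).1

/-- The habit without consumption, started from `1`. -/
def habFactor (p : Params) (w : ℝ≥0 → ℝ × ℝ) (t : ℝ≥0) : ℝ :=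
  Real.exp (-(p.ρ + p.β₂ ^ 2 / 2) * t + p.β₂ * (w t).2)

/-- The accumulated consumption out of a unit of capital, relative to `habFactor`. -/
def inflow (p : Params) (α : ℝ≥0 → ℝ) (w : ℝ≥0 → ℝ × ℝ) (t : ℝ≥0) : ℝ :=
  cumul (fun s => Real.exp (logCap p α w s) / habFactor p w s * α s) t

/-- The capital. -/
def capPath (p : Params) (z : ℝ × ℝ) (α : ℝ≥0 → ℝ) (w : ℝ≥0 → ℝ × ℝ) (t : ℝ≥0) : ℝ :=
  z.1 * Real.exp (logCap p α w t)

/-- The habit. -/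
def habPath (p : Params) (z : ℝ × ℝ) (α : ℝ≥0 → ℝ) (w : ℝ≥0 → ℝ × ℝ) (t : ℝ≥0) : ℝ :=
  habFactor p w t * (z.2 + p.ρ * z.1 * inflow p α w t)

/-- The state, capital and habit. -/
def statePath (p : Params) (z : ℝ × ℝ) (α : ℝ≥0 → ℝ) (w : ℝ≥0 → ℝ × ℝ) (t : ℝ≥0) : ℝ × ℝ :=
  (capPath p z α w t, habPath p z α w t)

variable {p : Params} {z : ℝ × ℝ} {α : ℝ≥0 → ℝ} {w : ℝ≥0 → ℝ × ℝ}

lemma habFactor_pos (p : Params) (w : ℝ≥0 → ℝ × ℝ) (t : ℝ≥0) : 0 < habFactor p w t :=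
  Real.exp_pos _

lemma continuous_habFactor (hw : Continuous w) : Continuous (habFactor p w) := by
  unfold habFactor; fun_prop

lemma continuous_logCap (hα : LocInt α) (hw : Continuous w) : Continuous (logCap p α w) := by
  have := continuous_cumul hα
  unfold logCap; fun_prop

lemma continuous_relGrowth (hα : LocInt α) (hw : Continuous w) :
    Continuous fun s => Real.exp (logCap p α w s) / habFactor p w s := by
  have h1 := continuous_logCap (p := p) hα hw
  exact h1.rexp.div (continuous_habFactor hw) fun s => (habFactor_pos p w s).ne'

lemma locInt_inflow (hα : LocInt α) (hw : Continuous w) :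
    LocInt fun s => Real.exp (logCap p α w s) / habFactor p w s * α s :=
  hα.continuous_mul (continuous_relGrowth hα hw)

lemma continuous_inflow (hα : LocInt α) (hw : Continuous w) : Continuous (inflow p α w) :=
  continuous_cumul (locInt_inflow hα hw)

lemma continuous_capPath (hα : LocInt α) (hw : Continuous w) :
    Continuous (capPath p z α w) :=
  continuous_const.mul (continuous_logCap hα hw).rexp

lemma continuous_habPath (hα : LocInt α) (hw : Continuous w) :
    Continuous (habPath p z α w) :=
  (continuous_habFactor hw).mul (continuous_const.add
    (continuous_const.mul (continuous_inflow hα hw)))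

lemma continuous_statePath (hα : LocInt α) (hw : Continuous w) :
    Continuous (statePath p z α w) :=
  (continuous_capPath hα hw).prodMk (continuous_habPath hα hw)

lemma inflow_nonneg (h0 : ∀ t, 0 ≤ α t) (t : ℝ≥0) : 0 ≤ inflow p α w t :=
  cumul_nonneg t fun s _ =>
    mul_nonneg (div_nonneg (Real.exp_pos _).le (habFactor_pos p w s).le) (h0 s)

lemma capPath_pos (hz : 0 < z.1) (t : ℝ≥0) : 0 < capPath p z α w t :=
  mul_pos hz (Real.exp_pos _)

lemma habFactor_mul_le_habPath (hρ : 0 ≤ p.ρ) (hz : 0 ≤ z.1) (h0 : ∀ t, 0 ≤ α t) (t : ℝ≥0) :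
    habFactor p w t * z.2 ≤ habPath p z α w t := by
  refine mul_le_mul_of_nonneg_left ?_ (habFactor_pos p w t).le
  have := mul_nonneg (mul_nonneg hρ hz) (inflow_nonneg (p := p) (w := w) h0 t)
  linarith

lemma habPath_pos (hρ : 0 ≤ p.ρ) (hz1 : 0 ≤ z.1) (hz : 0 < z.2) (h0 : ∀ t, 0 ≤ α t) (t : ℝ≥0) :
    0 < habPath p z α w t :=
  (mul_pos (habFactor_pos p w t) hz).trans_le (habFactor_mul_le_habPath hρ hz1 h0 t)

lemma statePath_zero (hw : w 0 = 0) : statePath p z α w 0 = z := by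
  simp [statePath, capPath, habPath, logCap, habFactor, inflow, cumul_zero, hw]

/-- The path after time `a`. -/
def shiftPath (w : ℝ≥0 → ℝ × ℝ) (a : ℝ≥0) (s : ℝ≥0) : ℝ × ℝ := w (a + s) - w a

lemma continuous_shiftPath (hw : Continuous w) (a : ℝ≥0) : Continuous (shiftPath w a) := by
  unfold shiftPath; fun_prop

lemma logCap_add (hα : LocInt α) (a s : ℝ≥0) :
    logCap p α w (a + s) = logCap p α w a
      + logCap p (fun u => α (a + u)) (shiftPath w a) s := by
  simp only [logCap, cumul_shift hα, shiftPath, Prod.fst_sub]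
  push_cast
  ring

lemma habFactor_add (a s : ℝ≥0) :
    habFactor p w (a + s) = habFactor p w a * habFactor p (shiftPath w a) s := by
  simp only [habFactor, ← Real.exp_add, shiftPath, Prod.snd_sub]
  push_cast
  congr 1
  ring

lemma inflow_add (hα : LocInt α) (hw : Continuous w) (a s : ℝ≥0) :
    inflow p α w (a + s) = inflow p α w a + Real.exp (logCap p α w a) / habFactor p w a *
      inflow p (fun u => α (a + u)) (shiftPath w a) s := by
  have e : ∀ u, Real.exp (logCap p α w (a + u)) / habFactor p w (a + u) * α (a + u)
      = Real.exp (logCap p α w a) / habFactor p w a *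
        (Real.exp (logCap p (fun u => α (a + u)) (shiftPath w a) u) /
          habFactor p (shiftPath w a) u * α (a + u)) := fun u => by
    have h1 := (habFactor_pos p w a).ne'
    have h2 := (habFactor_pos p (shiftPath w a) u).ne'
    rw [logCap_add hα, habFactor_add, Real.exp_add]
    field_simp
  simp only [inflow]
  rw [cumul_shift (locInt_inflow hα hw), ← cumul_const_mul]
  simp_rw [e]

lemma capPath_add (hα : LocInt α) (a s : ℝ≥0) :
    capPath p z α w (a + s)
      = capPath p (statePath p z α w a) (fun u => α (a + u)) (shiftPath w a) s := by
  simp only [capPath, statePath, logCap_add hα, Real.exp_add]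
  ring

lemma habPath_add (hα : LocInt α) (hw : Continuous w) (a s : ℝ≥0) :
    habPath p z α w (a + s)
      = habPath p (statePath p z α w a) (fun u => α (a + u)) (shiftPath w a) s := by
  have h1 := (habFactor_pos p w a).ne'
  simp only [habPath, statePath, capPath, inflow_add hα hw, habFactor_add]
  field_simp
  ring

/-- The flow property. It holds for each path without an exceptional null set, so controls and
Brownian motions can be shifted by random times inside the functional. -/
lemma statePath_add (hα : LocInt α) (hw : Continuous w) (a s : ℝ≥0) :
    statePath p z α w (a + s)
      = statePath p (statePath p z α w a) (fun u => α (a + u)) (shiftPath w a) s := by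
  simp only [statePath]
  rw [capPath_add hα, habPath_add hα hw]
  rfl

/-- Single times are null, so agreement strictly before `t` is enough. This fits concatenation,
where the new control takes over at the switching time itself. -/
lemma logCap_congr {α' : ℝ≥0 → ℝ} {t : ℝ≥0} (h : ∀ᵐ s ∂timeMeasure, s < t → α s = α' s)
    {s : ℝ≥0} (hs : s ≤ t) : logCap p α w s = logCap p α' w s := by
  have : cumul α s = cumul α' s := by
    refine integral_congr_ae ?_
    rw [Filter.EventuallyEq, ae_restrict_iff' measurableSet_Icc]
    have h2 : ∀ᵐ u ∂timeMeasure, u ≠ s := by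
      simp [ae_iff]
    filter_upwards [h, h2] with u hu hu2 hus
    exact hu (lt_of_lt_of_le (lt_of_le_of_ne hus.2 hu2) hs)
  simp [logCap, this]

lemma inflow_congr {α' : ℝ≥0 → ℝ} {t : ℝ≥0} (h : ∀ᵐ s ∂timeMeasure, s < t → α s = α' s)
    {s : ℝ≥0} (hs : s ≤ t) : inflow p α w s = inflow p α' w s := by
  refine integral_congr_ae ?_
  rw [Filter.EventuallyEq, ae_restrict_iff' measurableSet_Icc]
  have h2 : ∀ᵐ u ∂timeMeasure, u ≠ s := by
    simp [ae_iff]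
  filter_upwards [h, h2] with u hu hu2 hus
  have hut := lt_of_lt_of_le (lt_of_le_of_ne hus.2 hu2) hs
  rw [hu hut, logCap_congr h hut.le]

lemma statePath_congr {α' : ℝ≥0 → ℝ} {t : ℝ≥0} (h : ∀ᵐ s ∂timeMeasure, s < t → α s = α' s)
    {s : ℝ≥0} (hs : s ≤ t) : statePath p z α w s = statePath p z α' w s := by
  simp only [statePath, capPath, habPath, logCap_congr h hs, inflow_congr h hs]

/-! ### Losses -/

/-- Minus the utility of the consumption `c` for the habit `h`. -/
def lossRate (p : Params) (c h : ℝ) : ℝ≥0∞ :=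
  ENNReal.ofReal (1 / (p.σ - 1) * (c / h ^ p.γ) ^ (1 - p.σ))

/-- The discount factor. -/
def disc (p : Params) (t : ℝ≥0) : ℝ≥0∞ := ENNReal.ofReal (Real.exp (-p.θ * t))

/-- The discounted loss at time `t`. -/
def flowLoss (p : Params) (z : ℝ × ℝ) (α : ℝ≥0 → ℝ) (w : ℝ≥0 → ℝ × ℝ) (t : ℝ≥0) : ℝ≥0∞ :=
  disc p t * lossRate p (α t * capPath p z α w t) (habPath p z α w t)

/-- The discounted loss over the time set `S`. -/
def runCost (p : Params) (z : ℝ × ℝ) (α : ℝ≥0 → ℝ) (w : ℝ≥0 → ℝ × ℝ) (S : Set ℝ≥0) : ℝ≥0∞ :=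
  ∫⁻ t in S, flowLoss p z α w t ∂timeMeasure

lemma measurable_lossRate (p : Params) : Measurable (fun q : ℝ × ℝ => lossRate p q.1 q.2) := by
  unfold lossRate; fun_prop

lemma measurable_disc (p : Params) : Measurable (disc p) := by
  unfold disc; fun_prop

lemma disc_add (p : Params) (a s : ℝ≥0) : disc p (a + s) = disc p a * disc p s := by
  rw [disc, disc, disc, ← ENNReal.ofReal_mul (Real.exp_pos _).le, ← Real.exp_add]
  push_cast
  ring_nf

lemma disc_ne_top (p : Params) (t : ℝ≥0) : disc p t ≠ ∞ := ENNReal.ofReal_ne_top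

lemma disc_ne_zero (p : Params) (t : ℝ≥0) : disc p t ≠ 0 := by
  simp [disc, Real.exp_pos]

lemma disc_zero (p : Params) : disc p 0 = 1 := by simp [disc]

lemma disc_le_one (hθ : 0 ≤ p.θ) (t : ℝ≥0) : disc p t ≤ 1 := by
  rw [disc, ENNReal.ofReal_le_one, Real.exp_le_one_iff]
  have := mul_nonneg hθ (NNReal.coe_nonneg t)
  linarith

lemma flowLoss_add (hα : LocInt α) (hw : Continuous w) (a s : ℝ≥0) :
    flowLoss p z α w (a + s) = disc p a *
      flowLoss p (statePath p z α w a) (fun u => α (a + u)) (shiftPath w a) s := by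
  simp only [flowLoss, disc_add, capPath_add hα, habPath_add hα hw, mul_assoc]

lemma runCost_Ici (hα : LocInt α) (hw : Continuous w) (a : ℝ≥0) :
    runCost p z α w (Set.Ici a) = disc p a *
      runCost p (statePath p z α w a) (fun u => α (a + u)) (shiftPath w a) Set.univ := by
  simp only [runCost, Measure.restrict_univ]
  rw [setLIntegral_Ici_timeMeasure, ← lintegral_const_mul' _ _ (disc_ne_top p a)]
  simp_rw [flowLoss_add hα hw]

lemma runCost_add (S T : Set ℝ≥0) (hT : MeasurableSet T) (hST : Disjoint S T) :
    runCost p z α w (S ∪ T) = runCost p z α w S + runCost p z α w T :=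
  lintegral_union hT hST

lemma runCost_univ_split (a : ℝ≥0) :
    runCost p z α w Set.univ = runCost p z α w (Set.Iio a) + runCost p z α w (Set.Ici a) := by
  rw [← runCost_add _ _ measurableSet_Ici, Set.Iio_union_Ici]
  exact Set.disjoint_left.2 fun x h1 h2 => not_le.2 (Set.mem_Iio.1 h1) (Set.mem_Ici.1 h2)

lemma runCost_Ico (hα : LocInt α) (hw : Continuous w) (a s : ℝ≥0) :
    runCost p z α w (Set.Ico a (a + s)) = disc p a *
      runCost p (statePath p z α w a) (fun u => α (a + u)) (shiftPath w a) (Set.Iio s) := by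
  simp only [runCost]
  rw [← lintegral_indicator measurableSet_Ico, ← lintegral_indicator measurableSet_Iio,
    ← lintegral_const_mul' _ _ (disc_ne_top p a)]
  have h2 : (Set.Ico a (a + s)).indicator (fun t => flowLoss p z α w t)
      = (Set.Ici a).indicator ((Set.Iio (a + s)).indicator fun t => flowLoss p z α w t) := by
    rw [Set.indicator_indicator]; rfl
  rw [h2, lintegral_indicator measurableSet_Ici, setLIntegral_Ici_timeMeasure]
  refine lintegral_congr fun u => ?_
  by_cases hu : u < s
  · rw [Set.indicator_of_mem (show a + u ∈ Set.Iio (a + s) from add_lt_add_right hu a),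
      Set.indicator_of_mem (show u ∈ Set.Iio s from hu), flowLoss_add hα hw]
  · rw [Set.indicator_of_notMem (show a + u ∉ Set.Iio (a + s) from
      fun h => hu (lt_of_add_lt_add_left h)),
      Set.indicator_of_notMem (show u ∉ Set.Iio s from hu), mul_zero]

lemma runCost_Iio_add (hα : LocInt α) (hw : Continuous w) (a s : ℝ≥0) :
    runCost p z α w (Set.Iio (a + s)) = runCost p z α w (Set.Iio a) + disc p a *
      runCost p (statePath p z α w a) (fun u => α (a + u)) (shiftPath w a) (Set.Iio s) := by
  rw [← runCost_Ico hα hw, ← runCost_add _ _ measurableSet_Ico,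
    Set.Iio_union_Ico_eq_Iio le_self_add]
  exact Set.disjoint_left.2 fun x h1 h2 => absurd h2.1 (not_le.2 h1)

lemma flowLoss_congr {α' : ℝ≥0 → ℝ} {t : ℝ≥0} (h : ∀ᵐ s ∂timeMeasure, s < t → α s = α' s) :
    ∀ᵐ s ∂timeMeasure, s < t → flowLoss p z α w s = flowLoss p z α' w s := by
  filter_upwards [h] with s hs hst
  have := statePath_congr (p := p) (z := z) (w := w) h hst.le
  simp only [statePath, Prod.mk.injEq] at this
  simp only [flowLoss, hs hst, this.1, this.2]

lemma runCost_congr {α' : ℝ≥0 → ℝ} {t : ℝ≥0} (h : ∀ᵐ s ∂timeMeasure, s < t → α s = α' s)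
    {D : Set ℝ≥0} (hD : MeasurableSet D) (hDt : D ⊆ Set.Iio t) :
    runCost p z α w D = runCost p z α' w D := by
  refine lintegral_congr_ae ?_
  rw [Filter.EventuallyEq, ae_restrict_iff' hD]
  exact (flowLoss_congr h).mono fun s hs hsD => hs (hDt hsD)

lemma runCost_Iio_congr {α' : ℝ≥0 → ℝ} {t : ℝ≥0} (h : ∀ᵐ s ∂timeMeasure, s < t → α s = α' s) :
    runCost p z α w (Set.Iio t) = runCost p z α' w (Set.Iio t) :=
  runCost_congr h measurableSet_Iio subset_rfl

/-! ### Measurability -/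

/-- A control: a jointly measurable ratio between consumption and capital with values in `(0, R]`
whose primitive is adapted. -/
structure IsControl (p : Params) (𝒢 : Filtration ℝ≥0 mΩ) (A : ℝ≥0 → Ω → ℝ) : Prop where
  measurable : Measurable fun q : ℝ≥0 × Ω => A q.1 q.2
  pos : ∀ t ω, 0 < A t ω
  le : ∀ t ω, A t ω ≤ p.R
  adapted : ∀ t, Measurable[𝒢 t] fun ω => cumul (A · ω) t

lemma IsControl.locInt {𝒢 : Filtration ℝ≥0 mΩ} {A : ℝ≥0 → Ω → ℝ} (h : IsControl p 𝒢 A) (ω : Ω) :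
    LocInt fun s => A s ω :=
  locInt_of_bounded (h.measurable.comp measurable_prodMk_right) (C := p.R) fun t => by
    rw [abs_of_pos (h.pos t ω)]; exact h.le t ω

/-- Primitives of products of continuous adapted processes with processes whose primitives are
adapted are adapted. -/
lemma measurable_cumul_continuous_mul {m : MeasurableSpace Ω} {g y : ℝ≥0 → Ω → ℝ} {t : ℝ≥0}
    (hgc : ∀ ω, Continuous fun s => g s ω) (hgm : ∀ s ≤ t, Measurable[m] (g s))
    (hy : ∀ ω, LocInt fun s => y s ω)
    (hym : ∀ s ≤ t, Measurable[m] fun ω => cumul (y · ω) s) :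
    Measurable[m] fun ω => cumul (fun s => g s ω * y s ω) t := by
  refine measurable_of_tendsto_metrizable (f := fun (n : ℕ) ω =>
    ∑ i ∈ Finset.range n, g (t * (((i + 0 : ℕ) : ℝ≥0) / n)) ω *
      (cumul (y · ω) (t * (((i + 1 : ℕ) : ℝ≥0) / n))
        - cumul (y · ω) (t * ((i : ℝ≥0) / n)))) (fun n => ?_) ?_
  · refine Finset.measurable_sum _ fun i hi => ?_
    have hle : ∀ j ≤ n, t * ((j : ℝ≥0) / n) ≤ t := fun j hj =>
      mul_le_of_le_one_right zero_le (div_le_one_of_le₀ (by exact_mod_cast hj) zero_le)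
    have hi' := Finset.mem_range.1 hi
    exact (hgm _ (hle _ (by omega))).mul ((hym _ (hle _ (by omega))).sub (hym _ (hle _ (by omega))))
  · rw [tendsto_pi_nhds]
    exact fun ω => tendsto_sum_cumul (hgc ω) (hy ω) t 0 (by norm_num)

section adapted

variable {m : MeasurableSpace Ω} {A : ℝ≥0 → Ω → ℝ} {W : ℝ≥0 → Ω → ℝ × ℝ} {Z : Ω → ℝ × ℝ} {t : ℝ≥0}

lemma measurable_logCap (hA : Measurable[m] fun ω => cumul (A · ω) t)
    (hW : Measurable[m] (W t)) :
    Measurable[m] fun ω => logCap p (A · ω) (W · ω) t :=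
  (measurable_const.sub hA).add ((measurable_fst.comp hW).const_mul _)

lemma measurable_habFactor (hW : Measurable[m] (W t)) :
    Measurable[m] fun ω => habFactor p (W · ω) t :=
  Real.measurable_exp.comp (((measurable_snd.comp hW).const_mul _).const_add _)

lemma measurable_inflow (hA : ∀ s ≤ t, Measurable[m] fun ω => cumul (A · ω) s)
    (hAl : ∀ ω, LocInt fun s => A s ω) (hWc : ∀ ω, Continuous fun s => W s ω)
    (hW : ∀ s ≤ t, Measurable[m] (W s)) :
    Measurable[m] fun ω => inflow p (A · ω) (W · ω) t :=
  measurable_cumul_continuous_mul (y := A)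
    (g := fun s ω => Real.exp (logCap p (A · ω) (W · ω) s) /
      habFactor p (W · ω) s)
    (fun ω => continuous_relGrowth (hAl ω) (hWc ω))
    (fun s hs => (Real.measurable_exp.comp (measurable_logCap (hA s hs) (hW s hs))).div
      (measurable_habFactor (hW s hs))) hAl hA

lemma measurable_statePath (hA : ∀ s ≤ t, Measurable[m] fun ω => cumul (A · ω) s)
    (hAl : ∀ ω, LocInt fun s => A s ω) (hWc : ∀ ω, Continuous fun s => W s ω)
    (hW : ∀ s ≤ t, Measurable[m] (W s)) (hZ : Measurable[m] Z) :
    Measurable[m] fun ω => statePath p (Z ω) (A · ω) (W · ω) t :=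
  ((measurable_fst.comp hZ).mul (Real.measurable_exp.comp
    (measurable_logCap (hA t le_rfl) (hW t le_rfl)))).prodMk
    ((measurable_habFactor (hW t le_rfl)).mul ((measurable_snd.comp hZ).add
      (((measurable_fst.comp hZ).const_mul _).mul (measurable_inflow hA hAl hWc hW))))

end adapted

section joint

variable {A : ℝ≥0 → Ω → ℝ} {W : ℝ≥0 → Ω → ℝ × ℝ} {Z : Ω → ℝ × ℝ}

lemma measurable_cumul {f : ℝ≥0 → Ω → ℝ} (hf : Measurable fun q : ℝ≥0 × Ω => f q.1 q.2)
    (t : ℝ≥0) : Measurable fun ω => cumul (f · ω) t := by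
  have h1 : StronglyMeasurable fun q : Ω × ℝ≥0 => f q.2 q.1 :=
    (hf.comp measurable_swap).stronglyMeasurable
  exact (h1.integral_prod_right' (ν := timeMeasure.restrict (Set.Icc 0 t))).measurable

lemma measurable_statePath_joint (hA : Measurable fun q : ℝ≥0 × Ω => A q.1 q.2)
    (hAl : ∀ ω, LocInt fun s => A s ω) (hWc : ∀ ω, Continuous fun s => W s ω)
    (hW : ∀ s, Measurable (W s)) (hZ : Measurable Z) :
    Measurable fun q : ℝ≥0 × Ω =>
      statePath p (Z q.2) (A · q.2) (W · q.2) q.1 :=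
  measurable_uncurry_of_continuous_paths
    (D := fun t ω => statePath p (Z ω) (A · ω) (W · ω) t)
    (fun _ => measurable_statePath (fun s _ => measurable_cumul hA s) hAl hWc (fun s _ => hW s) hZ)
    (fun ω => continuous_statePath (hAl ω) (hWc ω))

lemma measurable_flowLoss (hA : Measurable fun q : ℝ≥0 × Ω => A q.1 q.2)
    (hAl : ∀ ω, LocInt fun s => A s ω) (hWc : ∀ ω, Continuous fun s => W s ω)
    (hW : ∀ s, Measurable (W s)) (hZ : Measurable Z) :
    Measurable fun q : ℝ≥0 × Ω =>
      flowLoss p (Z q.2) (A · q.2) (W · q.2) q.1 := by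
  have h := measurable_statePath_joint (p := p) hA hAl hWc hW hZ
  exact ((measurable_disc p).comp measurable_fst).mul
    ((measurable_lossRate p).comp ((hA.mul (measurable_fst.comp h)).prodMk (measurable_snd.comp h)))

lemma measurable_runCost (hA : Measurable fun q : ℝ≥0 × Ω => A q.1 q.2)
    (hAl : ∀ ω, LocInt fun s => A s ω) (hWc : ∀ ω, Continuous fun s => W s ω)
    (hW : ∀ s, Measurable (W s)) (hZ : Measurable Z) (S : Set ℝ≥0) :
    Measurable fun ω => runCost p (Z ω) (A · ω) (W · ω) S :=
  (measurable_flowLoss hA hAl hWc hW hZ).lintegral_prod_left'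

end joint

end

/-! ### Linear stochastic differential equations -/

/-- Polarization of the chain rule for squares, applied to the two factors and to their sum. -/
lemma cumul_mul_cumul {f g : ℝ≥0 → ℝ} (hf : LocInt f) (hg : LocInt g) (a b : ℝ) (t : ℝ≥0) :
    (a + cumul f t) * (b + cumul g t)
      = a * b + cumul (fun s => (a + cumul f s) * g s + (b + cumul g s) * f s) t := by
  have key : ∀ (c : ℝ) (u : ℝ≥0 → ℝ), LocInt u →
      (c + cumul u t) ^ 2 = c ^ 2 + cumul (fun s => 2 * (c + cumul u s) * u s) t := fun c u hu =>
    cumul_chain (φ := fun x => x ^ 2) (φ' := fun x => 2 * x) (S := Set.univ)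
      Set.ordConnected_univ (fun x _ => by simpa using hasDerivAt_pow 2 x) (by fun_prop) hu
      (fun _ _ => trivial)
  have hcf := continuous_cumul hf
  have hcg := continuous_cumul hg
  have hLf : ∀ (v : ℝ≥0 → ℝ), Continuous v → LocInt fun s => v s * f s := fun v hv =>
    hf.continuous_mul hv
  have hLg : ∀ (v : ℝ≥0 → ℝ), Continuous v → LocInt fun s => v s * g s := fun v hv =>
    hg.continuous_mul hv
  have h1 := key a f hf
  have h2 := key b g hg
  have h3 := key (a + b) (fun s => f s + g s) (hf.add hg)
  have e3 : cumul (fun s => 2 * (a + b + cumul (fun s => f s + g s) s) * (f s + g s)) t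
      = (cumul (fun s => 2 * (a + cumul f s) * f s) t + cumul (fun s => 2 * (b + cumul g s) * g s) t)
        + 2 * cumul (fun s => (a + cumul f s) * g s + (b + cumul g s) * f s) t := by
    have i1 : LocInt fun s => 2 * (a + cumul f s) * f s := hLf _ (by fun_prop)
    have i2 : LocInt fun s => 2 * (b + cumul g s) * g s := hLg _ (by fun_prop)
    have i3 : LocInt fun s => (a + cumul f s) * g s + (b + cumul g s) * f s :=
      (hLg _ (by fun_prop)).add (hLf _ (by fun_prop))
    rw [← cumul_add i1 i2, ← cumul_const_mul, ← cumul_add (i1.add i2) (i3.const_mul 2)]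
    congr 1
    ext s
    rw [cumul_add hf hg]
    ring
  rw [e3, cumul_add hf hg] at h3
  linarith

lemma exp_mul_eq_cumul (μ : ℝ) (t : ℝ≥0) :
    Real.exp (μ * t) = 1 + cumul (fun s => μ * Real.exp (μ * s)) t := by
  have h := exp_neg_cumul (f := fun _ => -μ) continuous_const.locInt t
  simp only [cumul_const, neg_mul, neg_neg] at h
  rw [h, sub_eq_add_neg, ← neg_one_mul, ← cumul_const_mul]
  congr 2
  ext s
  ring

/-- The solution of `dX = μ X dt + β X dW` started from `1`. -/
def linGrowth (μ β : ℝ) (w : ℝ≥0 → Ω → ℝ) (t : ℝ≥0) (ω : Ω) : ℝ :=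
  stochExp β w t ω * Real.exp (μ * t)

/-- The solution of `dX = (μ X + f) dt + β X dW` started from `x₀`. -/
def linSol (μ β x₀ : ℝ) (f w : ℝ≥0 → Ω → ℝ) (t : ℝ≥0) (ω : Ω) : ℝ :=
  linGrowth μ β w t ω * (x₀ + cumul (fun s => (linGrowth μ β w s ω)⁻¹ * f s ω) t)

lemma linGrowth_pos (μ β : ℝ) (w : ℝ≥0 → Ω → ℝ) (t : ℝ≥0) (ω : Ω) : 0 < linGrowth μ β w t ω :=
  mul_pos (stochExp_pos _ _ _ _) (Real.exp_pos _)

section linear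

variable {𝒢 : Filtration ℝ≥0 mΩ} {P : Measure Ω} {w f : ℝ≥0 → Ω → ℝ} {β : ℝ}

lemma IsRealBM.continuous_linGrowth (h : IsRealBM 𝒢 P w) (μ β : ℝ) (ω : Ω) :
    Continuous fun t => linGrowth μ β w t ω :=
  (h.continuous_stochExp β ω).mul (by fun_prop)

lemma IsRealBM.continuous_inv_linGrowth (h : IsRealBM 𝒢 P w) (μ β : ℝ) (ω : Ω) :
    Continuous fun t => (linGrowth μ β w t ω)⁻¹ :=
  (h.continuous_linGrowth μ β ω).inv₀ fun t => (linGrowth_pos μ β w t ω).ne'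

lemma IsRealBM.measurable_linGrowth (h : IsRealBM 𝒢 P w) (μ β : ℝ) (t : ℝ≥0) :
    Measurable[𝒢 t] (linGrowth μ β w t) :=
  (h.measurable_stochExp β t).mul_const _

lemma IsRealBM.measurable_cumul_inv_linGrowth (h : IsRealBM 𝒢 P w) (μ β : ℝ)
    (hf : ∀ ω, LocInt fun t => f t ω)
    (hfm : ∀ t, Measurable[𝒢 t] fun ω => cumul (f · ω) t) (t : ℝ≥0) :
    Measurable[𝒢 t] fun ω => cumul (fun s => (linGrowth μ β w s ω)⁻¹ * f s ω) t :=
  measurable_cumul_continuous_mul (g := fun s ω => (linGrowth μ β w s ω)⁻¹)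
    (h.continuous_inv_linGrowth μ β)
    (fun s hs => ((h.measurable_linGrowth μ β s).mono (𝒢.mono hs) le_rfl).inv) hf
    (fun s hs => (hfm s).mono (𝒢.mono hs) le_rfl)

lemma IsRealBM.measurable_linSol (h : IsRealBM 𝒢 P w) (μ β x₀ : ℝ)
    (hf : ∀ ω, LocInt fun t => f t ω)
    (hfm : ∀ t, Measurable[𝒢 t] fun ω => cumul (f · ω) t) (t : ℝ≥0) :
    Measurable[𝒢 t] (linSol μ β x₀ f w t) :=
  (h.measurable_linGrowth μ β t).mul
    ((h.measurable_cumul_inv_linGrowth μ β hf hfm t).const_add _)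

lemma IsRealBM.continuous_linSol (h : IsRealBM 𝒢 P w) (μ β x₀ : ℝ)
    (hf : ∀ ω, LocInt fun t => f t ω) (ω : Ω) : Continuous fun t => linSol μ β x₀ f w t ω :=
  (h.continuous_linGrowth μ β ω).mul (continuous_const.add
    (continuous_cumul ((hf ω).continuous_mul (h.continuous_inv_linGrowth μ β ω))))

/-- The solution is the product of the stochastic exponential of `β w` and the absolutely continuous
process `Y`, which collects `exp (μ t)` and the integral of `f` against the inverse growth. The
density of `Y` times the stochastic exponential is `μ X + f`, so
`IsRealBM.isItoIntegral_stochExp_mul` gives the equation. -/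
theorem IsRealBM.exists_isItoIntegral_linSol [IsProbabilityMeasure P] (h : IsRealBM 𝒢 P w)
    (hβ : β ≠ 0) (μ x₀ : ℝ) (hf : ∀ ω, LocInt fun t => f t ω)
    (hfm : ∀ t, Measurable[𝒢 t] fun ω => cumul (f · ω) t) :
    ∃ I, IsItoIntegral P (linSol μ β x₀ f w) w I ∧ ∀ ω t, linSol μ β x₀ f w t ω
      = x₀ + cumul (fun s => μ * linSol μ β x₀ f w s ω + f s ω) t + β * I t ω := by
  set F : ℝ≥0 → Ω → ℝ := fun s ω => (linGrowth μ β w s ω)⁻¹ * f s ω with hF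
  have hFl : ∀ ω, LocInt fun s => F s ω := fun ω =>
    (hf ω).continuous_mul (h.continuous_inv_linGrowth μ β ω)
  have hcF : ∀ ω, Continuous (cumul fun s => F s ω) := fun ω => continuous_cumul (hFl ω)
  set Y : ℝ≥0 → Ω → ℝ := fun t ω => Real.exp (μ * t) * (x₀ + cumul (F · ω) t) with hY
  set y : ℝ≥0 → Ω → ℝ := fun s ω => Real.exp (μ * s) * F s ω +
    (x₀ + cumul (F · ω) s) * (μ * Real.exp (μ * s)) with hy
  have hYm : ∀ t, Measurable[𝒢 t] (Y t) := fun t =>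
    ((h.measurable_cumul_inv_linGrowth μ β hf hfm t).const_add _).const_mul _
  have hyl : ∀ ω, LocInt fun s => y s ω := fun ω => by
    have h1 : LocInt fun s : ℝ≥0 => Real.exp (μ * s) * F s ω :=
      (hFl ω).continuous_mul (by fun_prop)
    have h2 : LocInt fun s : ℝ≥0 => (x₀ + cumul (F · ω) s) * (μ * Real.exp (μ * s)) := by
      have := hcF ω
      exact Continuous.locInt (by fun_prop)
    exact h1.add h2
  have hYy : ∀ ω t, Y t ω = x₀ + cumul (y · ω) t := fun ω t => by
    have h1 := cumul_mul_cumul (f := fun s : ℝ≥0 => μ * Real.exp (μ * s)) (g := fun s => F s ω)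
      (Continuous.locInt (by fun_prop)) (hFl ω) 1 x₀ t
    rw [← exp_mul_eq_cumul, one_mul] at h1
    simp only [hY, h1, hy, ← exp_mul_eq_cumul]
  have hmain := h.isItoIntegral_stochExp_mul hβ hYm hyl hYy
  have e1 : (fun t ω => stochExp β w t ω * Y t ω) = linSol μ β x₀ f w := by
    ext t ω
    simp only [hY, linSol, linGrowth, hF]
    ring
  have e2 : ∀ s ω, stochExp β w s ω * y s ω = μ * linSol μ β x₀ f w s ω + f s ω := fun s ω => by
    have h1 : linGrowth μ β w s ω * F s ω = f s ω := by
      simp only [hF]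
      rw [mul_inv_cancel_left₀ (linGrowth_pos μ β w s ω).ne']
    rw [← h1]
    simp only [hy, linSol, linGrowth, hF]
    ring
  rw [e1] at hmain
  refine ⟨_, hmain, fun ω t => ?_⟩
  have e3 := congrFun (congrFun e1 t) ω
  simp only [e2, e3]
  field_simp
  ring

end linear

lemma tendstoInMeasure_sub {P : Measure Ω} {f g : ℕ → Ω → ℝ} {F G : Ω → ℝ}
    (hf : TendstoInMeasure P f atTop F) (hg : TendstoInMeasure P g atTop G) :
    TendstoInMeasure P (fun n ω => f n ω - g n ω) atTop (fun ω => F ω - G ω) := by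
  have h1 : TendstoInMeasure P (fun n ω => f n ω - F ω) atTop (fun _ => 0) := by
    rw [tendstoInMeasure_iff_norm] at hf ⊢
    simpa using hf
  have h2 : TendstoInMeasure P (fun n ω => G ω - g n ω) atTop (fun _ => 0) := by
    rw [tendstoInMeasure_iff_norm] at hg ⊢
    simpa [norm_sub_rev] using hg
  have h3 := tendstoInMeasure_add_zero h1 h2
  rw [tendstoInMeasure_iff_norm] at h3 ⊢
  refine fun ε hε => (h3 ε hε).congr fun n => ?_
  congr 1
  ext ω
  simp only [Set.mem_ofPred_eq]
  ring_nf

/-- Replacing the time `s` by `min s t` does not change the integral over `[0, t]` and makes the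
integrand jointly measurable with respect to `ℱ t`. -/
lemma IsProgressive.measurable_cumul {ℱ : Filtration ℝ≥0 mΩ} {f : ℝ≥0 → Ω → ℝ}
    (hf : IsProgressive ℱ f) (t : ℝ≥0) :
    Measurable[ℱ t] fun ω => cumul (f · ω) t := by
  have h1 : @Measurable _ _ (@Prod.instMeasurableSpace Ω ℝ≥0 (ℱ t) _) _
      (fun q : Ω × ℝ≥0 => f (min q.2 t) q.1) :=
    (hf t).comp (g := fun p : Set.Iic t × Ω => f p.1 p.2)
      (f := fun q : Ω × ℝ≥0 => (⟨min q.2 t, Set.mem_Iic.2 (min_le_right _ _)⟩, q.1))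
      (Measurable.prodMk (Measurable.subtype_mk (measurable_snd.min measurable_const))
        measurable_fst)
  have h2 := (@StronglyMeasurable.integral_prod_right' Ω ℝ≥0 ℝ (ℱ t) _
    (timeMeasure.restrict (Set.Icc 0 t)) _ _ _ _
    (@Measurable.stronglyMeasurable _ _ (_) _ _ _ _ _ _ h1)).measurable
  have e : (fun ω => cumul (f · ω) t)
      = fun ω => ∫ s in Set.Icc 0 t, f (min s t) ω ∂timeMeasure := by
    ext ω
    refine setIntegral_congr_fun measurableSet_Icc fun s hs => ?_
    simp only [min_eq_left hs.2]
  rw [e]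
  exact h2

lemma IsProgressive.measurable_uncurry {ℱ : Filtration ℝ≥0 mΩ} {f : ℝ≥0 → Ω → ℝ}
    (hf : IsProgressive ℱ f) : Measurable fun q : ℝ≥0 × Ω => f q.1 q.2 := by
  refine measurable_of_tendsto_metrizable (f := fun (n : ℕ) (q : ℝ≥0 × Ω) => f (min q.1 n) q.2)
    (fun n => ?_) ?_
  · have h1 : Measurable fun p : Set.Iic (n : ℝ≥0) × Ω => f p.1 p.2 :=
      (hf n).mono (sup_le_sup le_rfl (MeasurableSpace.comap_mono (ℱ.le n))) le_rfl
    have h2 : Measurable fun q : ℝ≥0 × Ω =>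
        ((⟨min q.1 n, Set.mem_Iic.2 (min_le_right _ _)⟩, q.2) : Set.Iic (n : ℝ≥0) × Ω) :=
      Measurable.prodMk (Measurable.subtype_mk (measurable_fst.min measurable_const))
        measurable_snd
    exact h1.comp h2
  · rw [tendsto_pi_nhds]
    intro q
    refine tendsto_const_nhds.congr' ?_
    obtain ⟨n, hn⟩ := exists_nat_ge q.1
    filter_upwards [eventually_ge_atTop n] with m hm
    rw [min_eq_left (hn.trans (by exact_mod_cast hm))]

/-! ### The state equations and the explicit solutions -/

lemma IsItoIntegral.congr_integrator {P : Measure Ω} {H W W' I : ℝ≥0 → Ω → ℝ}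
    (hI : IsItoIntegral P H W I) (hW : ∀ᵐ ω ∂P, ∀ t, W t ω = W' t ω) :
    IsItoIntegral P H W' I := fun t => by
  refine (hI t).congr_left fun n => ?_
  filter_upwards [hW] with ω hω
  simp only [hω]

/-- The difference of the given and the explicit solution solves the homogeneous equation, driven by
the difference of the two Itô integrals. Paths on a null set, which belongs to `ℱ 0`, are replaced
by zero to have continuity and integrability everywhere. -/
lemma SolvesSDE.ae_eq_linSol {P : Measure Ω} [IsProbabilityMeasure P] {ℱ : Filtration ℝ≥0 mΩ}
    (hℱ : UsualHypotheses ℱ P) {w W : ℝ≥0 → Ω → ℝ} (h : IsRealBM ℱ P w)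
    (hw : ∀ᵐ ω ∂P, ∀ t, w t ω = W t ω) {β : ℝ} (hβ : β ≠ 0) {μ x₀ : ℝ} {f X : ℝ≥0 → Ω → ℝ}
    (hX : SolvesSDE ℱ P W x₀ β (fun t ω => μ * X t ω + f t ω) X)
    (hf : ∀ᵐ ω ∂P, LocallyIntegrable (f · ω) timeMeasure) (hfp : IsProgressive ℱ f) :
    ∀ᵐ ω ∂P, ∀ t, X t ω = linSol μ β x₀ f w t ω := by
  classical
  set N : Set Ω := {ω | Continuous (X · ω) ∧ LocInt fun t => f t ω} with hN
  have hNae : ∀ᵐ ω ∂P, ω ∈ N := by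
    filter_upwards [hX.continuous_paths, hf] with ω h1 h2
    exact ⟨h1, locInt_of_locallyIntegrable h2⟩
  have hN0 : MeasurableSet[ℱ 0] N := by
    have := (hℱ.complete Nᶜ hNae).compl
    rwa [compl_compl] at this
  set g : ℝ≥0 → Ω → ℝ := fun t ω => if ω ∈ N then f t ω else 0 with hg
  have hgl : ∀ ω, LocInt fun t => g t ω := fun ω => by
    by_cases hω : ω ∈ N
    · simp only [hg, hω, if_true]; exact hω.2
    · simp only [hg, hω, if_false]; exact continuous_const.locInt
  have hgm : ∀ t, Measurable[ℱ t] fun ω => cumul (g · ω) t := fun t => by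
    have e : (fun ω => cumul (g · ω) t)
        = fun ω => if ω ∈ N then cumul (f · ω) t else 0 := by
      ext ω
      by_cases hω : ω ∈ N
      · simp only [hg, hω, if_true]
      · simp only [hg, hω, if_false, cumul_const, zero_mul]
    rw [e]
    exact Measurable.ite (ℱ.mono zero_le _ hN0) (IsProgressive.measurable_cumul hfp t)
      measurable_const
  obtain ⟨I, hI, hIeq⟩ := h.exists_isItoIntegral_linSol hβ μ x₀ hgl hgm
  obtain ⟨I', hI', hIeq'⟩ := hX.equation
  set D : ℝ≥0 → Ω → ℝ := fun t ω => if ω ∈ N then X t ω - linSol μ β x₀ g w t ω else 0 with hD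
  have hDm : ∀ t, Measurable[ℱ t] (D t) := fun t =>
    Measurable.ite (ℱ.mono zero_le _ hN0)
      ((hX.adapted t).sub (h.measurable_linSol μ β x₀ hgl hgm t)) measurable_const
  have hDc : ∀ ω, Continuous fun t => D t ω := fun ω => by
    by_cases hω : ω ∈ N
    · simp only [hD, hω, if_true]
      exact hω.1.sub (h.continuous_linSol μ β x₀ hgl ω)
    · simp only [hD, hω, if_false]; exact continuous_const
  have hJ : IsItoIntegral P D w (fun t ω => I' t ω - I t ω) := fun t => by
    have h1 := tendstoInMeasure_sub
      ((hI'.congr_integrator (hw.mono fun ω h t => (h t).symm)) t) (hI t)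
    refine h1.congr_left fun n => ?_
    filter_upwards [hNae] with ω hω
    simp only [hD, hω, if_true]
    rw [← Finset.sum_sub_distrib]
    exact Finset.sum_congr rfl fun i _ => by ring
  have hzero := h.eq_zero_of_isItoIntegral hDm hDc hJ (μ := μ) (β := β) fun t => by
    filter_upwards [hNae, hIeq'] with ω hω h2
    have h3 := hIeq ω t
    have h4 : X t ω = x₀ + cumul (fun s => μ * X s ω + f s ω) t + β * I' t ω := h2 t
    have hXl : LocInt fun s => X s ω := hω.1.locInt
    have hLl : LocInt fun s => linSol μ β x₀ g w s ω := (h.continuous_linSol μ β x₀ hgl ω).locInt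
    have hfg : ∀ s, g s ω = f s ω := fun s => by simp only [hg, hω, if_true]
    rw [cumul_add (hXl.const_mul μ) hω.2, cumul_const_mul] at h4
    simp only [hfg] at h3
    rw [cumul_add (hLl.const_mul μ) hω.2, cumul_const_mul] at h3
    simp only [hD, hω, if_true]
    rw [cumul_sub hXl hLl, h4, h3]
    ring
  filter_upwards [hzero, hNae] with ω h1 hω t
  have h2 := h1 t
  simp only [hD, hω, if_true] at h2
  have hfg : ∀ s, g s ω = f s ω := fun s => by simp only [hg, hω, if_true]
  simp only [linSol, hfg] at h2 ⊢
  linarith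

section interface

variable {p : Params} {ℱ : Filtration ℝ≥0 mΩ} {P : Measure Ω} {W₁ W₂ : ℝ≥0 → Ω → ℝ}
  {W : ℝ≥0 → Ω → ℝ × ℝ}

lemma linGrowth_habit (t : ℝ≥0) (ω : Ω) :
    linGrowth (-p.ρ) p.β₂ (fun t ω => (W t ω).2) t ω = habFactor p (W · ω) t := by
  simp only [linGrowth, stochExp, habFactor, ← Real.exp_add]
  congr 1
  ring

lemma linGrowth_capital (α : ℝ≥0 → ℝ) (t : ℝ≥0) (ω : Ω) :
    linGrowth p.B p.β₁ (fun t ω => (W t ω).1) t ω * Real.exp (-cumul α t)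
      = Real.exp (logCap p α (W · ω) t) := by
  simp only [linGrowth, stochExp, logCap, ← Real.exp_add]
  congr 1
  ring

lemma capPath_eq_linGrowth (z : ℝ × ℝ) (α : ℝ≥0 → ℝ) (t : ℝ≥0) (ω : Ω) :
    capPath p z α (W · ω) t = linGrowth p.B p.β₁ (fun t ω => (W t ω).1) t ω *
      (z.1 * Real.exp (-cumul α t)) := by
  rw [capPath, ← linGrowth_capital]; ring

lemma habPath_eq_linSol (z : ℝ × ℝ) (α : ℝ≥0 → ℝ) (t : ℝ≥0) (ω : Ω) {c : ℝ≥0 → Ω → ℝ}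
    (hc : ∀ᵐ s ∂timeMeasure, c s ω = α s * capPath p z α (W · ω) s) :
    linSol (-p.ρ) p.β₂ z.2 (fun s ω => p.ρ * c s ω) (fun t ω => (W t ω).2) t ω
      = habPath p z α (W · ω) t := by
  rw [linSol, habPath, linGrowth_habit, inflow, ← cumul_const_mul]
  congr 2
  refine cumul_congr_ae ?_ t
  filter_upwards [hc] with s hs
  rw [hs, linGrowth_habit, capPath, div_eq_mul_inv]
  ring

/-- The control is `c / k`, progressive because `k` is continuous and positive off a null set, and
replaced by `R` where it leaves `(0, R]`. Dividing `k` by its growth without consumption gives `Y`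
with `Y = x - ∫ A Y`, so `Y = x exp (-∫ A)`. The habit is then the explicit one, since `c = A k` for
almost every time. -/
theorem IsAdmissible.exists_control [IsProbabilityMeasure P] (hℱ : UsualHypotheses ℱ P)
    (hW : IsBM ℱ P W) (hWW : ∀ᵐ ω ∂P, ∀ t, W t ω = (W₁ t ω, W₂ t ω)) (hp : p.Standing)
    {x y : ℝ} {c k h : ℝ≥0 → Ω → ℝ} (hc : IsAdmissible p ℱ P W₁ W₂ x y c k h) :
    ∃ A : ℝ≥0 → Ω → ℝ, IsControl p ℱ A ∧ ∀ᵐ ω ∂P,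
      (∀ t, (k t ω, h t ω) = statePath p (x, y) (A · ω) (W · ω) t) ∧
      ∀ᵐ t ∂timeMeasure, c t ω = A t ω * k t ω := by
  classical
  set N : Set Ω := {ω | Continuous (k · ω) ∧ ∀ t, 0 < k t ω} with hN
  have hNae : ∀ᵐ ω ∂P, ω ∈ N := by
    filter_upwards [hc.capital.continuous_paths, hc.state_pos] with ω h1 h2
    exact ⟨h1, fun t => (h2 t).1⟩
  have hN0 : MeasurableSet[ℱ 0] N := by
    have := (hℱ.complete Nᶜ hNae).compl
    rwa [compl_compl] at this
  set k' : ℝ≥0 → Ω → ℝ := fun t ω => if ω ∈ N then k t ω else 1 with hk'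
  have hk'p : IsProgressive ℱ k' := by
    have h1 : StronglyAdapted ℱ k' := fun t =>
      (Measurable.ite (ℱ.mono zero_le _ hN0) (hc.capital.adapted t)
        measurable_const).stronglyMeasurable
    refine (h1.isStronglyProgressive_of_continuous fun ω => ?_).isProgressive
    by_cases hω : ω ∈ N
    · simp only [hk', hω, if_true]; exact hω.1
    · simp only [hk', hω, if_false]; exact continuous_const
  have hq : IsProgressive ℱ fun t ω => c t ω / k' t ω := fun t =>
    (hc.progressive t).div (hk'p t)
  set A : ℝ≥0 → Ω → ℝ := fun t ω =>
    if 0 < c t ω / k' t ω ∧ c t ω / k' t ω ≤ p.R then c t ω / k' t ω else p.R with hA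
  have hAp : IsProgressive ℱ A := fun t => by
    have h1 := hq t
    refine Measurable.ite ?_ h1 measurable_const
    exact (measurableSet_lt measurable_const h1).inter (measurableSet_le h1 measurable_const)
  have hApos : ∀ t ω, 0 < A t ω := fun t ω => by
    simp only [hA]; split_ifs with h1
    · exact h1.1
    · exact hp.R_pos
  have hAle : ∀ t ω, A t ω ≤ p.R := fun t ω => by
    simp only [hA]; split_ifs with h1
    · exact h1.2
    · exact le_rfl
  have hAc : IsControl p ℱ A :=
    ⟨IsProgressive.measurable_uncurry hAp, hApos, hAle, IsProgressive.measurable_cumul hAp⟩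
  refine ⟨A, hAc, ?_⟩
  have hcap : SolvesSDE ℱ P W₁ x p.β₁ (fun t ω => p.B * k t ω + -c t ω) k := by
    have := hc.capital; simpa only [sub_eq_add_neg] using this
  have hhab : SolvesSDE ℱ P W₂ y p.β₂ (fun t ω => -p.ρ * h t ω + p.ρ * c t ω) h := by
    have := hc.habit
    have e : (fun (t : ℝ≥0) (ω : Ω) => p.ρ * (c t ω - h t ω))
      = fun t ω => -p.ρ * h t ω + p.ρ * c t ω := by ext t ω; ring
    rwa [e] at this
  have hk := hcap.ae_eq_linSol hℱ hW.fst (hWW.mono fun ω h t => by rw [h]) hp.β₁_pos.ne'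
    (hc.locallyIntegrable.mono fun ω h => h.neg)
    (fun t => (hc.progressive t).neg)
  have hh := hhab.ae_eq_linSol hℱ hW.snd (hWW.mono fun ω h t => by rw [h]) hp.β₂_pos.ne'
    (hc.locallyIntegrable.mono fun ω h =>
      ((locInt_of_locallyIntegrable h).const_mul p.ρ).locallyIntegrable)
    (fun t => (hc.progressive t).const_mul p.ρ)
  filter_upwards [hk, hh, hNae, Measure.ae_ae_of_ae_prod hc.control_pos,
    Measure.ae_ae_of_ae_prod hc.control_le, hc.locallyIntegrable] with ω h1 h2 hω h3 h4 h5
  have hkk : ∀ t, k' t ω = k t ω := fun t => by simp only [hk', hω, if_true]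
  have hcA : ∀ᵐ t ∂timeMeasure, c t ω = A t ω * k t ω := by
    filter_upwards [h3, h4] with t h6 h7
    have hk0 := hω.2 t
    have h8 : 0 < c t ω / k' t ω ∧ c t ω / k' t ω ≤ p.R := by
      rw [hkk]; exact ⟨div_pos h6 hk0, (div_le_iff₀ hk0).2 h7⟩
    have h9 : A t ω = c t ω / k t ω := by simp only [hA]; rw [if_pos h8, hkk]
    rw [h9, div_mul_cancel₀ _ hk0.ne']
  set w₁ : ℝ≥0 → Ω → ℝ := fun t ω => (W t ω).1 with hw₁
  set Y : ℝ≥0 → ℝ := fun t => x + cumul (fun s => (linGrowth p.B p.β₁ w₁ s ω)⁻¹ * -c s ω) t with hY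
  have hkY : ∀ t, k t ω = linGrowth p.B p.β₁ w₁ t ω * Y t := h1
  have hl : LocInt fun s => (linGrowth p.B p.β₁ w₁ s ω)⁻¹ * -c s ω :=
    (locInt_of_locallyIntegrable h5.neg).continuous_mul (hW.fst.continuous_inv_linGrowth _ _ ω)
  have hYexp : ∀ t, Y t = x * Real.exp (-cumul (A · ω) t) := by
    refine eq_exp_neg_cumul (hAc.measurable.comp measurable_prodMk_right) (C := p.R)
      (fun t => by change |A t ω| ≤ p.R; rw [abs_of_pos (hApos t ω)]; exact hAle t ω)
      (continuous_const.add (continuous_cumul hl)) fun t => ?_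
    rw [sub_eq_add_neg, ← neg_one_mul, ← cumul_const_mul]
    change x + cumul _ t = x + cumul _ t
    congr 1
    refine cumul_congr_ae ?_ t
    filter_upwards [hcA] with s hs
    have hG := (linGrowth_pos p.B p.β₁ w₁ s ω).ne'
    change _ = -1 * (A s ω * Y s)
    rw [hs, hkY s]
    field_simp
  have hkcap : ∀ t, k t ω = capPath p (x, y) (A · ω) (W · ω) t := fun t => by
    rw [capPath_eq_linGrowth, hkY, hYexp]
  refine ⟨fun t => Prod.ext (hkcap t) ?_, hcA⟩
  change h t ω = _
  rw [h2 t]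
  refine habPath_eq_linSol (x, y) (A · ω) t ω ?_
  filter_upwards [hcA] with s hs
  rw [hs, hkcap]

/-- A control has a progressive version. -/
lemma IsControl.exists_progressive {A : ℝ≥0 → Ω → ℝ} (hA : IsControl p ℱ A) (hR : 0 < p.R) :
    ∃ A' : ℝ≥0 → Ω → ℝ, IsProgressive ℱ A' ∧ (∀ t ω, 0 < A' t ω) ∧ (∀ t ω, A' t ω ≤ p.R) ∧
      ∀ ω, ∀ᵐ t ∂timeMeasure, A t ω = A' t ω := by
  classical
  -- Backward difference quotients of the primitive are continuous and adapted, hence progressive,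
  -- and converge to `A` at almost every time. Their limit inferior is the version, once its values
  -- outside `(0, R]` are discarded.
  set D : ℕ → ℝ≥0 → Ω → ℝ := fun n t ω => ((n : ℝ) + 1) *
    (cumul (A · ω) t - cumul (A · ω) (t - 1 / ((n : ℝ≥0) + 1))) with hD
  have hDp : ∀ n, IsProgressive ℱ (D n) := fun n => by
    have h1 : StronglyAdapted ℱ (D n) := fun t =>
      (((hA.adapted t).sub ((hA.adapted _).mono (ℱ.mono tsub_le_self) le_rfl)).const_mul
        _).stronglyMeasurable
    refine (h1.isStronglyProgressive_of_continuous fun ω => ?_).isProgressive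
    have := continuous_cumul (hA.locInt ω)
    exact continuous_const.mul (this.sub (this.comp (by fun_prop)))
  set L : ℝ≥0 → Ω → ℝ := fun t ω => liminf (fun n => D n t ω) atTop with hL
  have hLp : IsProgressive ℱ L := fun t => Measurable.liminf fun n => hDp n t
  refine ⟨fun t ω => if 0 < L t ω ∧ L t ω ≤ p.R then L t ω else p.R, fun t => ?_, fun t ω => ?_,
    fun t ω => ?_, fun ω => ?_⟩
  · have h1 := hLp t
    refine Measurable.ite ?_ h1 measurable_const
    exact (measurableSet_lt measurable_const h1).inter (measurableSet_le h1 measurable_const)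
  · dsimp only; split_ifs with h1
    · exact h1.1
    · exact hR
  · dsimp only; split_ifs with h1
    · exact h1.2
    · exact le_rfl
  · have h0 : ∀ᵐ t : ℝ≥0 ∂timeMeasure, t ≠ 0 := by simp [ae_iff]
    filter_upwards [ae_hasDerivAt_cumul (hA.locInt ω), h0] with t ht ht0
    have hlim : Tendsto (fun n => D n t ω) atTop (nhds (A t ω)) := by
      have h1 := hasDerivAt_iff_tendsto_slope_zero.1 ht
      have h2 : Tendsto (fun n : ℕ => -(1 / ((n : ℝ) + 1))) atTop (nhdsWithin 0 {0}ᶜ) := by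
        refine tendsto_nhdsWithin_iff.2 ⟨?_, .of_forall fun n => ?_⟩
        · simpa using (tendsto_one_div_add_atTop_nhds_zero_nat (𝕜 := ℝ)).neg
        · have : (0 : ℝ) < 1 / ((n : ℝ) + 1) := by positivity
          simp only [Set.mem_compl_iff, Set.mem_singleton_iff]
          linarith
      refine (h1.comp h2).congr' ?_
      have htp : (0 : ℝ) < t := NNReal.coe_pos.2 (pos_iff_ne_zero.2 ht0)
      filter_upwards [(tendsto_one_div_add_atTop_nhds_zero_nat (𝕜 := ℝ)).eventually
        (gt_mem_nhds htp)] with n hn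
      have hn' : 1 / ((n : ℝ≥0) + 1) ≤ t := by
        rw [← NNReal.coe_le_coe]; push_cast; exact hn.le
      have e1 : (((t - 1 / ((n : ℝ≥0) + 1) : ℝ≥0)) : ℝ) = t + -(1 / ((n : ℝ) + 1)) := by
        rw [NNReal.coe_sub hn']; push_cast; ring
      simp only [hD, Function.comp_apply, smul_eq_mul]
      rw [cumul_eq_intervalIntegral, cumul_eq_intervalIntegral, e1]
      have : (-(1 / ((n : ℝ) + 1)))⁻¹ = -((n : ℝ) + 1) := by rw [inv_neg, one_div, inv_inv]
      rw [this]
      ring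
    have hLA : L t ω = A t ω := hlim.liminf_eq
    simp only [hLA, hA.pos t ω, hA.le t ω, and_self, if_true]

/-- The converse of `IsAdmissible.exists_control`. Passing to a progressive version does not change
the state at all, because the ratio enters it only through integrals over time. -/
theorem IsControl.exists_admissible [IsProbabilityMeasure P] {A : ℝ≥0 → Ω → ℝ}
    (hA : IsControl p ℱ A) (hW : IsBM ℱ P W) (hWW : ∀ᵐ ω ∂P, ∀ t, W t ω = (W₁ t ω, W₂ t ω))
    (hp : p.Standing) {x y : ℝ} (hx : 0 < x) (hy : 0 < y) :
    ∃ c k h : ℝ≥0 → Ω → ℝ, IsAdmissible p ℱ P W₁ W₂ x y c k h ∧ ∀ ω,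
      (∀ t, (k t ω, h t ω) = statePath p (x, y) (A · ω) (W · ω) t) ∧
      ∀ᵐ t ∂timeMeasure, c t ω = A t ω * k t ω := by
  obtain ⟨A', hA'p, hA'0, hA'R, hAA⟩ := hA.exists_progressive hp.R_pos
  have hA' : IsControl p ℱ A' :=
    ⟨IsProgressive.measurable_uncurry hA'p, hA'0, hA'R, IsProgressive.measurable_cumul hA'p⟩
  set Z : ℝ≥0 → Ω → ℝ × ℝ := fun t ω => statePath p (x, y) (A' · ω) (W · ω) t
    with hZ
  have hZc : ∀ ω, Continuous fun t => Z t ω := fun ω =>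
    continuous_statePath (hA'.locInt ω) (hW.continuous ω)
  have hZm : ∀ t, Measurable[ℱ t] (Z t) := fun t =>
    measurable_statePath (fun s hs => (hA'.adapted s).mono (ℱ.mono hs) le_rfl) hA'.locInt
      hW.continuous (fun s hs => (hW.adapted s).mono (ℱ.mono hs) le_rfl) measurable_const
  have hZp : ∀ t ω, 0 < (Z t ω).1 ∧ 0 < (Z t ω).2 := fun t ω =>
    ⟨capPath_pos hx t, habPath_pos hp.ρ_pos.le hx.le hy (fun s => (hA'0 s ω).le) t⟩
  have hkp : IsProgressive ℱ fun t ω => (Z t ω).1 := by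
    have h1 : StronglyAdapted ℱ fun t ω => (Z t ω).1 := fun t =>
      (measurable_fst.comp (hZm t)).stronglyMeasurable
    exact (h1.isStronglyProgressive_of_continuous fun ω =>
      continuous_fst.comp (hZc ω)).isProgressive
  set c : ℝ≥0 → Ω → ℝ := fun t ω => A' t ω * (Z t ω).1 with hc
  have hcp : IsProgressive ℱ c := hA'p.mul hkp
  have hcl : ∀ ω, LocInt fun t => c t ω := fun ω => by
    have : LocInt fun t => (Z t ω).1 * A' t ω :=
      (hA'.locInt ω).continuous_mul (continuous_fst.comp (hZc ω))
    simpa only [hc, mul_comm] using this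
  have hncl : ∀ ω, LocInt fun t => -c t ω := fun ω => by
    simpa using (hcl ω).const_mul (-1)
  have hcm := IsProgressive.measurable_cumul hcp
  have hncp : IsProgressive ℱ fun t ω => -c t ω := fun t => (hcp t).neg
  have hncm := IsProgressive.measurable_cumul hncp
  have hρcp : IsProgressive ℱ fun t ω => p.ρ * c t ω := fun t => (hcp t).const_mul p.ρ
  have hρcm := IsProgressive.measurable_cumul hρcp
  obtain ⟨I₁, hI₁, hE₁⟩ := hW.fst.exists_isItoIntegral_linSol hp.β₁_pos.ne' p.B x hncl hncm
  obtain ⟨I₂, hI₂, hE₂⟩ := hW.snd.exists_isItoIntegral_linSol hp.β₂_pos.ne' (-p.ρ) y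
    (fun ω => (hcl ω).const_mul p.ρ) hρcm
  have e₂ : linSol (-p.ρ) p.β₂ y (fun s ω => p.ρ * c s ω) (fun t ω => (W t ω).2)
      = fun t ω => (Z t ω).2 := by
    ext t ω
    exact habPath_eq_linSol (x, y) (A' · ω) t ω (.of_forall fun s => rfl)
  have e₁ : linSol p.B p.β₁ x (fun s ω => -c s ω) (fun t ω => (W t ω).1)
      = fun t ω => (Z t ω).1 := by
    ext t ω
    have h1 := exp_neg_cumul (hA'.locInt ω) t
    change _ = capPath p (x, y) (A' · ω) (W · ω) t
    rw [capPath_eq_linGrowth, h1, linSol]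
    congr 1
    rw [mul_sub, mul_one, sub_eq_add_neg, ← neg_mul, ← cumul_const_mul]
    congr 1
    refine cumul_congr fun s _ => ?_
    have hG := (linGrowth_pos p.B p.β₁ (fun t ω => (W t ω).1) s ω).ne'
    change (linGrowth p.B p.β₁ (fun t ω => (W t ω).1) s ω)⁻¹ * -(A' s ω *
      capPath p (x, y) (A' · ω) (W · ω) s) = _
    rw [capPath_eq_linGrowth]
    field_simp
  rw [e₁] at hI₁
  rw [e₂] at hI₂
  refine ⟨c, fun t ω => (Z t ω).1, fun t ω => (Z t ω).2, ⟨hcp,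
    .of_forall fun ω => (hcl ω).locallyIntegrable,
    .of_forall fun q => mul_pos (hA'0 _ _) (hZp _ _).1,
    ⟨fun t => measurable_fst.comp (hZm t),
      .of_forall fun ω => continuous_fst.comp (hZc ω),
      .of_forall fun ω => LocInt.locallyIntegrable ?_,
      I₁, hI₁.congr_integrator (hWW.mono fun ω h t => by rw [h]),
      .of_forall fun ω t => ?_⟩,
    ⟨fun t => measurable_snd.comp (hZm t),
      .of_forall fun ω => continuous_snd.comp (hZc ω),
      .of_forall fun ω => LocInt.locallyIntegrable ?_,
      I₂, hI₂.congr_integrator (hWW.mono fun ω h t => by rw [h]),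
      .of_forall fun ω t => ?_⟩,
    .of_forall fun ω t => hZp t ω,
    .of_forall fun q => ?_⟩, fun ω => ⟨fun t => ?_, ?_⟩⟩
  · exact ((continuous_fst.comp (hZc ω)).locInt.const_mul p.B).sub (hcl ω)
  · have := hE₁ ω t
    rw [e₁] at this
    simp only [← sub_eq_add_neg] at this
    exact this
  · exact ((hcl ω).sub (continuous_snd.comp (hZc ω)).locInt).const_mul p.ρ
  · have := hE₂ ω t
    rw [e₂] at this
    refine this.trans ?_
    congr 2
    refine integral_congr_ae (.of_forall fun s => ?_)
    simp only
    ring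
  · exact mul_le_mul_of_nonneg_right (hA'R _ _) (hZp _ _).1.le
  · exact (statePath_congr (t := t) ((hAA ω).mono fun s hs _ => hs) le_rfl).symm
  · filter_upwards [hAA ω] with t ht
    simp only [hc, ht]

end interface

/-! ### Exponential moments -/

namespace IsBM

variable {𝒢 : Filtration ℝ≥0 mΩ} {P : Measure Ω} {W : ℝ≥0 → Ω → ℝ × ℝ}

lemma measurable (h : IsBM 𝒢 P W) (t : ℝ≥0) : Measurable (W t) :=
  (h.adapted t).mono (𝒢.le t) le_rfl

lemma measurable_incr (h : IsBM 𝒢 P W) (s u : ℝ≥0) :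
    Measurable (fun ω => W (s + u) ω - W s ω) := (h.measurable _).sub (h.measurable _)

lemma measurable_joint (h : IsBM 𝒢 P W) : Measurable fun q : ℝ≥0 × Ω => W q.1 q.2 :=
  measurable_uncurry_of_continuous_paths h.measurable h.continuous

variable [IsProbabilityMeasure P]

lemma map_incr (h : IsBM 𝒢 P W) (s u : ℝ≥0) :
    P.map (fun ω => W (s + u) ω - W s ω) = gauss u := by
  ext S hS
  rw [Measure.map_apply (h.measurable_incr s u) hS]
  have := h.incr s u Set.univ MeasurableSet.univ S hS
  rw [Set.univ_inter, measure_univ, one_mul] at this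
  exact this

lemma indep_incr (h : IsBM 𝒢 P W) (s u : ℝ≥0) :
    Indep (𝒢 s) (MeasurableSpace.comap (fun ω => W (s + u) ω - W s ω) inferInstance) P := by
  rw [Indep_iff]
  rintro D _ hD ⟨S, hS, rfl⟩
  have h1 := h.incr s u D hD S hS
  have h2 := h.incr s u Set.univ MeasurableSet.univ S hS
  rw [Set.univ_inter, measure_univ, one_mul] at h2
  rw [← h2] at h1
  exact h1

lemma lintegral_mul_incr (h : IsBM 𝒢 P W) (s u : ℝ≥0) {ζ : Ω → ℝ≥0∞} (hζ : Measurable[𝒢 s] ζ)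
    {F : ℝ × ℝ → ℝ≥0∞} (hF : Measurable F) :
    ∫⁻ ω, ζ ω * F (W (s + u) ω - W s ω) ∂P = (∫⁻ ω, ζ ω ∂P) * ∫⁻ x, F x ∂(gauss u) := by
  rw [lintegral_mul_eq_lintegral_mul_lintegral_of_independent_measurableSpace (𝒢.le s)
    (h.measurable_incr s u).comap_le (h.indep_incr s u) hζ
    (g := fun ω => F (W (s + u) ω - W s ω)) (hF.comp (comap_measurable _)), ← h.map_incr s u, lintegral_map hF (h.measurable_incr s u)]

end IsBM

lemma lintegral_exp_gauss (c : ℝ × ℝ) (u : ℝ≥0) :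
    ∫⁻ x, ENNReal.ofReal (Real.exp (c.1 * x.1 + c.2 * x.2)) ∂(gauss u)
      = ENNReal.ofReal (Real.exp ((c.1 ^ 2 + c.2 ^ 2) * u / 2)) := by
  have h1 : ∀ d : ℝ, ∫⁻ x, ENNReal.ofReal (Real.exp (d * x)) ∂(gaussianReal 0 u)
      = ENNReal.ofReal (Real.exp (u * d ^ 2 / 2)) := fun d => by
    rw [← integral_exp_gaussianReal, ofReal_integral_eq_lintegral_ofReal
      (integrable_exp_mul_gaussianReal _) (.of_forall fun x => (Real.exp_pos _).le)]
  simp_rw [Real.exp_add, ENNReal.ofReal_mul (Real.exp_pos _).le]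
  rw [gauss, lintegral_prod_mul (f := fun x => ENNReal.ofReal (Real.exp (c.1 * x)))
    (g := fun x => ENNReal.ofReal (Real.exp (c.2 * x))) (by fun_prop) (by fun_prop), h1, h1,
    ← ENNReal.ofReal_mul (Real.exp_pos _).le, ← Real.exp_add]
  congr 2
  ring

/-- The increments over `[0, s]` and `[s, s + u]` are independent of each other and of `ζ`, and each
contributes a Gaussian exponential moment. Two exponent vectors are needed because the habit
involves the path at two times. -/
lemma IsBM.lintegral_exp {𝒢 : Filtration ℝ≥0 mΩ} {P : Measure Ω} {W : ℝ≥0 → Ω → ℝ × ℝ}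
    [IsProbabilityMeasure P] (h : IsBM 𝒢 P W) (s u : ℝ≥0) {ζ : Ω → ℝ≥0∞}
    (hζ : Measurable[𝒢 0] ζ) (k : ℝ) (d c : ℝ × ℝ) {X : Ω → ℝ}
    (hX : ∀ ω, X ω = k + (d.1 * (W s ω).1 + d.2 * (W s ω).2)
      + (c.1 * ((W (s + u) ω).1 - (W s ω).1) + c.2 * ((W (s + u) ω).2 - (W s ω).2))) :
    ∫⁻ ω, ζ ω * ENNReal.ofReal (Real.exp (X ω)) ∂P = (∫⁻ ω, ζ ω ∂P) *
      ENNReal.ofReal (Real.exp (k + (d.1 ^ 2 + d.2 ^ 2) * s / 2 + (c.1 ^ 2 + c.2 ^ 2) * u / 2)) := by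
  have hF : ∀ e : ℝ × ℝ, Measurable fun x : ℝ × ℝ =>
      ENNReal.ofReal (Real.exp (e.1 * x.1 + e.2 * x.2)) := fun e => by fun_prop
  have h1 : ∀ ω, ζ ω * ENNReal.ofReal (Real.exp (X ω))
      = (ENNReal.ofReal (Real.exp k) * ζ ω *
        ENNReal.ofReal (Real.exp (d.1 * (W (0 + s) ω - W 0 ω).1 + d.2 * (W (0 + s) ω - W 0 ω).2))) *
        ENNReal.ofReal (Real.exp (c.1 * (W (s + u) ω - W s ω).1
          + c.2 * (W (s + u) ω - W s ω).2)) := fun ω => by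
    rw [hX, Real.exp_add, Real.exp_add, ENNReal.ofReal_mul (by positivity),
      ENNReal.ofReal_mul (by positivity), h.zero, sub_zero, zero_add]
    simp only [Prod.fst_sub, Prod.snd_sub]
    ring
  have hζ0 : Measurable[𝒢 0] fun ω => ENNReal.ofReal (Real.exp k) * ζ ω := hζ.const_mul _
  simp_rw [h1]
  rw [h.lintegral_mul_incr s u (ζ := fun ω => ENNReal.ofReal (Real.exp k) * ζ ω *
      ENNReal.ofReal (Real.exp (d.1 * (W (0 + s) ω - W 0 ω).1 + d.2 * (W (0 + s) ω - W 0 ω).2)))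
      ?_ (hF c), h.lintegral_mul_incr 0 s hζ0 (hF d), lintegral_exp_gauss, lintegral_exp_gauss,
    lintegral_const_mul _ (hζ.mono (𝒢.le 0) le_rfl), Real.exp_add, Real.exp_add,
    ENNReal.ofReal_mul (by positivity), ENNReal.ofReal_mul (by positivity)]
  · ring
  · refine (hζ0.mono (𝒢.mono zero_le) le_rfl).mul ?_
    simp only [h.zero, sub_zero, zero_add]
    exact (hF d).comp (h.adapted s)

section moments

variable {p : Params} {𝒢 : Filtration ℝ≥0 mΩ} {P : Measure Ω} {W : ℝ≥0 → Ω → ℝ × ℝ}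

/-- The geometric Brownian motion with drift `μ` driven by the first component. -/
def growth (p : Params) (μ : ℝ) (w : ℝ≥0 → ℝ × ℝ) (t : ℝ≥0) : ℝ :=
  Real.exp ((μ - p.β₁ ^ 2 / 2) * t + p.β₁ * (w t).1)

/-- The habit started from `1` that is fed at rate `r` by `growth`. -/
def relHab (p : Params) (μ r : ℝ) (w : ℝ≥0 → ℝ × ℝ) (t : ℝ≥0) : ℝ :=
  habFactor p w t * (1 + p.ρ * r * cumul (fun s => growth p μ w s / habFactor p w s) t)

lemma growth_pos (μ : ℝ) (w : ℝ≥0 → ℝ × ℝ) (t : ℝ≥0) : 0 < growth p μ w t := Real.exp_pos _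

lemma continuous_growth_div {w : ℝ≥0 → ℝ × ℝ} (hw : Continuous w) (μ : ℝ) :
    Continuous fun s => growth p μ w s / habFactor p w s := by
  refine Continuous.div ?_ (continuous_habFactor hw) fun s => (habFactor_pos p w s).ne'
  unfold growth; fun_prop

lemma relHab_pos {r : ℝ} (hρ : 0 ≤ p.ρ) (hr : 0 ≤ r) (μ : ℝ) (w : ℝ≥0 → ℝ × ℝ) (t : ℝ≥0) :
    0 < relHab p μ r w t := by
  have h : 0 ≤ cumul (fun s => growth p μ w s / habFactor p w s) t := cumul_nonneg t fun s _ =>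
    div_nonneg (growth_pos _ _ _).le (habFactor_pos p w s).le
  exact mul_pos (habFactor_pos p w t) (by positivity)

/-- Concavity of powers: a tangent bound. -/
lemma rpow_le_tangent {a H l : ℝ} (ha0 : 0 ≤ a) (ha1 : a ≤ 1) (hH : 0 < H) (hl : 0 < l) :
    H ^ a ≤ (1 - a) * l ^ a + a * l ^ (a - 1) * H := by
  have h := Real.geom_mean_le_arith_mean2_weighted (w₁ := 1 - a) (w₂ := a) (p₁ := l) (p₂ := H)
    (by linarith) ha0 hl.le hH.le (by ring)
  have h1 : H ^ a = l ^ (a - 1) * (l ^ (1 - a) * H ^ a) := by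
    rw [← mul_assoc, ← Real.rpow_add hl]; simp
  have h2 : l ^ a = l ^ (a - 1) * l := by
    rw [← Real.rpow_add_one hl.ne']; congr 1; ring
  rw [h1, h2]
  calc l ^ (a - 1) * (l ^ (1 - a) * H ^ a) ≤ l ^ (a - 1) * ((1 - a) * l + a * H) := by gcongr
    _ = _ := by ring

variable [IsProbabilityMeasure P]

/-- By its definition `relHab` is a term at time `t` plus an integral over earlier times `s` of
products of lognormals at `s` and `t`. The expectation of such a product grows at rate `p₁ + μ - b
β₁²` on `[0, s]` and `p₁ - ρ` on `[s, t]`; both are at most `p₁ + κ`, and integration over `s`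
yields the factor linear in `t`. -/
lemma lintegral_growth_mul_relHab (h : IsBM 𝒢 P W) (hρ : 0 ≤ p.ρ) {μ r b : ℝ} (hr : 0 ≤ r)
    {p₁ κ : ℝ}
    (hp₁ : p₁ = -b * μ + b * (1 + b) * p.β₁ ^ 2 / 2) (hκ : κ = max (μ - b * p.β₁ ^ 2) (-p.ρ))
    {ζ : Ω → ℝ≥0∞} (hζ : Measurable[𝒢 0] ζ) (t : ℝ≥0) :
    ∫⁻ ω, ζ ω * ENNReal.ofReal (growth p μ (W · ω) t ^ (-b) *
      relHab p μ r (W · ω) t) ∂P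
      ≤ ENNReal.ofReal ((1 + p.ρ * r * t) * Real.exp ((p₁ + κ) * t)) * ∫⁻ ω, ζ ω ∂P := by
  have hκ1 : μ - b * p.β₁ ^ 2 ≤ κ := hκ ▸ le_max_left _ _
  have hκ2 : -p.ρ ≤ κ := hκ ▸ le_max_right _ _
  set G : ℝ≥0 → Ω → ℝ := fun s ω => growth p μ (W · ω) t ^ (-b) *
    habFactor p (W · ω) t * (growth p μ (W · ω) s / habFactor p (W · ω) s)
    with hG
  have hGc : ∀ ω, Continuous fun s => G s ω := fun ω =>
    continuous_const.mul (continuous_growth_div (h.continuous ω) μ)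
  have hGpos : ∀ s ω, 0 ≤ G s ω := fun s ω => by
    have := growth_pos (p := p) μ (W · ω) t
    have := growth_pos (p := p) μ (W · ω) s
    have := habFactor_pos p (W · ω) t
    have := habFactor_pos p (W · ω) s
    positivity
  have hζ' : Measurable ζ := hζ.mono (𝒢.le 0) le_rfl
  have hGm : Measurable fun q : ℝ≥0 × Ω => G q.1 q.2 := by
    have h1 := h.measurable_joint
    have h2 := h.measurable t
    simp only [hG, growth, habFactor]
    fun_prop
  have e1 : ∀ ω, ENNReal.ofReal (growth p μ (W · ω) t ^ (-b) *
      relHab p μ r (W · ω) t) = ENNReal.ofReal (growth p μ (W · ω) t ^ (-b) *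
        habFactor p (W · ω) t)
        + ENNReal.ofReal (p.ρ * r) * ∫⁻ s in Set.Icc 0 t, ENNReal.ofReal (G s ω) ∂timeMeasure := by
    intro ω
    have h1 := growth_pos (p := p) μ (W · ω) t
    have h2 := habFactor_pos p (W · ω) t
    have hi : IntegrableOn (G · ω) (Set.Icc 0 t) timeMeasure := (hGc ω).locInt t
    rw [← ofReal_integral_eq_lintegral_ofReal hi (.of_forall fun s => hGpos s ω),
      ← ENNReal.ofReal_mul (by positivity), ← ENNReal.ofReal_add (by positivity)
      (mul_nonneg (by positivity) (integral_nonneg fun s => hGpos s ω))]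
    congr 1
    change _ = _ + p.ρ * r * cumul (G · ω) t
    simp only [hG]
    rw [cumul_const_mul, relHab]
    ring
  have hm1 : Measurable fun ω => ENNReal.ofReal (growth p μ (W · ω) t ^ (-b) *
        habFactor p (W · ω) t) := by
    have h2 := h.measurable t
    simp only [growth, habFactor]
    fun_prop
  have hm1' : Measurable fun ω => ζ ω * ENNReal.ofReal (growth p μ (W · ω) t ^ (-b) *
        habFactor p (W · ω) t) := hζ'.mul hm1
  have hm2 : Measurable fun ω => ∫⁻ s in Set.Icc 0 t, ENNReal.ofReal (G s ω) ∂timeMeasure :=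
    (hGm.ennreal_ofReal).lintegral_prod_left'
  have b1 : ∫⁻ ω, ζ ω * ENNReal.ofReal (growth p μ (W · ω) t ^ (-b) *
        habFactor p (W · ω) t) ∂P
      ≤ ENNReal.ofReal (Real.exp ((p₁ + κ) * t)) * ∫⁻ ω, ζ ω ∂P := by
    have h1 := h.lintegral_exp 0 t hζ ((-b * (μ - p.β₁ ^ 2 / 2) - (p.ρ + p.β₂ ^ 2 / 2)) * t) 0
      (-b * p.β₁, p.β₂) (X := fun ω => (-b * (μ - p.β₁ ^ 2 / 2) - (p.ρ + p.β₂ ^ 2 / 2)) * t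
        + (-b * p.β₁ * (W t ω).1 + p.β₂ * (W t ω).2)) (fun ω => by simp [h.zero])
    have h2 : ∀ ω, growth p μ (W · ω) t ^ (-b) * habFactor p (W · ω) t
        = Real.exp ((-b * (μ - p.β₁ ^ 2 / 2) - (p.ρ + p.β₂ ^ 2 / 2)) * t
        + (-b * p.β₁ * (W t ω).1 + p.β₂ * (W t ω).2)) := fun ω => by
      rw [growth, habFactor, ← Real.exp_mul, ← Real.exp_add]
      congr 1; ring
    simp_rw [h2]
    rw [h1, mul_comm]
    gcongr
    have h3 : (0 : ℝ) ≤ t := NNReal.coe_nonneg t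
    have h4 := mul_le_mul_of_nonneg_right hκ2 h3
    simp only [Prod.fst_zero, Prod.snd_zero, NNReal.coe_zero]
    rw [hp₁]
    nlinarith
  have b2 : ∀ s ∈ Set.Icc 0 t, ∫⁻ ω, ζ ω * ENNReal.ofReal (G s ω) ∂P
      ≤ ENNReal.ofReal (Real.exp ((p₁ + κ) * t)) * ∫⁻ ω, ζ ω ∂P := by
    intro s hs
    obtain ⟨u, rfl⟩ := exists_add_of_le hs.2
    have h1 := h.lintegral_exp s u hζ
      ((-b * (μ - p.β₁ ^ 2 / 2) - (p.ρ + p.β₂ ^ 2 / 2)) * (s + u)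
        + ((μ - p.β₁ ^ 2 / 2) + (p.ρ + p.β₂ ^ 2 / 2)) * s) ((1 - b) * p.β₁, 0)
      (-b * p.β₁, p.β₂) (X := fun ω =>
        (-b * (μ - p.β₁ ^ 2 / 2) - (p.ρ + p.β₂ ^ 2 / 2)) * (s + u)
        + (-b * p.β₁ * (W (s + u) ω).1 + p.β₂ * (W (s + u) ω).2)
        + (((μ - p.β₁ ^ 2 / 2) + (p.ρ + p.β₂ ^ 2 / 2)) * s
        + (p.β₁ * (W s ω).1 - p.β₂ * (W s ω).2))) (fun ω => by ring)
    have h2 : ∀ ω, G s ω = Real.exp ((-b * (μ - p.β₁ ^ 2 / 2) - (p.ρ + p.β₂ ^ 2 / 2)) * (s + u)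
        + (-b * p.β₁ * (W (s + u) ω).1 + p.β₂ * (W (s + u) ω).2)
        + (((μ - p.β₁ ^ 2 / 2) + (p.ρ + p.β₂ ^ 2 / 2)) * s
        + (p.β₁ * (W s ω).1 - p.β₂ * (W s ω).2))) := fun ω => by
      simp only [hG]
      rw [growth, growth, habFactor, habFactor, ← Real.exp_mul, ← Real.exp_add, ← Real.exp_sub,
        ← Real.exp_add]
      congr 1
      push_cast
      ring
    simp_rw [h2]
    rw [h1, mul_comm]
    gcongr
    have h3 := mul_le_mul_of_nonneg_right hκ2 (NNReal.coe_nonneg u)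
    have h4 := mul_le_mul_of_nonneg_right hκ1 (NNReal.coe_nonneg s)
    push_cast
    rw [hp₁]
    nlinarith
  have b3 : ∫⁻ ω, ζ ω * ∫⁻ s in Set.Icc 0 t, ENNReal.ofReal (G s ω) ∂timeMeasure ∂P
      ≤ ENNReal.ofReal t * (ENNReal.ofReal (Real.exp ((p₁ + κ) * t)) * ∫⁻ ω, ζ ω ∂P) := by
    have h1 : ∀ ω, ζ ω * ∫⁻ s in Set.Icc 0 t, ENNReal.ofReal (G s ω) ∂timeMeasure
        = ∫⁻ s in Set.Icc 0 t, ζ ω * ENNReal.ofReal (G s ω) ∂timeMeasure := fun ω =>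
      (lintegral_const_mul _ ((hGm.comp measurable_prodMk_right).ennreal_ofReal)).symm
    simp_rw [h1]
    rw [lintegral_lintegral_swap]
    · calc _ ≤ ∫⁻ s in Set.Icc 0 t, (ENNReal.ofReal (Real.exp ((p₁ + κ) * t)) * ∫⁻ ω, ζ ω ∂P)
            ∂timeMeasure := setLIntegral_mono' measurableSet_Icc b2
        _ = _ := by rw [setLIntegral_const, timeMeasure_Icc, mul_comm]; simp
    · exact ((hζ'.comp measurable_fst).mul
        ((hGm.comp measurable_swap).ennreal_ofReal)).aemeasurable
  have h3 : (0 : ℝ) ≤ t := NNReal.coe_nonneg t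
  calc _ = ∫⁻ ω, (ζ ω * ENNReal.ofReal (growth p μ (W · ω) t ^ (-b) *
        habFactor p (W · ω) t) + ENNReal.ofReal (p.ρ * r) *
        (ζ ω * ∫⁻ s in Set.Icc 0 t, ENNReal.ofReal (G s ω) ∂timeMeasure)) ∂P := by
        refine lintegral_congr fun ω => ?_
        rw [e1]; ring
    _ ≤ ENNReal.ofReal (Real.exp ((p₁ + κ) * t)) * ∫⁻ ω, ζ ω ∂P + ENNReal.ofReal (p.ρ * r) *
        (ENNReal.ofReal t * (ENNReal.ofReal (Real.exp ((p₁ + κ) * t)) * ∫⁻ ω, ζ ω ∂P)) := by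
        rw [lintegral_add_left hm1', lintegral_const_mul' _ _ ENNReal.ofReal_ne_top]
        gcongr
    _ = _ := by
        rw [ENNReal.ofReal_mul (p := 1 + p.ρ * r * t) (by positivity),
          ENNReal.ofReal_add (by norm_num) (by positivity),
          ENNReal.ofReal_one, ENNReal.ofReal_mul (p := p.ρ * r) (by positivity)]
        ring

lemma lintegral_growth_rpow (h : IsBM 𝒢 P W) (μ e : ℝ) {ζ : Ω → ℝ≥0∞} (hζ : Measurable[𝒢 0] ζ)
    (t : ℝ≥0) :
    ∫⁻ ω, ζ ω * ENNReal.ofReal (growth p μ (W · ω) t ^ e) ∂P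
      = (∫⁻ ω, ζ ω ∂P) *
        ENNReal.ofReal (Real.exp ((e * (μ - p.β₁ ^ 2 / 2) + e ^ 2 * p.β₁ ^ 2 / 2) * t)) := by
  have h1 := h.lintegral_exp 0 t hζ (e * (μ - p.β₁ ^ 2 / 2) * t) 0
    (e * p.β₁, 0) (X := fun ω => e * (μ - p.β₁ ^ 2 / 2) * t + e * p.β₁ * (W t ω).1)
    (fun ω => by simp [h.zero])
  have h2 : ∀ ω, growth p μ (W · ω) t ^ e
      = Real.exp (e * (μ - p.β₁ ^ 2 / 2) * t + e * p.β₁ * (W t ω).1) := fun ω => by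
    rw [growth, ← Real.exp_mul]
    congr 1; ring
  simp_rw [h2]
  rw [h1]
  congr 3
  simp only [Prod.fst_zero, Prod.snd_zero, NNReal.coe_zero]
  ring

/-- The power `a ≤ 1` is replaced by its tangent at the level `l = exp (κ t)`. With this level, both
terms of the tangent bound grow at the rate `p₁ + a κ`. -/
lemma lintegral_growth_mul_relHab_rpow (h : IsBM 𝒢 P W) (hρ : 0 ≤ p.ρ) {μ r b a : ℝ}
    (hr : 0 ≤ r) (ha0 : 0 ≤ a) (ha1 : a ≤ 1) {p₁ κ : ℝ}
    (hp₁ : p₁ = -b * μ + b * (1 + b) * p.β₁ ^ 2 / 2) (hκ : κ = max (μ - b * p.β₁ ^ 2) (-p.ρ))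
    {ζ : Ω → ℝ≥0∞} (hζ : Measurable[𝒢 0] ζ) (t : ℝ≥0) :
    ∫⁻ ω, ζ ω * ENNReal.ofReal (growth p μ (W · ω) t ^ (-b) *
      relHab p μ r (W · ω) t ^ a) ∂P
      ≤ ENNReal.ofReal ((1 + p.ρ * r * t) * Real.exp ((p₁ + a * κ) * t)) * ∫⁻ ω, ζ ω ∂P := by
  have ht : (0 : ℝ) ≤ t := NNReal.coe_nonneg t
  set l : ℝ := Real.exp (κ * t) with hl
  have hl0 : 0 < l := Real.exp_pos _
  have hζ' : Measurable ζ := hζ.mono (𝒢.le 0) le_rfl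
  have hm1 : Measurable fun ω => ENNReal.ofReal (growth p μ (W · ω) t ^ (-b)) := by
    have h2 := h.measurable t
    simp only [growth]
    fun_prop
  have hm1' : Measurable fun ω =>
      ζ ω * ENNReal.ofReal (growth p μ (W · ω) t ^ (-b)) := hζ'.mul hm1
  have hpt : ∀ ω, ENNReal.ofReal (growth p μ (W · ω) t ^ (-b) *
      relHab p μ r (W · ω) t ^ a) ≤
      ENNReal.ofReal ((1 - a) * l ^ a) * ENNReal.ofReal (growth p μ (W · ω) t ^ (-b)) +
      ENNReal.ofReal (a * l ^ (a - 1)) * ENNReal.ofReal (growth p μ (W · ω) t ^ (-b) *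
        relHab p μ r (W · ω) t) := fun ω => by
    have h1 := growth_pos (p := p) μ (W · ω) t
    have h2 := relHab_pos (p := p) hρ hr μ (W · ω) t
    have h3 : 0 ≤ 1 - a := by linarith
    rw [← ENNReal.ofReal_mul (by positivity), ← ENNReal.ofReal_mul (by positivity),
      ← ENNReal.ofReal_add (by positivity) (by positivity)]
    refine ENNReal.ofReal_le_ofReal ?_
    calc _ ≤ growth p μ (W · ω) t ^ (-b) *
        ((1 - a) * l ^ a + a * l ^ (a - 1) * relHab p μ r (W · ω) t) := by
          gcongr; exact rpow_le_tangent ha0 ha1 h2 hl0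
      _ = _ := by ring
  have h3 : 0 ≤ 1 - a := by linarith
  calc _ ≤ ∫⁻ ω, (ENNReal.ofReal ((1 - a) * l ^ a) *
        (ζ ω * ENNReal.ofReal (growth p μ (W · ω) t ^ (-b))) +
        ENNReal.ofReal (a * l ^ (a - 1)) * (ζ ω * ENNReal.ofReal
          (growth p μ (W · ω) t ^ (-b) * relHab p μ r (W · ω) t))) ∂P := by
        refine lintegral_mono fun ω => (mul_le_mul_right (hpt ω) _).trans (le_of_eq ?_)
        ring
    _ ≤ ENNReal.ofReal ((1 - a) * l ^ a) * (ENNReal.ofReal (Real.exp (p₁ * t)) * ∫⁻ ω, ζ ω ∂P) +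
        ENNReal.ofReal (a * l ^ (a - 1)) *
          (ENNReal.ofReal ((1 + p.ρ * r * t) * Real.exp ((p₁ + κ) * t)) * ∫⁻ ω, ζ ω ∂P) := by
        rw [lintegral_add_left (hm1'.const_mul _), lintegral_const_mul _ hm1',
          lintegral_const_mul' _ _ ENNReal.ofReal_ne_top, lintegral_growth_rpow h μ (-b) hζ t,
          mul_comm (∫⁻ ω, ζ ω ∂P)]
        gcongr
        · rw [hp₁]; nlinarith
        · exact lintegral_growth_mul_relHab h hρ hr hp₁ hκ hζ t
    _ = ENNReal.ofReal ((1 - a) * l ^ a * Real.exp (p₁ * t)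
          + a * l ^ (a - 1) * ((1 + p.ρ * r * t) * Real.exp ((p₁ + κ) * t))) * ∫⁻ ω, ζ ω ∂P := by
        rw [ENNReal.ofReal_add (by positivity) (by positivity),
          ENNReal.ofReal_mul (p := (1 - a) * l ^ a) (by positivity),
          ENNReal.ofReal_mul (p := a * l ^ (a - 1)) (by positivity)]
        ring
    _ ≤ _ := by
        gcongr
        have e1 : l ^ a * Real.exp (p₁ * t) = Real.exp ((p₁ + a * κ) * t) := by
          rw [hl, ← Real.exp_mul, ← Real.exp_add]; congr 1; ring
        have e2 : l ^ (a - 1) * Real.exp ((p₁ + κ) * t) = Real.exp ((p₁ + a * κ) * t) := by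
          rw [hl, ← Real.exp_mul, ← Real.exp_add]; congr 1; ring
        have e3 : (1 - a) * l ^ a * Real.exp (p₁ * t)
            + a * l ^ (a - 1) * ((1 + p.ρ * r * t) * Real.exp ((p₁ + κ) * t))
            = (1 - a) * (l ^ a * Real.exp (p₁ * t))
              + a * (1 + p.ρ * r * t) * (l ^ (a - 1) * Real.exp ((p₁ + κ) * t)) := by ring
        rw [e3, e1, e2, ← add_mul]
        refine mul_le_mul_of_nonneg_right ?_ (Real.exp_pos _).le
        nlinarith [mul_nonneg (mul_nonneg hρ hr) ht]

end moments

/-! ### Moment bounds for the state -/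

/-- The exponent `σ - 1` of the capital in the losses. -/
def Params.b (p : Params) : ℝ := p.σ - 1

/-- The exponent `γ (σ - 1)` of the habit in the losses. -/
def Params.a (p : Params) : ℝ := p.γ * (p.σ - 1)

/-- The weight that dominates the losses. -/
def psi (p : Params) (z : ℝ × ℝ) : ℝ≥0∞ := ENNReal.ofReal (z.1 ^ (-p.b) * (z.1 ^ p.a + z.2 ^ p.a))

lemma measurable_psi (p : Params) : Measurable (psi p) := by unfold psi; fun_prop

lemma Params.Standing.b_pos {p : Params} (hp : p.Standing) : 0 < p.b := by
  have := hp.one_lt_σ; unfold Params.b; linarith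

lemma Params.Standing.a_nonneg {p : Params} (hp : p.Standing) : 0 ≤ p.a :=
  mul_nonneg hp.γ_nonneg hp.b_pos.le

lemma lossRate_eq {p : Params} {c h : ℝ} (hc : 0 < c) (hh : 0 < h) :
    lossRate p c h = ENNReal.ofReal (1 / p.b * (c ^ (-p.b) * h ^ p.a)) := by
  have h1 : 1 - p.σ = -p.b := by unfold Params.b; ring
  rw [lossRate, h1, Real.div_rpow hc.le (Real.rpow_nonneg hh.le _), ← Real.rpow_mul hh.le]
  have h2 : p.γ * -p.b = -p.a := by unfold Params.b Params.a; ring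
  rw [h2, Real.rpow_neg hh.le, div_inv_eq_mul]
  rfl

section pathwise

variable {p : Params} {z : ℝ × ℝ} {α : ℝ≥0 → ℝ} {w : ℝ≥0 → ℝ × ℝ}

lemma exp_logCap_const (r : ℝ) (t : ℝ≥0) :
    Real.exp (logCap p (fun _ => r) w t) = growth p (p.B - r) w t := by
  rw [logCap, growth, cumul_const]
  congr 1; ring

lemma exp_logCap_le (h0 : ∀ t, 0 ≤ α t) (t : ℝ≥0) :
    Real.exp (logCap p α w t) ≤ growth p p.B w t := by
  have := cumul_nonneg t fun s _ => h0 s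
  rw [logCap, growth, Real.exp_le_exp]
  linarith

lemma le_exp_logCap {r : ℝ} (hα : LocInt α) (h0 : ∀ t, α t ≤ r) (t : ℝ≥0) :
    growth p p.B w t * Real.exp (-(r * t)) ≤ Real.exp (logCap p α w t) := by
  have h1 : cumul α t ≤ cumul (fun _ => r) t :=
    cumul_mono hα continuous_const.locInt t fun s _ => h0 s
  rw [cumul_const] at h1
  rw [logCap, growth, ← Real.exp_add, Real.exp_le_exp]
  linarith

lemma relInflow_le {μ r : ℝ} (hα : LocInt α) (hw : Continuous w) (h0 : ∀ t, 0 ≤ α t)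
    (hr : ∀ t, α t ≤ r) (hμ : ∀ t, Real.exp (logCap p α w t) ≤ growth p μ w t) (t : ℝ≥0) :
    inflow p α w t ≤ r * cumul (fun s => growth p μ w s / habFactor p w s) t := by
  rw [← cumul_const_mul]
  refine cumul_mono (locInt_inflow hα hw) (((continuous_growth_div hw μ).locInt).const_mul r) t
    fun s _ => ?_
  rw [mul_comm]
  have := habFactor_pos p w s
  have := growth_pos (p := p) μ w s
  refine mul_le_mul (hr s) ?_ (by positivity) ((h0 s).trans (hr s))
  gcongr
  exact hμ s

lemma relHabit_le {μ r : ℝ} (hρ : 0 ≤ p.ρ) (hα : LocInt α) (hw : Continuous w) (h0 : ∀ t, 0 ≤ α t)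
    (hr : ∀ t, α t ≤ r) (hμ : ∀ t, Real.exp (logCap p α w t) ≤ growth p μ w t)
    (hz1 : 0 ≤ z.1) (hz2 : 0 ≤ z.2) (t : ℝ≥0) :
    z.2 + p.ρ * z.1 * inflow p α w t ≤
      (z.1 + z.2) * (1 + p.ρ * r * cumul (fun s => growth p μ w s / habFactor p w s) t) := by
  have h1 := relInflow_le hα hw h0 hr hμ t
  have h2 := inflow_nonneg (p := p) (w := w) h0 t
  set q := cumul (fun s => growth p μ w s / habFactor p w s) t
  calc z.2 + p.ρ * z.1 * inflow p α w t ≤ z.2 + p.ρ * z.1 * (r * q) := by gcongr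
    _ ≤ _ := by
      have := mul_nonneg hρ (h2.trans h1)
      nlinarith [mul_nonneg hz2 this]

lemma habPath_le {μ r : ℝ} (hρ : 0 ≤ p.ρ) (hα : LocInt α) (hw : Continuous w) (h0 : ∀ t, 0 ≤ α t)
    (hr : ∀ t, α t ≤ r) (hμ : ∀ t, Real.exp (logCap p α w t) ≤ growth p μ w t)
    (hz1 : 0 ≤ z.1) (hz2 : 0 ≤ z.2) (t : ℝ≥0) :
    habPath p z α w t ≤ (z.1 + z.2) * relHab p μ r w t := by
  have h1 := mul_le_mul_of_nonneg_left (relHabit_le hρ hα hw h0 hr hμ hz1 hz2 t)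
    (habFactor_pos p w t).le
  refine h1.trans (le_of_eq ?_)
  rw [relHab]; ring

/-- The weight of a state with capital `z.1 g` and habit `(z.1 + z.2) H`. -/
def envelope (p : Params) (z : ℝ × ℝ) (g H : ℝ) : ℝ≥0∞ :=
  ENNReal.ofReal (z.1 ^ (p.a - p.b)) * ENNReal.ofReal (g ^ (p.a - p.b)) +
    ENNReal.ofReal (z.1 ^ (-p.b) * (z.1 + z.2) ^ p.a) * ENNReal.ofReal (g ^ (-p.b) * H ^ p.a)

/-- The capital enters `psi` with negative and positive powers, so it is needed from below and from
above. The gap `e` is `exp (-R t)` for general controls and `1` for constant ones. -/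
lemma psi_le_envelope (hp : p.Standing) {g H e : ℝ} (hz1 : 0 < z.1) (hz2 : 0 < z.2) (hg : 0 < g)
    (hH : 0 < H) (he : 0 < e) {x y : ℝ} (hx : z.1 * (g * e) ≤ x) (hx' : x ≤ z.1 * g)
    (hy : 0 < y) (hy' : y ≤ (z.1 + z.2) * H) :
    psi p (x, y) ≤ ENNReal.ofReal (e ^ (-p.b)) * envelope p z g H := by
  have hb := hp.b_pos
  have ha := hp.a_nonneg
  have hx0 : 0 < x := lt_of_lt_of_le (by positivity) hx
  rw [envelope, ← ENNReal.ofReal_mul (by positivity), ← ENNReal.ofReal_mul (by positivity),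
    ← ENNReal.ofReal_add (by positivity) (by positivity), ← ENNReal.ofReal_mul (by positivity)]
  refine ENNReal.ofReal_le_ofReal ?_
  have h1 : x ^ (-p.b) ≤ (z.1 * (g * e)) ^ (-p.b) :=
    Real.rpow_le_rpow_of_nonpos (by positivity) hx (by linarith)
  have h2 : x ^ p.a ≤ (z.1 * g) ^ p.a := Real.rpow_le_rpow hx0.le hx' ha
  have h3 : y ^ p.a ≤ ((z.1 + z.2) * H) ^ p.a := Real.rpow_le_rpow hy.le hy' ha
  calc x ^ (-p.b) * (x ^ p.a + y ^ p.a)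
      ≤ (z.1 * (g * e)) ^ (-p.b) * ((z.1 * g) ^ p.a + ((z.1 + z.2) * H) ^ p.a) := by gcongr
    _ = _ := by
      rw [Real.mul_rpow hz1.le (by positivity), Real.mul_rpow hg.le he.le,
        Real.mul_rpow hz1.le hg.le, Real.mul_rpow (by positivity) hH.le,
        sub_eq_neg_add p.a, Real.rpow_add hz1, Real.rpow_add hg]
      ring

lemma psi_statePath_le (hp : p.Standing) (hα : LocInt α) (hw : Continuous w) (h0 : ∀ t, 0 ≤ α t)
    (hR : ∀ t, α t ≤ p.R) (hz1 : 0 < z.1) (hz2 : 0 < z.2) (t : ℝ≥0) :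
    psi p (statePath p z α w t) ≤ ENNReal.ofReal (Real.exp (-(p.R * t)) ^ (-p.b)) *
      envelope p z (growth p p.B w t) (relHab p p.B p.R w t) := by
  refine psi_le_envelope hp hz1 hz2 (growth_pos _ _ _)
    (relHab_pos hp.ρ_pos.le hp.R_pos.le _ _ _) (Real.exp_pos _)
    (mul_le_mul_of_nonneg_left (le_exp_logCap hα hR t) hz1.le)
    (mul_le_mul_of_nonneg_left (exp_logCap_le h0 t) hz1.le)
    (habPath_pos hp.ρ_pos.le hz1.le hz2 h0 t)
    (habPath_le hp.ρ_pos.le hα hw h0 hR (exp_logCap_le h0) hz1.le hz2.le t)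

lemma psi_statePath_const_le (hp : p.Standing) (hw : Continuous w) {r : ℝ} (h0 : 0 ≤ r)
    (hz1 : 0 < z.1) (hz2 : 0 < z.2) (t : ℝ≥0) :
    psi p (statePath p z (fun _ => r) w t) ≤
      envelope p z (growth p (p.B - r) w t) (relHab p (p.B - r) r w t) := by
  have h1 := psi_le_envelope hp hz1 hz2 (growth_pos (p := p) (p.B - r) w t)
    (relHab_pos hp.ρ_pos.le h0 (p.B - r) w t) one_pos
    (x := capPath p z (fun _ => r) w t) (y := habPath p z (fun _ => r) w t)
    (by rw [mul_one, capPath, exp_logCap_const])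
    (by rw [capPath, exp_logCap_const])
    (habPath_pos hp.ρ_pos.le hz1.le hz2 (fun _ => h0) t)
    (habPath_le hp.ρ_pos.le continuous_const.locInt hw (fun _ => h0) (fun _ => le_rfl)
      (fun s => (exp_logCap_const r s).le) hz1.le hz2.le t)
  simp only [Real.one_rpow, ENNReal.ofReal_one, one_mul] at h1
  exact h1

/-- The loss blows up as consumption vanishes, so `psi` bounds it only through a floor `e` of the
ratio. -/
lemma flowLoss_le_psi (hp : p.Standing) {e : ℝ} (he : 0 < e) (t : ℝ≥0) (het : e ≤ α t)
    (h0 : ∀ t, 0 ≤ α t) (hz1 : 0 < z.1) (hz2 : 0 < z.2) :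
    flowLoss p z α w t ≤
      ENNReal.ofReal (e ^ (-p.b) / p.b) * (disc p t * psi p (statePath p z α w t)) := by
  have hb := hp.b_pos
  have hc := capPath_pos (p := p) (α := α) (w := w) hz1 t
  have hh := habPath_pos (w := w) hp.ρ_pos.le hz1.le hz2 h0 t
  have hα : 0 < α t := he.trans_le het
  rw [flowLoss, lossRate_eq (mul_pos hα hc) hh,
    mul_left_comm (ENNReal.ofReal (e ^ (-p.b) / p.b))]
  refine mul_le_mul_right ?_ _
  have e1 : psi p (statePath p z α w t) = ENNReal.ofReal (capPath p z α w t ^ (-p.b) *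
      (capPath p z α w t ^ p.a + habPath p z α w t ^ p.a)) := rfl
  rw [e1, ← ENNReal.ofReal_mul (by positivity)]
  refine ENNReal.ofReal_le_ofReal ?_
  rw [Real.mul_rpow hα.le hc.le]
  have h1 : α t ^ (-p.b) ≤ e ^ (-p.b) := Real.rpow_le_rpow_of_nonpos he het (by linarith)
  have h2 : 0 ≤ capPath p z α w t ^ p.a := by positivity
  calc 1 / p.b * (α t ^ (-p.b) * capPath p z α w t ^ (-p.b) * habPath p z α w t ^ p.a)
      ≤ 1 / p.b * (e ^ (-p.b) * capPath p z α w t ^ (-p.b) *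
        (capPath p z α w t ^ p.a + habPath p z α w t ^ p.a)) := by
        gcongr; linarith
    _ = _ := by ring

end pathwise

section moments

variable {p : Params} {𝒢 : Filtration ℝ≥0 mΩ} {P : Measure Ω} {W : ℝ≥0 → Ω → ℝ × ℝ}
  [IsProbabilityMeasure P]

/-- The exponential growth rate of the expected losses. -/
def lossGrowth (p : Params) (μ : ℝ) : ℝ :=
  -p.b * μ + p.b * (1 + p.b) * p.β₁ ^ 2 / 2 + p.a * max (μ - p.b * p.β₁ ^ 2) (-p.ρ)

omit [IsProbabilityMeasure P] in
lemma measurable_growth (h : IsBM 𝒢 P W) (μ : ℝ) (t : ℝ≥0) :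
    Measurable fun ω => growth p μ (W · ω) t := by
  have := h.measurable t
  unfold growth; fun_prop

/-- One summand of the envelope is a lognormal moment of exponent `a - b`, with rate at most
`lossGrowth` because `a (1 - a) ≥ 0`; the other is covered by `lintegral_growth_mul_relHab_rpow`.
Subadditivity of the power `a ≤ 1` brings back the weight of the initial state. -/
lemma lintegral_envelope_le (h : IsBM 𝒢 P W) (hp : p.Standing) (ha1 : p.a ≤ 1) {μ r : ℝ}
    (hr : 0 ≤ r) {ζ : Ω → ℝ≥0∞} (hζ : Measurable[𝒢 0] ζ) {Z : Ω → ℝ × ℝ} (hZ : Measurable[𝒢 0] Z)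
    (hZ1 : ∀ ω, 0 < (Z ω).1) (hZ2 : ∀ ω, 0 < (Z ω).2) (t : ℝ≥0) :
    ∫⁻ ω, ζ ω * envelope p (Z ω) (growth p μ (W · ω) t)
      (relHab p μ r (W · ω) t) ∂P ≤
      ENNReal.ofReal ((2 + p.ρ * r * t) * Real.exp (lossGrowth p μ * t)) *
        ∫⁻ ω, ζ ω * psi p (Z ω) ∂P := by
  have hb := hp.b_pos
  have ha := hp.a_nonneg
  have hρ := hp.ρ_pos.le
  have ht := NNReal.coe_nonneg t
  have hm1 : Measurable[𝒢 0] fun ω => (Z ω).1 := measurable_fst.comp hZ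
  have hm2 : Measurable[𝒢 0] fun ω => (Z ω).2 := measurable_snd.comp hZ
  have hζ1 : Measurable[𝒢 0] fun ω => ζ ω * ENNReal.ofReal ((Z ω).1 ^ (p.a - p.b)) :=
    hζ.mul (hm1.pow_const _).ennreal_ofReal
  have hζ2 : Measurable[𝒢 0] fun ω =>
      ζ ω * ENNReal.ofReal ((Z ω).1 ^ (-p.b) * ((Z ω).1 + (Z ω).2) ^ p.a) :=
    hζ.mul ((hm1.pow_const _).mul ((hm1.add hm2).pow_const _)).ennreal_ofReal
  have hfm : Measurable fun ω => ζ ω * ENNReal.ofReal ((Z ω).1 ^ (p.a - p.b)) *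
      ENNReal.ofReal (growth p μ (W · ω) t ^ (p.a - p.b)) :=
    (hζ1.mono (𝒢.le 0) le_rfl).mul ((measurable_growth h μ t).pow_const _).ennreal_ofReal
  have hψ1 : ∫⁻ ω, ζ ω * ENNReal.ofReal ((Z ω).1 ^ (p.a - p.b)) ∂P
      ≤ ∫⁻ ω, ζ ω * psi p (Z ω) ∂P := by
    refine lintegral_mono fun ω => ?_
    have h1 := hZ1 ω
    have h2 := hZ2 ω
    refine mul_le_mul_right (ENNReal.ofReal_le_ofReal ?_) _
    rw [sub_eq_neg_add, Real.rpow_add h1]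
    have : 0 ≤ (Z ω).2 ^ p.a := by positivity
    gcongr
    linarith
  have hψ2 : ∫⁻ ω, ζ ω * ENNReal.ofReal ((Z ω).1 ^ (-p.b) * ((Z ω).1 + (Z ω).2) ^ p.a) ∂P
      ≤ ∫⁻ ω, ζ ω * psi p (Z ω) ∂P := by
    refine lintegral_mono fun ω => ?_
    have h1 := hZ1 ω
    have h2 := hZ2 ω
    refine mul_le_mul_right (ENNReal.ofReal_le_ofReal ?_) _
    gcongr
    exact Real.rpow_add_le_add_rpow h1.le h2.le ha ha1
  have hκ1 := le_max_left (μ - p.b * p.β₁ ^ 2) (-p.ρ)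
  have hlg : (p.a - p.b) * (μ - p.β₁ ^ 2 / 2) + (p.a - p.b) ^ 2 * p.β₁ ^ 2 / 2
      ≤ lossGrowth p μ := by
    unfold lossGrowth
    have h1 := mul_le_mul_of_nonneg_left hκ1 ha
    have h2 : 0 ≤ p.a * (1 - p.a) * p.β₁ ^ 2 :=
      mul_nonneg (mul_nonneg ha (by linarith)) (sq_nonneg _)
    nlinarith
  calc _ = ∫⁻ ω, (ζ ω * ENNReal.ofReal ((Z ω).1 ^ (p.a - p.b)) *
        ENNReal.ofReal (growth p μ (W · ω) t ^ (p.a - p.b)) +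
        ζ ω * ENNReal.ofReal ((Z ω).1 ^ (-p.b) * ((Z ω).1 + (Z ω).2) ^ p.a) *
        ENNReal.ofReal (growth p μ (W · ω) t ^ (-p.b) *
          relHab p μ r (W · ω) t ^ p.a)) ∂P := by
        refine lintegral_congr fun ω => ?_
        rw [envelope]; ring
    _ ≤ ENNReal.ofReal (Real.exp (lossGrowth p μ * t)) * ∫⁻ ω, ζ ω * psi p (Z ω) ∂P +
        ENNReal.ofReal ((1 + p.ρ * r * t) * Real.exp (lossGrowth p μ * t)) *
          ∫⁻ ω, ζ ω * psi p (Z ω) ∂P := by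
        rw [lintegral_add_left hfm, lintegral_growth_rpow h μ _ hζ1, mul_comm]
        refine add_le_add ?_ ((lintegral_growth_mul_relHab_rpow h hρ hr ha ha1 rfl rfl hζ2 t).trans ?_)
        · gcongr
        · exact mul_le_mul_right hψ2 _
    _ = _ := by
        rw [← add_mul, ← ENNReal.ofReal_add (by positivity) (by positivity)]
        congr 2; ring

lemma lintegral_psi_statePath_le (h : IsBM 𝒢 P W) (hp : p.Standing) (ha1 : p.a ≤ 1)
    {ζ : Ω → ℝ≥0∞} (hζ : Measurable[𝒢 0] ζ) {Z : Ω → ℝ × ℝ} (hZ : Measurable[𝒢 0] Z)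
    (hZ1 : ∀ ω, 0 < (Z ω).1) (hZ2 : ∀ ω, 0 < (Z ω).2) (t : ℝ≥0) :
    ∫⁻ ω, ζ ω * (ENNReal.ofReal (Real.exp (-(p.R * t)) ^ (-p.b)) * envelope p (Z ω)
      (growth p p.B (W · ω) t) (relHab p p.B p.R (W · ω) t)) ∂P ≤
      ENNReal.ofReal ((2 + p.ρ * p.R * t) * Real.exp ((p.b * p.R + lossGrowth p p.B) * t)) *
        ∫⁻ ω, ζ ω * psi p (Z ω) ∂P := by
  have ht := NNReal.coe_nonneg t
  have hρ := hp.ρ_pos.le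
  have hR := hp.R_pos.le
  simp_rw [mul_left_comm (ζ _)]
  rw [lintegral_const_mul' _ _ ENNReal.ofReal_ne_top]
  refine (mul_le_mul_right (lintegral_envelope_le h hp ha1 hR hζ hZ hZ1 hZ2 t) _).trans
    (le_of_eq ?_)
  have e1 : Real.exp ((p.b * p.R + lossGrowth p p.B) * t)
      = Real.exp (-(p.R * t) * -p.b) * Real.exp (lossGrowth p p.B * t) := by
    rw [← Real.exp_add]; congr 1; ring
  rw [← mul_assoc, ← ENNReal.ofReal_mul (by positivity), ← Real.exp_mul, e1]
  congr 2
  ring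

/-! ### The discount rate and constant controls -/

/-- A small ratio `r` for which the expected discounted losses decay at rate at least `q`. -/
structure BaseRate (p : Params) (r q : ℝ) : Prop where
  pos : 0 < r
  le : r ≤ p.R
  rate_pos : 0 < q
  decay : lossGrowth p (p.B - r) + q ≤ p.θ

/-- The growth `B` of the capital only helps, because `a ≤ b`; so it suffices that `θ` exceeds
`lossGrowth p 0`, which is the inequality `key`. In both cases of the standing assumption this
follows from the size of the maximum `M`. -/
lemma exists_baseRate (hp : p.Standing) : ∃ r q, BaseRate p r q := by
  have hb := hp.b_pos
  have ha := hp.a_nonneg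
  have hρ := hp.ρ_pos
  have hB := hp.B_nonneg
  have hab : p.a = p.γ * p.b := rfl
  have hab' : p.a ≤ p.b := by rw [hab]; nlinarith [hp.γ_lt_one]
  have key : p.b * (1 + p.b) * p.β₁ ^ 2 / 2 + p.a * max (-(p.b * p.β₁ ^ 2)) (-p.ρ) < p.θ := by
    set M : ℝ := max 2 (1 / (p.γ * (p.σ - 1))) with hM
    have hM2 : 2 ≤ M := le_max_left _ _
    -- The lower bound `1 / a` in `M` is what absorbs terms linear in `a` into quadratic ones. For
    -- `a = 0` both sides vanish and the convention for `1 / 0` does not matter.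
    have hMa : p.a ≤ M * p.a ^ 2 := by
      rcases ha.eq_or_lt with h0 | h0
      · rw [← h0]; simp
      · have h1 : 1 / p.a ≤ M := le_max_right _ _
        rw [div_le_iff₀ h0] at h1
        nlinarith
    have hMb : p.a ≤ M * p.b ^ 2 := by
      refine hMa.trans ?_
      gcongr
    have hs1 := sq_nonneg p.β₁
    have hs2 := sq_nonneg p.β₂
    have hσ : p.σ - 1 = p.b := rfl
    have hc1 := hp.discount_of_nonpos
    have hc2 := hp.discount_of_pos
    rw [← hM, hσ] at hc1 hc2
    have t1 := mul_le_mul_of_nonneg_right hMa hs2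
    have t2 := mul_le_mul_of_nonneg_right hMb hs1
    have t3 := mul_le_mul_of_nonneg_right hM2 (mul_nonneg (sq_nonneg p.b) hs1)
    have t4 : 0 ≤ p.a * (p.b * p.β₁ ^ 2) := by positivity
    have t5 : 0 ≤ p.a * p.ρ := by positivity
    have t6 : 0 ≤ p.a * p.β₂ ^ 2 := by positivity
    have t7 : 0 ≤ p.a * p.β₁ ^ 2 := by positivity
    rcases le_or_gt (p.ρ + (p.β₂ ^ 2 - p.β₁ ^ 2) / 2) 0 with hc | hc
    · have h1 := hc1 hc
      have e1 : p.b * (-(p.γ * p.ρ) - (p.γ * p.β₂ ^ 2 - p.β₁ ^ 2) / 2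
          + M * p.b * (p.β₁ ^ 2 + p.γ ^ 2 * p.β₂ ^ 2))
          = -(p.a * p.ρ) - p.a * p.β₂ ^ 2 / 2 + p.b * p.β₁ ^ 2 / 2 + M * p.b ^ 2 * p.β₁ ^ 2
            + M * p.a ^ 2 * p.β₂ ^ 2 := by rw [hab]; ring
      rw [e1] at h1
      have t8 := mul_nonneg ha (neg_nonneg.2 hc)
      rcases max_cases (-(p.b * p.β₁ ^ 2)) (-p.ρ) with ⟨h2, h3⟩ | ⟨h2, h3⟩ <;> rw [h2] <;> nlinarith
    · have h1 := hc2 hc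
      have e1 : p.b * (p.β₁ ^ 2 * (1 - p.γ) / 2 + M * p.b * (p.β₁ ^ 2 + p.γ ^ 2 * p.β₂ ^ 2))
          = p.b * p.β₁ ^ 2 / 2 - p.a * p.β₁ ^ 2 / 2 + M * p.b ^ 2 * p.β₁ ^ 2
            + M * p.a ^ 2 * p.β₂ ^ 2 := by rw [hab]; ring
      rw [e1] at h1
      have t9 : max (-(p.b * p.β₁ ^ 2)) (-p.ρ) ≤ 0 :=
        max_le (neg_nonpos.2 (by positivity)) (by linarith)
      have t8 := mul_nonneg ha (neg_nonneg.2 t9)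
      nlinarith
  set q := p.θ - (p.b * (1 + p.b) * p.β₁ ^ 2 / 2 + p.a * max (-(p.b * p.β₁ ^ 2)) (-p.ρ)) with hq
  have hq0 : 0 < q := by rw [hq]; linarith
  -- Consuming at the ratio `r` raises the growth rate by at most `b r`. This choice spends at most
  -- half of the margin `q` and leaves the other half as the decay rate.
  refine ⟨min p.R (q / (2 * p.b)), q / 2, lt_min hp.R_pos (by positivity), min_le_left _ _,
    by linarith, ?_⟩
  set r := min p.R (q / (2 * p.b)) with hr
  have hr0 : 0 < r := lt_min hp.R_pos (by positivity)
  have hr1 : p.b * r ≤ q / 2 := by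
    have : r ≤ q / (2 * p.b) := min_le_right _ _
    rw [le_div_iff₀ (by positivity)] at this
    linarith
  unfold lossGrowth
  have h1 : max (p.B - r - p.b * p.β₁ ^ 2) (-p.ρ) ≤ p.B + max (-(p.b * p.β₁ ^ 2)) (-p.ρ) := by
    refine max_le ?_ ?_
    · have := le_max_left (-(p.b * p.β₁ ^ 2)) (-p.ρ); linarith
    · have := le_max_right (-(p.b * p.β₁ ^ 2)) (-p.ρ); linarith
  have h2 := mul_le_mul_of_nonneg_left h1 ha
  have h3 := mul_le_mul_of_nonneg_right hab' hB
  nlinarith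

variable {r q : ℝ}

lemma lintegral_exp_timeMeasure (hq : 0 < q) :
    ∫⁻ t : ℝ≥0, ENNReal.ofReal (Real.exp (-(q * t))) ∂timeMeasure = ENNReal.ofReal (1 / q) := by
  have h1 := measurableEmbedding_coe_nnreal.lintegral_map (μ := timeMeasure)
    (fun x : ℝ => ENNReal.ofReal (Real.exp (-(q * x))))
  rw [← h1, map_coe_timeMeasure, setLIntegral_congr Ioi_ae_eq_Ici.symm,
    ← ofReal_integral_eq_lintegral_ofReal]
  · congr 1
    have := integral_exp_neg_mul_rpow (p := 1) (b := q) one_pos hq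
    have h2 := integral_exp_mul_Ioi (a := -q) (by linarith) 0
    simp only [neg_mul] at h2
    rw [h2]; simp
  · have := exp_neg_integrableOn_Ioi 0 hq
    simp only [neg_mul] at this
    exact this
  · exact .of_forall fun x => (Real.exp_pos _).le

/-- The constant in the moment bound for constant controls. -/
def baseMoment (p : Params) (r q : ℝ) : ℝ := 2 + p.ρ * r * (2 / q)

/-- The constant in the bound of the losses of constant controls. -/
def baseConst (p : Params) (r q : ℝ) : ℝ≥0∞ :=
  ENNReal.ofReal (r ^ (-p.b) / p.b) * (ENNReal.ofReal (baseMoment p r q) * ENNReal.ofReal (2 / q))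

lemma baseConst_ne_top : baseConst p r q ≠ ∞ :=
  ENNReal.mul_ne_top ENNReal.ofReal_ne_top
    (ENNReal.mul_ne_top ENNReal.ofReal_ne_top ENNReal.ofReal_ne_top)

/-- Half of the decay rate `q` absorbs the factor linear in `t`, through the constant `baseMoment`;
the other half remains and makes the bound integrable in time. -/
lemma BaseRate.lintegral_psi_le (hr : BaseRate p r q) (h : IsBM 𝒢 P W) (hp : p.Standing)
    (ha1 : p.a ≤ 1) {ζ : Ω → ℝ≥0∞} (hζ : Measurable[𝒢 0] ζ) {Z : Ω → ℝ × ℝ}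
    (hZ : Measurable[𝒢 0] Z) (hZ1 : ∀ ω, 0 < (Z ω).1) (hZ2 : ∀ ω, 0 < (Z ω).2) (t : ℝ≥0) :
    ∫⁻ ω, ζ ω * (disc p t * psi p (statePath p (Z ω) (fun _ => r) (W · ω) t)) ∂P ≤
      ENNReal.ofReal (baseMoment p r q) * ENNReal.ofReal (Real.exp (-(q / 2 * t))) *
        ∫⁻ ω, ζ ω * psi p (Z ω) ∂P := by
  have ht := NNReal.coe_nonneg t
  have hρ := hp.ρ_pos.le
  have hr0 := hr.pos.le
  have hq := hr.rate_pos
  have hC : 0 ≤ baseMoment p r q := by unfold baseMoment; positivity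
  simp_rw [mul_left_comm (ζ _)]
  rw [lintegral_const_mul' _ _ (disc_ne_top p t)]
  calc disc p t * ∫⁻ ω, ζ ω * psi p (statePath p (Z ω) (fun _ => r) (W · ω) t) ∂P
      ≤ disc p t * (ENNReal.ofReal ((2 + p.ρ * r * t) * Real.exp (lossGrowth p (p.B - r) * t)) *
        ∫⁻ ω, ζ ω * psi p (Z ω) ∂P) := by
        gcongr
        refine (lintegral_mono fun ω => ?_).trans
          (lintegral_envelope_le h hp ha1 hr0 hζ hZ hZ1 hZ2 t)
        exact mul_le_mul_right
          (psi_statePath_const_le hp (h.continuous ω) hr0 (hZ1 ω) (hZ2 ω) t) _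
    _ ≤ _ := by
        rw [← mul_assoc, disc, ← ENNReal.ofReal_mul (by positivity), ← ENNReal.ofReal_mul hC]
        refine mul_le_mul_left (ENNReal.ofReal_le_ofReal ?_) _
        have h1 : p.θ * t ≥ lossGrowth p (p.B - r) * t + q * t := by
          nlinarith [mul_le_mul_of_nonneg_right hr.decay ht]
        have h2 : Real.exp (-p.θ * t) * Real.exp (lossGrowth p (p.B - r) * t)
            ≤ Real.exp (-(q / 2 * t)) * Real.exp (-(q / 2 * t)) := by
          rw [← Real.exp_add, ← Real.exp_add, Real.exp_le_exp]
          linarith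
        have h3 : (2 + p.ρ * r * t) * Real.exp (-(q / 2 * t)) ≤ baseMoment p r q := by
          have h4 : q / 2 * t ≤ Real.exp (q / 2 * t) := by
            have := Real.add_one_le_exp (q / 2 * t); linarith
          have h5 : (t : ℝ) ≤ 2 / q * Real.exp (q / 2 * t) := by
            calc (t : ℝ) = 2 / q * (q / 2 * t) := by field_simp
              _ ≤ _ := by gcongr
          have h6 : (1 : ℝ) ≤ Real.exp (q / 2 * t) := Real.one_le_exp (by positivity)
          rw [Real.exp_neg, ← div_eq_mul_inv, div_le_iff₀ (Real.exp_pos _), baseMoment]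
          nlinarith [mul_le_mul_of_nonneg_left h5 (mul_nonneg hρ hr0)]
        calc Real.exp (-p.θ * t) * ((2 + p.ρ * r * t) * Real.exp (lossGrowth p (p.B - r) * t))
            = (2 + p.ρ * r * t) * (Real.exp (-p.θ * t) * Real.exp (lossGrowth p (p.B - r) * t)) := by
              ring
          _ ≤ (2 + p.ρ * r * t) * (Real.exp (-(q / 2 * t)) * Real.exp (-(q / 2 * t))) := by gcongr
          _ = (2 + p.ρ * r * t) * Real.exp (-(q / 2 * t)) * Real.exp (-(q / 2 * t)) := by ring
          _ ≤ _ := by gcongr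

/-- A constant ratio keeps the loss comparable to `psi` at all times, and the weight decays
exponentially in expectation. This is the a priori upper bound of the optimal loss. -/
lemma BaseRate.lintegral_runCost_le (hr : BaseRate p r q) (h : IsBM 𝒢 P W) (hp : p.Standing)
    (ha1 : p.a ≤ 1) {ζ : Ω → ℝ≥0∞} (hζ : Measurable[𝒢 0] ζ) {Z : Ω → ℝ × ℝ}
    (hZ : Measurable[𝒢 0] Z) (hZ1 : ∀ ω, 0 < (Z ω).1) (hZ2 : ∀ ω, 0 < (Z ω).2) :
    ∫⁻ ω, ζ ω * runCost p (Z ω) (fun _ => r) (W · ω) Set.univ ∂P ≤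
      baseConst p r q * ∫⁻ ω, ζ ω * psi p (Z ω) ∂P := by
  have hζ' : Measurable ζ := hζ.mono (𝒢.le 0) le_rfl
  have hZ' : Measurable Z := hZ.mono (𝒢.le 0) le_rfl
  have hf : Measurable fun q : ℝ≥0 × Ω =>
      flowLoss p (Z q.2) (fun _ => r) (W · q.2) q.1 :=
    measurable_flowLoss (A := fun _ _ => r) measurable_const (fun _ => continuous_const.locInt)
      h.continuous h.measurable hZ'
  have e1 : ∀ ω, ζ ω * runCost p (Z ω) (fun _ => r) (W · ω) Set.univ
      = ∫⁻ t, ζ ω * flowLoss p (Z ω) (fun _ => r) (W · ω) t ∂timeMeasure := fun ω => by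
    have hm : Measurable fun t => flowLoss p (Z ω) (fun _ => r) (W · ω) t :=
      hf.comp measurable_prodMk_right
    rw [runCost, Measure.restrict_univ, lintegral_const_mul _ hm]
  simp_rw [e1]
  rw [lintegral_lintegral_swap ((hζ'.comp measurable_fst).mul (hf.comp measurable_swap)).aemeasurable]
  calc _ ≤ ∫⁻ t : ℝ≥0, ENNReal.ofReal (r ^ (-p.b) / p.b) * (ENNReal.ofReal (baseMoment p r q) *
        ENNReal.ofReal (Real.exp (-(q / 2 * t))) * ∫⁻ ω, ζ ω * psi p (Z ω) ∂P) ∂timeMeasure := by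
        refine lintegral_mono fun t => ?_
        refine le_trans ?_ (mul_le_mul_right (hr.lintegral_psi_le h hp ha1 hζ hZ hZ1 hZ2 t) _)
        rw [← lintegral_const_mul' _ _ ENNReal.ofReal_ne_top]
        refine lintegral_mono fun ω => ?_
        rw [mul_left_comm]
        exact mul_le_mul_right (flowLoss_le_psi hp hr.pos t le_rfl (fun _ => hr.pos.le)
          (hZ1 ω) (hZ2 ω)) _
    _ = _ := by
        rw [lintegral_const_mul' _ _ ENNReal.ofReal_ne_top]
        simp_rw [mul_assoc]
        rw [lintegral_const_mul' _ _ ENNReal.ofReal_ne_top, lintegral_mul_const _ (by fun_prop),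
          lintegral_exp_timeMeasure (by linarith [hr.rate_pos] : 0 < q / 2), baseConst, one_div_div]
        ring

end moments

/-! ### A lower bound of the losses over a unit of time -/

/-- The hypothesis says that `c P` is at most the measure with density `Y`, both restricted to `m`;
integrals of `m`-measurable functions compare accordingly. This replaces a lower bound of a
conditional expectation. -/
lemma const_mul_lintegral_le_of_forall_set {Ω : Type*} {m mΩ : MeasurableSpace Ω} (hm : m ≤ mΩ)
    {P : Measure Ω}
    {Y : Ω → ℝ≥0∞} (hY : Measurable Y) {c : ℝ≥0∞}
    (h : ∀ D, MeasurableSet[m] D → c * P D ≤ ∫⁻ ω in D, Y ω ∂P) {η : Ω → ℝ≥0∞}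
    (hη : Measurable[m] η) : c * ∫⁻ ω, η ω ∂P ≤ ∫⁻ ω, η ω * Y ω ∂P := by
  have h1 : c • P.trim hm ≤ (P.withDensity Y).trim hm := by
    refine Measure.le_iff.2 fun D hD => ?_
    rw [Measure.smul_apply, trim_measurableSet_eq hm hD, trim_measurableSet_eq hm hD,
      withDensity_apply _ (hm D hD)]
    exact h D hD
  have h2 := lintegral_mono' h1 (le_refl η)
  rw [lintegral_smul_measure, lintegral_trim hm hη, lintegral_trim hm hη,
    lintegral_withDensity_eq_lintegral_mul _ hY (hη.mono hm le_rfl)] at h2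
  refine h2.trans (le_of_eq (lintegral_congr fun ω => ?_))
  simp only [Pi.mul_apply, mul_comm]

lemma timeMeasure_Iio_one : timeMeasure (Set.Iio 1) = 1 := by
  have h : Set.Iio (1 : ℝ≥0) = Set.Ico 0 1 := by ext; simp
  rw [h, timeMeasure_Ico]; simp

section expectation

variable {p : Params} {𝒢 : Filtration ℝ≥0 mΩ} {P : Measure Ω} {W : ℝ≥0 → Ω → ℝ × ℝ}
  [IsProbabilityMeasure P]

/-- At time `s` the expectation is that of `ζ` times `exp (K s)`, which lies between `exp (-|K|)`
and `exp |K|` for `s < 1`. -/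
lemma IsBM.lintegral_exp_unit (h : IsBM 𝒢 P W) {ζ : Ω → ℝ≥0∞} (hζ : Measurable[𝒢 0] ζ)
    (k : ℝ) (e : ℝ × ℝ) {K : ℝ} (hK : K = k + (e.1 ^ 2 + e.2 ^ 2) / 2) {X : ℝ≥0 → Ω → ℝ}
    (hX : ∀ s ω, X s ω = Real.exp (k * s + (e.1 * (W s ω).1 + e.2 * (W s ω).2))) :
    ENNReal.ofReal (Real.exp (-|K|)) * ∫⁻ ω, ζ ω ∂P
      ≤ ∫⁻ ω, ζ ω * ∫⁻ s in Set.Iio 1, ENNReal.ofReal (X s ω) ∂timeMeasure ∂P ∧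
    ∫⁻ ω, ζ ω * ∫⁻ s in Set.Iio 1, ENNReal.ofReal (X s ω) ∂timeMeasure ∂P
      ≤ ENNReal.ofReal (Real.exp |K|) * ∫⁻ ω, ζ ω ∂P := by
  have hζ' : Measurable ζ := hζ.mono (𝒢.le 0) le_rfl
  have hXm : Measurable fun q : ℝ≥0 × Ω => X q.1 q.2 := by
    have := h.measurable_joint
    simp only [hX]
    fun_prop
  have e1 : ∀ ω, ζ ω * ∫⁻ s in Set.Iio 1, ENNReal.ofReal (X s ω) ∂timeMeasure
      = ∫⁻ s in Set.Iio 1, ζ ω * ENNReal.ofReal (X s ω) ∂timeMeasure := fun ω => by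
    have hm : Measurable fun s => ENNReal.ofReal (X s ω) :=
      (hXm.comp measurable_prodMk_right).ennreal_ofReal
    rw [lintegral_const_mul _ hm]
  simp_rw [e1]
  rw [lintegral_lintegral_swap ((hζ'.comp measurable_fst).mul
    (hXm.comp measurable_swap).ennreal_ofReal).aemeasurable]
  have e2 : ∀ s, ∫⁻ ω, ζ ω * ENNReal.ofReal (X s ω) ∂P
      = ENNReal.ofReal (Real.exp (K * s)) * ∫⁻ ω, ζ ω ∂P := fun s => by
    simp_rw [hX]
    rw [h.lintegral_exp 0 s hζ (k * s) 0 e (X := fun ω => k * s + (e.1 * (W s ω).1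
      + e.2 * (W s ω).2)) (fun ω => by simp [h.zero]), mul_comm, hK]
    congr 3
    simp only [Prod.fst_zero, Prod.snd_zero, NNReal.coe_zero]
    ring
  simp_rw [e2]
  have e3 : ∀ c : ℝ≥0∞, c = ∫⁻ s in Set.Iio (1 : ℝ≥0), c ∂timeMeasure := fun c => by
    rw [setLIntegral_const, timeMeasure_Iio_one, mul_one]
  have e4 : ∀ s ∈ Set.Iio (1 : ℝ≥0), |K * s| ≤ |K| := fun s hs => by
    have h1 : (s : ℝ) ≤ 1 := by exact_mod_cast (Set.mem_Iio.1 hs).le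
    rw [abs_mul, abs_of_nonneg (NNReal.coe_nonneg s)]
    exact mul_le_of_le_one_right (abs_nonneg _) h1
  constructor
  · rw [e3 (ENNReal.ofReal (Real.exp (-|K|)) * ∫⁻ ω, ζ ω ∂P)]
    refine setLIntegral_mono' measurableSet_Iio fun s hs => ?_
    gcongr
    linarith [e4 s hs, neg_abs_le (K * s)]
  · rw [e3 (ENNReal.ofReal (Real.exp |K|) * ∫⁻ ω, ζ ω ∂P)]
    refine setLIntegral_mono' measurableSet_Iio fun s hs => ?_
    gcongr
    linarith [e4 s hs, le_abs_self (K * s)]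

end expectation

section pathwise

variable {p : Params} {z : ℝ × ℝ} {α : ℝ≥0 → ℝ} {w : ℝ≥0 → ℝ × ℝ}

/-- The loss is smallest in the extreme case of the largest ratio `R`, a capital that grows without
consumption, and a habit without inflow. -/
lemma flowLoss_ge (hp : p.Standing) (h0 : ∀ t, 0 < α t) (hR : ∀ t, α t ≤ p.R)
    (hz1 : 0 < z.1) (hz2 : 0 < z.2) {s : ℝ≥0} (hs : s ≤ 1) :
    disc p 1 * ENNReal.ofReal (p.R ^ (-p.b) / p.b) * ENNReal.ofReal (z.1 ^ (-p.b) * z.2 ^ p.a) *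
      ENNReal.ofReal (growth p p.B w s ^ (-p.b) * habFactor p w s ^ p.a) ≤ flowLoss p z α w s := by
  have hb := hp.b_pos
  have ha := hp.a_nonneg
  have hR0 := hp.R_pos
  have h1 := capPath_pos (p := p) (α := α) (w := w) hz1 s
  have h2 := habPath_pos (w := w) hp.ρ_pos.le hz1.le hz2 (fun t => (h0 t).le) s
  have h3 := growth_pos (p := p) p.B w s
  have h4 := habFactor_pos p w s
  have h5 := h0 s
  rw [flowLoss, lossRate_eq (mul_pos h5 h1) h2, mul_assoc, mul_assoc,
    ← ENNReal.ofReal_mul (by positivity), ← ENNReal.ofReal_mul (by positivity)]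
  refine mul_le_mul' ?_ (ENNReal.ofReal_le_ofReal ?_)
  · refine ENNReal.ofReal_le_ofReal (Real.exp_le_exp.2 ?_)
    have : (s : ℝ) ≤ (1 : ℝ≥0) := by exact_mod_cast hs
    nlinarith [hp.θ_pos]
  · have e1 : (p.R * (z.1 * growth p p.B w s)) ^ (-p.b) ≤ (α s * capPath p z α w s) ^ (-p.b) := by
      refine Real.rpow_le_rpow_of_nonpos (by positivity) ?_ (by linarith)
      exact mul_le_mul (hR s) (mul_le_mul_of_nonneg_left (exp_logCap_le (fun t => (h0 t).le) s)
        hz1.le) h1.le hR0.le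
    have e2 : (habFactor p w s * z.2) ^ p.a ≤ habPath p z α w s ^ p.a :=
      Real.rpow_le_rpow (by positivity)
        (habFactor_mul_le_habPath hp.ρ_pos.le hz1.le (fun t => (h0 t).le) s) ha
    calc _ = 1 / p.b * ((p.R * (z.1 * growth p p.B w s)) ^ (-p.b) *
        (habFactor p w s * z.2) ^ p.a) := by
          rw [Real.mul_rpow hR0.le (by positivity), Real.mul_rpow hz1.le h3.le,
            Real.mul_rpow h4.le hz2.le]
          ring
      _ ≤ _ := by gcongr

/-- The convex function `u ^ (-b)` lies above its tangent at `1`. -/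
lemma one_add_le_rpow_neg {b u : ℝ} (hb : 0 ≤ b) (hu : 0 < u) : 1 + b ≤ u ^ (-b) + b * u := by
  have h1 : u ^ (-b) = Real.exp (-b * Real.log u) := by
    rw [Real.rpow_def_of_pos hu]; ring_nf
  have h2 := Real.add_one_le_exp (-b * Real.log u)
  have h3 := mul_le_mul_of_nonneg_left (Real.log_le_sub_one_of_pos hu) hb
  rw [h1]; linarith

/-- This is `one_add_le_rpow_neg` at `u = x / (l S E ^ e)`, rescaled. The relation between `e` and
`g` makes the last term linear in `E ^ (-g) * x`, a quantity whose time integral is under control;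
the level `l` stays free. -/
lemma tangent_loss {b S l E e g x : ℝ} (hb : 0 ≤ b) (hS : 0 < S) (hl : 0 < l) (hE : 0 < E)
    (hx : 0 < x) (he : e * (b + 1) = g) :
    (1 + b) * l ^ (-b) * E ^ (-b * e) ≤
      S ^ b * x ^ (-b) + b * l ^ (-b - 1) * S⁻¹ * (E ^ (-g) * x) := by
  have hu : 0 < x / (l * S * E ^ e) := by positivity
  have h1 := one_add_le_rpow_neg hb hu
  have h2 : 0 ≤ l ^ (-b) * E ^ (-b * e) := by positivity
  have e1 : (x / (l * S * E ^ e)) ^ (-b) * (l ^ (-b) * E ^ (-b * e)) = S ^ b * x ^ (-b) := by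
    rw [Real.div_rpow hx.le (by positivity), Real.mul_rpow (by positivity) (by positivity),
      Real.mul_rpow hl.le hS.le, ← Real.rpow_mul hE.le, mul_comm e, Real.rpow_neg hS.le b]
    have := Real.rpow_pos_of_pos hl (-b)
    have := Real.rpow_pos_of_pos hE (-b * e)
    have := Real.rpow_pos_of_pos hS b
    field_simp
  have e2 : x / (l * S * E ^ e) * (l ^ (-b) * E ^ (-b * e))
      = l ^ (-b - 1) * S⁻¹ * (E ^ (-g) * x) := by
    have h3 : E ^ (-g) = E ^ (-b * e) / E ^ e := by
      rw [← Real.rpow_sub hE]; congr 1; linarith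
    rw [h3, Real.rpow_sub_one hl.ne']
    have := Real.rpow_pos_of_pos hE e
    field_simp
  calc (1 + b) * l ^ (-b) * E ^ (-b * e) = (1 + b) * (l ^ (-b) * E ^ (-b * e)) := by ring
    _ ≤ ((x / (l * S * E ^ e)) ^ (-b) + b * (x / (l * S * E ^ e))) *
        (l ^ (-b) * E ^ (-b * e)) := by gcongr
    _ = (x / (l * S * E ^ e)) ^ (-b) * (l ^ (-b) * E ^ (-b * e))
        + b * (x / (l * S * E ^ e) * (l ^ (-b) * E ^ (-b * e))) := by ring
    _ = _ := by rw [e1, e2]; ring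

/-- The ratio between consumption and weighted habit. -/
def relCons (p : Params) (z : ℝ × ℝ) (α : ℝ≥0 → ℝ) (w : ℝ≥0 → ℝ × ℝ) (s : ℝ≥0) : ℝ :=
  α s * capPath p z α w s / habPath p z α w s ^ p.γ

lemma relCons_pos (hp : p.Standing) (h0 : ∀ t, 0 < α t) (hz1 : 0 < z.1) (hz2 : 0 < z.2)
    (s : ℝ≥0) : 0 < relCons p z α w s :=
  div_pos (mul_pos (h0 s) (capPath_pos hz1 s))
    (Real.rpow_pos_of_pos (habPath_pos hp.ρ_pos.le hz1.le hz2 (fun t => (h0 t).le) s) _)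

/-- Consumption feeds the habit. Write the habit as `E H` with `E` the habit factor: up to the
factor `1 / ρ`, the integrand is `H ^ (-γ)` times the derivative of `H`, a primitive of which is `H
^ (1 - γ) / (1 - γ)`. So the integral is bounded by the final value of `H`, which the maximal ratio
`R` controls. No control can therefore keep consumption high relative to the habit. -/
lemma lintegral_relCons_le (hp : p.Standing) (hα : LocInt α)
    (hw : Continuous w) (h0 : ∀ t, 0 < α t)
    (hR : ∀ t, α t ≤ p.R) (hz1 : 0 < z.1) (hz2 : 0 < z.2) :
    ∫⁻ s in Set.Iio 1, ENNReal.ofReal (habFactor p w s ^ (-(1 - p.γ)) * relCons p z α w s)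
        ∂timeMeasure
      ≤ ENNReal.ofReal ((z.1 + z.2) ^ (1 - p.γ) / (p.ρ * (1 - p.γ))) *
        (1 + ENNReal.ofReal (p.ρ * p.R) * ∫⁻ s in Set.Iio 1,
          ENNReal.ofReal (growth p p.B w s / habFactor p w s) ∂timeMeasure) := by
  have hρ := hp.ρ_pos
  have hR0 := hp.R_pos
  have hγ : 0 < 1 - p.γ := by linarith [hp.γ_lt_one]
  have h0' : ∀ t, 0 ≤ α t := fun t => (h0 t).le
  have hIcc : Set.Iio (1 : ℝ≥0) =ᵐ[timeMeasure] Set.Icc 0 1 := by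
    rw [show Set.Icc (0 : ℝ≥0) 1 = Set.Iic 1 from by ext; simp]
    exact Iio_ae_eq_Iic
  set g : ℝ≥0 → ℝ := fun s => p.ρ * z.1 * (Real.exp (logCap p α w s) / habFactor p w s * α s)
    with hg
  have hgl : LocInt g := (locInt_inflow hα hw).const_mul _
  have hgc : ∀ s, cumul g s = p.ρ * z.1 * inflow p α w s := fun s => cumul_const_mul _ _ _
  set H : ℝ≥0 → ℝ := fun s => z.2 + cumul g s with hH
  have hHpos : ∀ s, 0 < H s := fun s => by
    have := inflow_nonneg (p := p) (w := w) h0' s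
    simp only [hH, hgc]; positivity
  have hgpos : ∀ s, 0 ≤ g s := fun s => by
    have := habFactor_pos p w s
    have := h0' s
    positivity
  have hchain := cumul_chain (φ := fun x => x ^ (1 - p.γ) / (1 - p.γ)) (φ' := fun x => x ^ (-p.γ))
    (S := Set.Ioi 0) Set.ordConnected_Ioi (fun x hx => by
      have := (Real.hasDerivAt_rpow_const (x := x) (p := 1 - p.γ)
        (Or.inl (ne_of_gt hx))).div_const (1 - p.γ)
      refine this.congr_deriv ?_
      rw [mul_div_cancel_left₀ _ hγ.ne']
      congr 1; ring)
    (fun x hx => (Real.continuousAt_rpow_const _ _ (Or.inl (ne_of_gt hx))).continuousWithinAt)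
    hgl (c := z.2) (t := 1) (fun s _ => hHpos s)
  have e1 : ∀ s, habFactor p w s ^ (-(1 - p.γ)) * relCons p z α w s
      = 1 / p.ρ * (H s ^ (-p.γ) * g s) := fun s => by
    have hE := habFactor_pos p w s
    have hh : habPath p z α w s = habFactor p w s * H s := by
      simp only [hH, hgc]; rfl
    rw [relCons, hh, Real.mul_rpow hE.le (hHpos s).le, capPath, hg, Real.rpow_neg (hHpos s).le,
      neg_sub, sub_eq_add_neg, Real.rpow_add hE, Real.rpow_neg hE.le 1, Real.rpow_one]
    have := Real.rpow_pos_of_pos hE p.γ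
    have := Real.rpow_pos_of_pos (hHpos s) p.γ
    field_simp
  have hHc : Continuous fun s => H s ^ (-p.γ) :=
    (continuous_const.add (continuous_cumul hgl)).rpow_const fun s => Or.inl (hHpos s).ne'
  have hli : LocInt fun s => 1 / p.ρ * (H s ^ (-p.γ) * g s) :=
    (hgl.continuous_mul hHc).const_mul _
  have hQ : LocInt fun s => growth p p.B w s / habFactor p w s := (continuous_growth_div hw _).locInt
  have hQ0 : ∀ s, 0 ≤ growth p p.B w s / habFactor p w s := fun s =>
    div_nonneg (growth_pos _ _ _).le (habFactor_pos p w s).le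
  rw [setLIntegral_congr hIcc, setLIntegral_congr hIcc]
  simp_rw [e1]
  rw [← ofReal_integral_eq_lintegral_ofReal (hli 1) (.of_forall fun s => by
      have := hHpos s
      have := hgpos s
      positivity),
    ← ofReal_integral_eq_lintegral_ofReal (hQ 1) (.of_forall hQ0)]
  change ENNReal.ofReal (cumul (fun s => 1 / p.ρ * (H s ^ (-p.γ) * g s)) 1) ≤
    _ * (1 + _ * ENNReal.ofReal (cumul (fun s => growth p p.B w s / habFactor p w s) 1))
  have hQ1 : 0 ≤ cumul (fun s => growth p p.B w s / habFactor p w s) 1 :=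
    cumul_nonneg 1 fun s _ => hQ0 s
  set Q := cumul (fun s => growth p p.B w s / habFactor p w s) 1 with hQdef
  rw [← ENNReal.ofReal_mul (by positivity), ← ENNReal.ofReal_one,
    ← ENNReal.ofReal_add (by norm_num) (by positivity), ← ENNReal.ofReal_mul (by positivity)]
  refine ENNReal.ofReal_le_ofReal ?_
  rw [cumul_const_mul]
  have h1 : cumul (fun s => H s ^ (-p.γ) * g s) 1 ≤ H 1 ^ (1 - p.γ) / (1 - p.γ) := by
    have : 0 ≤ z.2 ^ (1 - p.γ) / (1 - p.γ) := by positivity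
    simp only [hH]
    linarith
  have h2 : H 1 ≤ (z.1 + z.2) * (1 + p.ρ * p.R * Q) := by
    simp only [hH, hgc]
    exact relHabit_le hρ.le hα hw h0' hR (exp_logCap_le h0') hz1.le hz2.le 1
  have h3 : H 1 ^ (1 - p.γ) ≤ (z.1 + z.2) ^ (1 - p.γ) * (1 + p.ρ * p.R * Q) := by
    have h4 : 1 ≤ 1 + p.ρ * p.R * Q := by
      have : 0 ≤ p.ρ * p.R * Q := by positivity
      linarith
    calc H 1 ^ (1 - p.γ) ≤ ((z.1 + z.2) * (1 + p.ρ * p.R * Q)) ^ (1 - p.γ) :=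
          Real.rpow_le_rpow (hHpos 1).le h2 hγ.le
      _ = (z.1 + z.2) ^ (1 - p.γ) * (1 + p.ρ * p.R * Q) ^ (1 - p.γ) :=
          Real.mul_rpow (by positivity) (by positivity)
      _ ≤ (z.1 + z.2) ^ (1 - p.γ) * (1 + p.ρ * p.R * Q) ^ (1 : ℝ) := by
          refine mul_le_mul_of_nonneg_left (Real.rpow_le_rpow_of_exponent_le h4 ?_)
            (by positivity)
          linarith [hp.γ_nonneg]
      _ = _ := by rw [Real.rpow_one]
  calc 1 / p.ρ * cumul (fun s => H s ^ (-p.γ) * g s) 1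
      ≤ 1 / p.ρ * ((z.1 + z.2) ^ (1 - p.γ) * (1 + p.ρ * p.R * Q) / (1 - p.γ)) := by
        gcongr
        refine h1.trans ?_
        gcongr
    _ = _ := by field_simp

end pathwise

section lower

variable {p : Params} {𝒢 : Filtration ℝ≥0 mΩ} {P : Measure Ω} {W : ℝ≥0 → Ω → ℝ × ℝ}
  [IsProbabilityMeasure P]

/-- The rate of the first lower bound. -/
def lowerRate₁ (p : Params) : ℝ :=
  (-p.b * (p.B - p.β₁ ^ 2 / 2) - p.a * (p.ρ + p.β₂ ^ 2 / 2))
    + ((-p.b * p.β₁) ^ 2 + (p.a * p.β₂) ^ 2) / 2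

/-- The constant of the first lower bound. -/
def lowerConst₁ (p : Params) : ℝ≥0∞ :=
  disc p 1 * ENNReal.ofReal (p.R ^ (-p.b) / p.b) * ENNReal.ofReal (Real.exp (-|lowerRate₁ p|))

/-- Expectation of the pathwise bound `flowLoss_ge`. It accounts for states whose habit is not small
against the capital. -/
lemma lower_bound₁ (h : IsBM 𝒢 P W) (hp : p.Standing) {ζ : Ω → ℝ≥0∞} (hζ : Measurable[𝒢 0] ζ)
    {Z : Ω → ℝ × ℝ} (hZ : Measurable[𝒢 0] Z)
    (hZ1 : ∀ ω, 0 < (Z ω).1) (hZ2 : ∀ ω, 0 < (Z ω).2) {A : ℝ≥0 → Ω → ℝ} (hA : IsControl p 𝒢 A) :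
    lowerConst₁ p * ∫⁻ ω, ζ ω * ENNReal.ofReal ((Z ω).1 ^ (-p.b) * (Z ω).2 ^ p.a) ∂P
      ≤ ∫⁻ ω, ζ ω * runCost p (Z ω) (A · ω) (W · ω) (Set.Iio 1) ∂P := by
  have hm1 : Measurable[𝒢 0] fun ω => (Z ω).1 := measurable_fst.comp hZ
  have hm2 : Measurable[𝒢 0] fun ω => (Z ω).2 := measurable_snd.comp hZ
  have hζ1 : Measurable[𝒢 0] fun ω => ζ ω * ENNReal.ofReal ((Z ω).1 ^ (-p.b) * (Z ω).2 ^ p.a) :=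
    hζ.mul ((hm1.pow_const _).mul (hm2.pow_const _)).ennreal_ofReal
  have h1 := (h.lintegral_exp_unit hζ1 (-p.b * (p.B - p.β₁ ^ 2 / 2) - p.a * (p.ρ + p.β₂ ^ 2 / 2))
    (-p.b * p.β₁, p.a * p.β₂) (K := lowerRate₁ p) rfl
    (X := fun s ω => growth p p.B (W · ω) s ^ (-p.b) *
      habFactor p (W · ω) s ^ p.a) (fun s ω => by
        rw [growth, habFactor, ← Real.exp_mul, ← Real.exp_mul, ← Real.exp_add]
        congr 1; ring)).1
  calc lowerConst₁ p * ∫⁻ ω, ζ ω * ENNReal.ofReal ((Z ω).1 ^ (-p.b) * (Z ω).2 ^ p.a) ∂P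
      ≤ disc p 1 * ENNReal.ofReal (p.R ^ (-p.b) / p.b) *
        ∫⁻ ω, ζ ω * ENNReal.ofReal ((Z ω).1 ^ (-p.b) * (Z ω).2 ^ p.a) * ∫⁻ s in Set.Iio 1,
          ENNReal.ofReal (growth p p.B (W · ω) s ^ (-p.b) *
            habFactor p (W · ω) s ^ p.a) ∂timeMeasure ∂P := by
        rw [lowerConst₁, mul_assoc]
        exact mul_le_mul_right h1 _
    _ ≤ _ := by
        rw [← lintegral_const_mul' _ _ (ENNReal.mul_ne_top (disc_ne_top _ _)
          ENNReal.ofReal_ne_top)]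
        refine lintegral_mono fun ω => ?_
        have e : ∀ a b c d : ℝ≥0∞, a * (b * c * d) = b * (a * c * d) := fun a b c d => by ring
        rw [e]
        refine mul_le_mul_right ?_ _
        rw [← lintegral_const_mul' _ _ (ENNReal.mul_ne_top (ENNReal.mul_ne_top (disc_ne_top _ _)
          ENNReal.ofReal_ne_top) ENNReal.ofReal_ne_top)]
        exact setLIntegral_mono' measurableSet_Iio fun s hs =>
          flowLoss_ge hp (fun t => hA.pos t ω) (fun t => hA.le t ω) (hZ1 ω) (hZ2 ω)
            (le_of_lt hs)

/-- This covers a habit that is small against the capital. The loss is a negative power of relative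
consumption, and `lintegral_relCons_le` bounds relative consumption from above on average; the
tangent inequality `tangent_loss` turns this into a lower bound of the loss, as in Jensen's
inequality. The bound is first shown on events of the initial σ-algebra and then for all weights.
The constant does not depend on the control, the filtration or the Brownian motion. -/
lemma exists_lower_bound₂ (hp : p.Standing) : ∃ c : ℝ≥0∞, c ≠ 0 ∧ c ≠ ∞ ∧
    ∀ {𝒢 : Filtration ℝ≥0 mΩ} {W : ℝ≥0 → Ω → ℝ × ℝ} (_ : IsBM 𝒢 P W) {ζ : Ω → ℝ≥0∞}
    (_ : Measurable[𝒢 0] ζ) {Z : Ω → ℝ × ℝ} (_ : Measurable[𝒢 0] Z)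
    (_ : ∀ ω, 0 < (Z ω).1) (_ : ∀ ω, 0 < (Z ω).2) {A : ℝ≥0 → Ω → ℝ} (_ : IsControl p 𝒢 A),
    c * ∫⁻ ω, ζ ω * ENNReal.ofReal (((Z ω).1 + (Z ω).2) ^ (-(p.b * (1 - p.γ)))) ∂P
      ≤ ∫⁻ ω, ζ ω * runCost p (Z ω) (A · ω) (W · ω) (Set.Iio 1) ∂P := by
  have hb := hp.b_pos
  have hρ := hp.ρ_pos
  have hR0 := hp.R_pos
  have hγ : 0 < 1 - p.γ := by linarith [hp.γ_lt_one]
  -- The exponent for which the powers of the habit factor in `tangent_loss` match those in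
  -- `lintegral_relCons_le`.
  set e : ℝ := (1 - p.γ) / (p.b + 1) with he
  have he' : e * (p.b + 1) = 1 - p.γ := by rw [he]; field_simp
  set K₁ : ℝ := (p.b * e * (p.ρ + p.β₂ ^ 2 / 2)) + (0 ^ 2 + (-(p.b * e) * p.β₂) ^ 2) / 2 with hK₁
  set K₂ : ℝ := ((p.B - p.β₁ ^ 2 / 2) + (p.ρ + p.β₂ ^ 2 / 2)) + (p.β₁ ^ 2 + (-p.β₂) ^ 2) / 2
    with hK₂
  set m₁ : ℝ := Real.exp (-|K₁|) with hm₁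
  set m₂ : ℝ := 1 + p.ρ * p.R * Real.exp |K₂| with hm₂
  have hm₁0 : 0 < m₁ := Real.exp_pos _
  have hm₂0 : 0 < m₂ := by positivity
  -- With this level the linear term is at most `b` times `l ^ (-b) * m₁` in expectation. The
  -- tangent inequality starts from `1 + b` such units, so exactly one remains.
  set l : ℝ := m₂ / (p.ρ * (1 - p.γ) * m₁) with hl
  have hl0 : 0 < l := by positivity
  refine ⟨disc p 1 * ENNReal.ofReal (1 / p.b) * ENNReal.ofReal (l ^ (-p.b) * m₁), ?_,
    ENNReal.mul_ne_top (ENNReal.mul_ne_top (disc_ne_top _ _) ENNReal.ofReal_ne_top)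
      ENNReal.ofReal_ne_top, ?_⟩
  · simp only [ne_eq, mul_eq_zero, ENNReal.ofReal_eq_zero, not_or, not_le]
    exact ⟨⟨disc_ne_zero p 1, by positivity⟩, by positivity⟩
  intro 𝒢 W h ζ hζ Z hZ hZ1 hZ2 A hA
  have hm1 : Measurable[𝒢 0] fun ω => (Z ω).1 := measurable_fst.comp hZ
  have hm2 : Measurable[𝒢 0] fun ω => (Z ω).2 := measurable_snd.comp hZ
  set S : Ω → ℝ := fun ω => ((Z ω).1 + (Z ω).2) ^ (1 - p.γ) with hS
  have hS0 : ∀ ω, 0 < S ω := fun ω => Real.rpow_pos_of_pos (add_pos (hZ1 ω) (hZ2 ω)) _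
  have hSm : Measurable[𝒢 0] S := (hm1.add hm2).pow_const _
  set X : ℝ≥0 → Ω → ℝ := fun s ω => relCons p (Z ω) (A · ω) (W · ω) s with hX
  have hX0 : ∀ s ω, 0 < X s ω := fun s ω =>
    relCons_pos hp (fun t => hA.pos t ω) (hZ1 ω) (hZ2 ω) s
  have hXm : Measurable fun q : ℝ≥0 × Ω => X q.1 q.2 := by
    have h1 := measurable_statePath_joint (p := p) hA.measurable hA.locInt h.continuous h.measurable
      (hZ.mono (𝒢.le 0) le_rfl)
    exact (hA.measurable.mul (measurable_fst.comp h1)).div ((measurable_snd.comp h1).pow_const _)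
  set I : Ω → ℝ≥0∞ := fun ω => ∫⁻ s in Set.Iio 1, ENNReal.ofReal (X s ω ^ (-p.b)) ∂timeMeasure
    with hI
  have hIm : Measurable I :=
    ((hXm.pow_const (-p.b)).ennreal_ofReal).lintegral_prod_left'
  set Y : Ω → ℝ≥0∞ := fun ω => ENNReal.ofReal (S ω ^ p.b) * I ω with hY
  have hYm : Measurable Y :=
    ((hSm.mono (𝒢.le 0) le_rfl).pow_const _).ennreal_ofReal.mul hIm
  -- the pathwise inequality
  have hpath : ∀ ω, ENNReal.ofReal ((1 + p.b) * l ^ (-p.b)) * ∫⁻ s in Set.Iio 1,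
        ENNReal.ofReal (habFactor p (W · ω) s ^ (-p.b * e)) ∂timeMeasure ≤
      Y ω + ENNReal.ofReal (p.b * l ^ (-p.b - 1) / (p.ρ * (1 - p.γ))) *
        (1 + ENNReal.ofReal (p.ρ * p.R) * ∫⁻ s in Set.Iio 1, ENNReal.ofReal
          (growth p p.B (W · ω) s / habFactor p (W · ω) s) ∂timeMeasure) := by
    intro ω
    have hXω : Measurable fun s => X s ω := hXm.comp measurable_prodMk_right
    have h1 := lintegral_relCons_le hp (hA.locInt ω)
      (h.continuous ω) (fun t => hA.pos t ω) (fun t => hA.le t ω) (hZ1 ω) (hZ2 ω)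
    calc _ = ∫⁻ s in Set.Iio 1, ENNReal.ofReal ((1 + p.b) * l ^ (-p.b)) *
          ENNReal.ofReal (habFactor p (W · ω) s ^ (-p.b * e)) ∂timeMeasure := by
          rw [lintegral_const_mul' _ _ ENNReal.ofReal_ne_top]
      _ ≤ ∫⁻ s in Set.Iio 1, (ENNReal.ofReal (S ω ^ p.b) * ENNReal.ofReal (X s ω ^ (-p.b)) +
          ENNReal.ofReal (p.b * l ^ (-p.b - 1) * (S ω)⁻¹) * ENNReal.ofReal
            (habFactor p (W · ω) s ^ (-(1 - p.γ)) * X s ω)) ∂timeMeasure := by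
          refine lintegral_mono fun s => ?_
          have hE := habFactor_pos p (W · ω) s
          have h2 := hS0 ω
          have h3 := hX0 s ω
          rw [← ENNReal.ofReal_mul (by positivity), ← ENNReal.ofReal_mul (by positivity),
            ← ENNReal.ofReal_mul (by positivity), ← ENNReal.ofReal_add (by positivity)
            (by positivity)]
          exact ENNReal.ofReal_le_ofReal (tangent_loss hb.le h2 hl0 hE h3 he')
      _ ≤ _ := by
          rw [lintegral_add_left ((hXω.pow_const _).ennreal_ofReal.const_mul _),
            lintegral_const_mul' _ _ ENNReal.ofReal_ne_top,
            lintegral_const_mul' _ _ ENNReal.ofReal_ne_top]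
          refine add_le_add le_rfl ((mul_le_mul_right h1 _).trans (le_of_eq ?_))
          have h2 := hS0 ω
          rw [← mul_assoc, ← ENNReal.ofReal_mul (by positivity)]
          congr 2
          change p.b * l ^ (-p.b - 1) * (S ω)⁻¹ * (S ω / (p.ρ * (1 - p.γ))) = _
          field_simp
  -- the inequality in expectation
  have hset : ∀ D, MeasurableSet[𝒢 0] D →
      ENNReal.ofReal (l ^ (-p.b) * m₁) * P D ≤ ∫⁻ ω in D, Y ω ∂P := by
    intro D hD
    have hD' : MeasurableSet D := 𝒢.le 0 D hD
    set χ : Ω → ℝ≥0∞ := D.indicator 1 with hχ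
    have hχm : Measurable[𝒢 0] χ :=
      (@measurable_const _ _ _ (𝒢 0) (1 : ℝ≥0∞)).indicator hD
    have hχi : ∀ f : Ω → ℝ≥0∞, ∫⁻ ω, χ ω * f ω ∂P = ∫⁻ ω in D, f ω ∂P := fun f => by
      rw [← lintegral_indicator hD']
      refine lintegral_congr fun ω => ?_
      by_cases hω : ω ∈ D <;> simp [hχ, hω]
    have hχ1 : ∫⁻ ω, χ ω ∂P = P D := by rw [hχ, lintegral_indicator_one hD']
    have b1 := (h.lintegral_exp_unit hχm (p.b * e * (p.ρ + p.β₂ ^ 2 / 2))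
      (0, -(p.b * e) * p.β₂) (K := K₁) rfl
      (X := fun s ω => habFactor p (W · ω) s ^ (-p.b * e)) (fun s ω => by
        rw [habFactor, ← Real.exp_mul]; congr 1; ring)).1
    have b2 := (h.lintegral_exp_unit hχm ((p.B - p.β₁ ^ 2 / 2) + (p.ρ + p.β₂ ^ 2 / 2))
      (p.β₁, -p.β₂) (K := K₂) rfl
      (X := fun s ω => growth p p.B (W · ω) s / habFactor p (W · ω) s)
      (fun s ω => by rw [growth, habFactor, ← Real.exp_sub]; congr 1; ring)).2
    rw [hχi, hχ1] at b1 b2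
    have hc1 : (0 : ℝ) ≤ p.b * l ^ (-p.b - 1) / (p.ρ * (1 - p.γ)) := by positivity
    have hint : ENNReal.ofReal ((1 + p.b) * l ^ (-p.b)) * (ENNReal.ofReal m₁ * P D) ≤
        ∫⁻ ω in D, Y ω ∂P + ENNReal.ofReal (p.b * l ^ (-p.b - 1) / (p.ρ * (1 - p.γ))) *
          (P D + ENNReal.ofReal (p.ρ * p.R) * (ENNReal.ofReal (Real.exp |K₂|) * P D)) := by
      calc _ ≤ ENNReal.ofReal ((1 + p.b) * l ^ (-p.b)) * ∫⁻ ω in D, ∫⁻ s in Set.Iio 1,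
            ENNReal.ofReal (habFactor p (W · ω) s ^ (-p.b * e)) ∂timeMeasure ∂P :=
            mul_le_mul_right b1 _
        _ ≤ ∫⁻ ω in D, (Y ω + ENNReal.ofReal (p.b * l ^ (-p.b - 1) / (p.ρ * (1 - p.γ))) *
            (1 + ENNReal.ofReal (p.ρ * p.R) * ∫⁻ s in Set.Iio 1, ENNReal.ofReal
              (growth p p.B (W · ω) s / habFactor p (W · ω) s)
              ∂timeMeasure)) ∂P := by
            rw [← lintegral_const_mul' _ _ ENNReal.ofReal_ne_top]
            exact lintegral_mono hpath
        _ ≤ _ := by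
            rw [lintegral_add_left hYm, lintegral_const_mul' _ _ ENNReal.ofReal_ne_top,
              lintegral_add_left measurable_const, lintegral_const_mul' _ _ ENNReal.ofReal_ne_top,
              setLIntegral_const, one_mul]
            gcongr
    have e1 : ENNReal.ofReal ((1 + p.b) * l ^ (-p.b)) * (ENNReal.ofReal m₁ * P D)
        = ENNReal.ofReal (l ^ (-p.b) * m₁) * P D
          + ENNReal.ofReal (p.b * (l ^ (-p.b) * m₁)) * P D := by
      rw [← mul_assoc, ← ENNReal.ofReal_mul (by positivity), ← add_mul,
        ← ENNReal.ofReal_add (by positivity) (by positivity)]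
      congr 2; ring
    have e2 : ENNReal.ofReal (p.b * l ^ (-p.b - 1) / (p.ρ * (1 - p.γ))) *
          (P D + ENNReal.ofReal (p.ρ * p.R) * (ENNReal.ofReal (Real.exp |K₂|) * P D))
        = ENNReal.ofReal (p.b * (l ^ (-p.b) * m₁)) * P D := by
      have e3 : P D + ENNReal.ofReal (p.ρ * p.R) * (ENNReal.ofReal (Real.exp |K₂|) * P D)
          = ENNReal.ofReal m₂ * P D := by
        rw [hm₂, ENNReal.ofReal_add (by norm_num) (by positivity), ENNReal.ofReal_one,
          ENNReal.ofReal_mul (p := p.ρ * p.R) (by positivity)]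
        ring
      rw [e3, ← mul_assoc, ← ENNReal.ofReal_mul hc1]
      congr 2
      rw [Real.rpow_sub_one hl0.ne']
      have : m₂ = l * (p.ρ * (1 - p.γ) * m₁) := by rw [hl]; field_simp
      rw [this]
      field_simp
    rw [e1, e2] at hint
    exact (ENNReal.add_le_add_iff_right (ENNReal.mul_ne_top ENNReal.ofReal_ne_top
      (measure_ne_top P D))).1 hint
  have hη : Measurable[𝒢 0] fun ω => ζ ω * ENNReal.ofReal (S ω ^ (-p.b)) :=
    hζ.mul (hSm.pow_const _).ennreal_ofReal
  have hfin := const_mul_lintegral_le_of_forall_set (𝒢.le 0) hYm hset hη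
  have e1 : ∀ ω, ((Z ω).1 + (Z ω).2) ^ (-(p.b * (1 - p.γ))) = S ω ^ (-p.b) := fun ω => by
    rw [hS, ← Real.rpow_mul (add_pos (hZ1 ω) (hZ2 ω)).le]
    congr 1; ring
  simp_rw [e1]
  rw [mul_assoc]
  refine (mul_le_mul_right hfin _).trans ?_
  rw [← lintegral_const_mul' _ _ (ENNReal.mul_ne_top (disc_ne_top _ _) ENNReal.ofReal_ne_top)]
  refine lintegral_mono fun ω => ?_
  have e2 : ζ ω * ENNReal.ofReal (S ω ^ (-p.b)) * Y ω = ζ ω * I ω := by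
    simp only [hY]
    rw [mul_assoc, ← mul_assoc (ENNReal.ofReal (S ω ^ (-p.b))), ← ENNReal.ofReal_mul
      (Real.rpow_nonneg (hS0 ω).le _), ← Real.rpow_add (hS0 ω)]
    simp
  rw [e2, mul_left_comm]
  refine mul_le_mul_right ?_ _
  rw [hI, ← lintegral_const_mul' _ _ (ENNReal.mul_ne_top (disc_ne_top _ _) ENNReal.ofReal_ne_top)]
  refine setLIntegral_mono' measurableSet_Iio fun s hs => ?_
  rw [flowLoss, lossRate, mul_assoc, ← ENNReal.ofReal_mul (by positivity)]
  refine mul_le_mul' ?_ (le_of_eq ?_)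
  · refine ENNReal.ofReal_le_ofReal (Real.exp_le_exp.2 ?_)
    have : (s : ℝ) ≤ (1 : ℝ≥0) := by exact_mod_cast le_of_lt (Set.mem_Iio.1 hs)
    nlinarith [hp.θ_pos]
  · have : (1 : ℝ) - p.σ = -p.b := by unfold Params.b; ring
    rw [this]; rfl

/-- The losses over a unit of time dominate the weight of the initial state. -/
theorem exists_lower_bound (hp : p.Standing) : ∃ C : ℝ≥0∞, C ≠ ∞ ∧
    ∀ {𝒢 : Filtration ℝ≥0 mΩ} {W : ℝ≥0 → Ω → ℝ × ℝ} (_ : IsBM 𝒢 P W) {ζ : Ω → ℝ≥0∞}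
    (_ : Measurable[𝒢 0] ζ) {Z : Ω → ℝ × ℝ} (_ : Measurable[𝒢 0] Z)
    (_ : ∀ ω, 0 < (Z ω).1) (_ : ∀ ω, 0 < (Z ω).2) {A : ℝ≥0 → Ω → ℝ} (_ : IsControl p 𝒢 A),
    ∫⁻ ω, ζ ω * psi p (Z ω) ∂P ≤
      C * ∫⁻ ω, ζ ω * runCost p (Z ω) (A · ω) (W · ω) (Set.Iio 1) ∂P := by
  have hb := hp.b_pos
  have ha := hp.a_nonneg
  obtain ⟨c, hc0, hc0', hc⟩ := exists_lower_bound₂ (Ω := Ω) (mΩ := mΩ) (P := P) hp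
  have hc1 : lowerConst₁ p ≠ 0 := by
    have := hp.R_pos
    simp only [lowerConst₁, ne_eq, mul_eq_zero, ENNReal.ofReal_eq_zero, not_or, not_le]
    exact ⟨⟨disc_ne_zero p 1, by positivity⟩, Real.exp_pos _⟩
  set D : ℝ≥0∞ := ENNReal.ofReal (2 ^ (p.b * (1 - p.γ))) with hD
  have hc1' : lowerConst₁ p ≠ ∞ := ENNReal.mul_ne_top (ENNReal.mul_ne_top (disc_ne_top _ _)
    ENNReal.ofReal_ne_top) ENNReal.ofReal_ne_top
  refine ⟨2 * (lowerConst₁ p)⁻¹ + D * c⁻¹, ENNReal.add_ne_top.2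
    ⟨ENNReal.mul_ne_top (by simp) (ENNReal.inv_ne_top.2 hc1),
      ENNReal.mul_ne_top ENNReal.ofReal_ne_top (ENNReal.inv_ne_top.2 hc0)⟩, ?_⟩
  intro 𝒢 W h ζ hζ Z hZ hZ1 hZ2 A hA
  have hm1 : Measurable fun ω => (Z ω).1 := measurable_fst.comp (hZ.mono (𝒢.le 0) le_rfl)
  have hm2 : Measurable fun ω => (Z ω).2 := measurable_snd.comp (hZ.mono (𝒢.le 0) le_rfl)
  have h1 := lower_bound₁ h hp hζ hZ hZ1 hZ2 hA
  have h2 := hc h hζ hZ hZ1 hZ2 hA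
  set J := ∫⁻ ω, ζ ω * runCost p (Z ω) (A · ω) (W · ω) (Set.Iio 1) ∂P
  have h1' : ∫⁻ ω, ζ ω * ENNReal.ofReal ((Z ω).1 ^ (-p.b) * (Z ω).2 ^ p.a) ∂P
      ≤ (lowerConst₁ p)⁻¹ * J := (ENNReal.mul_le_iff_le_inv hc1 hc1').1 h1
  have h2' : ∫⁻ ω, ζ ω * ENNReal.ofReal (((Z ω).1 + (Z ω).2) ^ (-(p.b * (1 - p.γ)))) ∂P
      ≤ c⁻¹ * J := (ENNReal.mul_le_iff_le_inv hc0 hc0').1 h2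
  calc _ ≤ ∫⁻ ω, (2 * (ζ ω * ENNReal.ofReal ((Z ω).1 ^ (-p.b) * (Z ω).2 ^ p.a)) +
        D * (ζ ω * ENNReal.ofReal (((Z ω).1 + (Z ω).2) ^ (-(p.b * (1 - p.γ)))))) ∂P := by
        refine lintegral_mono fun ω => ?_
        have hz1 := hZ1 ω
        have hz2 := hZ2 ω
        rw [mul_left_comm, mul_left_comm D, ← mul_add]
        refine mul_le_mul_right ?_ _
        have e2 : (2 : ℝ≥0∞) = ENNReal.ofReal 2 := by simp
        rw [e2, hD, ← ENNReal.ofReal_mul (by positivity), ← ENNReal.ofReal_mul (by positivity),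
          ← ENNReal.ofReal_add (by positivity) (by positivity), psi]
        refine ENNReal.ofReal_le_ofReal ?_
        have hab : p.a = p.b - p.b * (1 - p.γ) := by unfold Params.a Params.b; ring
        have k0 : 0 ≤ (Z ω).1 ^ (-p.b) * (Z ω).2 ^ p.a := by positivity
        -- The term of `psi` without habit is the capital to the power `-b (1 - γ)`. If the capital
        -- is the larger component, it is comparable with the sum of both; otherwise this term is at
        -- most the other term of `psi`.
        rcases le_total (Z ω).2 (Z ω).1 with hle | hle
        · have k1 : (Z ω).1 ^ (-p.b) * (Z ω).1 ^ p.a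
              ≤ 2 ^ (p.b * (1 - p.γ)) * ((Z ω).1 + (Z ω).2) ^ (-(p.b * (1 - p.γ))) := by
            rw [← Real.rpow_add hz1, show -p.b + p.a = -(p.b * (1 - p.γ)) by rw [hab]; ring]
            have k2 : (2 * (Z ω).1) ^ (-(p.b * (1 - p.γ)))
                ≤ ((Z ω).1 + (Z ω).2) ^ (-(p.b * (1 - p.γ))) :=
              Real.rpow_le_rpow_of_nonpos (by positivity) (by linarith)
                (by have := hp.γ_lt_one; nlinarith)
            rw [Real.mul_rpow (by norm_num) hz1.le] at k2
            calc (Z ω).1 ^ (-(p.b * (1 - p.γ))) = 2 ^ (p.b * (1 - p.γ)) *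
                (2 ^ (-(p.b * (1 - p.γ))) * (Z ω).1 ^ (-(p.b * (1 - p.γ)))) := by
                  rw [← mul_assoc, ← Real.rpow_add (by norm_num)]; simp
              _ ≤ _ := by gcongr
          rw [mul_add]; linarith
        · have k1 : (Z ω).1 ^ (-p.b) * (Z ω).1 ^ p.a ≤ (Z ω).1 ^ (-p.b) * (Z ω).2 ^ p.a := by
            gcongr
          have k2 : 0 ≤ 2 ^ (p.b * (1 - p.γ)) * ((Z ω).1 + (Z ω).2) ^ (-(p.b * (1 - p.γ))) := by
            positivity
          rw [mul_add]; linarith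
    _ ≤ 2 * ((lowerConst₁ p)⁻¹ * J) + D * (c⁻¹ * J) := by
        have hζ' : Measurable ζ := hζ.mono (𝒢.le 0) le_rfl
        have hm : Measurable fun ω =>
            2 * (ζ ω * ENNReal.ofReal ((Z ω).1 ^ (-p.b) * (Z ω).2 ^ p.a)) :=
          (hζ'.mul ((hm1.pow_const _).mul (hm2.pow_const _)).ennreal_ofReal).const_mul _
        rw [lintegral_add_left hm,
          lintegral_const_mul' _ _ (by simp), lintegral_const_mul' _ _ ENNReal.ofReal_ne_top]
        gcongr
    _ = _ := by ring

end lower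

/-! ### Finite stopping times and the strong Markov property -/

/-- A finite stopping time. -/
def IsStop (𝒢 : Filtration ℝ≥0 mΩ) (σ : Ω → ℝ≥0) : Prop :=
  ∀ t, MeasurableSet[𝒢 t] {ω | σ ω ≤ t}

lemma isStop_const (𝒢 : Filtration ℝ≥0 mΩ) (a : ℝ≥0) : IsStop 𝒢 fun _ => a :=
  fun _ => MeasurableSet.const _

lemma IsStop.measurableSet_add {𝒢 : Filtration ℝ≥0 mΩ} {σ : Ω → ℝ≥0} (hσ : IsStop 𝒢 σ)
    (s t : ℝ≥0) : MeasurableSet[𝒢 t] {ω | σ ω + s ≤ t} := by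
  by_cases h : s ≤ t
  · have : {ω | σ ω + s ≤ t} = {ω | σ ω ≤ t - s} := by
      ext ω; exact (le_tsub_iff_right h).symm
    rw [this]
    exact 𝒢.mono tsub_le_self _ (hσ _)
  · have : {ω | σ ω + s ≤ t} = ∅ := by
      ext ω
      simp only [Set.mem_ofPred_eq, Set.mem_empty_iff_false, iff_false]
      exact fun h' => h (le_add_self.trans h')
    rw [this]
    exact @MeasurableSet.empty _ (𝒢 t)

lemma IsStop.add {𝒢 : Filtration ℝ≥0 mΩ} {σ : Ω → ℝ≥0} (hσ : IsStop 𝒢 σ) (s : ℝ≥0) :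
    IsStop 𝒢 fun ω => σ ω + s := fun t => hσ.measurableSet_add s t

/-- The filtration `s ↦ 𝒢_{σ + s}`. -/
def shiftFilt (𝒢 : Filtration ℝ≥0 mΩ) {σ : Ω → ℝ≥0} (hσ : IsStop 𝒢 σ) : Filtration ℝ≥0 mΩ where
  seq s :=
    { MeasurableSet' := fun D => ∀ t, MeasurableSet[𝒢 t] (D ∩ {ω | σ ω + s ≤ t})
      measurableSet_empty := fun t => by rw [Set.empty_inter]; exact @MeasurableSet.empty _ (𝒢 t)
      measurableSet_compl := fun D hD t => by
        have : Dᶜ ∩ {ω | σ ω + s ≤ t} = {ω | σ ω + s ≤ t} \ (D ∩ {ω | σ ω + s ≤ t}) := by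
          ext ω; simp only [Set.mem_inter_iff, Set.mem_compl_iff, Set.mem_sdiff]; tauto
        rw [this]
        exact (hσ.measurableSet_add s t).diff (hD t)
      measurableSet_iUnion := fun D hD t => by
        rw [Set.iUnion_inter]
        exact MeasurableSet.iUnion fun i => hD i t }
  mono' s s' hs D hD t := by
    have : D ∩ {ω | σ ω + s' ≤ t} = (D ∩ {ω | σ ω + s ≤ t}) ∩ {ω | σ ω + s' ≤ t} := by
      ext ω
      simp only [Set.mem_inter_iff, Set.mem_ofPred_eq]
      constructor
      · exact fun h => ⟨⟨h.1, (add_le_add_right hs _).trans h.2⟩, h.2⟩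
      · exact fun h => ⟨h.1.1, h.2⟩
    rw [this]
    exact (hD t).inter (hσ.measurableSet_add s' t)
  le' s D hD := by
    have : D = ⋃ n : ℕ, D ∩ {ω | σ ω + s ≤ (n : ℝ≥0)} := by
      ext ω
      simp only [Set.mem_iUnion, Set.mem_inter_iff, Set.mem_ofPred_eq, exists_and_left]
      exact ⟨fun h => ⟨h, exists_nat_ge _⟩, fun h => h.1⟩
    rw [this]
    exact MeasurableSet.iUnion fun n => 𝒢.le _ _ (hD _)

section

variable {𝒢 : Filtration ℝ≥0 mΩ} {σ : Ω → ℝ≥0}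

lemma IsStop.measurable_min (hσ : IsStop 𝒢 σ) (t : ℝ≥0) :
    Measurable[𝒢 t] fun ω => min (σ ω) t := by
  refine Measurable.mono (ma := 𝒢 t) (measurable_of_Iic fun u => ?_) le_rfl le_rfl
  by_cases h : t ≤ u
  · have : (fun ω => min (σ ω) t) ⁻¹' Set.Iic u = Set.univ := by
      ext ω; simp [h]
    rw [this]
    exact MeasurableSet.univ
  · have : (fun ω => min (σ ω) t) ⁻¹' Set.Iic u = {ω | σ ω ≤ u} := by
      ext ω; simp [h]
    rw [this]
    exact 𝒢.mono (not_le.1 h).le _ (hσ u)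

lemma IsStop.measurable_tsub (hσ : IsStop 𝒢 σ) (t : ℝ≥0) :
    Measurable[𝒢 t] fun ω => t - σ ω := by
  have : (fun ω => t - σ ω) = fun ω => t - min (σ ω) t := by
    ext ω
    rcases le_total (σ ω) t with h | h
    · rw [min_eq_left h]
    · rw [min_eq_right h, tsub_self, tsub_eq_zero_of_le h]
  rw [this]
  exact measurable_const.sub (hσ.measurable_min t)

lemma IsStop.measurable (hσ : IsStop 𝒢 σ) : Measurable σ :=
  measurable_of_Iic fun t => 𝒢.le t _ (hσ t)

lemma measurable_stopped_min (hσ : IsStop 𝒢 σ) {β : Type*} [TopologicalSpace β]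
    [TopologicalSpace.PseudoMetrizableSpace β] [MeasurableSpace β] [BorelSpace β]
    {X : ℝ≥0 → Ω → β} (hX : ∀ t, Measurable[𝒢 t] (X t)) (hXc : ∀ ω, Continuous fun t => X t ω)
    (t : ℝ≥0) : Measurable[𝒢 t] fun ω => X (min (σ ω) t) ω := by
  have h1 := @measurable_uncurry_of_continuous_paths Ω (𝒢 t) β _ _ _ _
    (fun s ω => X (min s t) ω) (fun s => (hX _).mono (𝒢.mono (min_le_right s t)) le_rfl)
    (fun ω => (hXc ω).comp (by fun_prop))
  have h2 : (fun ω => X (min (σ ω) t) ω)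
      = (fun q : ℝ≥0 × Ω => X (min q.1 t) q.2) ∘ fun ω => (min (σ ω) t, ω) := by
    ext ω; simp
  rw [h2]
  exact h1.comp ((hσ.measurable_min t).prodMk measurable_id)

/-- Values of continuous adapted processes at stopping times. -/
lemma measurable_stopped (hσ : IsStop 𝒢 σ) {β : Type*} [TopologicalSpace β]
    [TopologicalSpace.PseudoMetrizableSpace β] [MeasurableSpace β] [BorelSpace β]
    {X : ℝ≥0 → Ω → β} (hX : ∀ t, Measurable[𝒢 t] (X t)) (hXc : ∀ ω, Continuous fun t => X t ω)
    (s : ℝ≥0) : Measurable[shiftFilt 𝒢 hσ s] fun ω => X (σ ω + s) ω := by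
  intro B hB t
  have h1 := measurable_stopped_min (hσ.add s) hX hXc t hB
  have h2 : (fun ω => X (σ ω + s) ω) ⁻¹' B ∩ {ω | σ ω + s ≤ t}
      = (fun ω => X (min (σ ω + s) t) ω) ⁻¹' B ∩ {ω | σ ω + s ≤ t} := by
    ext ω
    simp only [Set.mem_inter_iff, Set.mem_preimage, Set.mem_ofPred_eq, and_congr_left_iff]
    intro h
    rw [min_eq_left h]
  rw [h2]
  exact h1.inter (hσ.measurableSet_add s t)

lemma measurable_stopped_zero (hσ : IsStop 𝒢 σ) {β : Type*} [TopologicalSpace β]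
    [TopologicalSpace.PseudoMetrizableSpace β] [MeasurableSpace β] [BorelSpace β]
    {X : ℝ≥0 → Ω → β} (hX : ∀ t, Measurable[𝒢 t] (X t)) (hXc : ∀ ω, Continuous fun t => X t ω) :
    Measurable[shiftFilt 𝒢 hσ 0] fun ω => X (σ ω) ω := by
  simpa using measurable_stopped hσ hX hXc 0

lemma le_shiftFilt (hσ : IsStop 𝒢 σ) : 𝒢 0 ≤ shiftFilt 𝒢 hσ 0 :=
  fun D hD t => (𝒢.mono zero_le D hD).inter (hσ.measurableSet_add 0 t)

lemma IsStop.measurable_shiftFilt (hσ : IsStop 𝒢 σ) : Measurable[shiftFilt 𝒢 hσ 0] σ :=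
  measurable_stopped_zero hσ (X := fun t _ => t) (fun _ => measurable_const)
    (fun _ => continuous_id)

lemma cumul_congr_of_lt {f g : ℝ≥0 → ℝ} {t : ℝ≥0} (h : ∀ s < t, f s = g s) :
    cumul f t = cumul g t := by
  rw [cumul, cumul, setIntegral_congr_set (s := Set.Icc 0 t) Ico_ae_eq_Icc.symm,
    setIntegral_congr_set (s := Set.Icc 0 t) Ico_ae_eq_Icc.symm]
  exact setIntegral_congr_fun measurableSet_Ico fun s hs => h s hs.2

lemma measure_eq_tsum_fiber {P : Measure Ω} {c : Ω → ℕ} (hc : Measurable c) {A : Set Ω}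
    (hA : MeasurableSet A) : P A = ∑' k, P (A ∩ c ⁻¹' {k}) := by
  rw [← measure_iUnion]
  · congr 1
    ext ω; simp
  · intro i j hij
    refine Set.disjoint_left.2 fun ω h1 h2 => hij ?_
    rw [← h1.2, ← h2.2]
  · exact fun k => hA.inter (hc (measurableSet_singleton k))

variable {P : Measure Ω} {W : ℝ≥0 → Ω → ℝ × ℝ} [IsProbabilityMeasure P]

omit [IsProbabilityMeasure P] in
-- Rounded up to a grid, the stopping time takes countably many values. On each of them the
-- increment starts at a deterministic time, and the corresponding part of `D` is already known
-- then.
lemma IsBM.incr_ceil (h : IsBM 𝒢 P W) (hσ : IsStop 𝒢 σ) {D : Set Ω}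
    (hD : ∀ t, MeasurableSet[𝒢 t] (D ∩ {ω | σ ω ≤ t})) (hD' : MeasurableSet D) (n : ℕ) (u : ℝ≥0)
    {S : Set (ℝ × ℝ)} (hS : MeasurableSet S) :
    P (D ∩ {ω | W ((⌈σ ω * (n + 1)⌉₊ : ℝ≥0) / (n + 1) + u) ω
      - W ((⌈σ ω * (n + 1)⌉₊ : ℝ≥0) / (n + 1)) ω ∈ S}) = P D * gauss u S := by
  set c : Ω → ℕ := fun ω => ⌈σ ω * (n + 1)⌉₊ with hc
  have hn : (0 : ℝ≥0) < n + 1 := by positivity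
  have hcle : ∀ ω k, c ω ≤ k ↔ σ ω ≤ (k : ℝ≥0) / (n + 1) := fun ω k => by
    rw [hc, Nat.ceil_le, le_div_iff₀ hn]
  have hset : ∀ k j : ℕ, j ≤ k → MeasurableSet[𝒢 ((k : ℝ≥0) / (n + 1))] (D ∩ {ω | c ω ≤ j}) := by
    intro k j hj
    simp only [hcle]
    exact 𝒢.mono (by gcongr) _ (hD _)
  have hfib : ∀ k : ℕ, MeasurableSet[𝒢 ((k : ℝ≥0) / (n + 1))] (D ∩ c ⁻¹' {k}) := by
    intro k
    have : D ∩ c ⁻¹' {k} = (D ∩ {ω | c ω ≤ k}) \ ⋃ j ∈ Finset.range k, (D ∩ {ω | c ω ≤ j}) := by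
      ext ω
      simp only [Set.mem_inter_iff, Set.mem_preimage, Set.mem_singleton_iff, Set.mem_sdiff,
        Set.mem_ofPred_eq, Set.mem_iUnion, Finset.mem_range, not_exists, not_and]
      constructor
      · rintro ⟨h1, h2⟩
        exact ⟨⟨h1, h2.le⟩, fun j hj _ => by omega⟩
      · rintro ⟨⟨h1, h2⟩, h3⟩
        refine ⟨h1, ?_⟩
        by_contra h4
        exact h3 (c ω) (by omega) h1 le_rfl
    rw [this]
    exact (hset k k le_rfl).diff (Finset.measurableSet_biUnion _ fun j hj =>
      hset k j (Finset.mem_range.1 hj).le)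
  have hcm : Measurable c := (hσ.measurable.mul_const _).nat_ceil
  have hjm : ∀ v : ℝ≥0, Measurable fun ω => W ((c ω : ℝ≥0) / (n + 1) + v) ω := fun v => by
    have h1 : Measurable fun ω => ((c ω : ℝ≥0) / (n + 1) + v, ω) :=
      (((measurable_from_nat (f := fun k : ℕ => (k : ℝ≥0))).comp hcm).div_const _ |>.add_const
        v).prodMk measurable_id
    exact h.measurable_joint.comp h1
  have hev : MeasurableSet {ω | W ((c ω : ℝ≥0) / (n + 1) + u) ω - W ((c ω : ℝ≥0) / (n + 1)) ω ∈ S} :=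
    ((hjm u).sub (by simpa using hjm 0)) hS
  change P (D ∩ {ω | W ((c ω : ℝ≥0) / (n + 1) + u) ω - W ((c ω : ℝ≥0) / (n + 1)) ω ∈ S}) = _
  rw [measure_eq_tsum_fiber hcm (hD'.inter hev), measure_eq_tsum_fiber hcm hD',
    ← ENNReal.tsum_mul_right]
  refine tsum_congr fun k => ?_
  rw [← h.incr _ u _ (hfib k) S hS]
  congr 1
  ext ω
  simp only [Set.mem_inter_iff, Set.mem_ofPred_eq, Set.mem_preimage, Set.mem_singleton_iff]
  constructor
  · rintro ⟨⟨h1, h2⟩, h3⟩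
    rw [h3] at h2
    exact ⟨⟨h1, h3⟩, h2⟩
  · rintro ⟨⟨h1, h3⟩, h2⟩
    rw [h3]
    exact ⟨⟨h1, h2⟩, rfl⟩

lemma tendsto_ceil_div (s : ℝ≥0) :
    Tendsto (fun n : ℕ => (⌈s * (n + 1)⌉₊ : ℝ≥0) / (n + 1)) atTop (nhds s) := by
  have h : Tendsto (fun n : ℕ => s + 1 / ((n : ℝ≥0) + 1)) atTop (nhds s) := by
    simpa using (tendsto_one_div_add_atTop_nhds_zero_nat (𝕜 := ℝ≥0)).const_add s
  refine tendsto_of_tendsto_of_tendsto_of_le_of_le tendsto_const_nhds h (fun n => ?_) fun n => ?_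
  · have hn : (0 : ℝ≥0) < n + 1 := by positivity
    exact (le_div_iff₀ hn).2 (Nat.le_ceil _)
  · have hn : (0 : ℝ≥0) < n + 1 := by positivity
    change (⌈s * (n + 1)⌉₊ : ℝ≥0) / (n + 1) ≤ s + 1 / ((n : ℝ≥0) + 1)
    rw [div_le_iff₀ hn, add_mul, one_div, inv_mul_cancel₀ hn.ne']
    exact (Nat.ceil_lt_add_one zero_le).le

lemma tendsto_floor_div (s : ℝ≥0) :
    Tendsto (fun n : ℕ => (⌊s * (n + 1)⌋₊ : ℝ≥0) / (n + 1)) atTop (nhds s) := by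
  have h : Tendsto (fun n : ℕ => s - 1 / ((n : ℝ≥0) + 1)) atTop (nhds s) := by
    have := (tendsto_const_nhds (x := s)).sub (tendsto_one_div_add_atTop_nhds_zero_nat (𝕜 := ℝ≥0))
    simpa using this
  refine tendsto_of_tendsto_of_tendsto_of_le_of_le h tendsto_const_nhds (fun n => ?_) fun n => ?_
  · have hn : (0 : ℝ≥0) < n + 1 := by positivity
    change s - 1 / ((n : ℝ≥0) + 1) ≤ (⌊s * (n + 1)⌋₊ : ℝ≥0) / (n + 1)
    rw [tsub_le_iff_right, ← add_div, le_div_iff₀ hn]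
    exact (Nat.lt_floor_add_one _).le
  · have hn : (0 : ℝ≥0) < n + 1 := by positivity
    exact (div_le_iff₀ hn).2 (Nat.floor_le zero_le)

/-- Increments after a stopping time. -/
lemma IsBM.incr_stopping (h : IsBM 𝒢 P W) (hσ : IsStop 𝒢 σ) {D : Set Ω}
    (hD : ∀ t, MeasurableSet[𝒢 t] (D ∩ {ω | σ ω ≤ t})) (hD' : MeasurableSet D) (u : ℝ≥0)
    {S : Set (ℝ × ℝ)} (hS : MeasurableSet S) :
    P (D ∩ {ω | W (σ ω + u) ω - W (σ ω) ω ∈ S}) = P D * gauss u S := by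
  have hjm : ∀ {τ : Ω → ℝ≥0}, Measurable τ → Measurable fun ω => W (τ ω + u) ω - W (τ ω) ω :=
    fun hτ => (h.measurable_joint.comp ((hτ.add_const u).prodMk measurable_id)).sub
      (h.measurable_joint.comp (hτ.prodMk measurable_id))
  set σn : ℕ → Ω → ℝ≥0 := fun n ω => (⌈σ ω * (n + 1)⌉₊ : ℝ≥0) / (n + 1) with hσn
  have hσm : ∀ n, Measurable (σn n) := fun n =>
    ((measurable_from_nat (f := fun k : ℕ => (k : ℝ≥0))).comp
      (hσ.measurable.mul_const _).nat_ceil).div_const _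
  have hlaw : ∀ n, (P.restrict D).map (fun ω => W (σn n ω + u) ω - W (σn n ω) ω)
      = P D • gauss u := fun n => by
    ext T hT
    rw [Measure.map_apply (hjm (hσm n)) hT, Measure.restrict_apply (hjm (hσm n) hT), Set.inter_comm]
    exact h.incr_ceil hσ hD hD' n u hT
  -- The rounded times converge to `σ` and the paths are continuous, so bounded continuous functions
  -- of the increments converge in expectation. The laws along the sequence do not depend on `n`.
  have hmain : (P.restrict D).map (fun ω => W (σ ω + u) ω - W (σ ω) ω) = P D • gauss u := by
    have : IsFiniteMeasure (P D • gauss u) := by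
      rw [← hlaw 0]
      exact Measure.isFiniteMeasure_map _ _
    refine ext_of_forall_lintegral_eq_of_IsFiniteMeasure fun f => ?_
    rw [lintegral_map f.measurable_coe_ennreal_comp (hjm hσ.measurable)]
    have h1 : Tendsto (fun n => ∫⁻ ω, f (W (σn n ω + u) ω - W (σn n ω) ω) ∂(P.restrict D)) atTop
        (nhds (∫⁻ ω, f (W (σ ω + u) ω - W (σ ω) ω) ∂(P.restrict D))) := by
      refine tendsto_lintegral_of_dominated_convergence (fun _ => (nndist f 0 : ℝ≥0))
        (fun n => f.measurable_coe_ennreal_comp.comp (hjm (hσm n))) (fun n => ?_) ?_ ?_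
      · exact .of_forall fun ω => ENNReal.coe_le_coe.2
          (BoundedContinuousFunction.NNReal.upper_bound f _)
      · rw [lintegral_const]
        exact ENNReal.mul_ne_top ENNReal.coe_ne_top (measure_ne_top _ _)
      · refine .of_forall fun ω => ?_
        have h2 : Continuous fun t => (f (W (t + u) ω - W t ω) : ℝ≥0∞) := by
          have := h.continuous ω
          fun_prop
        exact (h2.tendsto (σ ω)).comp (tendsto_ceil_div (σ ω))
    refine tendsto_nhds_unique h1 (tendsto_const_nhds.congr fun n => ?_)
    rw [← hlaw n, lintegral_map f.measurable_coe_ennreal_comp (hjm (hσm n))]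
  have h3 := congrArg (fun μ => μ S) hmain
  simp only [Measure.smul_apply, smul_eq_mul] at h3
  rw [Measure.map_apply (hjm hσ.measurable) hS, Measure.restrict_apply (hjm hσ.measurable hS),
    Set.inter_comm] at h3
  exact h3

/-- The strong Markov property. -/
theorem IsBM.shift (h : IsBM 𝒢 P W) (hσ : IsStop 𝒢 σ) :
    IsBM (shiftFilt 𝒢 hσ) P fun s ω => shiftPath (W · ω) (σ ω) s where
  adapted s := by
    have h1 := measurable_stopped hσ h.adapted h.continuous s
    have h2 := (measurable_stopped_zero hσ h.adapted h.continuous).mono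
      ((shiftFilt 𝒢 hσ).mono (zero_le (a := s))) le_rfl
    exact h1.sub h2
  continuous ω := continuous_shiftPath (h.continuous ω) _
  zero ω := by simp [shiftPath]
  incr s u D hD S hS := by
    rw [← h.incr_stopping (hσ.add s) hD ((shiftFilt 𝒢 hσ).le s D hD) u hS]
    congr 2
    ext ω
    simp only [shiftPath, Set.mem_ofPred_eq, sub_sub_sub_cancel_right, add_assoc]

end

/-! ### Shifting and concatenating controls -/

section control

variable {p : Params} {𝒢 : Filtration ℝ≥0 mΩ} {σ : Ω → ℝ≥0} {A A' : ℝ≥0 → Ω → ℝ}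

/-- Primitives are continuous adapted processes, so they can be evaluated at the stopping times `σ`
and `σ + s`. Asking for adapted primitives of a control, rather than for progressive measurability,
makes shifts this simple. -/
lemma IsControl.shift (hA : IsControl p 𝒢 A) (hσ : IsStop 𝒢 σ) :
    IsControl p (shiftFilt 𝒢 hσ) fun s ω => A (σ ω + s) ω where
  measurable := hA.measurable.comp
    (((hσ.measurable.comp measurable_snd).add measurable_fst).prodMk measurable_snd)
  pos _ _ := hA.pos _ _
  le _ _ := hA.le _ _
  adapted s := by
    have h0 : ∀ ω, Continuous fun t => cumul (A · ω) t := fun ω =>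
      continuous_cumul (hA.locInt ω)
    have h1 := measurable_stopped hσ hA.adapted h0 s
    have h2 := (measurable_stopped_zero hσ hA.adapted h0).mono
      ((shiftFilt 𝒢 hσ).mono (zero_le (a := s))) le_rfl
    have h3 := h1.sub h2
    have e : (fun ω => cumul (fun u => A (σ ω + u) ω) s) = (fun ω => cumul (A · ω)
        (σ ω + s)) - fun ω => cumul (A · ω) (σ ω) := by
      ext ω
      simp [cumul_shift (hA.locInt ω)]
    rw [e]
    exact h3

/-- Continuous processes adapted to the shifted filtration, seen from the original time. -/
lemma measurable_unshift (hσ : IsStop 𝒢 σ) {X : ℝ≥0 → Ω → ℝ}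
    (hX : ∀ s, Measurable[shiftFilt 𝒢 hσ s] (X s)) (hXc : ∀ ω, Continuous fun s => X s ω)
    {x₀ : ℝ} (hX0 : ∀ ω, X 0 ω = x₀) (t : ℝ≥0) : Measurable[𝒢 t] fun ω => X (t - σ ω) ω := by
  refine @measurable_of_tendsto_metrizable Ω ℝ (𝒢 t) _ _ _ _
    (fun (n : ℕ) ω => X ((⌊(t - σ ω) * (n + 1)⌋₊ : ℝ≥0) / (n + 1)) ω) _ (fun n => ?_) ?_
  · intro B hB
    set c : Ω → ℕ := fun ω => ⌊(t - σ ω) * (n + 1)⌋₊ with hc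
    have hcm : Measurable[𝒢 t] c := Nat.measurable_floor.comp ((hσ.measurable_tsub t).mul_const _)
    have hn : (0 : ℝ≥0) < n + 1 := by positivity
    -- Rounding down keeps `σ + k / (n + 1) ≤ t`, so each piece is an event of the shifted
    -- filtration that is visible at time `t`. Before `σ` the truncated difference is zero, and the
    -- process equals `x₀`.
    have : (fun ω => X ((⌊(t - σ ω) * (n + 1)⌋₊ : ℝ≥0) / (n + 1)) ω) ⁻¹' B
        = (⋃ k : ℕ, (c ⁻¹' {k} ∩ {ω | σ ω ≤ t}) ∩
          ((X ((k : ℝ≥0) / (n + 1)) ⁻¹' B) ∩ {ω | σ ω + (k : ℝ≥0) / (n + 1) ≤ t})) ∪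
          ({ω | σ ω ≤ t}ᶜ ∩ {_ω | x₀ ∈ B}) := by
      ext ω
      simp only [Set.mem_preimage, Set.mem_union, Set.mem_iUnion, Set.mem_inter_iff,
        Set.mem_singleton_iff, Set.mem_ofPred_eq, Set.mem_compl_iff]
      by_cases h : σ ω ≤ t
      · have hk : σ ω + (c ω : ℝ≥0) / (n + 1) ≤ t := by
          have h1 : (c ω : ℝ≥0) / (n + 1) ≤ t - σ ω := by
            rw [div_le_iff₀ hn]; exact Nat.floor_le zero_le
          calc σ ω + (c ω : ℝ≥0) / (n + 1) ≤ σ ω + (t - σ ω) := by gcongr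
            _ = t := add_tsub_cancel_of_le h
        constructor
        · exact fun h1 => Or.inl ⟨c ω, ⟨rfl, h⟩, h1, hk⟩
        · rintro (⟨k, ⟨h1, -⟩, h2, -⟩ | h1)
          · rw [← h1] at h2; exact h2
          · exact absurd h h1.1
      · have h1 : t - σ ω = 0 := tsub_eq_zero_of_le (not_le.1 h).le
        simp [h, h1, hX0]
    rw [this]
    refine MeasurableSet.union (MeasurableSet.iUnion fun k => MeasurableSet.inter
      ((hcm (measurableSet_singleton k)).inter (hσ t)) (hX _ hB t)) ((hσ t).compl.inter
        (@MeasurableSet.const _ (𝒢 t) _))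
  · rw [tendsto_pi_nhds]
    intro ω
    exact ((hXc ω).tendsto _).comp (tendsto_floor_div (t - σ ω))

/-- The process that follows `A` before `σ` and `A'` from `σ` on. -/
def concat (σ : Ω → ℝ≥0) (A A' : ℝ≥0 → Ω → ℝ) (t : ℝ≥0) (ω : Ω) : ℝ :=
  if t < σ ω then A t ω else A' (t - σ ω) ω

lemma concat_of_lt {ω : Ω} {t : ℝ≥0} (h : t < σ ω) : concat σ A A' t ω = A t ω := if_pos h

lemma concat_add (ω : Ω) (s : ℝ≥0) : concat σ A A' (σ ω + s) ω = A' s ω := by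
  rw [concat, if_neg (not_lt.2 le_self_add), add_tsub_cancel_left]

lemma IsControl.concat (hσ : IsStop 𝒢 σ) (hA : IsControl p 𝒢 A)
    (hA' : IsControl p (shiftFilt 𝒢 hσ) A') : IsControl p 𝒢 (concat σ A A') where
  measurable := by
    have h1 : Measurable fun q : ℝ≥0 × Ω => σ q.2 := hσ.measurable.comp measurable_snd
    exact Measurable.ite (measurableSet_lt measurable_fst h1) hA.measurable
      (hA'.measurable.comp ((measurable_fst.sub h1).prodMk measurable_snd))
  pos t ω := by unfold HabitModel.concat; split_ifs; exacts [hA.pos _ _, hA'.pos _ _]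
  le t ω := by unfold HabitModel.concat; split_ifs; exacts [hA.le _ _, hA'.le _ _]
  adapted t := by
    have hm : Measurable fun q : ℝ≥0 × Ω => HabitModel.concat σ A A' q.1 q.2 := by
      have h1 : Measurable fun q : ℝ≥0 × Ω => σ q.2 := hσ.measurable.comp measurable_snd
      exact Measurable.ite (measurableSet_lt measurable_fst h1) hA.measurable
        (hA'.measurable.comp ((measurable_fst.sub h1).prodMk measurable_snd))
    have hl : ∀ ω, LocInt fun s => HabitModel.concat σ A A' s ω := fun ω =>
      locInt_of_bounded (hm.comp measurable_prodMk_right) (C := p.R) fun s => by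
        rw [HabitModel.concat]
        split_ifs
        · rw [abs_of_pos (hA.pos _ _)]; exact hA.le _ _
        · rw [abs_of_pos (hA'.pos _ _)]; exact hA'.le _ _
    have e : ∀ ω, cumul (fun s => HabitModel.concat σ A A' s ω) t
        = cumul (A · ω) (min (σ ω) t) + cumul (A' · ω) (t - σ ω) := by
      intro ω
      have hlt : ∀ u ≤ σ ω, cumul (fun s => HabitModel.concat σ A A' s ω) u
          = cumul (A · ω) u := fun u hu => by
        exact cumul_congr_of_lt fun s hs => concat_of_lt (hs.trans_le hu)
      rcases le_total (σ ω) t with h | h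
      · obtain ⟨s, rfl⟩ := exists_add_of_le h
        rw [cumul_shift (hl ω), hlt _ le_rfl, min_eq_left h, add_tsub_cancel_left]
        simp only [concat_add]
      · rw [min_eq_right h, tsub_eq_zero_of_le h, cumul_zero, add_zero, hlt t h]
    simp_rw [e]
    refine Measurable.add ?_ ?_
    · exact measurable_stopped_min hσ hA.adapted (fun ω => continuous_cumul (hA.locInt ω)) t
    · exact measurable_unshift hσ (X := fun s ω => cumul (A' · ω) s) hA'.adapted
        (fun ω => continuous_cumul (hA'.locInt ω)) (x₀ := 0) (fun ω => cumul_zero _) t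

end control

/-! ### The law of the driving paths and integration with respect to frozen initial data -/

lemma lintegral_of_indep {Ω : Type*} {m mΩ : MeasurableSpace Ω} {P : Measure Ω}
    [IsProbabilityMeasure P] (hm : m ≤ mΩ) {α β : Type*} [MeasurableSpace α] [MeasurableSpace β] {X : Ω → α}
    (hX : Measurable[m] X) {Y : Ω → β} (hY : Measurable Y)
    (h : Indep m (MeasurableSpace.comap Y inferInstance) P) {F : α × β → ℝ≥0∞}
    (hF : Measurable F) :
    ∫⁻ ω, F (X ω, Y ω) ∂P = ∫⁻ ω, ∫⁻ y, F (X ω, y) ∂(P.map Y) ∂P := by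
  have hX' : Measurable X := hX.mono hm le_rfl
  have h1 : IndepFun X Y P := indep_of_indep_of_le_left h hX.comap_le
  have h2 := (indepFun_iff_map_prod_eq_prod_map_map hX'.aemeasurable hY.aemeasurable).1 h1
  have : IsProbabilityMeasure (P.map Y) := Measure.isProbabilityMeasure_map hY.aemeasurable
  have e1 : ∫⁻ ω, F (X ω, Y ω) ∂P = ∫⁻ q, F q ∂(P.map fun ω => (X ω, Y ω)) :=
    (lintegral_map hF (hX'.prodMk hY)).symm
  rw [e1, h2, lintegral_prod _ hF.aemeasurable, lintegral_map hF.lintegral_prod_right' hX']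

/-- The space of continuous paths. -/
abbrev PathSpace : Type := {w : ℝ≥0 → ℝ × ℝ // Continuous w}

namespace IsBM

variable {𝒢 𝒢' : Filtration ℝ≥0 mΩ} {P : Measure Ω} {W W' : ℝ≥0 → Ω → ℝ × ℝ}

/-- The paths as elements of the path space. -/
def path (h : IsBM 𝒢 P W) (ω : Ω) : PathSpace := ⟨fun t => W t ω, h.continuous ω⟩

lemma measurable_path (h : IsBM 𝒢 P W) : Measurable h.path :=
  (measurable_pi_lambda _ h.measurable).subtype_mk

variable [IsProbabilityMeasure P]

/-- The finite-dimensional distributions are universal, and independent of the initial data. -/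
lemma exists_lintegral_prod (P : Measure Ω) [IsProbabilityMeasure P] (I : Finset ℝ≥0) :
    ∀ f : ℝ≥0 → ℝ × ℝ → ℝ≥0∞, (∀ t, Measurable (f t)) → ∃ c : ℝ≥0∞,
      ∀ {𝒢 : Filtration ℝ≥0 mΩ} {W : ℝ≥0 → Ω → ℝ × ℝ}, IsBM 𝒢 P W → ∀ {ζ : Ω → ℝ≥0∞},
        Measurable[𝒢 0] ζ → ∫⁻ ω, ζ ω * ∏ t ∈ I, f t (W t ω) ∂P = (∫⁻ ω, ζ ω ∂P) * c := by
  induction I using Finset.induction_on_max with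
  | empty => exact fun f _ => ⟨1, fun _ _ _ => by simp⟩
  | insert a I ha ih =>
    intro f hf
    set m : ℝ≥0 := I.sup id with hm
    have hIm : ∀ t ∈ I, t ≤ m := fun t ht => Finset.le_sup (f := id) ht
    have hma : m ≤ a := Finset.sup_le fun t ht => (ha t ht).le
    -- The factor at the last time `a` is integrated out given the path up to the preceding time
    -- `m`, which leaves a function of the position at `m` to be merged with the factor there. Only
    -- the Gaussian law of increments enters, so `c` is the same for all Brownian motions.
    set g : ℝ × ℝ → ℝ≥0∞ := fun x => ∫⁻ y, f a (x + y) ∂(gauss (a - m)) with hg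
    have hgF : Measurable fun q : (ℝ × ℝ) × (ℝ × ℝ) => f a (q.1 + q.2) :=
      (hf a).comp (measurable_fst.add measurable_snd)
    have hgm : Measurable g := hgF.lintegral_prod_right'
    have haI : a ∉ I := fun h => lt_irrefl _ (ha a h)
    have hpeel : ∀ {𝒢 : Filtration ℝ≥0 mΩ} {W : ℝ≥0 → Ω → ℝ × ℝ}, IsBM 𝒢 P W →
        ∀ {ζ : Ω → ℝ≥0∞}, Measurable[𝒢 0] ζ →
        ∫⁻ ω, ζ ω * ∏ t ∈ insert a I, f t (W t ω) ∂P
          = ∫⁻ ω, ζ ω * ((∏ t ∈ I, f t (W t ω)) * g (W m ω)) ∂P := by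
      intro 𝒢 W h ζ hζ
      have hη : Measurable[𝒢 m] fun ω => ζ ω * ∏ t ∈ I, f t (W t ω) :=
        (hζ.mono (𝒢.mono zero_le) le_rfl).mul (Finset.measurable_prod _ fun t ht =>
          (hf t).comp ((h.adapted t).mono (𝒢.mono (hIm t ht)) le_rfl))
      have hF : Measurable fun q : (ℝ≥0∞ × (ℝ × ℝ)) × (ℝ × ℝ) => q.1.1 * f a (q.1.2 + q.2) :=
        (measurable_fst.comp measurable_fst).mul
          ((hf a).comp ((measurable_snd.comp measurable_fst).add measurable_snd))
      have h1 := lintegral_of_indep (𝒢.le m) (hη.prodMk (h.adapted m)) (h.measurable_incr m (a - m))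
        (h.indep_incr m (a - m)) hF
      rw [h.map_incr] at h1
      simp only [add_tsub_cancel_of_le hma, add_sub_cancel] at h1
      calc _ = ∫⁻ ω, ζ ω * (∏ t ∈ I, f t (W t ω)) * f a (W a ω) ∂P := by
            refine lintegral_congr fun ω => ?_
            rw [Finset.prod_insert haI]
            ring
        _ = _ := h1
        _ = _ := by
            refine lintegral_congr fun ω => ?_
            have h2 : Measurable fun y => f a (W m ω + y) := (hf a).comp (measurable_const_add _)
            rw [lintegral_const_mul _ h2, mul_assoc]
    rcases I.eq_empty_or_nonempty with hI | hI
    · refine ⟨g 0, fun {𝒢 W} h {ζ} hζ => ?_⟩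
      have h0 : m = 0 := by rw [hm, hI]; rfl
      rw [hpeel h hζ]
      simp only [hI, Finset.prod_empty, one_mul, h0, h.zero]
      exact lintegral_mul_const _ (hζ.mono (𝒢.le 0) le_rfl)
    · have hmI : m ∈ I := by
        obtain ⟨i, hi, hi'⟩ := Finset.exists_mem_eq_sup I hI id
        rw [hm, hi']; exact hi
      obtain ⟨c, hc⟩ := ih (Function.update f m fun x => f m x * g x) (fun t => by
        by_cases ht : t = m
        · subst ht; rw [Function.update_self]; exact (hf _).mul hgm
        · rw [Function.update_of_ne ht]; exact hf t)
      refine ⟨c, fun {𝒢 W} h {ζ} hζ => ?_⟩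
      rw [hpeel h hζ, ← hc h hζ]
      refine lintegral_congr fun ω => ?_
      congr 1
      rw [← Finset.mul_prod_erase _ _ hmI, ← Finset.mul_prod_erase _ _ hmI, Function.update_self,
        mul_right_comm]
      congr 1
      refine Finset.prod_congr rfl fun t ht => ?_
      rw [Function.update_of_ne (Finset.ne_of_mem_erase ht)]

/-- The law of the paths is universal, and the paths are independent of the initial data. -/
lemma map_restrict_path (h : IsBM 𝒢 P W) (h' : IsBM 𝒢' P W') {D : Set Ω}
    (hD : MeasurableSet[𝒢 0] D) : (P.restrict D).map h.path = P D • P.map h'.path := by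
  have hD' : MeasurableSet D := 𝒢.le 0 D hD
  have hfin : IsFiniteMeasure ((P.restrict D).map h.path) := Measure.isFiniteMeasure_map _ _
  refine ext_of_generate_finite
    (Set.preimage Subtype.val '' squareCylinders fun _ : ℝ≥0 => {s : Set (ℝ × ℝ) | MeasurableSet s})
    ?_ ?_ ?_ ?_
  · rw [← MeasurableSpace.comap_generateFrom, generateFrom_squareCylinders]
    rfl
  · exact (isPiSystem_squareCylinders (fun _ => MeasurableSpace.isPiSystem_measurableSet)
      (by simp)).comap Subtype.val
  · rintro _ ⟨_, ⟨I, t, ht, rfl⟩, rfl⟩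
    have ht' : ∀ i, MeasurableSet (t i) := fun i => by simpa using ht i trivial
    have hS : MeasurableSet (Subtype.val ⁻¹' (I : Set ℝ≥0).pi t : Set PathSpace) :=
      measurable_subtype_coe (MeasurableSet.pi I.countable_toSet fun i _ => ht' i)
    obtain ⟨c, hc⟩ := exists_lintegral_prod P I (fun i => (t i).indicator 1)
      (fun i => measurable_one.indicator (ht' i))
    have hprod : ∀ {𝒢 : Filtration ℝ≥0 mΩ} {W : ℝ≥0 → Ω → ℝ × ℝ} (h : IsBM 𝒢 P W) (ω : Ω),
        ∏ i ∈ I, (t i).indicator (1 : ℝ × ℝ → ℝ≥0∞) (W i ω)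
          = (h.path ⁻¹' (Subtype.val ⁻¹' (I : Set ℝ≥0).pi t)).indicator 1 ω := by
      intro 𝒢 W h ω
      by_cases hω : ∀ i ∈ I, W i ω ∈ t i
      · have hmem : ω ∈ h.path ⁻¹' (Subtype.val ⁻¹' (I : Set ℝ≥0).pi t) := fun i hi => hω i hi
        rw [Finset.prod_congr rfl (fun i hi => Set.indicator_of_mem (hω i hi) _),
          Set.indicator_of_mem hmem]
        simp
      · have hmem : ω ∉ h.path ⁻¹' (Subtype.val ⁻¹' (I : Set ℝ≥0).pi t) :=
          fun hmem => hω fun i hi => hmem i hi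
        rw [Set.indicator_of_notMem hmem]
        push Not at hω
        obtain ⟨i, hi, hi'⟩ := hω
        exact Finset.prod_eq_zero hi (Set.indicator_of_notMem hi' _)
    have h1 := hc h (ζ := D.indicator 1)
      ((@measurable_const _ _ _ (𝒢 0) (1 : ℝ≥0∞)).indicator hD)
    have h2 := hc h' (ζ := 1) measurable_const
    simp only [hprod h, hprod h', Pi.one_apply, one_mul, lintegral_one, measure_univ] at h1 h2
    rw [lintegral_indicator_one (h'.measurable_path hS)] at h2
    rw [lintegral_indicator_one hD', ← h2] at h1
    have e : ∀ ω, D.indicator (1 : Ω → ℝ≥0∞) ω *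
        (h.path ⁻¹' (Subtype.val ⁻¹' (I : Set ℝ≥0).pi t)).indicator 1 ω
        = (h.path ⁻¹' (Subtype.val ⁻¹' (I : Set ℝ≥0).pi t) ∩ D).indicator 1 ω := fun ω => by
      rw [Set.inter_comm, Set.inter_indicator_one]; rfl
    simp_rw [e] at h1
    rw [lintegral_indicator_one ((h.measurable_path hS).inter hD')] at h1
    rw [Measure.map_apply h.measurable_path hS, Measure.restrict_apply (h.measurable_path hS), h1,
      Measure.smul_apply, Measure.map_apply h'.measurable_path hS, smul_eq_mul]
  · rw [Measure.map_apply h.measurable_path MeasurableSet.univ, Measure.smul_apply,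
      Measure.map_apply h'.measurable_path MeasurableSet.univ]
    simp

lemma map_path_eq (h : IsBM 𝒢 P W) (h' : IsBM 𝒢' P W') : P.map h.path = P.map h'.path := by
  have := map_restrict_path h h' (D := Set.univ) MeasurableSet.univ
  simpa using this

lemma indep_path (h : IsBM 𝒢 P W) :
    Indep (𝒢 0) (MeasurableSpace.comap h.path inferInstance) P := by
  rw [Indep_iff]
  rintro D _ hD ⟨S, hS, rfl⟩
  have h1 := congrArg (fun μ => μ S) (h.map_restrict_path h hD)
  simp only [Measure.smul_apply, smul_eq_mul] at h1
  rw [Measure.map_apply h.measurable_path hS, Measure.map_apply h.measurable_path hS,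
    Measure.restrict_apply (h.measurable_path hS), Set.inter_comm] at h1
  exact h1

/-- Integration with frozen initial data. -/
lemma lintegral_freeze (h : IsBM 𝒢 P W) {ζ : Ω → ℝ≥0∞} (hζ : Measurable[𝒢 0] ζ)
    {α : Type*} [MeasurableSpace α] {Z : Ω → α} (hZ : Measurable[𝒢 0] Z)
    {G : α × PathSpace → ℝ≥0∞} (hG : Measurable G) :
    ∫⁻ ω, ζ ω * G (Z ω, h.path ω) ∂P
      = ∫⁻ ω, ζ ω * ∫⁻ w, G (Z ω, w) ∂(P.map h.path) ∂P := by
  have hF : Measurable fun q : (ℝ≥0∞ × α) × PathSpace => q.1.1 * G (q.1.2, q.2) :=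
    (measurable_fst.comp measurable_fst).mul
      (hG.comp ((measurable_snd.comp measurable_fst).prodMk measurable_snd))
  rw [lintegral_of_indep (𝒢.le 0) (hζ.prodMk hZ) h.measurable_path h.indep_path hF]
  refine lintegral_congr fun ω => ?_
  have h2 : Measurable fun w => G (Z ω, w) := hG.comp measurable_prodMk_left
  rw [lintegral_const_mul _ h2]

end IsBM

/-! ### Values of piecewise constant controls -/

section values

variable {p : Params}

/-- The losses until `δ` under the constant control `a`, followed by a terminal loss. -/
def stepCost (p : Params) (δ : ℝ≥0) (U : ℝ × ℝ → ℝ≥0∞) (a : ℝ) (z : ℝ × ℝ) (w : ℝ≥0 → ℝ × ℝ) :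
    ℝ≥0∞ :=
  runCost p z (fun _ => a) w (Set.Iio δ) + disc p δ * U (statePath p z (fun _ => a) w δ)

lemma measurable_stepCost (δ : ℝ≥0) {U : ℝ × ℝ → ℝ≥0∞} (hU : Measurable U) :
    Measurable fun q : (ℝ × (ℝ × ℝ)) × PathSpace => stepCost p δ U q.1.1 q.1.2 q.2.1 := by
  have hA : Measurable fun q : ℝ≥0 × ((ℝ × (ℝ × ℝ)) × PathSpace) => q.2.1.1 :=
    measurable_fst.comp (measurable_fst.comp measurable_snd)
  have hW : ∀ s : ℝ≥0, Measurable fun q : (ℝ × (ℝ × ℝ)) × PathSpace => q.2.1 s := fun s =>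
    (measurable_pi_apply s).comp (measurable_subtype_coe.comp measurable_snd)
  have hAl : ∀ q : (ℝ × (ℝ × ℝ)) × PathSpace, LocInt fun _ => q.1.1 :=
    fun _ => continuous_const.locInt
  have hZ : Measurable fun q : (ℝ × (ℝ × ℝ)) × PathSpace => q.1.2 :=
    measurable_snd.comp measurable_fst
  have hδ : Measurable fun q : (ℝ × (ℝ × ℝ)) × PathSpace => (δ, q) := measurable_prodMk_left
  have h1 := measurable_runCost (p := p) (A := fun _ q => q.1.1) hA hAl (fun q => q.2.2) hW hZ
    (Set.Iio δ)
  have h2 := (measurable_statePath_joint (p := p) (A := fun _ q => q.1.1) hA hAl (fun q => q.2.2)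
    hW hZ).comp hδ
  exact h1.add ((hU.comp h2).const_mul _)

/-- The expectation of `stepCost` under the law `ν` of the driving paths. -/
def stepVal (p : Params) (ν : Measure PathSpace) (δ : ℝ≥0) (U : ℝ × ℝ → ℝ≥0∞) (a : ℝ)
    (z : ℝ × ℝ) : ℝ≥0∞ := ∫⁻ w, stepCost p δ U a z w.1 ∂ν

/-- The values of the control problem with piecewise constant controls in a finite set `Λ`. -/
def discVal (p : Params) (ν : Measure PathSpace) (δ : ℝ≥0) (Λ : Finset ℝ) (U₀ : ℝ × ℝ → ℝ≥0∞) :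
    ℕ → ℝ × ℝ → ℝ≥0∞
  | 0 => U₀
  | N + 1 => fun z => ⨅ a ∈ Λ, stepVal p ν δ (discVal p ν δ Λ U₀ N) a z

variable {ν : Measure PathSpace} [SFinite ν] {δ : ℝ≥0} {Λ : Finset ℝ} {U U₀ : ℝ × ℝ → ℝ≥0∞}

lemma measurable_stepVal (hU : Measurable U) :
    Measurable fun q : ℝ × (ℝ × ℝ) => stepVal p ν δ U q.1 q.2 :=
  (measurable_stepCost δ hU).lintegral_prod_right'

lemma measurable_stepVal_right (hU : Measurable U) (a : ℝ) : Measurable (stepVal p ν δ U a) :=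
  Measurable.of_uncurry_left (f := stepVal p ν δ U) (measurable_stepVal hU)

lemma measurable_finset_iInf {α : Type*} [MeasurableSpace α] {F : ℝ → α → ℝ≥0∞}
    (hF : ∀ a, Measurable (F a)) : Measurable fun z => ⨅ a ∈ Λ, F a z := by
  simpa using Measurable.biInf (Λ : Set ℝ) Λ.countable_toSet (fun a _ => hF a)

lemma measurable_discVal (hU₀ : Measurable U₀) (N : ℕ) : Measurable (discVal p ν δ Λ U₀ N) := by
  induction N with
  | zero => exact hU₀
  | succ N ih =>
    exact measurable_finset_iInf (measurable_stepVal_right ih)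

/-- A measurable choice of minimizers in a finite set. -/
lemma exists_measurable_argmin {α : Type*} [MeasurableSpace α] (hΛ : Λ.Nonempty)
    {F : ℝ → α → ℝ≥0∞} (hF : ∀ a, Measurable (F a)) :
    ∃ g : α → ℝ, Measurable g ∧ (∀ z, g z ∈ Λ) ∧ ∀ z, F (g z) z = ⨅ a ∈ Λ, F a z := by
  classical
  induction hΛ using Finset.Nonempty.cons_induction with
  | singleton b => exact ⟨fun _ => b, measurable_const, by simp, by simp⟩
  | cons b Λ hb hΛ ih =>
    obtain ⟨g, hg, hgm, hgF⟩ := ih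
    have hm : Measurable fun z => F (g z) z := by
      simp_rw [hgF]
      exact measurable_finset_iInf hF
    refine ⟨fun z => if F b z ≤ F (g z) z then b else g z,
      Measurable.ite (measurableSet_le (hF b) hm) measurable_const hg, fun z => ?_, fun z => ?_⟩
    · simp only [Finset.mem_cons]
      split_ifs
      · exact Or.inl rfl
      · exact Or.inr (hgm z)
    · rw [Finset.cons_eq_insert, Finset.iInf_insert, ← hgF]
      dsimp only
      split_ifs with h
      · exact (inf_eq_left.2 h).symm
      · exact (inf_eq_right.2 (not_le.1 h).le).symm

end values

/-- `ν` is the law of the paths of Brownian motions on `(Ω, P)`. -/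
def IsPathLaw (P : Measure Ω) (ν : Measure PathSpace) : Prop :=
  ∀ (𝒢 : Filtration ℝ≥0 mΩ) (W : ℝ≥0 → Ω → ℝ × ℝ) (h : IsBM 𝒢 P W), P.map h.path = ν

lemma IsBM.isPathLaw {P : Measure Ω} [IsProbabilityMeasure P] {𝒢 : Filtration ℝ≥0 mΩ}
    {W : ℝ≥0 → Ω → ℝ × ℝ} (h : IsBM 𝒢 P W) : IsPathLaw P (P.map h.path) :=
  fun _ _ h' => h'.map_path_eq h

lemma le_shiftFilt_const (𝒢 : Filtration ℝ≥0 mΩ) (a s : ℝ≥0) :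
    𝒢 (a + s) ≤ shiftFilt 𝒢 (isStop_const 𝒢 a) s := by
  intro D hD t
  by_cases h : a + s ≤ t
  · have : D ∩ {_ω : Ω | a + s ≤ t} = D := by ext; simp [h]
    rw [this]
    exact 𝒢.mono h D hD
  · have : D ∩ {_ω : Ω | a + s ≤ t} = ∅ := by ext; simp [h]
    rw [this]
    exact @MeasurableSet.empty _ (𝒢 t)

section control

variable {p : Params} {𝒢 : Filtration ℝ≥0 mΩ} {P : Measure Ω} {W : ℝ≥0 → Ω → ℝ × ℝ}
  {A : ℝ≥0 → Ω → ℝ} {Z : Ω → ℝ × ℝ}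

lemma IsControl.measurable_state (hA : IsControl p 𝒢 A) (h : IsBM 𝒢 P W)
    (hZ : Measurable[𝒢 0] Z) (t : ℝ≥0) :
    Measurable[𝒢 t] fun ω => statePath p (Z ω) (A · ω) (W · ω) t :=
  measurable_statePath (fun s hs => (hA.adapted s).mono (𝒢.mono hs) le_rfl) hA.locInt h.continuous
    (fun s hs => (h.adapted s).mono (𝒢.mono hs) le_rfl) (hZ.mono (𝒢.mono zero_le) le_rfl)

lemma IsControl.measurable_state_stop (hA : IsControl p 𝒢 A) (h : IsBM 𝒢 P W)
    (hZ : Measurable[𝒢 0] Z) {σ : Ω → ℝ≥0} (hσ : IsStop 𝒢 σ) :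
    Measurable[shiftFilt 𝒢 hσ 0] fun ω =>
      statePath p (Z ω) (A · ω) (W · ω) (σ ω) :=
  measurable_stopped_zero hσ
    (X := fun t ω => statePath p (Z ω) (A · ω) (W · ω) t)
    (hA.measurable_state h hZ) (fun ω => continuous_statePath (hA.locInt ω) (h.continuous ω))

lemma IsControl.state_pos (hA : IsControl p 𝒢 A) (hρ : 0 ≤ p.ρ) (hZ1 : ∀ ω, 0 < (Z ω).1)
    (hZ2 : ∀ ω, 0 < (Z ω).2) (w : ℝ≥0 → ℝ × ℝ) (ω : Ω) (t : ℝ≥0) :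
    0 < (statePath p (Z ω) (A · ω) w t).1 ∧
      0 < (statePath p (Z ω) (A · ω) w t).2 :=
  ⟨capPath_pos (hZ1 ω) t, habPath_pos hρ (hZ1 ω).le (hZ2 ω) (fun t => (hA.pos t ω).le) t⟩

lemma isControl_initial {a : Ω → ℝ} (ha : Measurable[𝒢 0] a) (h0 : ∀ ω, 0 < a ω)
    (hR : ∀ ω, a ω ≤ p.R) : IsControl p 𝒢 fun _ ω => a ω where
  measurable := (ha.mono (𝒢.le 0) le_rfl).comp measurable_snd
  pos _ ω := h0 ω
  le _ ω := hR ω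
  adapted t := by
    simp_rw [cumul_const]
    exact (ha.mono (𝒢.mono zero_le) le_rfl).mul_const _

variable [IsProbabilityMeasure P] {ν : Measure PathSpace} {δ : ℝ≥0} {Λ : Finset ℝ}
  {U U₀ : ℝ × ℝ → ℝ≥0∞} {ζ : Ω → ℝ≥0∞}

lemma IsBM.lintegral_stepCost (h : IsBM 𝒢 P W) (hν : IsPathLaw P ν) (hζ : Measurable[𝒢 0] ζ)
    (hZ : Measurable[𝒢 0] Z) {a : Ω → ℝ} (ha : Measurable[𝒢 0] a) (hU : Measurable U) :
    ∫⁻ ω, ζ ω * stepCost p δ U (a ω) (Z ω) (W · ω) ∂P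
      = ∫⁻ ω, ζ ω * stepVal p ν δ U (a ω) (Z ω) ∂P := by
  rw [← hν 𝒢 W h]
  exact h.lintegral_freeze hζ (ha.prodMk hZ) (measurable_stepCost δ hU)

/-- Controls that are constant on the intervals `[i δ, (i + 1) δ)`, with values in `Λ`. -/
structure IsStepControl (𝒢 : Filtration ℝ≥0 mΩ) (δ : ℝ≥0) (Λ : Finset ℝ) (A : ℝ≥0 → Ω → ℝ) :
    Prop where
  const : ∀ (i : ℕ) (s : ℝ≥0) ω, i * δ ≤ s → s < (i + 1) * δ → A s ω = A (i * δ) ω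
  mem : ∀ (i : ℕ) ω, A (i * δ) ω ∈ Λ
  adapted : ∀ i : ℕ, Measurable[𝒢 (i * δ)] (A (i * δ))

omit [IsProbabilityMeasure P] in
lemma IsStepControl.shift (hA : IsStepControl 𝒢 δ Λ A) :
    IsStepControl (shiftFilt 𝒢 (isStop_const 𝒢 δ)) δ Λ fun s ω => A (δ + s) ω where
  const i s ω h1 h2 := by
    have e : δ + i * δ = ((i + 1 : ℕ) : ℝ≥0) * δ := by push_cast; ring
    rw [e]
    refine hA.const (i + 1) _ ω ?_ ?_
    · rw [← e]; gcongr
    · calc δ + s < δ + (i + 1) * δ := by gcongr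
        _ = _ := by push_cast; ring
  mem i ω := by
    have e : δ + i * δ = ((i + 1 : ℕ) : ℝ≥0) * δ := by push_cast; ring
    rw [e]; exact hA.mem _ _
  adapted i := by
    have e : δ + i * δ = ((i + 1 : ℕ) : ℝ≥0) * δ := by push_cast; ring
    refine Measurable.mono ?_ (le_shiftFilt_const 𝒢 δ (i * δ)) le_rfl
    rw [e]; exact hA.adapted _

/-- The discrete values bound the losses of piecewise constant controls from below. -/
lemma IsStepControl.lintegral_discVal_le (hν : IsPathLaw P ν) [SFinite ν] (hU₀ : Measurable U₀)
    (N : ℕ) : ∀ {𝒢 : Filtration ℝ≥0 mΩ} {W : ℝ≥0 → Ω → ℝ × ℝ} (_ : IsBM 𝒢 P W) {ζ : Ω → ℝ≥0∞}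
      (_ : Measurable[𝒢 0] ζ) {Z : Ω → ℝ × ℝ} (_ : Measurable[𝒢 0] Z) {A : ℝ≥0 → Ω → ℝ}
      (_ : IsControl p 𝒢 A) (_ : IsStepControl 𝒢 δ Λ A),
      ∫⁻ ω, ζ ω * discVal p ν δ Λ U₀ N (Z ω) ∂P ≤
        ∫⁻ ω, ζ ω * (runCost p (Z ω) (A · ω) (W · ω) (Set.Iio (N * δ)) +
          disc p (N * δ) *
            U₀ (statePath p (Z ω) (A · ω) (W · ω) (N * δ))) ∂P := by
  induction N with
  | zero =>
    intro 𝒢 W h ζ hζ Z hZ A hA hstep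
    refine lintegral_mono fun ω => ?_
    rw [Nat.cast_zero, zero_mul, disc_zero, one_mul, statePath_zero (w := fun s => W s ω) (h.zero ω)]
    exact mul_le_mul_right le_add_self _
  | succ N ih =>
    intro 𝒢 W h ζ hζ Z hZ A hA hstep
    have hσ := isStop_const 𝒢 δ
    have hζ' : Measurable ζ := hζ.mono (𝒢.le 0) le_rfl
    have hZ' : Measurable Z := hZ.mono (𝒢.le 0) le_rfl
    have hζs : Measurable[shiftFilt 𝒢 hσ 0] fun ω => ζ ω * disc p δ :=
      (hζ.mono (le_shiftFilt hσ) le_rfl).mul_const _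
    -- The problem after the first step is the same problem for the shifted Brownian motion, with
    -- the state at `δ` as random initial state and the discount factor moved into the weight.
    have hIH := ih (h.shift hσ) hζs (hA.measurable_state_stop h hZ hσ) (hA.shift hσ) hstep.shift
    have hUN : Measurable (discVal p ν δ Λ U₀ N) := measurable_discVal hU₀ N
    have ha : Measurable[𝒢 0] (A 0) :=
      (by simp : ((0 : ℕ) : ℝ≥0) * δ = 0) ▸ hstep.adapted 0
    have hcost : Measurable fun ω => ζ ω *
        runCost p (Z ω) (A · ω) (W · ω) (Set.Iio δ) :=
      hζ'.mul (measurable_runCost hA.measurable hA.locInt h.continuous h.measurable hZ' _)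
    have hA0 : ∀ ω s, s < δ → A s ω = A 0 ω := fun ω s hs => by
      have := hstep.const 0 s ω (by simp) (by simpa using hs)
      simpa using this
    calc ∫⁻ ω, ζ ω * discVal p ν δ Λ U₀ (N + 1) (Z ω) ∂P
        ≤ ∫⁻ ω, ζ ω * stepVal p ν δ (discVal p ν δ Λ U₀ N) (A 0 ω) (Z ω) ∂P := by
          refine lintegral_mono fun ω => mul_le_mul_right ?_ _
          have h1 : A 0 ω ∈ Λ := by simpa using hstep.mem 0 ω
          exact iInf₂_le (A 0 ω) h1
      _ = ∫⁻ ω, ζ ω * stepCost p δ (discVal p ν δ Λ U₀ N) (A 0 ω) (Z ω) (W · ω) ∂P :=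
          (h.lintegral_stepCost hν hζ hZ ha hUN).symm
      _ = ∫⁻ ω, (ζ ω * runCost p (Z ω) (A · ω) (W · ω) (Set.Iio δ) +
            ζ ω * disc p δ * discVal p ν δ Λ U₀ N
              (statePath p (Z ω) (A · ω) (W · ω) δ)) ∂P := by
          refine lintegral_congr fun ω => ?_
          rw [stepCost, runCost_Iio_congr (α := fun _ => A 0 ω) (α' := fun s => A s ω)
            (.of_forall fun s hs => (hA0 ω s hs).symm),
            statePath_congr (α := fun _ => A 0 ω) (α' := fun s => A s ω) (t := δ)
            (.of_forall fun s hs => (hA0 ω s hs).symm) le_rfl]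
          ring
      _ ≤ _ := by
          rw [lintegral_add_left hcost]
          refine (add_le_add le_rfl hIH).trans (le_of_eq ?_)
          rw [← lintegral_add_left hcost]
          refine lintegral_congr fun ω => ?_
          have e : ((N + 1 : ℕ) : ℝ≥0) * δ = δ + N * δ := by push_cast; ring
          rw [e, runCost_Iio_add (hA.locInt ω) (h.continuous ω), disc_add,
            statePath_add (hA.locInt ω) (h.continuous ω)]
          ring

variable {r q : ℝ}

/-- The terminal loss of the discrete problems. -/
def initVal (p : Params) (r q : ℝ) (z : ℝ × ℝ) : ℝ≥0∞ := baseConst p r q * psi p z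

lemma measurable_initVal : Measurable (initVal p r q) := (measurable_psi p).const_mul _

/-- The discrete values are attained by controls. -/
lemma exists_control_lintegral_le (hp : p.Standing) (ha1 : p.a ≤ 1) (hr : BaseRate p r q)
    (hν : IsPathLaw P ν) [SFinite ν] (hΛ : Λ.Nonempty) (hΛ0 : ∀ a ∈ Λ, 0 < a ∧ a ≤ p.R) (N : ℕ) :
    ∀ {𝒢 : Filtration ℝ≥0 mΩ} {W : ℝ≥0 → Ω → ℝ × ℝ} (_ : IsBM 𝒢 P W)
      {Z : Ω → ℝ × ℝ} (_ : Measurable[𝒢 0] Z) (_ : ∀ ω, 0 < (Z ω).1) (_ : ∀ ω, 0 < (Z ω).2),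
      ∃ A : ℝ≥0 → Ω → ℝ, IsControl p 𝒢 A ∧ ∀ {ζ : Ω → ℝ≥0∞}, Measurable[𝒢 0] ζ →
        ∫⁻ ω, ζ ω * runCost p (Z ω) (A · ω) (W · ω) Set.univ ∂P ≤
          ∫⁻ ω, ζ ω * discVal p ν δ Λ (initVal p r q) N (Z ω) ∂P := by
  induction N with
  | zero =>
    intro 𝒢 W h Z hZ hZ1 hZ2
    refine ⟨fun _ _ => r, isControl_initial measurable_const (fun _ => hr.pos) (fun _ => hr.le),
      fun {ζ} hζ => ?_⟩
    simp only [discVal, initVal]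
    -- After the last step the ratio `r` is kept forever; the terminal loss `initVal` was chosen to
    -- bound the loss this causes.
    refine (hr.lintegral_runCost_le h hp ha1 hζ hZ hZ1 hZ2).trans (le_of_eq ?_)
    rw [← lintegral_const_mul' _ _ baseConst_ne_top]
    exact lintegral_congr fun ω => mul_left_comm _ _ _
  | succ N ih =>
    intro 𝒢 W h Z hZ hZ1 hZ2
    have hσ := isStop_const 𝒢 δ
    have hZ' : Measurable Z := hZ.mono (𝒢.le 0) le_rfl
    have hUN : Measurable (discVal p ν δ Λ (initVal p r q) N) :=
      measurable_discVal measurable_initVal N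
    -- A minimum over finitely many ratios is attained at a measurable function of the state, so no
    -- measurable selection theorem is involved.
    obtain ⟨g, hg, hgm, hgF⟩ := exists_measurable_argmin hΛ
      (F := fun a z => stepVal p ν δ (discVal p ν δ Λ (initVal p r q) N) a z)
      (measurable_stepVal_right hUN)
    have ha : Measurable[𝒢 0] fun ω => g (Z ω) := hg.comp hZ
    have hA₁ : IsControl p 𝒢 fun _ ω => g (Z ω) := isControl_initial ha
      (fun ω => (hΛ0 _ (hgm _)).1) (fun ω => (hΛ0 _ (hgm _)).2)
    have hpos := fun ω => hA₁.state_pos hp.ρ_pos.le hZ1 hZ2 (W · ω) ω δ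
    obtain ⟨A', hA', hcost⟩ := ih (h.shift hσ) (hA₁.measurable_state_stop h hZ hσ)
      (fun ω => (hpos ω).1) (fun ω => (hpos ω).2)
    have hA := IsControl.concat hσ hA₁ hA'
    refine ⟨_, hA, fun {ζ} hζ => ?_⟩
    have hζ' : Measurable ζ := hζ.mono (𝒢.le 0) le_rfl
    have hζs : Measurable[shiftFilt 𝒢 hσ 0] fun ω => ζ ω * disc p δ :=
      (hζ.mono (le_shiftFilt hσ) le_rfl).mul_const _
    have hcostm : Measurable fun ω => ζ ω *
        runCost p (Z ω) (fun _ => g (Z ω)) (W · ω) (Set.Iio δ) :=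
      hζ'.mul (measurable_runCost hA₁.measurable hA₁.locInt h.continuous h.measurable hZ' _)
    calc _ = ∫⁻ ω, (ζ ω * runCost p (Z ω) (fun _ => g (Z ω)) (W · ω) (Set.Iio δ) +
            ζ ω * disc p δ * runCost p (statePath p (Z ω) (fun _ => g (Z ω)) (W · ω) δ)
              (A' · ω) (shiftPath (W · ω) δ) Set.univ) ∂P := by
          refine lintegral_congr fun ω => ?_
          have hc : ∀ s < δ, concat (fun _ => δ) (fun _ ω => g (Z ω)) A' s ω = g (Z ω) :=
            fun s hs => concat_of_lt hs
          have hc' : ∀ s, concat (fun _ => δ) (fun _ ω => g (Z ω)) A' (δ + s) ω = A' s ω :=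
            fun s => concat_add ω s
          rw [runCost_univ_split δ, runCost_Ici (hA.locInt ω) (h.continuous ω),
            runCost_Iio_congr (α' := fun _ => g (Z ω)) (.of_forall hc),
            statePath_congr (α' := fun _ => g (Z ω)) (t := δ) (.of_forall hc)
              le_rfl]
          simp_rw [hc']
          ring
      _ ≤ ∫⁻ ω, (ζ ω * runCost p (Z ω) (fun _ => g (Z ω)) (W · ω) (Set.Iio δ) +
            ζ ω * disc p δ * discVal p ν δ Λ (initVal p r q) N
              (statePath p (Z ω) (fun _ => g (Z ω)) (W · ω) δ)) ∂P := by
          rw [lintegral_add_left hcostm, lintegral_add_left hcostm]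
          exact add_le_add le_rfl (hcost hζs)
      _ = ∫⁻ ω, ζ ω * stepCost p δ (discVal p ν δ Λ (initVal p r q) N) (g (Z ω)) (Z ω)
            (W · ω) ∂P := by
          refine lintegral_congr fun ω => ?_
          rw [stepCost]
          ring
      _ = ∫⁻ ω, ζ ω * stepVal p ν δ (discVal p ν δ Λ (initVal p r q) N) (g (Z ω)) (Z ω) ∂P :=
          h.lintegral_stepCost hν hζ hZ ha hUN
      _ = _ := by simp_rw [hgF]; rfl

/-! ### The candidate for the optimal loss -/

/-- The finite set of controls at level `n`. -/
def controlGrid (p : Params) (r : ℝ) (n : ℕ) : Finset ℝ :=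
  insert r ((Finset.range (n + 1)).image fun i : ℕ => p.R * ((i + 1 : ℝ) / (n + 1)))

lemma controlGrid_nonempty (p : Params) (r : ℝ) (n : ℕ) : (controlGrid p r n).Nonempty :=
  Finset.insert_nonempty _ _

lemma controlGrid_pos_le (hR : 0 < p.R) (hr : 0 < r) (hr' : r ≤ p.R) (n : ℕ) :
    ∀ a ∈ controlGrid p r n, 0 < a ∧ a ≤ p.R := by
  intro a ha
  simp only [controlGrid, Finset.mem_insert, Finset.mem_image, Finset.mem_range] at ha
  rcases ha with rfl | ⟨i, hi, rfl⟩
  · exact ⟨hr, hr'⟩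
  · refine ⟨by positivity, mul_le_of_le_one_right hR.le (div_le_one_of_le₀ ?_ (by positivity))⟩
    exact_mod_cast hi

/-- The value of the level `n` problem with `N` steps of length `1 / (n + 1)`. -/
def levelVal (p : Params) (ν : Measure PathSpace) (r q : ℝ) (n N : ℕ) : ℝ × ℝ → ℝ≥0∞ :=
  discVal p ν (1 / (n + 1)) (controlGrid p r n) (initVal p r q) N

/-- The infimum of the discrete values. -/
def infVal (p : Params) (ν : Measure PathSpace) (r q : ℝ) (z : ℝ × ℝ) : ℝ≥0∞ :=
  ⨅ n, ⨅ N, levelVal p ν r q n N z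

lemma measurable_levelVal [SFinite ν] (n N : ℕ) : Measurable (levelVal p ν r q n N) :=
  measurable_discVal measurable_initVal N

lemma measurable_infVal [SFinite ν] : Measurable (infVal p ν r q) :=
  Measurable.iInf fun n => Measurable.iInf fun N => measurable_levelVal n N

/-- The problem without any step has the finite value `initVal`. -/
lemma infVal_ne_top (z : ℝ × ℝ) : infVal p ν r q z ≠ ∞ := by
  refine ne_top_of_le_ne_top ?_ (iInf₂_le 0 0)
  exact ENNReal.mul_ne_top baseConst_ne_top ENNReal.ofReal_ne_top

end control

/-! ### Convergence of the losses along convergent controls -/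

section pathwise

variable {p : Params} {z : ℝ × ℝ} {α : ℕ → ℝ≥0 → ℝ} {α' : ℝ≥0 → ℝ} {w : ℝ≥0 → ℝ × ℝ} {R : ℝ}

lemma tendsto_cumul {f : ℕ → ℝ≥0 → ℝ} {f' g : ℝ≥0 → ℝ} (hf : ∀ n, LocInt (f n)) (hg : LocInt g)
    (hfg : ∀ n s, |f n s| ≤ g s)
    (hlim : ∀ᵐ s ∂timeMeasure, Tendsto (fun n => f n s) atTop (nhds (f' s))) (t : ℝ≥0) :
    Tendsto (fun n => cumul (f n) t) atTop (nhds (cumul f' t)) :=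
  tendsto_integral_of_dominated_convergence g (fun n => (hf n t).aestronglyMeasurable) (hg t)
    (fun n => .of_forall fun s => by simpa using hfg n s) (ae_restrict_of_ae hlim)

/-- The ratio enters the state only through integrals over time. These converge by domination, as
ratios are at most `R` and the capital grows at most as without consumption. -/
lemma tendsto_statePath (hα : ∀ n, LocInt (α n)) (hw : Continuous w) (h0 : ∀ n s, 0 ≤ α n s)
    (hR : ∀ n s, α n s ≤ R)
    (hlim : ∀ᵐ s ∂timeMeasure, Tendsto (fun n => α n s) atTop (nhds (α' s))) (t : ℝ≥0) :
    Tendsto (fun n => statePath p z (α n) w t) atTop (nhds (statePath p z α' w t)) := by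
  have h1 : ∀ s, Tendsto (fun n => Real.exp (logCap p (α n) w s)) atTop
      (nhds (Real.exp (logCap p α' w s))) := fun s => by
    have := tendsto_cumul hα (continuous_const (y := R)).locInt
      (fun n s => by rw [abs_of_nonneg (h0 n s)]; exact hR n s) hlim s
    exact (Real.continuous_exp.tendsto _).comp ((this.const_sub _).add_const _)
  have h2 : Tendsto (fun n => inflow p (α n) w t) atTop (nhds (inflow p α' w t)) := by
    refine tendsto_cumul (g := fun s => R * (growth p p.B w s / habFactor p w s))
      (fun n => locInt_inflow (hα n) hw) ((continuous_growth_div hw _).locInt.const_mul R)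
      (fun n s => ?_) ?_ t
    · have h3 := habFactor_pos p w s
      have h4 := h0 n s
      rw [abs_of_nonneg (by positivity), mul_comm]
      have h5 := growth_pos (p := p) p.B w s
      refine mul_le_mul (hR n s) ?_ (by positivity) (h4.trans (hR n s))
      gcongr
      exact exp_logCap_le (h0 n) s
    · filter_upwards [hlim] with s hs
      exact ((h1 s).div_const _).mul hs
  exact ((h1 t).const_mul _).prodMk_nhds ((((h2.const_mul _).const_add _)).const_mul _)

lemma continuousAt_lossRate {x : ℝ × ℝ} (h1 : 0 < x.1) (h2 : 0 < x.2) :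
    ContinuousAt (fun q : ℝ × ℝ => lossRate p q.1 q.2) x := by
  unfold lossRate
  have h3 : ContinuousAt (fun q : ℝ × ℝ => q.2 ^ p.γ) x :=
    continuousAt_snd.rpow_const (Or.inl h2.ne')
  have h4 := Real.rpow_pos_of_pos h2 p.γ
  have h5 : ContinuousAt (fun q : ℝ × ℝ => (q.1 / q.2 ^ p.γ) ^ (1 - p.σ)) x :=
    (continuousAt_fst.div h3 h4.ne').rpow_const (Or.inl (div_pos h1 h4).ne')
  exact ENNReal.continuous_ofReal.continuousAt.comp (h5.const_mul _)

lemma continuousAt_psi {x : ℝ × ℝ} (h1 : 0 < x.1) (h2 : 0 < x.2) : ContinuousAt (psi p) x := by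
  unfold psi
  refine ENNReal.continuous_ofReal.continuousAt.comp ?_
  exact (continuousAt_fst.rpow_const (Or.inl h1.ne')).mul
    ((continuousAt_fst.rpow_const (Or.inl h1.ne')).add
      (continuousAt_snd.rpow_const (Or.inl h2.ne')))

lemma tendsto_flowLoss (hp : p.Standing) (hα : ∀ n, LocInt (α n)) (hw : Continuous w)
    (h0 : ∀ n s, 0 ≤ α n s) (hR : ∀ n s, α n s ≤ R) (h0' : ∀ s, 0 < α' s) (hz1 : 0 < z.1)
    (hz2 : 0 < z.2)
    (hlim : ∀ᵐ s ∂timeMeasure, Tendsto (fun n => α n s) atTop (nhds (α' s))) :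
    ∀ᵐ s ∂timeMeasure, Tendsto (fun n => flowLoss p z (α n) w s) atTop
      (nhds (flowLoss p z α' w s)) := by
  filter_upwards [hlim] with s hs
  have h1 := tendsto_statePath (p := p) (z := z) hα hw h0 hR hlim s
  have h2 := (continuous_fst.tendsto _).comp h1
  have h3 := (continuous_snd.tendsto _).comp h1
  have hc := capPath_pos (p := p) (α := α') (w := w) hz1 s
  have hh := habPath_pos (w := w) hp.ρ_pos.le hz1.le hz2 (fun t => (h0' t).le) s
  have h4 := (continuousAt_lossRate (p := p) (x := (α' s * capPath p z α' w s, habPath p z α' w s))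
    (mul_pos (h0' s) hc) hh).tendsto.comp ((hs.mul h2).prodMk_nhds h3)
  exact ENNReal.Tendsto.const_mul h4 (Or.inr (disc_ne_top p s))

/-- A bound of the weight of the state that does not depend on the control. -/
def psiBound (p : Params) (z : ℝ × ℝ) (w : ℝ≥0 → ℝ × ℝ) (t : ℝ≥0) : ℝ≥0∞ :=
  ENNReal.ofReal (Real.exp (-(p.R * t)) ^ (-p.b)) *
    envelope p z (growth p p.B w t) (relHab p p.B p.R w t)

end pathwise

section expectation

variable {p : Params} {𝒢 : Filtration ℝ≥0 mΩ} {P : Measure Ω} {W : ℝ≥0 → Ω → ℝ × ℝ}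
  {Z : Ω → ℝ × ℝ} {ζ : Ω → ℝ≥0∞}

lemma measurable_psiBound (h : IsBM 𝒢 P W) (hZ : Measurable Z) :
    Measurable fun q : ℝ≥0 × Ω => psiBound p (Z q.2) (W · q.2) q.1 := by
  have hg : Measurable fun q : ℝ≥0 × Ω => growth p p.B (W · q.2) q.1 := by
    have := h.measurable_joint
    unfold growth; fun_prop
  have hE : Measurable fun q : ℝ≥0 × Ω => habFactor p (W · q.2) q.1 := by
    have := h.measurable_joint
    unfold habFactor; fun_prop
  have hQ : Measurable fun q : ℝ≥0 × Ω => cumul (fun s => growth p p.B (W · q.2) s /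
      habFactor p (W · q.2) s) q.1 :=
    measurable_uncurry_of_continuous_paths
      (D := fun t ω => cumul (fun s => growth p p.B (W · ω) s /
        habFactor p (W · ω) s) t)
      (fun t => measurable_cumul (hg.div hE) t)
      (fun ω => continuous_cumul (continuous_growth_div (h.continuous ω) _).locInt)
  have hH : Measurable fun q : ℝ≥0 × Ω => relHab p p.B p.R (W · q.2) q.1 :=
    hE.mul ((hQ.const_mul _).const_add _)
  have hz1 : Measurable fun q : ℝ≥0 × Ω => (Z q.2).1 :=
    measurable_fst.comp (hZ.comp measurable_snd)
  have hz2 : Measurable fun q : ℝ≥0 × Ω => (Z q.2).2 :=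
    measurable_snd.comp (hZ.comp measurable_snd)
  have ht : Measurable fun q : ℝ≥0 × Ω => (q.1 : ℝ) := by fun_prop
  unfold psiBound envelope
  fun_prop

variable [IsProbabilityMeasure P]

lemma lintegral_psiBound_le (h : IsBM 𝒢 P W) (hp : p.Standing) (ha1 : p.a ≤ 1)
    (hζ : Measurable[𝒢 0] ζ) (hZ : Measurable[𝒢 0] Z)
    (hZ1 : ∀ ω, 0 < (Z ω).1) (hZ2 : ∀ ω, 0 < (Z ω).2) {t T : ℝ≥0} (htT : t ≤ T) :
    ∫⁻ ω, ζ ω * psiBound p (Z ω) (W · ω) t ∂P ≤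
      ENNReal.ofReal ((2 + p.ρ * p.R * T) * Real.exp (|p.b * p.R + lossGrowth p p.B| * T)) *
        ∫⁻ ω, ζ ω * psi p (Z ω) ∂P := by
  refine (lintegral_psi_statePath_le h hp ha1 hζ hZ hZ1 hZ2 t).trans ?_
  have hρ := hp.ρ_pos
  have hR := hp.R_pos
  have h1 : (t : ℝ) ≤ T := by exact_mod_cast htT
  have h2 := NNReal.coe_nonneg t
  refine mul_le_mul_left (ENNReal.ofReal_le_ofReal ?_) _
  have h3 : (p.b * p.R + lossGrowth p p.B) * t ≤ |p.b * p.R + lossGrowth p p.B| * T :=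
    mul_le_mul (le_abs_self _) h1 h2 (abs_nonneg _)
  gcongr

/-- The losses over a finite horizon, with a terminal loss, depend continuously on the control as
long as the control is bounded from below. -/
theorem tendsto_lintegral_cost (h : IsBM 𝒢 P W) (hp : p.Standing) (ha1 : p.a ≤ 1)
    (hζ : Measurable[𝒢 0] ζ) (hZ : Measurable[𝒢 0] Z)
    (hZ1 : ∀ ω, 0 < (Z ω).1) (hZ2 : ∀ ω, 0 < (Z ω).2) (hfin : ∫⁻ ω, ζ ω * psi p (Z ω) ∂P ≠ ∞)
    {A : ℕ → ℝ≥0 → Ω → ℝ} {A' : ℝ≥0 → Ω → ℝ} (hA : ∀ m, IsControl p 𝒢 (A m))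
    (hA' : IsControl p 𝒢 A') {e : ℝ} (he : 0 < e) (heA : ∀ m s ω, e ≤ A m s ω)
    (hlim : ∀ ω, ∀ᵐ s ∂timeMeasure, Tendsto (fun m => A m s ω) atTop (nhds (A' s ω)))
    (T : ℝ≥0) {C : ℝ≥0∞} (hC : C ≠ ∞) :
    Tendsto (fun m => ∫⁻ ω, ζ ω * (runCost p (Z ω) (fun s => A m s ω) (W · ω) (Set.Iio T) +
        disc p T * (C * psi p (statePath p (Z ω) (fun s => A m s ω) (W · ω) T))) ∂P) atTop
      (nhds (∫⁻ ω, ζ ω * (runCost p (Z ω) (A' · ω) (W · ω) (Set.Iio T) +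
        disc p T * (C * psi p (statePath p (Z ω) (A' · ω) (W · ω) T))) ∂P)) := by
  have hb := hp.b_pos
  have hζ' : Measurable ζ := hζ.mono (𝒢.le 0) le_rfl
  have hZ' : Measurable Z := hZ.mono (𝒢.le 0) le_rfl
  have hfl : ∀ {A : ℝ≥0 → Ω → ℝ}, IsControl p 𝒢 A → Measurable fun q : ℝ≥0 × Ω =>
      flowLoss p (Z q.2) (A · q.2) (W · q.2) q.1 := fun {A} hA =>
    measurable_flowLoss hA.measurable hA.locInt h.continuous h.measurable hZ'
  have hB := measurable_psiBound (p := p) h hZ'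
  set κ : ℝ≥0∞ := ENNReal.ofReal (e ^ (-p.b) / p.b) with hκ
  have hκ' : κ ≠ ∞ := ENNReal.ofReal_ne_top
  set M : ℝ≥0∞ := ENNReal.ofReal ((2 + p.ρ * p.R * T) *
    Real.exp (|p.b * p.R + lossGrowth p p.B| * T)) * ∫⁻ ω, ζ ω * psi p (Z ω) ∂P with hM
  have hM' : M ≠ ∞ := ENNReal.mul_ne_top ENNReal.ofReal_ne_top hfin
  have hψ : ∀ {A : ℝ≥0 → Ω → ℝ}, IsControl p 𝒢 A → ∀ ω s,
      psi p (statePath p (Z ω) (A · ω) (W · ω) s)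
        ≤ psiBound p (Z ω) (W · ω) s := fun {A} hA ω s =>
    psi_statePath_le hp (hA.locInt ω) (h.continuous ω) (fun t => (hA.pos t ω).le)
      (fun t => hA.le t ω) (hZ1 ω) (hZ2 ω) s
  -- The dominating function: the floor `e` bounds the loss by a multiple of `psi`, and `psiBound`
  -- bounds `psi` along the state independently of the control. Its expectation is finite on the
  -- finite horizon `T`.
  set D : Ω → ℝ≥0∞ := fun ω => ∫⁻ s in Set.Iio T,
    ζ ω * (κ * psiBound p (Z ω) (W · ω) s) ∂timeMeasure with hD
  have hjm : Measurable fun q : Ω × ℝ≥0 => ζ q.1 * (κ * psiBound p (Z q.1) (W · q.1) q.2) :=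
    (hζ'.comp measurable_fst).mul ((hB.comp measurable_swap).const_mul _)
  have hDm : Measurable D := hjm.lintegral_prod_right'
  have hDfin : ∫⁻ ω, D ω ∂P ≠ ∞ := by
    rw [hD, lintegral_lintegral_swap hjm.aemeasurable]
    refine ne_top_of_le_ne_top ?_ (setLIntegral_mono' (g := fun _ => κ * M) measurableSet_Iio
      fun s hs => ?_)
    · rw [setLIntegral_const]
      refine ENNReal.mul_ne_top (ENNReal.mul_ne_top hκ' hM') ?_
      rw [show Set.Iio T = Set.Ico 0 T by ext; simp, timeMeasure_Ico]
      exact ENNReal.ofReal_ne_top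
    · simp_rw [mul_left_comm (ζ _)]
      rw [lintegral_const_mul' _ _ hκ']
      exact mul_le_mul_right (lintegral_psiBound_le h hp ha1 hζ hZ hZ1 hZ2 (le_of_lt hs)) _
  have hDae : ∀ᵐ ω ∂P, D ω ≠ ∞ := by
    filter_upwards [ae_lt_top hDm hDfin] with ω hω using hω.ne
  have hflow : ∀ m ω s, flowLoss p (Z ω) (fun s => A m s ω) (W · ω) s
      ≤ κ * psiBound p (Z ω) (W · ω) s := fun m ω s => by
    refine (flowLoss_le_psi hp he s (heA m s ω) (fun t => ((hA m).pos t ω).le) (hZ1 ω)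
      (hZ2 ω)).trans (mul_le_mul_right ?_ _)
    calc _ ≤ 1 * psi p (statePath p (Z ω) (fun s => A m s ω) (W · ω) s) :=
          mul_le_mul_left (disc_le_one hp.θ_pos.le s) _
      _ ≤ _ := by rw [one_mul]; exact hψ (hA m) ω s
  have hin : ∀ {A : ℝ≥0 → Ω → ℝ}, IsControl p 𝒢 A → ∀ ω,
      ζ ω * runCost p (Z ω) (A · ω) (W · ω) (Set.Iio T)
        = ∫⁻ s in Set.Iio T, ζ ω * flowLoss p (Z ω) (A · ω) (W · ω) s
          ∂timeMeasure := fun {A} hA ω => by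
    have hm : Measurable fun s => flowLoss p (Z ω) (A · ω) (W · ω) s :=
      (hfl hA).comp measurable_prodMk_right
    rw [runCost, lintegral_const_mul _ hm]
  have hst : ∀ {A : ℝ≥0 → Ω → ℝ}, IsControl p 𝒢 A → Measurable fun ω =>
      psi p (statePath p (Z ω) (A · ω) (W · ω) T) := fun {A} hA =>
    (measurable_psi p).comp ((hA.measurable_state h hZ T).mono (𝒢.le T) le_rfl)
  have hrc : ∀ {A : ℝ≥0 → Ω → ℝ}, IsControl p 𝒢 A → Measurable fun ω =>
      runCost p (Z ω) (A · ω) (W · ω) (Set.Iio T) := fun {A} hA =>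
    measurable_runCost hA.measurable hA.locInt h.continuous h.measurable hZ' _
  have hBT : Measurable fun ω => ζ ω * (disc p T * (C * psiBound p (Z ω) (W · ω) T)) :=
    hζ'.mul (((hB.comp measurable_prodMk_left).const_mul _).const_mul _)
  have hFm : ∀ m, Measurable fun ω => ζ ω *
      (runCost p (Z ω) (fun s => A m s ω) (W · ω) (Set.Iio T) +
        disc p T * (C * psi p (statePath p (Z ω) (fun s => A m s ω) (W · ω) T))) :=
    fun m => hζ'.mul ((hrc (hA m)).add (((hst (hA m)).const_mul _).const_mul _))
  refine tendsto_lintegral_of_dominated_convergence (fun ω => D ω +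
      ζ ω * (disc p T * (C * psiBound p (Z ω) (W · ω) T))) hFm
    (fun m => .of_forall fun ω => ?_) ?_ ?_
  · dsimp only
    rw [mul_add, hin (hA m)]
    refine add_le_add ?_ ?_
    · exact lintegral_mono fun s => mul_le_mul_right (hflow m ω s) _
    · exact mul_le_mul_right (mul_le_mul_right (mul_le_mul_right (hψ (hA m) ω T) _) _) _
  · rw [lintegral_add_left hDm]
    refine ENNReal.add_ne_top.2 ⟨hDfin, ?_⟩
    have e1 : ∀ ω, ζ ω * (disc p T * (C * psiBound p (Z ω) (W · ω) T))
        = disc p T * C * (ζ ω * psiBound p (Z ω) (W · ω) T) := fun ω => by ring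
    simp_rw [e1]
    have hdc := ENNReal.mul_ne_top (disc_ne_top p T) hC
    rw [lintegral_const_mul' _ _ hdc]
    exact ENNReal.mul_ne_top hdc (ne_top_of_le_ne_top hM'
      (lintegral_psiBound_le h hp ha1 hζ hZ hZ1 hZ2 le_rfl))
  · have hfinT : ∀ᵐ ω ∂P, ζ ω * psi p (Z ω) ≠ ∞ := by
      have hm : Measurable fun ω => ζ ω * psi p (Z ω) := hζ'.mul ((measurable_psi p).comp hZ')
      filter_upwards [ae_lt_top hm hfin] with ω hω using hω.ne
    filter_upwards [hDae, hfinT] with ω hω hωT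
    have hψ0 : psi p (Z ω) ≠ 0 := by
      have h1 := hZ1 ω
      have h2 := hZ2 ω
      simp only [psi, ne_eq, ENNReal.ofReal_eq_zero, not_le]
      positivity
    have hζω : ζ ω ≠ ∞ := fun h' => hωT (by rw [h', ENNReal.top_mul hψ0])
    have hp1 : ∀ s, _ := fun s => hA'.state_pos hp.ρ_pos.le hZ1 hZ2 (W · ω) ω s
    have hψlim := (continuousAt_psi (p := p) (hp1 T).1 (hp1 T).2).tendsto.comp
      (tendsto_statePath (p := p) (z := Z ω) (R := p.R) (fun m => (hA m).locInt ω) (h.continuous ω)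
        (fun m s => ((hA m).pos s ω).le) (fun m s => (hA m).le s ω) (hlim ω) T)
    simp_rw [mul_add]
    refine Tendsto.add ?_ ?_
    · simp_rw [hin hA', fun m => hin (hA m) ω]
      refine tendsto_lintegral_of_dominated_convergence
        (fun s => ζ ω * (κ * psiBound p (Z ω) (W · ω) s))
        (fun m => ((hfl (hA m)).comp measurable_prodMk_right).const_mul _)
        (fun m => .of_forall fun s => mul_le_mul_right (hflow m ω s) _) hω
        (ae_restrict_of_ae ?_)
      filter_upwards [tendsto_flowLoss (p := p) (z := Z ω) (R := p.R) hp
        (fun m => (hA m).locInt ω) (h.continuous ω) (fun m s => ((hA m).pos s ω).le)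
        (fun m s => (hA m).le s ω) (fun s => hA'.pos s ω) (hZ1 ω) (hZ2 ω) (hlim ω)] with s hs
      exact ENNReal.Tendsto.const_mul hs (Or.inr hζω)
    · exact ENNReal.Tendsto.const_mul (ENNReal.Tendsto.const_mul (ENNReal.Tendsto.const_mul hψlim
        (Or.inr hC)) (Or.inr (disc_ne_top p T))) (Or.inr hζω)

end expectation

/-! ### Approximation of controls by piecewise constant controls -/

section grid

variable {p : Params} {𝒢 : Filtration ℝ≥0 mΩ} {m : ℕ} {X : ℕ → Ω → ℝ}

/-- The process that equals `X i` on the `i`-th interval of length `1 / (m + 1)`. -/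
def gridControl (m : ℕ) (X : ℕ → Ω → ℝ) (s : ℝ≥0) (ω : Ω) : ℝ := X ⌊s * (m + 1)⌋₊ ω

lemma floor_grid (m i : ℕ) : ⌊(i : ℝ≥0) * (1 / ((m : ℝ≥0) + 1)) * (m + 1)⌋₊ = i := by
  have hm : (m : ℝ≥0) + 1 ≠ 0 := by positivity
  rw [one_div, inv_mul_cancel_right₀ hm, Nat.floor_natCast]

lemma gridControl_apply (i : ℕ) (ω : Ω) :
    gridControl m X (i * (1 / ((m : ℝ≥0) + 1))) ω = X i ω := by
  rw [gridControl, floor_grid]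

lemma measurable_natFloor_pair {m₀ : MeasurableSpace Ω} {Y : ℕ → Ω → ℝ}
    (hY : ∀ i, Measurable (Y i)) (c : ℝ≥0) :
    Measurable fun q : ℝ≥0 × Ω => Y ⌊q.1 * c⌋₊ q.2 := by
  have h1 : Measurable fun q : ℕ × Ω => Y q.1 q.2 := measurable_from_prod_countable_right hY
  have h2 : Measurable fun q : ℝ≥0 × Ω => (⌊q.1 * c⌋₊, q.2) :=
    (Nat.measurable_floor.comp (measurable_fst.mul_const c)).prodMk measurable_snd
  exact h1.comp h2

lemma isStepControl_gridControl {Λ : Finset ℝ} (hΛ : ∀ i ω, X i ω ∈ Λ)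
    (hX : ∀ i : ℕ, Measurable[𝒢 (i * (1 / ((m : ℝ≥0) + 1)))] (X i)) :
    IsStepControl 𝒢 (1 / ((m : ℝ≥0) + 1)) Λ (gridControl m X) where
  const i s ω h1 h2 := by
    have hm : (0 : ℝ≥0) < (m : ℝ≥0) + 1 := by positivity
    rw [gridControl_apply, gridControl]
    congr 1
    rw [Nat.floor_eq_iff zero_le]
    rw [mul_one_div, div_le_iff₀ hm] at h1
    rw [mul_one_div, lt_div_iff₀ hm] at h2
    exact ⟨h1, h2⟩
  mem i ω := by rw [gridControl_apply]; exact hΛ i ω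
  adapted i := by
    have : gridControl m X (i * (1 / ((m : ℝ≥0) + 1))) = X i := by
      ext ω; exact gridControl_apply i ω
    rw [this]; exact hX i

lemma isControl_gridControl (h0 : ∀ i ω, 0 < X i ω) (hR : ∀ i ω, X i ω ≤ p.R)
    (hX : ∀ i : ℕ, Measurable[𝒢 (i * (1 / ((m : ℝ≥0) + 1)))] (X i)) :
    IsControl p 𝒢 (gridControl m X) where
  measurable := by
    have h1 : ∀ i, Measurable (X i) := fun i => (hX i).mono (𝒢.le _) le_rfl
    have h2 := measurable_natFloor_pair h1 ((m : ℝ≥0) + 1)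
    unfold gridControl
    exact h2
  pos _ _ := h0 _ _
  le _ _ := hR _ _
  adapted t := by
    have hm : (0 : ℝ≥0) < (m : ℝ≥0) + 1 := by positivity
    -- Capping the index at `K` changes nothing up to time `t` and leaves only variables that are
    -- measurable with respect to `𝒢 t`.
    set K := ⌊t * (m + 1)⌋₊ with hK
    have hY : ∀ i, Measurable[𝒢 t] (X (min i K)) := fun i => by
      refine (hX _).mono (𝒢.mono ?_) le_rfl
      rw [mul_one_div, div_le_iff₀ hm]
      exact (Nat.cast_le.2 (min_le_right i K)).trans (Nat.floor_le zero_le)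
    have h2 := measurable_natFloor_pair (m₀ := 𝒢 t) hY ((m : ℝ≥0) + 1)
    have h1 := @measurable_cumul Ω (𝒢 t) (fun s ω => X (min ⌊s * (m + 1)⌋₊ K) ω) h2 t
    have e : (fun ω => cumul (fun s => gridControl m X s ω) t)
        = fun ω => cumul (fun s => X (min ⌊s * (m + 1)⌋₊ K) ω) t := by
      ext ω
      refine cumul_congr fun s hs => ?_
      rw [gridControl, min_eq_left]
      exact Nat.floor_le_floor (by gcongr)
    rw [e]
    exact h1

end grid

section approx

variable {p : Params} {𝒢 : Filtration ℝ≥0 mΩ}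

lemma cumul_sub_le {α : ℝ≥0 → ℝ} (hα : LocInt α) {R : ℝ} (hR : ∀ s, α s ≤ R) (a : ℝ≥0)
    {b : ℝ≥0} (hab : a ≤ b) : cumul α b - cumul α a ≤ R * (b - a) := by
  obtain ⟨s, rfl⟩ := exists_add_of_le hab
  have h1 := cumul_mono (hα.shift a) (continuous_const (y := R)).locInt s fun u _ => hR (a + u)
  rw [cumul_const] at h1
  rw [cumul_shift hα]
  push_cast
  linarith

/-- The average of `α` over the last interval of length `1 / (m + 1)` before the time
`i / (m + 1)`. -/
def lastMean (m : ℕ) (α : ℝ≥0 → ℝ) (i : ℕ) : ℝ :=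
  ((m : ℝ) + 1) * (cumul α (i * (1 / ((m : ℝ≥0) + 1)))
    - cumul α (i * (1 / ((m : ℝ≥0) + 1)) - 1 / ((m : ℝ≥0) + 1)))

lemma lastMean_le {α : ℝ≥0 → ℝ} (hα : LocInt α) {R : ℝ} (hR0 : 0 ≤ R) (hR : ∀ s, α s ≤ R)
    (m i : ℕ) : lastMean m α i ≤ R := by
  have hm : (0 : ℝ) < (m : ℝ) + 1 := by positivity
  set t : ℝ≥0 := i * (1 / ((m : ℝ≥0) + 1))
  set d : ℝ≥0 := 1 / ((m : ℝ≥0) + 1) with hd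
  have h1 := cumul_sub_le hα hR (t - d) (b := t) tsub_le_self
  have h2 : (t : ℝ) - (t - d : ℝ≥0) ≤ d := by
    have : t ≤ (t - d) + d := le_tsub_add
    have : (t : ℝ) ≤ (t - d : ℝ≥0) + d := by exact_mod_cast this
    linarith
  have h3 : (d : ℝ) = 1 / ((m : ℝ) + 1) := by rw [hd]; push_cast; rfl
  calc lastMean m α i ≤ ((m : ℝ) + 1) * (R * (1 / ((m : ℝ) + 1))) := by
        refine mul_le_mul_of_nonneg_left (h1.trans ?_) hm.le
        rw [← h3]
        gcongr
    _ = R := by field_simp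

lemma ae_ne_timeMeasure (a : ℝ≥0) : ∀ᵐ s ∂timeMeasure, s ≠ a := by
  rw [ae_iff]
  have : {s : ℝ≥0 | ¬ s ≠ a} = Set.Icc a a := by ext; simp
  rw [this, Set.Icc_self, measure_singleton]

/-- The averaging interval lies before the grid point, so that the mean is known there; hence it
need not contain `s`. Still, both of its ends are within two mesh widths of `s`, so
differentiability of the primitive at `s` gives them errors that are small compared with the mesh.
-/
lemma tendsto_lastMean {α : ℝ≥0 → ℝ} (hα : LocInt α) : ∀ᵐ (s : ℝ≥0) ∂timeMeasure,
    Tendsto (fun m : ℕ => lastMean m α ⌊s * (m + 1)⌋₊) atTop (nhds (α s)) := by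
  have h0 := ae_ne_timeMeasure 0
  filter_upwards [ae_hasDerivAt_cumul hα, h0] with s hs hs0
  set F : ℝ → ℝ := fun x => ∫ s in (0 : ℝ)..x, α s.toNNReal with hF
  set d : ℕ → ℝ≥0 := fun m => 1 / ((m : ℝ≥0) + 1) with hd
  set b : ℕ → ℝ≥0 := fun m => (⌊s * (m + 1)⌋₊ : ℝ≥0) * d m with hb
  have hdpos : ∀ m, (0 : ℝ) < d m := fun m => by
    rw [hd]; push_cast; positivity
  have hd0 : Tendsto (fun m => (d m : ℝ)) atTop (nhds 0) := by
    have : (fun m => (d m : ℝ)) = fun m : ℕ => 1 / ((m : ℝ) + 1) := by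
      ext m; rw [hd]; push_cast; rfl
    rw [this]
    exact tendsto_one_div_add_atTop_nhds_zero_nat
  have hb1 : ∀ m, b m ≤ s := fun m => by
    have hm : (0 : ℝ≥0) < (m : ℝ≥0) + 1 := by positivity
    rw [hb, hd]
    simp only [mul_one_div]
    rw [div_le_iff₀ hm]
    exact Nat.floor_le zero_le
  have hb2 : ∀ m, s ≤ b m + d m := fun m => by
    have hm : (0 : ℝ≥0) < (m : ℝ≥0) + 1 := by positivity
    rw [hb, hd]
    simp only [mul_one_div]
    rw [← add_div, le_div_iff₀ hm]
    exact (Nat.lt_floor_add_one _).le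
  have hbm : ∀ m, |(b m : ℝ) - s| ≤ 2 * d m := fun m => by
    have h1 : (b m : ℝ) ≤ s := by exact_mod_cast hb1 m
    have h2 : (s : ℝ) ≤ b m + d m := by exact_mod_cast hb2 m
    have := hdpos m
    rw [abs_le]; constructor <;> linarith
  have hae : ∀ᶠ m in atTop, d m ≤ b m := by
    have h1 : ∀ᶠ m in atTop, (d m : ℝ) < s / 2 :=
      hd0.eventually (gt_mem_nhds (by
        have : (0 : ℝ) < s := NNReal.coe_pos.2 (pos_iff_ne_zero.2 hs0)
        positivity))
    filter_upwards [h1] with m hm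
    have h2 : (s : ℝ) ≤ b m + d m := by exact_mod_cast hb2 m
    have : (d m : ℝ) ≤ b m := by linarith
    exact_mod_cast this
  have ham : ∀ᶠ m in atTop, |((b m : ℝ) - d m) - s| ≤ 2 * d m := by
    filter_upwards with m
    have h1 : (b m : ℝ) ≤ s := by exact_mod_cast hb1 m
    have h2 : (s : ℝ) ≤ b m + d m := by exact_mod_cast hb2 m
    have := hdpos m
    rw [abs_le]; constructor <;> linarith
  have key : ∀ x : ℕ → ℝ, (∀ᶠ m in atTop, |x m - s| ≤ 2 * d m) →
      Tendsto (fun m => (F (x m) - F s - (x m - s) * α s) / d m) atTop (nhds 0) := by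
    intro x hx
    have hO : (fun m => x m - s) =O[atTop] fun m => (d m : ℝ) := by
      refine Asymptotics.IsBigO.of_bound 2 ?_
      filter_upwards [hx] with m hm
      rw [Real.norm_eq_abs, Real.norm_eq_abs, abs_of_pos (hdpos m)]
      exact hm
    have hxs : Tendsto x atTop (nhds (s : ℝ)) := by
      have := hO.trans_tendsto hd0
      simpa using this.add_const (s : ℝ)
    have h1 := (hasDerivAt_iff_isLittleO.1 hs).comp_tendsto hxs
    exact (h1.trans_isBigO hO).tendsto_div_nhds_zero
  have h1 := (key (fun m => b m) (.of_forall hbm)).sub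
    (key (fun m => (b m : ℝ) - d m) ham)
  have h2 := h1.add_const (α s)
  rw [sub_zero, zero_add] at h2
  refine h2.congr' ?_
  filter_upwards [hae] with m hm
  have e1 : ((b m - d m : ℝ≥0) : ℝ) = (b m : ℝ) - d m := NNReal.coe_sub hm
  have e2 : (d m : ℝ) = 1 / ((m : ℝ) + 1) := by rw [hd]; push_cast; rfl
  have hm0 : (m : ℝ) + 1 ≠ 0 := by positivity
  change _ = ((m : ℝ) + 1) * (cumul α (b m) - cumul α (b m - d m))
  rw [cumul_eq_intervalIntegral, cumul_eq_intervalIntegral, e1]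
  change _ = ((m : ℝ) + 1) * (F (b m) - F (b m - d m))
  rw [e2]
  field_simp
  ring

/-- Rounding up to the grid of level `m`. -/
def roundUp (R : ℝ) (m : ℕ) (x : ℝ) : ℝ := R * ((⌈x * (m + 1) / R⌉₊ : ℝ) / (m + 1))

lemma le_roundUp {R : ℝ} (hR : 0 < R) (m : ℕ) (x : ℝ) : x ≤ roundUp R m x := by
  have h := Nat.le_ceil (x * (m + 1) / R)
  have hm : (0 : ℝ) < (m : ℝ) + 1 := by positivity
  rw [div_le_iff₀ hR] at h
  rw [roundUp, ← mul_div_assoc, le_div_iff₀ hm]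
  linarith

lemma roundUp_le {R : ℝ} (hR : 0 < R) (m : ℕ) {x : ℝ} (hx : 0 ≤ x) :
    roundUp R m x ≤ x + R * (1 / ((m : ℝ) + 1)) := by
  have hm : (0 : ℝ) < (m : ℝ) + 1 := by positivity
  have h := (Nat.ceil_lt_add_one (a := x * (m + 1) / R) (by positivity)).le
  calc roundUp R m x ≤ R * ((x * (m + 1) / R + 1) / (m + 1)) := by unfold roundUp; gcongr
    _ = _ := by field_simp

lemma roundUp_mem (r : ℝ) (hR : 0 < p.R) (m : ℕ) {x : ℝ} (hx : 0 < x) (hxR : x ≤ p.R) :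
    roundUp p.R m x ∈ controlGrid p r m := by
  have hm : (0 : ℝ) < (m : ℝ) + 1 := by positivity
  set k := ⌈x * (m + 1) / p.R⌉₊ with hk
  have h1 : 0 < k := Nat.ceil_pos.2 (by positivity)
  have h2 : k ≤ m + 1 := by
    rw [hk, Nat.ceil_le, div_le_iff₀ hR]
    push_cast
    nlinarith
  simp only [controlGrid, Finset.mem_insert, Finset.mem_image, Finset.mem_range]
  refine Or.inr ⟨k - 1, by omega, ?_⟩
  rw [roundUp, ← hk, Nat.cast_sub h1]
  simp

lemma tendsto_roundUp {R : ℝ} (hR : 0 < R) {x : ℕ → ℝ} {y : ℝ} (hx : ∀ m, 0 ≤ x m)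
    (h : Tendsto x atTop (nhds y)) : Tendsto (fun m => roundUp R m (x m)) atTop (nhds y) := by
  have h1 : Tendsto (fun m : ℕ => x m + R * (1 / ((m : ℝ) + 1))) atTop (nhds y) := by
    simpa using h.add (tendsto_one_div_add_atTop_nhds_zero_nat.const_mul R)
  exact tendsto_of_tendsto_of_tendsto_of_le_of_le h h1 (fun m => le_roundUp hR m _)
    fun m => roundUp_le hR m (hx m)

variable {A : ℝ≥0 → Ω → ℝ} {S : Ω → ℝ≥0} {e r : ℝ}

/-- The values of the approximation of level `m` of the control that follows `max A e` before `S`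
and `r` from `S` on. -/
def approxVal (p : Params) (A : ℝ≥0 → Ω → ℝ) (S : Ω → ℝ≥0) (e r : ℝ) (m i : ℕ) (ω : Ω) : ℝ :=
  open scoped Classical in
  if i * (1 / ((m : ℝ≥0) + 1)) < S ω then
    roundUp p.R m (max (lastMean m (A · ω) i) e) else r

lemma approxVal_mem (hA : IsControl p 𝒢 A) (hR : 0 < p.R) (he : 0 < e) (heR : e ≤ p.R) (m i : ℕ)
    (ω : Ω) : approxVal p A S e r m i ω ∈ controlGrid p r m := by
  unfold approxVal
  split_ifs
  · exact roundUp_mem r hR m (lt_of_lt_of_le he (le_max_right _ _))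
      (max_le (lastMean_le (hA.locInt ω) hR.le (fun s => hA.le s ω) m i) heR)
  · exact Finset.mem_insert_self _ _

lemma measurable_approxVal (hA : IsControl p 𝒢 A) (hS : IsStop 𝒢 S) (m i : ℕ) :
    Measurable[𝒢 (i * (1 / ((m : ℝ≥0) + 1)))] (approxVal p A S e r m i) := by
  have h1 : MeasurableSet[𝒢 (i * (1 / ((m : ℝ≥0) + 1)))]
      {ω | (i : ℝ≥0) * (1 / ((m : ℝ≥0) + 1)) < S ω} := by
    have := (hS (i * (1 / ((m : ℝ≥0) + 1)))).compl
    have e : {ω | (i : ℝ≥0) * (1 / ((m : ℝ≥0) + 1)) < S ω}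
        = {ω | S ω ≤ i * (1 / ((m : ℝ≥0) + 1))}ᶜ := by ext; simp
    rw [e]; exact this
  have h2 : Measurable[𝒢 (i * (1 / ((m : ℝ≥0) + 1)))] fun ω => lastMean m (A · ω) i :=
    ((hA.adapted _).sub ((hA.adapted _).mono (𝒢.mono tsub_le_self) le_rfl)).const_mul _
  have h3 : Measurable fun x => roundUp p.R m x := by
    unfold roundUp
    exact (((measurable_from_nat (f := fun k : ℕ => (k : ℝ))).comp
      (Nat.measurable_ceil.comp ((measurable_id.mul_const _).div_const _))).div_const _).const_mul _
  exact Measurable.ite h1 (h3.comp (h2.max measurable_const)) measurable_const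

lemma IsControl.max_const (hA : IsControl p 𝒢 A) (hR : 0 < p.R) (heR : e ≤ p.R) :
    IsControl p 𝒢 fun s ω => max (A s ω) e where
  measurable := hA.measurable.max measurable_const
  pos s ω := lt_of_lt_of_le (hA.pos s ω) (le_max_left _ _)
  le s ω := max_le (hA.le s ω) heR
  adapted t := by
    -- The primitive of a maximum is not a function of the primitive, so adaptedness is read off
    -- from a progressive version.
    obtain ⟨A', hA', -, -, hAA⟩ := hA.exists_progressive hR
    have h1 : IsProgressive 𝒢 fun s ω => max (A' s ω) e := fun i => (hA' i).max measurable_const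
    have h2 : (fun ω => cumul (fun s => max (A s ω) e) t)
        = fun ω => cumul (fun s => max (A' s ω) e) t := by
      ext ω
      exact cumul_congr_ae ((hAA ω).mono fun s hs => by rw [hs]) t
    rw [h2]
    exact IsProgressive.measurable_cumul h1 t

lemma isControl_switch (hA : IsControl p 𝒢 A) (hS : IsStop 𝒢 S) (hR : 0 < p.R)
    (heR : e ≤ p.R) (hr : 0 < r) (hr' : r ≤ p.R) :
    IsControl p 𝒢 (concat S (fun s ω => max (A s ω) e) fun _ _ => r) :=
  (hA.max_const hR heR).concat hS
    (isControl_initial (a := fun _ => r) measurable_const (fun _ => hr) fun _ => hr')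

lemma tendsto_approx (hA : IsControl p 𝒢 A) (hR : 0 < p.R) (he : 0 < e) (ω : Ω) :
    ∀ᵐ s ∂timeMeasure, Tendsto (fun m => gridControl m (approxVal p A S e r m) s ω) atTop
      (nhds (concat S (fun s ω => max (A s ω) e) (fun _ _ => r) s ω)) := by
  have h0 := ae_ne_timeMeasure (S ω)
  filter_upwards [tendsto_lastMean (hA.locInt ω), h0] with s hs hsS
  have hfl : Tendsto (fun m : ℕ => (⌊s * (m + 1)⌋₊ : ℝ≥0) * (1 / ((m : ℝ≥0) + 1))) atTop
      (nhds s) := by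
    simpa only [mul_one_div] using tendsto_floor_div s
  rcases lt_or_gt_of_ne hsS with h | h
  · have e1 : concat S (fun s ω => max (A s ω) e) (fun _ _ => r) s ω = max (A s ω) e :=
      concat_of_lt h
    rw [e1]
    have h1 := tendsto_roundUp hR (fun m => he.le.trans (le_max_right _ _))
      (hs.max (tendsto_const_nhds (x := e)))
    refine h1.congr' ?_
    filter_upwards [hfl.eventually (gt_mem_nhds h)] with m hm
    rw [gridControl, approxVal, if_pos hm]
  · have e1 : concat S (fun s ω => max (A s ω) e) (fun _ _ => r) s ω = r :=
      if_neg (not_lt.2 h.le)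
    rw [e1]
    refine tendsto_const_nhds.congr' ?_
    filter_upwards [hfl.eventually (lt_mem_nhds h)] with m hm
    rw [gridControl, approxVal, if_neg (not_lt.2 hm.le)]

end approx

/-! ### The discrete values bound the losses of all controls -/

section pathwise

variable {p : Params} {z : ℝ × ℝ} {α : ℝ≥0 → ℝ} {w : ℝ≥0 → ℝ × ℝ} {e d : ℝ}

/-- The accumulated inflow at maximal growth, relative to the initial habit. -/
def habitLoad (p : Params) (z : ℝ × ℝ) (w : ℝ≥0 → ℝ × ℝ) (t : ℝ≥0) : ℝ :=
  z.1 / z.2 * cumul (fun s => growth p p.B w s / habFactor p w s) t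

lemma LocInt.max_const (hα : LocInt α) (e : ℝ) : LocInt fun s => max (α s) e := fun t =>
  (hα t).sup ((continuous_const (y := e)).locInt t)

lemma capPath_max_le (hα : LocInt α) (hz1 : 0 < z.1) (t : ℝ≥0) :
    capPath p z (fun s => max (α s) e) w t ≤ capPath p z α w t := by
  have := cumul_mono hα (hα.max_const e) t fun s _ => le_max_left _ _
  refine mul_le_mul_of_nonneg_left (Real.exp_le_exp.2 ?_) hz1.le
  unfold logCap
  linarith

/-- The floor adds at most `e t` to the accumulated ratio, which costs the capital at most the
factor `exp (-d)`. -/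
lemma le_capPath_max (hα : LocInt α) (h0 : ∀ t, 0 < α t) (he : 0 ≤ e) (hz1 : 0 < z.1) {t : ℝ≥0}
    (ht : e * t ≤ d) :
    Real.exp (-d) * capPath p z α w t ≤ capPath p z (fun s => max (α s) e) w t := by
  have h1 := cumul_mono (hα.max_const e) (hα.add (continuous_const (y := e)).locInt) t
    fun s _ => max_le_add_of_nonneg (h0 s).le he
  rw [cumul_add hα continuous_const.locInt, cumul_const] at h1
  unfold capPath
  rw [mul_left_comm, ← Real.exp_add]
  refine mul_le_mul_of_nonneg_left (Real.exp_le_exp.2 ?_) hz1.le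
  unfold logCap
  linarith

/-- The floor adds to the inflow at most `e` times the inflow at maximal growth. Measured against
the initial habit this is `e * habitLoad`, hence at most `d`. -/
lemma habPath_max_le (hρ : 0 ≤ p.ρ) (hα : LocInt α) (hw : Continuous w) (h0 : ∀ t, 0 < α t)
    (he : 0 ≤ e) (hz1 : 0 < z.1) (hz2 : 0 < z.2) {t : ℝ≥0} (ht : e * habitLoad p z w t ≤ d) :
    habPath p z (fun s => max (α s) e) w t ≤ (1 + p.ρ * d) * habPath p z α w t := by
  have hG := (continuous_growth_div (p := p) hw p.B).locInt
  have h1 : inflow p (fun s => max (α s) e) w t ≤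
      inflow p α w t + e * cumul (fun s => growth p p.B w s / habFactor p w s) t := by
    rw [← cumul_const_mul, inflow, inflow, ← cumul_add (locInt_inflow hα hw) (hG.const_mul e)]
    refine cumul_mono (locInt_inflow (hα.max_const e) hw)
      ((locInt_inflow hα hw).add (hG.const_mul e)) t fun s _ => ?_
    have hF := habFactor_pos p w s
    have h2 := cumul_mono hα (hα.max_const e) s fun u _ => le_max_left _ _
    have h3 : Real.exp (logCap p (fun s => max (α s) e) w s) ≤ Real.exp (logCap p α w s) := by
      rw [Real.exp_le_exp]; unfold logCap; linarith
    have h4 := exp_logCap_le (p := p) (w := w) (fun u => (h0 u).le) s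
    calc _ ≤ Real.exp (logCap p α w s) / habFactor p w s * (α s + e) := by
          have := max_le_add_of_nonneg (h0 s).le he
          have := (h0 s).le.trans (le_max_left (α s) e)
          gcongr
      _ = Real.exp (logCap p α w s) / habFactor p w s * α s
          + e * (Real.exp (logCap p α w s) / habFactor p w s) := by ring
      _ ≤ _ := by gcongr
  have h5 := inflow_nonneg (p := p) (w := w) (fun s => (h0 s).le) t
  have h6 : e * (z.1 * cumul (fun s => growth p p.B w s / habFactor p w s) t) ≤ d * z.2 := by
    rw [habitLoad] at ht
    have := mul_le_mul_of_nonneg_right ht hz2.le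
    field_simp at this
    linarith
  unfold habPath
  rw [mul_left_comm]
  refine mul_le_mul_of_nonneg_left ?_ (habFactor_pos p w t).le
  have h7 := mul_le_mul_of_nonneg_left h1 (mul_nonneg hρ hz1.le)
  have h8 := mul_le_mul_of_nonneg_left h6 hρ
  have h9 : 0 ≤ z.1 * cumul (fun s => growth p p.B w s / habFactor p w s) t :=
    mul_nonneg hz1.le (cumul_nonneg t fun s _ =>
      (div_pos (growth_pos _ _ _) (habFactor_pos p w s)).le)
  have h10 : 0 ≤ d := by
    by_contra h
    have := mul_neg_of_neg_of_pos (not_le.1 h) hz2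
    have := mul_nonneg he h9
    linarith
  have h11 : 0 ≤ p.ρ * d * (p.ρ * z.1 * inflow p α w t) := by positivity
  nlinarith

/-- The loss of optimality of the perturbation of a control by a small floor. -/
def floorFactor (p : Params) (d : ℝ) : ℝ≥0∞ := ENNReal.ofReal (Real.exp (p.b * d) * (1 + p.ρ * d))

lemma rpow_le_floorFactor (hp : p.Standing) (ha1 : p.a ≤ 1) (hd : 0 ≤ d) {c c' h h' : ℝ}
    (hc : 0 < c) (hh : 0 < h) (hh' : 0 < h') (hcc : Real.exp (-d) * c ≤ c')
    (hhh : h' ≤ (1 + p.ρ * d) * h) :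
    c' ^ (-p.b) ≤ Real.exp (p.b * d) * c ^ (-p.b) ∧ h' ^ p.a ≤ (1 + p.ρ * d) * h ^ p.a := by
  have hK : 1 ≤ 1 + p.ρ * d := by
    have := mul_nonneg hp.ρ_pos.le hd
    linarith
  constructor
  · calc c' ^ (-p.b) ≤ (Real.exp (-d) * c) ^ (-p.b) :=
          Real.rpow_le_rpow_of_nonpos (by positivity) hcc (by have := hp.b_pos; linarith)
      _ = _ := by
          rw [Real.mul_rpow (Real.exp_pos _).le hc.le, ← Real.exp_mul]
          congr 2; ring
  · calc h' ^ p.a ≤ ((1 + p.ρ * d) * h) ^ p.a := Real.rpow_le_rpow hh'.le hhh hp.a_nonneg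
      _ = (1 + p.ρ * d) ^ p.a * h ^ p.a := Real.mul_rpow (by linarith) hh.le
      _ ≤ (1 + p.ρ * d) ^ (1 : ℝ) * h ^ p.a := by gcongr
      _ = _ := by rw [Real.rpow_one]

lemma lossRate_le_floorFactor (hp : p.Standing) (ha1 : p.a ≤ 1) (hd : 0 ≤ d) {c c' h h' : ℝ}
    (hc : 0 < c) (hh : 0 < h) (hh' : 0 < h') (hcc : Real.exp (-d) * c ≤ c')
    (hhh : h' ≤ (1 + p.ρ * d) * h) : lossRate p c' h' ≤ floorFactor p d * lossRate p c h := by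
  obtain ⟨h1, h2⟩ := rpow_le_floorFactor hp ha1 hd hc hh hh' hcc hhh
  have hc' : 0 < c' := lt_of_lt_of_le (by positivity) hcc
  have hb := hp.b_pos
  have hK := mul_nonneg hp.ρ_pos.le hd
  rw [lossRate_eq hc hh, lossRate_eq hc' hh', floorFactor, ← ENNReal.ofReal_mul (by positivity)]
  refine ENNReal.ofReal_le_ofReal ?_
  calc _ ≤ 1 / p.b * (Real.exp (p.b * d) * c ^ (-p.b) * ((1 + p.ρ * d) * h ^ p.a)) := by gcongr
    _ = _ := by ring

lemma psi_le_floorFactor (hp : p.Standing) (ha1 : p.a ≤ 1) (hd : 0 ≤ d) {c c' h h' : ℝ}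
    (hc : 0 < c) (hh : 0 < h) (hh' : 0 < h') (hcc : Real.exp (-d) * c ≤ c') (hcc' : c' ≤ c)
    (hhh : h' ≤ (1 + p.ρ * d) * h) : psi p (c', h') ≤ floorFactor p d * psi p (c, h) := by
  obtain ⟨h1, h2⟩ := rpow_le_floorFactor hp ha1 hd hc hh hh' hcc hhh
  have hc' : 0 < c' := lt_of_lt_of_le (by positivity) hcc
  have hK := mul_nonneg hp.ρ_pos.le hd
  have h3 : c' ^ p.a ≤ (1 + p.ρ * d) * c ^ p.a := by
    have h4 := Real.rpow_le_rpow hc'.le hcc' hp.a_nonneg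
    have h5 := Real.rpow_nonneg hc.le p.a
    nlinarith
  rw [psi, psi, floorFactor, ← ENNReal.ofReal_mul (by positivity)]
  refine ENNReal.ofReal_le_ofReal ?_
  calc _ ≤ Real.exp (p.b * d) * c ^ (-p.b) *
        ((1 + p.ρ * d) * c ^ p.a + (1 + p.ρ * d) * h ^ p.a) := by dsimp only; gcongr
    _ = _ := by ring

/-- The larger ratio itself lowers the loss; only the smaller capital and the larger habit raise it,
each by a factor close to one for small `d`. -/
lemma flowLoss_max_le (hp : p.Standing) (ha1 : p.a ≤ 1) (hd : 0 ≤ d) (hα : LocInt α)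
    (hw : Continuous w) (h0 : ∀ t, 0 < α t) (he : 0 ≤ e) (hz1 : 0 < z.1) (hz2 : 0 < z.2) {t : ℝ≥0}
    (ht : e * t ≤ d) (ht' : e * habitLoad p z w t ≤ d) :
    flowLoss p z (fun s => max (α s) e) w t ≤ floorFactor p d * flowLoss p z α w t ∧
      psi p (statePath p z (fun s => max (α s) e) w t) ≤
        floorFactor p d * psi p (statePath p z α w t) := by
  have h1 := le_capPath_max (p := p) (w := w) hα h0 he hz1 ht
  have h2 := habPath_max_le hp.ρ_pos.le hα hw h0 he hz1 hz2 ht'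
  have h3 := capPath_pos (p := p) (α := α) (w := w) hz1 t
  have h4 := habPath_pos (w := w) hp.ρ_pos.le hz1.le hz2 (fun s => (h0 s).le) t
  have h5 := habPath_pos (w := w) hp.ρ_pos.le hz1.le hz2
    (fun s => (h0 s).le.trans (le_max_left (α s) e)) t
  constructor
  · unfold flowLoss
    rw [mul_left_comm]
    refine mul_le_mul_right ?_ _
    refine lossRate_le_floorFactor hp ha1 hd (mul_pos (h0 t) h3) h4 h5 ?_ h2
    have h6 := le_max_left (α t) e
    have h7 := h0 t
    calc _ = α t * (Real.exp (-d) * capPath p z α w t) := by ring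
      _ ≤ max (α t) e * (Real.exp (-d) * capPath p z α w t) := by gcongr
      _ ≤ _ := mul_le_mul_of_nonneg_left h1 (h7.le.trans h6)
  · exact psi_le_floorFactor hp ha1 hd h3 h4 h5 h1 (capPath_max_le hα hz1 t) h2

end pathwise

section control

variable {p : Params} {𝒢 : Filtration ℝ≥0 mΩ} {P : Measure Ω} [IsProbabilityMeasure P]
  {W : ℝ≥0 → Ω → ℝ × ℝ} {A : ℝ≥0 → Ω → ℝ} {Z : Ω → ℝ × ℝ} {ζ : Ω → ℝ≥0∞} {r q : ℝ}
  {σ : Ω → ℝ≥0} {ν : Measure PathSpace}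

lemma measurable_runCost_Ici (hA : IsControl p 𝒢 A) (h : IsBM 𝒢 P W) (hZ : Measurable[𝒢 0] Z)
    (hσ : IsStop 𝒢 σ) :
    Measurable fun ω => runCost p (Z ω) (A · ω) (W · ω) (Set.Ici (σ ω)) := by
  have h1 := h.shift hσ
  have h2 := hA.shift hσ
  have h3 := (hA.measurable_state_stop h hZ hσ).mono ((shiftFilt 𝒢 hσ).le 0) le_rfl
  have h4 := measurable_runCost (p := p) h2.measurable h2.locInt h1.continuous h1.measurable h3 Set.univ
  have e : (fun ω => runCost p (Z ω) (A · ω) (W · ω) (Set.Ici (σ ω))) =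
      fun ω => disc p (σ ω) * runCost p (statePath p (Z ω) (A · ω) (W · ω) (σ ω))
        (fun s => A (σ ω + s) ω) (fun s => shiftPath (W · ω) (σ ω) s) Set.univ := by
    ext ω; exact runCost_Ici (hA.locInt ω) (h.continuous ω) _
  rw [e]
  exact ((measurable_disc p).comp hσ.measurable).mul h4

/-- The lower bound of the losses, at a stopping time. -/
lemma exists_stopped_lower_bound (hp : p.Standing) : ∃ C : ℝ≥0∞, C ≠ ∞ ∧
    ∀ {𝒢 : Filtration ℝ≥0 mΩ} {W : ℝ≥0 → Ω → ℝ × ℝ} (_ : IsBM 𝒢 P W) {ζ : Ω → ℝ≥0∞}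
    (_ : Measurable[𝒢 0] ζ) {Z : Ω → ℝ × ℝ} (_ : Measurable[𝒢 0] Z)
    (_ : ∀ ω, 0 < (Z ω).1) (_ : ∀ ω, 0 < (Z ω).2) {A : ℝ≥0 → Ω → ℝ} (_ : IsControl p 𝒢 A)
    {σ : Ω → ℝ≥0} (_ : IsStop 𝒢 σ),
    ∫⁻ ω, ζ ω * (disc p (σ ω) *
        psi p (statePath p (Z ω) (A · ω) (W · ω) (σ ω))) ∂P ≤
      C * ∫⁻ ω, ζ ω *
        runCost p (Z ω) (A · ω) (W · ω) (Set.Ici (σ ω)) ∂P := by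
  obtain ⟨C, hC, hb⟩ := exists_lower_bound (Ω := Ω) (P := P) hp
  refine ⟨C, hC, fun {𝒢 W} h {ζ} hζ {Z} hZ hZ1 hZ2 {A} hA {σ} hσ => ?_⟩
  have hpos := fun ω => hA.state_pos hp.ρ_pos.le hZ1 hZ2 (W · ω) ω (σ ω)
  have hζ' : Measurable[shiftFilt 𝒢 hσ 0] fun ω => ζ ω * disc p (σ ω) :=
    (hζ.mono (le_shiftFilt hσ) le_rfl).mul ((measurable_disc p).comp hσ.measurable_shiftFilt)
  have h1 := hb (h.shift hσ) hζ' (hA.measurable_state_stop h hZ hσ) (fun ω => (hpos ω).1)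
    (fun ω => (hpos ω).2) (hA.shift hσ)
  simp only [mul_assoc] at h1
  refine h1.trans (mul_le_mul_right (lintegral_mono fun ω => mul_le_mul_right ?_ _) _)
  dsimp only
  rw [runCost_Ici (hA.locInt ω) (h.continuous ω)]
  exact mul_le_mul_right (lintegral_mono_set (Set.subset_univ _)) _

/-- The losses of a control that is constant from a stopping time on. -/
lemma BaseRate.lintegral_runCost_Ici_le (hr : BaseRate p r q) (h : IsBM 𝒢 P W) (hp : p.Standing)
    (ha1 : p.a ≤ 1) (hζ : Measurable[𝒢 0] ζ) (hZ : Measurable[𝒢 0] Z) (hZ1 : ∀ ω, 0 < (Z ω).1)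
    (hZ2 : ∀ ω, 0 < (Z ω).2) (hσ : IsStop 𝒢 σ) (hA : IsControl p 𝒢 A)
    (hAr : ∀ ω s, A (σ ω + s) ω = r) :
    ∫⁻ ω, ζ ω * runCost p (Z ω) (A · ω) (W · ω) (Set.Ici (σ ω)) ∂P ≤
      baseConst p r q * ∫⁻ ω, ζ ω * (disc p (σ ω) *
        psi p (statePath p (Z ω) (A · ω) (W · ω) (σ ω))) ∂P := by
  have hpos := fun ω => hA.state_pos hp.ρ_pos.le hZ1 hZ2 (W · ω) ω (σ ω)
  have hζ' : Measurable[shiftFilt 𝒢 hσ 0] fun ω => ζ ω * disc p (σ ω) :=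
    (hζ.mono (le_shiftFilt hσ) le_rfl).mul ((measurable_disc p).comp hσ.measurable_shiftFilt)
  have h1 := hr.lintegral_runCost_le (h.shift hσ) hp ha1 hζ' (hA.measurable_state_stop h hZ hσ)
    (fun ω => (hpos ω).1) (fun ω => (hpos ω).2)
  simp only [mul_assoc] at h1
  refine le_trans (le_of_eq (lintegral_congr fun ω => ?_)) h1
  rw [runCost_Ici (hA.locInt ω) (h.continuous ω)]
  simp_rw [hAr]

/-- The discrete values bound the losses of the controls that are constant from a stopping time on
and bounded away from zero before. -/
lemma lintegral_infVal_le_switch (h : IsBM 𝒢 P W) (hp : p.Standing) (ha1 : p.a ≤ 1)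
    (hr : BaseRate p r q) (hν : IsPathLaw P ν) [SFinite ν] (hζ : Measurable[𝒢 0] ζ)
    (hZ : Measurable[𝒢 0] Z) (hZ1 : ∀ ω, 0 < (Z ω).1) (hZ2 : ∀ ω, 0 < (Z ω).2)
    (hfin : ∫⁻ ω, ζ ω * psi p (Z ω) ∂P ≠ ∞) (hA : IsControl p 𝒢 A) (hσ : IsStop 𝒢 σ) {e : ℝ}
    (he : 0 < e) (heR : e ≤ p.R) (n : ℕ) {A' : ℝ≥0 → Ω → ℝ}
    (hA' : A' = concat σ (fun s ω => max (A s ω) e) fun _ _ => r) :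
    ∫⁻ ω, ζ ω * infVal p ν r q (Z ω) ∂P ≤
      ∫⁻ ω, ζ ω * (runCost p (Z ω) (A' · ω) (W · ω) (Set.Iio n) +
        disc p n * (baseConst p r q *
          psi p (statePath p (Z ω) (A' · ω) (W · ω) n))) ∂P := by
  have hR := hp.R_pos
  have hmem := fun m i ω => approxVal_mem (S := σ) (r := r) hA hR he heR m i ω
  have hposle := fun m i ω => controlGrid_pos_le hR hr.pos hr.le m _ (hmem m i ω)
  have hmeas := fun m i => measurable_approxVal (e := e) (r := r) hA hσ m i
  have hctrl : ∀ m, IsControl p 𝒢 (gridControl m (approxVal p A σ e r m)) := fun m =>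
    isControl_gridControl (fun i ω => (hposle m i ω).1) (fun i ω => (hposle m i ω).2) (hmeas m)
  -- Rounding up, instead of to the nearest grid point, preserves the floor `e`, so the
  -- approximations are bounded from below uniformly in `m`.
  have hlow : ∀ m s ω, min e r ≤ gridControl m (approxVal p A σ e r m) s ω := fun m s ω => by
    rw [gridControl, approxVal]
    split_ifs
    · exact (min_le_left _ _).trans ((le_max_right _ _).trans (le_roundUp hR m _))
    · exact min_le_right _ _
  have hlim := tendsto_lintegral_cost h hp ha1 hζ hZ hZ1 hZ2 hfin hctrl
    (isControl_switch hA hσ hR heR hr.pos hr.le) (lt_min he hr.pos) hlow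
    (fun ω => tendsto_approx hA hR he ω) n (baseConst_ne_top (p := p) (r := r) (q := q))
  rw [hA']
  refine ge_of_tendsto' hlim fun m => ?_
  have h1 := IsStepControl.lintegral_discVal_le (p := p) hν (measurable_initVal (p := p) (r := r)
    (q := q)) (n * (m + 1)) h hζ hZ (hctrl m) (isStepControl_gridControl (hmem m) (hmeas m))
  -- At mesh `1 / (m + 1)`, the horizon `n` is reached after `n (m + 1)` steps.
  have e1 : ((n * (m + 1) : ℕ) : ℝ≥0) * (1 / ((m : ℝ≥0) + 1)) = n := by
    push_cast; field_simp
  rw [e1] at h1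
  refine le_trans (lintegral_mono fun ω => mul_le_mul_right ?_ _) h1
  exact iInf₂_le (f := fun m N => levelVal p ν r q m N (Z ω)) m (n * (m + 1))

end control

section control

variable {p : Params} {𝒢 : Filtration ℝ≥0 mΩ} {P : Measure Ω}
  {W : ℝ≥0 → Ω → ℝ × ℝ} {A : ℝ≥0 → Ω → ℝ} {Z : Ω → ℝ × ℝ} {ζ : Ω → ℝ≥0∞} {r q : ℝ}
  {ν : Measure PathSpace}

lemma monotone_cumul {f : ℝ≥0 → ℝ} (hf : LocInt f) (h0 : ∀ s, 0 ≤ f s) : Monotone (cumul f) := by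
  intro a b hab
  obtain ⟨s, rfl⟩ := exists_add_of_le hab
  rw [cumul_shift hf]
  linarith [cumul_nonneg s fun u _ => h0 (a + u)]

/-- There are stopping times that tend to infinity up to which the habit load is bounded. -/
lemma IsBM.exists_truncation (h : IsBM 𝒢 P W) (p : Params) (hZ : Measurable[𝒢 0] Z)
    (hZ1 : ∀ ω, 0 < (Z ω).1) (hZ2 : ∀ ω, 0 < (Z ω).2) :
    ∃ S : ℕ → Ω → ℝ≥0, (∀ n, IsStop 𝒢 (S n)) ∧ (∀ n ω, S n ω ≤ n) ∧
      (∀ n ω t, t ≤ S n ω → habitLoad p (Z ω) (W · ω) t ≤ n) ∧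
      ∀ ω t, ∀ᶠ n in atTop, t < S n ω := by
  -- `S n` is the time at which this continuous and strictly increasing clock reads `n`. It is a
  -- stopping time because `S n ≤ t` means that the clock has reached `n` at time `t`, and adding
  -- `t` itself forces `S n ≤ n`.
  set G : Ω → ℝ≥0 → ℝ := fun ω t => t + habitLoad p (Z ω) (W · ω) t with hG
  have hli : ∀ ω, LocInt fun s => growth p p.B (W · ω) s / habFactor p (W · ω) s :=
    fun ω => (continuous_growth_div (h.continuous ω) _).locInt
  have h0 : ∀ ω s, 0 ≤ growth p p.B (W · ω) s / habFactor p (W · ω) s :=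
    fun ω s => (div_pos (growth_pos _ _ _) (habFactor_pos _ _ _)).le
  have hz : ∀ ω, 0 ≤ (Z ω).1 / (Z ω).2 := fun ω => (div_pos (hZ1 ω) (hZ2 ω)).le
  have hL0 : ∀ ω t, 0 ≤ habitLoad p (Z ω) (W · ω) t := fun ω t =>
    mul_nonneg (hz ω) (cumul_nonneg t fun s _ => h0 ω s)
  have hmono : ∀ ω, StrictMono (G ω) := fun ω s t hst =>
    add_lt_add_of_lt_of_le (NNReal.coe_lt_coe.2 hst)
      (mul_le_mul_of_nonneg_left (monotone_cumul (hli ω) (h0 ω) hst.le) (hz ω))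
  have hcont : ∀ ω, Continuous (G ω) := fun ω =>
    NNReal.continuous_coe.add (continuous_const.mul (continuous_cumul (hli ω)))
  have hG0 : ∀ ω, G ω 0 = 0 := fun ω => by simp [hG, habitLoad, cumul_zero]
  have hex : ∀ (n : ℕ) ω, ∃ s, G ω s = n := fun n ω => by
    obtain ⟨s, -, hs⟩ := intermediate_value_Icc (zero_le (a := (n : ℝ≥0))) (hcont ω).continuousOn
      (show (n : ℝ) ∈ Set.Icc (G ω 0) (G ω n) from
        ⟨(hG0 ω).trans_le (Nat.cast_nonneg n), le_add_of_nonneg_right (hL0 ω n)⟩)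
    exact ⟨s, hs⟩
  choose S hS using hex
  have hGm : ∀ t, Measurable[𝒢 t] fun ω => G ω t := fun t => by
    have h1 := measurable_cumul_continuous_mul (m := 𝒢 t) (t := t)
      (g := fun s ω => growth p p.B (W · ω) s / habFactor p (W · ω) s)
      (y := fun _ _ => 1) (fun ω => continuous_growth_div (h.continuous ω) _)
      (fun s hs => ?_) (fun ω => continuous_const.locInt) (fun s _ => measurable_const)
    · simp only [mul_one] at h1
      have h2 := hZ.mono (𝒢.mono (zero_le (a := t))) le_rfl
      exact ((h2.fst.div h2.snd).mul h1).const_add _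
    · have h2 : Measurable[𝒢 t] (W s) := (h.adapted s).mono (𝒢.mono hs) le_rfl
      refine Measurable.div ?_ (measurable_habFactor h2)
      unfold growth
      exact Real.measurable_exp.comp ((h2.fst.const_mul _).const_add _)
  refine ⟨S, fun n t => ?_, fun n ω => ?_, fun n ω t ht => ?_, fun ω t => ?_⟩
  · have : {ω | S n ω ≤ t} = {ω | (n : ℝ) ≤ G ω t} := by
      ext ω
      rw [Set.mem_ofPred_eq, Set.mem_ofPred_eq, ← hS n ω, (hmono ω).le_iff_le]
    rw [this]
    have h1 : Measurable[𝒢 t] fun _ : Ω => (n : ℝ) := measurable_const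
    exact measurableSet_le h1 (hGm t)
  · have h1 : (S n ω : ℝ) ≤ n := by
      rw [← hS n ω]; exact le_add_of_nonneg_right (hL0 ω _)
    exact_mod_cast h1
  · rw [← hS n ω]
    exact (le_add_of_nonneg_left t.coe_nonneg).trans ((hmono ω).le_iff_le.2 ht)
  · obtain ⟨N, hN⟩ := exists_nat_gt (G ω t)
    filter_upwards [eventually_ge_atTop N] with n hn
    rw [← (hmono ω).lt_iff_lt, hS]
    exact hN.trans_le (by exact_mod_cast hn)

variable [IsProbabilityMeasure P]

/-- The control is perturbed: the floor `e` before `S`, the ratio `r` from `S` on. Before `S` the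
losses grow at most by `floorFactor`. After `S` they are at most `baseConst` times the weight at
`S`, which `hC` bounds by the losses of `A` after `S`. The terminal loss at `n` is bounded through
`hC` by the losses of the perturbed control after `S`. -/
lemma lintegral_infVal_le_floor (h : IsBM 𝒢 P W) (hp : p.Standing) (ha1 : p.a ≤ 1)
    (hr : BaseRate p r q) (hν : IsPathLaw P ν) [SFinite ν] {C : ℝ≥0∞} (hC :
      ∀ {A : ℝ≥0 → Ω → ℝ} (_ : IsControl p 𝒢 A) {σ : Ω → ℝ≥0} (_ : IsStop 𝒢 σ),
      ∫⁻ ω, ζ ω * (disc p (σ ω) *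
        psi p (statePath p (Z ω) (A · ω) (W · ω) (σ ω))) ∂P ≤
      C * ∫⁻ ω, ζ ω *
        runCost p (Z ω) (A · ω) (W · ω) (Set.Ici (σ ω)) ∂P)
    (hζ : Measurable[𝒢 0] ζ) (hZ : Measurable[𝒢 0] Z) (hZ1 : ∀ ω, 0 < (Z ω).1)
    (hZ2 : ∀ ω, 0 < (Z ω).2) (hfin : ∫⁻ ω, ζ ω * psi p (Z ω) ∂P ≠ ∞) (hA : IsControl p 𝒢 A)
    {S : Ω → ℝ≥0} (hS : IsStop 𝒢 S) (n : ℕ) (hSn : ∀ ω, S ω ≤ n)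
    (hSl : ∀ ω t, t ≤ S ω → habitLoad p (Z ω) (W · ω) t ≤ n) {e d : ℝ} (he : 0 < e)
    (heR : e ≤ p.R) (hd : e * n ≤ d) :
    ∫⁻ ω, ζ ω * infVal p ν r q (Z ω) ∂P ≤ floorFactor p d *
      (∫⁻ ω, ζ ω * runCost p (Z ω) (A · ω) (W · ω) Set.univ ∂P +
        (1 + baseConst p r q * C) * (baseConst p r q * C) *
        ∫⁻ ω, ζ ω * runCost p (Z ω) (A · ω) (W · ω) (Set.Ici (S ω)) ∂P) := by
  have hd0 : 0 ≤ d := le_trans (by positivity) hd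
  have hζ' : Measurable ζ := hζ.mono (𝒢.le 0) le_rfl
  have hZ' : Measurable Z := hZ.mono (𝒢.le 0) le_rfl
  have hF : floorFactor p d ≠ ∞ := ENNReal.ofReal_ne_top
  have hK : baseConst p r q ≠ ∞ := baseConst_ne_top
  obtain ⟨A', hA'⟩ : ∃ A', A' = concat S (fun s ω => max (A s ω) e) fun _ _ => r := ⟨_, rfl⟩
  have hcA' : IsControl p 𝒢 A' := hA' ▸ isControl_switch hA hS hp.R_pos heR hr.pos hr.le
  have hlt : ∀ ω, ∀ᵐ s ∂timeMeasure, s < S ω → A' s ω = max (A s ω) e := fun ω =>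
    .of_forall fun s hs => by rw [hA', concat_of_lt hs]
  have hpt : ∀ ω t, t ≤ S ω → _ := fun ω t ht => flowLoss_max_le hp ha1 hd0 (hA.locInt ω)
    (h.continuous ω) (fun s => hA.pos s ω) he.le (hZ1 ω) (hZ2 ω) (t := t)
    ((mul_le_mul_of_nonneg_left (by exact_mod_cast ht.trans (hSn ω)) he.le).trans hd)
    ((mul_le_mul_of_nonneg_left (hSl ω t ht) he.le).trans hd)
  have hbefore : ∀ ω, runCost p (Z ω) (A' · ω) (W · ω) (Set.Iio (S ω)) ≤
      floorFactor p d * runCost p (Z ω) (A · ω) (W · ω) Set.univ := fun ω => by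
    rw [runCost_Iio_congr (hlt ω)]
    refine le_trans ?_ (mul_le_mul_right (lintegral_mono_set (Set.subset_univ (Set.Iio (S ω)))) _)
    rw [runCost, ← lintegral_const_mul' _ _ hF]
    exact setLIntegral_mono' measurableSet_Iio fun t ht => (hpt ω t (le_of_lt ht)).1
  set T := ∫⁻ ω, ζ ω *
    runCost p (Z ω) (A' · ω) (W · ω) (Set.Ici (S ω)) ∂P with hT
  set T₀ := ∫⁻ ω, ζ ω *
    runCost p (Z ω) (A · ω) (W · ω) (Set.Ici (S ω)) ∂P with hT₀
  set J₀ := ∫⁻ ω, ζ ω *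
    runCost p (Z ω) (A · ω) (W · ω) Set.univ ∂P with hJ₀
  have hTle : T ≤ floorFactor p d * (baseConst p r q * C * T₀) := by
    calc T ≤ _ := hr.lintegral_runCost_Ici_le h hp ha1 hζ hZ hZ1 hZ2 hS hcA'
          (fun ω s => by rw [hA', concat_add])
      _ ≤ baseConst p r q * (floorFactor p d * ∫⁻ ω, ζ ω * (disc p (S ω) *
          psi p (statePath p (Z ω) (A · ω) (W · ω) (S ω))) ∂P) := by
          refine mul_le_mul_right ?_ _
          rw [← lintegral_const_mul' _ _ hF]
          refine lintegral_mono fun ω => ?_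
          rw [statePath_congr (hlt ω) le_rfl, mul_left_comm (floorFactor p d),
            mul_left_comm (floorFactor p d)]
          exact mul_le_mul_right (mul_le_mul_right (hpt ω _ le_rfl).2 _) _
      _ ≤ baseConst p r q * (floorFactor p d * (C * T₀)) := by gcongr; exact hC hA hS
      _ = _ := by ring
  have hterm : ∫⁻ ω, ζ ω * (disc p n *
      psi p (statePath p (Z ω) (A' · ω) (W · ω) n)) ∂P ≤ C * T := by
    refine (hC hcA' (isStop_const 𝒢 n)).trans (mul_le_mul_right (lintegral_mono fun ω =>
      mul_le_mul_right (lintegral_mono_set (Set.Ici_subset_Ici.2 (hSn ω))) _) _)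
  have hm' : Measurable fun ω => ζ ω *
      runCost p (Z ω) (A' · ω) (W · ω) (Set.Ici (S ω)) :=
    hζ'.mul (measurable_runCost_Ici hcA' h hZ hS)
  have hrun : ∫⁻ ω, ζ ω * runCost p (Z ω) (A' · ω) (W · ω) (Set.Iio n) ∂P ≤
      floorFactor p d * J₀ + T := by
    rw [hJ₀, ← lintegral_const_mul' _ _ hF, hT,
      ← lintegral_add_right _ hm']
    refine lintegral_mono fun ω => ?_
    rw [mul_left_comm, ← mul_add]
    refine mul_le_mul_right (le_trans ?_ (add_le_add (hbefore ω) le_rfl)) _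
    rw [← runCost_univ_split]
    exact lintegral_mono_set (Set.subset_univ _)
  have hm : Measurable fun ω => ζ ω *
      runCost p (Z ω) (A' · ω) (W · ω) (Set.Iio n) :=
    hζ'.mul (measurable_runCost hcA'.measurable hcA'.locInt h.continuous h.measurable hZ' _)
  calc _ ≤ _ := lintegral_infVal_le_switch h hp ha1 hr hν hζ hZ hZ1 hZ2 hfin hA hS he heR n hA'
    _ = ∫⁻ ω, ζ ω * runCost p (Z ω) (A' · ω) (W · ω) (Set.Iio n) ∂P +
        baseConst p r q * ∫⁻ ω, ζ ω * (disc p n *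
          psi p (statePath p (Z ω) (A' · ω) (W · ω) n)) ∂P := by
      rw [← lintegral_const_mul' _ _ hK, ← lintegral_add_left hm]
      exact lintegral_congr fun ω => by ring
    _ ≤ floorFactor p d * J₀ + T + baseConst p r q * (C * T) := by gcongr
    _ = floorFactor p d * J₀ + (1 + baseConst p r q * C) * T := by ring
    _ ≤ floorFactor p d * J₀ +
        (1 + baseConst p r q * C) * (floorFactor p d * (baseConst p r q * C * T₀)) := by gcongr
    _ = _ := by ring

lemma tendsto_floorFactor (p : Params) :
    Tendsto (fun n : ℕ => floorFactor p (p.R * (1 / ((n : ℝ) + 1)))) atTop (nhds 1) := by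
  have h1 : Continuous fun x : ℝ => floorFactor p (p.R * x) := by
    exact ENNReal.continuous_ofReal.comp (by fun_prop)
  have h2 := (h1.tendsto 0).comp tendsto_one_div_add_atTop_nhds_zero_nat
  simpa [floorFactor, Function.comp_def] using h2

/-- The discrete values bound the losses of all controls. -/
theorem lintegral_infVal_le (h : IsBM 𝒢 P W) (hp : p.Standing) (ha1 : p.a ≤ 1)
    (hr : BaseRate p r q) (hν : IsPathLaw P ν) [SFinite ν] (hζ : Measurable[𝒢 0] ζ)
    (hZ : Measurable[𝒢 0] Z) (hZ1 : ∀ ω, 0 < (Z ω).1) (hZ2 : ∀ ω, 0 < (Z ω).2)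
    (hA : IsControl p 𝒢 A) :
    ∫⁻ ω, ζ ω * infVal p ν r q (Z ω) ∂P ≤
      ∫⁻ ω, ζ ω * runCost p (Z ω) (A · ω) (W · ω) Set.univ ∂P := by
  by_cases hJ : ∫⁻ ω, ζ ω * runCost p (Z ω) (A · ω) (W · ω) Set.univ ∂P = ∞
  · rw [hJ]; exact le_top
  have hζ' : Measurable ζ := hζ.mono (𝒢.le 0) le_rfl
  have hZ' : Measurable Z := hZ.mono (𝒢.le 0) le_rfl
  obtain ⟨C, hC, hCle⟩ := exists_stopped_lower_bound (Ω := Ω) (P := P) hp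
  -- The lower bound at time zero: finite losses force the initial weight to be integrable, so no
  -- integrability of the initial state has to be assumed.
  have hfin : ∫⁻ ω, ζ ω * psi p (Z ω) ∂P ≠ ∞ := by
    refine ne_top_of_le_ne_top (ENNReal.mul_ne_top hC hJ) ?_
    have h1 := hCle h hζ hZ hZ1 hZ2 hA (isStop_const 𝒢 0)
    have h2 : ∀ ω, statePath p (Z ω) (A · ω) (W · ω) 0 = Z ω := fun ω =>
      statePath_zero (h.zero ω)
    have h3 : Set.Ici (0 : ℝ≥0) = Set.univ := by ext; simp
    simpa only [disc_zero, one_mul, h2, h3] using h1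
  obtain ⟨S, hS, hSn, hSl, hSt⟩ := h.exists_truncation p hZ hZ1 hZ2
  have hfl : Measurable fun q : ℝ≥0 × Ω =>
      flowLoss p (Z q.2) (A · q.2) (W · q.2) q.1 :=
    measurable_flowLoss hA.measurable hA.locInt h.continuous h.measurable hZ'
  have hflω : ∀ ω, Measurable fun t =>
      flowLoss p (Z ω) (A · ω) (W · ω) t := fun ω => by
    have h1 : Measurable fun t : ℝ≥0 => (t, ω) := measurable_prodMk_right
    exact hfl.comp h1
  have htail : Tendsto (fun n => ∫⁻ ω, ζ ω *
      runCost p (Z ω) (A · ω) (W · ω) (Set.Ici (S n ω)) ∂P) atTop (nhds 0) := by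
    have hle : ∀ n ω, runCost p (Z ω) (A · ω) (W · ω) (Set.Ici (S n ω)) ≤
        runCost p (Z ω) (A · ω) (W · ω) Set.univ := fun n ω =>
      lintegral_mono_set (Set.subset_univ _)
    rw [← lintegral_zero (μ := P)]
    refine tendsto_lintegral_of_dominated_convergence (fun ω => ζ ω *
      runCost p (Z ω) (A · ω) (W · ω) Set.univ)
      (fun n => hζ'.mul (measurable_runCost_Ici hA h hZ (hS n)))
      (fun n => .of_forall fun ω => mul_le_mul_right (hle n ω) _) hJ ?_
    have hfinω : ∀ᵐ ω ∂P, ζ ω * runCost p (Z ω) (A · ω) (W · ω) Set.univ < ∞ :=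
      ae_lt_top (hζ'.mul (measurable_runCost hA.measurable hA.locInt h.continuous
      h.measurable hZ' Set.univ)) hJ
    filter_upwards [hfinω] with ω hω
    have hm := hflω ω
    have e : ∀ n, ζ ω * runCost p (Z ω) (A · ω) (W · ω) (Set.Ici (S n ω)) =
        ∫⁻ t, ζ ω * (Set.Ici (S n ω)).indicator
          (fun t => flowLoss p (Z ω) (A · ω) (W · ω) t) t ∂timeMeasure :=
      fun n => by
        rw [lintegral_const_mul _ (hm.indicator measurableSet_Ici),
          lintegral_indicator measurableSet_Ici]
        rfl
    simp_rw [e]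
    rw [← lintegral_zero (μ := timeMeasure)]
    refine tendsto_lintegral_of_dominated_convergence (fun t => ζ ω *
      flowLoss p (Z ω) (A · ω) (W · ω) t)
      (fun n => (hm.indicator measurableSet_Ici).const_mul _)
      (fun n => .of_forall fun t => mul_le_mul_right
        (Set.indicator_le_self _ _ t) _) ?_ (.of_forall fun t => ?_)
    · rw [lintegral_const_mul _ hm]
      simpa only [runCost, Measure.restrict_univ] using hω.ne
    · refine tendsto_const_nhds.congr' ?_
      filter_upwards [hSt ω t] with n hn
      rw [Set.indicator_of_notMem (by simpa using hn), mul_zero]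
  have hb : baseConst p r q * C ≠ ∞ := ENNReal.mul_ne_top baseConst_ne_top hC
  have hlim := ENNReal.Tendsto.mul (tendsto_floorFactor p) (Or.inl one_ne_zero)
    (((ENNReal.Tendsto.const_mul htail (Or.inr (ENNReal.mul_ne_top
      (ENNReal.add_ne_top.2 ⟨ENNReal.one_ne_top, hb⟩) hb)))).const_add
      (∫⁻ ω, ζ ω * runCost p (Z ω) (A · ω) (W · ω) Set.univ ∂P))
    (Or.inr ENNReal.one_ne_top)
  rw [mul_zero, add_zero, one_mul] at hlim
  refine ge_of_tendsto' hlim fun n => ?_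
  have hR := hp.R_pos
  have hn : (0 : ℝ) < (n : ℝ) + 1 := by positivity
  -- The floor is `R / (n + 1)²` and the tolerance is `d = R / (n + 1)`: the floor must be so small
  -- that its product with the growing bound `n` on time and habit load still tends to zero.
  refine lintegral_infVal_le_floor h hp ha1 hr hν (fun hA _ hσ => hCle h hζ hZ hZ1 hZ2 hA hσ) hζ hZ
    hZ1 hZ2 hfin hA (hS n) n (hSn n) (hSl n) (e := p.R * (1 / ((n : ℝ) + 1)) ^ 2) (by positivity)
    (mul_le_of_le_one_right hR.le (pow_le_one₀ (by positivity)
      ((div_le_one hn).2 (by linarith [n.cast_nonneg (α := ℝ)])))) ?_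
  have : (1 / ((n : ℝ) + 1)) * n ≤ 1 := by
    rw [one_div_mul_eq_div, div_le_one hn]; linarith
  calc _ = p.R * (1 / ((n : ℝ) + 1)) * ((1 / ((n : ℝ) + 1)) * n) := by ring
    _ ≤ _ := mul_le_of_le_one_right (by positivity) this

end control

section

/-! ### Nearly optimal controls -/

lemma lintegral_eq_tsum_fiber {P : Measure Ω} {c : Ω → ℕ} (hc : Measurable c) (f : Ω → ℝ≥0∞) :
    ∫⁻ ω, f ω ∂P = ∑' k, ∫⁻ ω in c ⁻¹' {k}, f ω ∂P := by
  have h1 : ⋃ k, c ⁻¹' {k} = Set.univ := by ext ω; simp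
  rw [← lintegral_iUnion (fun k => hc (measurableSet_singleton k)), h1, Measure.restrict_univ]
  exact fun i j hij => Set.disjoint_left.2 fun ω h1 h2 => hij (h1.symm.trans h2)

lemma measurable_select {X Y : Type*} {m : MeasurableSpace X} [MeasurableSpace Y] {F : ℕ → X → Y}
    (hF : ∀ i, Measurable (F i)) {c : X → ℕ} (hc : Measurable c) : Measurable fun x => F (c x) x := by
  have h1 : Measurable fun q : ℕ × X => F q.1 q.2 := measurable_from_prod_countable_right hF
  exact h1.comp (hc.prodMk measurable_id)

variable {p : Params} {𝒢 : Filtration ℝ≥0 mΩ} {P : Measure Ω} [IsProbabilityMeasure P]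
  {W : ℝ≥0 → Ω → ℝ × ℝ} {A : ℝ≥0 → Ω → ℝ} {Z : Ω → ℝ × ℝ} {r q : ℝ} {ν : Measure PathSpace}

/-- There are controls whose losses almost attain the infimum of the discrete values. -/
theorem exists_control_infVal (h : IsBM 𝒢 P W) (hp : p.Standing) (ha1 : p.a ≤ 1)
    (hr : BaseRate p r q) (hν : IsPathLaw P ν) [SFinite ν] (hZ : Measurable[𝒢 0] Z)
    (hZ1 : ∀ ω, 0 < (Z ω).1) (hZ2 : ∀ ω, 0 < (Z ω).2) {ε : ℝ≥0∞} (hε : ε ≠ 0) :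
    ∃ A : ℝ≥0 → Ω → ℝ, IsControl p 𝒢 A ∧ ∀ {ζ : Ω → ℝ≥0∞}, Measurable[𝒢 0] ζ →
      ∫⁻ ω, ζ ω * runCost p (Z ω) (A · ω) (W · ω) Set.univ ∂P ≤
        ∫⁻ ω, ζ ω * (infVal p ν r q (Z ω) + ε) ∂P := by
  classical
  set L : ℕ → ℝ × ℝ → ℝ≥0∞ := fun i => levelVal p ν r q i.unpair.1 i.unpair.2 with hL
  have hLm : ∀ i, Measurable (L i) := fun i => measurable_levelVal _ _
  have hex : ∀ z, ∃ i, L i z < infVal p ν r q z + ε := fun z => by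
    obtain ⟨n, hn⟩ := iInf_lt_iff.1 (ENNReal.lt_add_right (infVal_ne_top (p := p) (ν := ν) (r := r)
      (q := q) z) hε)
    obtain ⟨N, hN⟩ := iInf_lt_iff.1 hn
    refine ⟨Nat.pair n N, ?_⟩
    rw [hL]
    simp only [Nat.unpair_pair]
    exact hN
  -- The index of the first nearly optimal level depends measurably on the state, since each level
  -- value and their infimum are measurable. Finiteness of `infVal` makes such a level exist for
  -- every `ε ≠ 0`.
  have hc : Measurable fun z => Nat.find (hex z) := measurable_find hex fun i =>
    measurableSet_lt (hLm i) (measurable_infVal.add_const _)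
  have hc0 : Measurable[𝒢 0] fun ω => Nat.find (hex (Z ω)) := hc.comp hZ
  have hcm : Measurable fun ω => Nat.find (hex (Z ω)) := hc0.mono (𝒢.le 0) le_rfl
  choose A hA hcost using fun i : ℕ => exists_control_lintegral_le (δ := 1 / ((i.unpair.1 : ℝ≥0) + 1))
    hp ha1 hr hν (controlGrid_nonempty p r i.unpair.1)
    (controlGrid_pos_le hp.R_pos hr.pos hr.le i.unpair.1) i.unpair.2 h hZ hZ1 hZ2
  refine ⟨fun s ω => A (Nat.find (hex (Z ω))) s ω, ⟨?_, fun t ω => (hA _).pos t ω,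
    fun t ω => (hA _).le t ω, fun t => ?_⟩, fun {ζ} hζ => ?_⟩
  · exact measurable_select (F := fun i (q : ℝ≥0 × Ω) => A i q.1 q.2) (fun i => (hA i).measurable)
      (hcm.comp measurable_snd)
  · exact measurable_select (m := 𝒢 t) (F := fun i ω => cumul (fun s => A i s ω) t)
      (fun i => (hA i).adapted t) (hc0.mono (𝒢.mono zero_le) le_rfl)
  · rw [lintegral_eq_tsum_fiber hcm, lintegral_eq_tsum_fiber hcm]
    refine ENNReal.tsum_le_tsum fun i => ?_
    have hD0 : MeasurableSet[𝒢 0] ((fun ω => Nat.find (hex (Z ω))) ⁻¹' {i}) :=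
      hc0 (measurableSet_singleton i)
    have hD := 𝒢.le 0 _ hD0
    -- Each level's control was bounded for all weights at once, so the bound may be localized to
    -- the event on which that level is selected.
    have h1 := hcost i (ζ := ((fun ω => Nat.find (hex (Z ω))) ⁻¹' {i}).indicator ζ)
      (hζ.indicator hD0)
    have e : ∀ g : Ω → ℝ≥0∞, ∫⁻ ω, ((fun ω => Nat.find (hex (Z ω))) ⁻¹' {i}).indicator ζ ω * g ω ∂P =
        ∫⁻ ω in (fun ω => Nat.find (hex (Z ω))) ⁻¹' {i}, ζ ω * g ω ∂P := fun g => by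
      rw [← lintegral_indicator hD]
      exact lintegral_congr fun ω => (Set.indicator_mul_left _ _ _).symm
    rw [e, e] at h1
    refine le_trans (le_of_eq (setLIntegral_congr_fun hD fun ω hω => ?_))
      (h1.trans (setLIntegral_mono' hD fun ω hω => mul_le_mul_right ?_ _))
    · have : Nat.find (hex (Z ω)) = i := hω
      simp only [this]
    · have : Nat.find (hex (Z ω)) = i := hω
      have h2 := Nat.find_spec (hex (Z ω))
      rw [this] at h2
      exact h2.le

/-- Every control can be continued after a stopping time in a nearly optimal way. -/
theorem IsControl.exists_continuation (hA : IsControl p 𝒢 A) (h : IsBM 𝒢 P W) (hp : p.Standing)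
    (ha1 : p.a ≤ 1) (hr : BaseRate p r q) (hν : IsPathLaw P ν) [SFinite ν]
    (hZ : Measurable[𝒢 0] Z) (hZ1 : ∀ ω, 0 < (Z ω).1) (hZ2 : ∀ ω, 0 < (Z ω).2) {S : Ω → ℝ≥0}
    (hS : IsStop 𝒢 S) {ε : ℝ≥0∞} (hε : ε ≠ 0) :
    ∃ A' : ℝ≥0 → Ω → ℝ, IsControl p 𝒢 A' ∧ (∀ ω, ∀ s < S ω, A' s ω = A s ω) ∧
      ∀ {ζ : Ω → ℝ≥0∞}, Measurable[shiftFilt 𝒢 hS 0] ζ →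
        ∫⁻ ω, ζ ω * runCost p (Z ω) (A' · ω) (W · ω) (Set.Ici (S ω)) ∂P ≤
          ∫⁻ ω, ζ ω * (disc p (S ω) * (infVal p ν r q
            (statePath p (Z ω) (A · ω) (W · ω) (S ω)) + ε)) ∂P := by
  have hpos := fun ω => hA.state_pos hp.ρ_pos.le hZ1 hZ2 (W · ω) ω (S ω)
  obtain ⟨A'', hA'', hcost⟩ := exists_control_infVal (h.shift hS) hp ha1 hr hν
    (hA.measurable_state_stop h hZ hS) (fun ω => (hpos ω).1) (fun ω => (hpos ω).2) hε
  have hc := IsControl.concat hS hA hA''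
  have hlt : ∀ ω, ∀ s < S ω, HabitModel.concat S A A'' s ω = A s ω := fun ω s hs => concat_of_lt hs
  refine ⟨_, hc, hlt, fun {ζ} hζ => ?_⟩
  have h1 := hcost (hζ.mul ((measurable_disc p).comp hS.measurable_shiftFilt))
  simp only [Pi.mul_apply, Function.comp_apply, mul_assoc] at h1
  refine le_trans (le_of_eq (lintegral_congr fun ω => ?_)) h1
  rw [runCost_Ici (hc.locInt ω) (h.continuous ω),
    statePath_congr (.of_forall (hlt ω)) le_rfl]
  simp_rw [concat_add]

end

/-! ### Stopping times with infinite values -/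

/-- The minimum of an extended time and `n`. -/
def cut (τ : Ω → WithTop ℝ≥0) (n : ℕ) (ω : Ω) : ℝ≥0 :=
  (min (τ ω) ((n : ℝ≥0) : WithTop ℝ≥0)).untopD 0

/-- The discounted terminal loss along the path `x` of the state, at an extended time. -/
def termLoss (p : Params) (v : ℝ × ℝ → ℝ≥0∞) (t : WithTop ℝ≥0) (x : ℝ≥0 → ℝ × ℝ) : ℝ≥0∞ :=
  open scoped Classical in if t = ⊤ then 0 else disc p (t.untopD 0) * v (x (t.untopD 0))

section cut

variable {p : Params} {v : ℝ × ℝ → ℝ≥0∞} {x : ℝ≥0 → ℝ × ℝ} {τ : Ω → WithTop ℝ≥0}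
  {𝒢 : Filtration ℝ≥0 mΩ} {n : ℕ} {ω : Ω}

/-- The minimum with `n` is never `⊤`, so the default value in `cut` plays no role. -/
lemma coe_cut : (cut τ n ω : WithTop ℝ≥0) = min (τ ω) ((n : ℝ≥0) : WithTop ℝ≥0) := by
  unfold cut
  induction τ ω using WithTop.recTopCoe with
  | top => rw [min_eq_right le_top, WithTop.untopD_coe]
  | coe t => rw [← WithTop.coe_min, WithTop.untopD_coe]

lemma coe_cut_of_le (h : τ ω ≤ ((n : ℝ≥0) : WithTop ℝ≥0)) : (cut τ n ω : WithTop ℝ≥0) = τ ω := by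
  rw [coe_cut, min_eq_left h]

lemma cut_of_lt (h : ((n : ℝ≥0) : WithTop ℝ≥0) < τ ω) : cut τ n ω = n :=
  WithTop.coe_injective (by rw [coe_cut, min_eq_right h.le])

lemma termLoss_top : termLoss p v ⊤ x = 0 := if_pos rfl

lemma termLoss_coe (t : ℝ≥0) : termLoss p v t x = disc p t * v (x t) := by
  rw [termLoss, if_neg WithTop.coe_ne_top, WithTop.untopD_coe]

lemma termLoss_of_le (h : τ ω ≤ ((n : ℝ≥0) : WithTop ℝ≥0)) :
    termLoss p v (τ ω) x = disc p (cut τ n ω) * v (x (cut τ n ω)) := by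
  rw [← termLoss_coe, coe_cut_of_le h]

lemma isStop_cut (hτ : IsStoppingTime 𝒢 τ) (n : ℕ) : IsStop 𝒢 (cut τ n) := fun t => by
  have : {ω | cut τ n ω ≤ t} = {ω | τ ω ≤ t} ∪ {_ω | (n : ℝ≥0) ≤ t} := by
    ext ω
    rw [Set.mem_ofPred_eq, ← WithTop.coe_le_coe, coe_cut, min_le_iff, WithTop.coe_le_coe]
    rfl
  rw [this]
  exact (hτ t).union (@MeasurableSet.const _ (𝒢 t) _)

/-- If `τ ≤ a ≤ m`, the cut time is `τ` itself, so intersecting with the event that it is at most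
`t` leaves `τ ≤ min a t`. -/
lemma measurableSet_le_cut (hτ : IsStoppingTime 𝒢 τ) {a m : ℕ} (ham : a ≤ m) :
    MeasurableSet[shiftFilt 𝒢 (isStop_cut hτ m) 0] {ω | τ ω ≤ ((a : ℝ≥0) : WithTop ℝ≥0)} := by
  intro t
  have : {ω | τ ω ≤ ((a : ℝ≥0) : WithTop ℝ≥0)} ∩ {ω | cut τ m ω + 0 ≤ t} =
      {ω | τ ω ≤ ((min (a : ℝ≥0) t : ℝ≥0) : WithTop ℝ≥0)} := by
    ext ω
    rw [Set.mem_inter_iff, Set.mem_ofPred_eq, Set.mem_ofPred_eq, Set.mem_ofPred_eq, add_zero,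
      ← WithTop.coe_le_coe (b := cut τ m ω), coe_cut, WithTop.coe_min, le_min_iff, min_le_iff]
    refine and_congr_right fun h => ⟨fun h' => h'.elim id fun h'' => ?_, Or.inl⟩
    have : ((a : ℝ≥0) : WithTop ℝ≥0) ≤ ((m : ℝ≥0) : WithTop ℝ≥0) :=
      WithTop.coe_le_coe.2 (Nat.cast_le.2 ham)
    exact h.trans (this.trans h'')
  rw [this]
  exact 𝒢.mono (min_le_right _ _) _ (hτ _)

lemma measurableSet_le_nat (hτ : IsStoppingTime 𝒢 τ) (n : ℕ) :
    MeasurableSet {ω | τ ω ≤ ((n : ℝ≥0) : WithTop ℝ≥0)} := 𝒢.le _ _ (hτ n)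

lemma iUnion_le_nat (τ : Ω → WithTop ℝ≥0) :
    ⋃ n : ℕ, {ω | τ ω ≤ ((n : ℝ≥0) : WithTop ℝ≥0)} = {ω | τ ω ≠ ⊤} := by
  ext ω
  simp only [Set.mem_iUnion, Set.mem_ofPred_eq]
  refine ⟨fun ⟨n, hn⟩ h => ?_, fun h => ?_⟩
  · rw [h, top_le_iff] at hn
    exact WithTop.coe_ne_top hn
  · lift τ ω to ℝ≥0 using h with t
    obtain ⟨n, hn⟩ := exists_nat_ge t
    exact ⟨n, WithTop.coe_le_coe.2 hn⟩

lemma measurableSet_lt_time (t : WithTop ℝ≥0) : MeasurableSet {s : ℝ≥0 | (s : WithTop ℝ≥0) < t} := by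
  induction t using WithTop.recTopCoe with
  | top => simp only [WithTop.coe_lt_top]; exact MeasurableSet.univ
  | coe t => simp only [WithTop.coe_lt_coe]; exact measurableSet_Iio

lemma measurableSet_lt_joint (hτ : IsStoppingTime 𝒢 τ) :
    MeasurableSet {x : ℝ≥0 × Ω | (x.1 : WithTop ℝ≥0) < τ x.2} := by
  have : {x : ℝ≥0 × Ω | (x.1 : WithTop ℝ≥0) < τ x.2} = ⋃ n : ℕ, {x | x.1 < cut τ n x.2} := by
    ext x
    simp only [Set.mem_iUnion, Set.mem_ofPred_eq]
    refine ⟨fun h => ?_, fun ⟨n, h⟩ => ?_⟩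
    · obtain ⟨n, hn⟩ := exists_nat_gt x.1
      exact ⟨n, by rw [← WithTop.coe_lt_coe, coe_cut]; exact lt_min h (WithTop.coe_lt_coe.2 hn)⟩
    · rw [← WithTop.coe_lt_coe, coe_cut] at h
      exact h.trans_le (min_le_left _ _)
  rw [this]
  exact MeasurableSet.iUnion fun n =>
    measurableSet_lt measurable_fst ((isStop_cut hτ n).measurable.comp measurable_snd)

end cut

lemma tendsto_setLIntegral_inter_Ici {f : ℝ≥0 → ℝ≥0∞} (hf : Measurable f) {D : Set ℝ≥0}
    (hD : MeasurableSet D) (hfin : ∫⁻ t in D, f t ∂timeMeasure ≠ ∞) :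
    Tendsto (fun n : ℕ => ∫⁻ t in D ∩ Set.Ici (n : ℝ≥0), f t ∂timeMeasure) atTop (nhds 0) := by
  simp_rw [fun n : ℕ => (lintegral_indicator (μ := timeMeasure)
    (hD.inter (measurableSet_Ici (a := (n : ℝ≥0)))) f).symm]
  rw [← lintegral_indicator hD] at hfin
  rw [← lintegral_zero (μ := timeMeasure)]
  refine tendsto_lintegral_of_dominated_convergence _
    (fun n => hf.indicator (hD.inter measurableSet_Ici))
    (fun n => .of_forall fun t =>
      Set.indicator_le_indicator_of_subset Set.inter_subset_left (fun _ => zero_le) t) hfin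
    (.of_forall fun t => tendsto_const_nhds.congr' ?_)
  obtain ⟨N, hN⟩ := exists_nat_gt t
  filter_upwards [eventually_ge_atTop N] with n hn
  rw [Set.indicator_of_notMem]
  rintro ⟨-, h⟩
  exact absurd (hN.trans_le (Nat.cast_le.2 hn)) (not_lt.2 h)

section control

variable {p : Params} {𝒢 : Filtration ℝ≥0 mΩ} {P : Measure Ω}
  {W : ℝ≥0 → Ω → ℝ × ℝ} {A : ℝ≥0 → Ω → ℝ} {Z : Ω → ℝ × ℝ} {r q : ℝ} {ν : Measure PathSpace}
  {τ : Ω → WithTop ℝ≥0} {v : ℝ × ℝ → ℝ≥0∞}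

lemma measurable_runCost_joint (hA : IsControl p 𝒢 A) (h : IsBM 𝒢 P W) (hZ : Measurable Z)
    {D : Set (ℝ≥0 × Ω)} (hD : MeasurableSet D) :
    Measurable fun ω =>
      runCost p (Z ω) (A · ω) (W · ω) {t | (t, ω) ∈ D} := by
  have h1 := ((measurable_flowLoss (p := p) hA.measurable hA.locInt h.continuous h.measurable
    hZ).indicator hD).lintegral_prod_left' (μ := timeMeasure)
  have e : ∀ ω, MeasurableSet {t | (t, ω) ∈ D} := fun ω => by
    have h2 : Measurable fun t : ℝ≥0 => (t, ω) := measurable_prodMk_right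
    exact h2 hD
  refine (congrArg Measurable (funext fun ω => ?_)).mp h1
  rw [runCost, ← lintegral_indicator (e ω)]
  rfl

lemma measurable_termLoss (hτ : IsStoppingTime 𝒢 τ) (hA : IsControl p 𝒢 A) (h : IsBM 𝒢 P W)
    (hZ : Measurable Z) (hv : Measurable v) :
    Measurable fun ω => termLoss p v (τ ω)
      (fun t => statePath p (Z ω) (A · ω) (W · ω) t) := by
  have hfin : MeasurableSet {ω | τ ω = ⊤} := by
    have := (MeasurableSet.iUnion (measurableSet_le_nat hτ)).compl
    rw [iUnion_le_nat] at this
    convert this using 1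
    ext ω; simp
  have h1 : Measurable fun ω => (τ ω).untopD 0 := measurable_of_Iic fun t => by
    have : (fun ω => (τ ω).untopD 0) ⁻¹' Set.Iic t = {ω | τ ω ≤ t} ∪ {ω | τ ω = ⊤} := by
      ext ω
      simp only [Set.mem_preimage, Set.mem_Iic, Set.mem_union, Set.mem_ofPred_eq]
      induction τ ω using WithTop.recTopCoe with
      | top => simp
      | coe s =>
        rw [WithTop.untopD_coe, WithTop.coe_le_coe]
        exact ⟨Or.inl, fun h => h.elim id fun h => absurd h WithTop.coe_ne_top⟩
    rw [this]
    exact (𝒢.le t _ (hτ t)).union hfin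
  have h2 := (measurable_statePath_joint (p := p) hA.measurable hA.locInt h.continuous h.measurable
    hZ).comp (h1.prodMk measurable_id)
  exact Measurable.ite hfin measurable_const (((measurable_disc p).comp h1).mul (hv.comp h2))

variable [IsProbabilityMeasure P]

/-- The losses after a stopping time dominate the infimum of the discrete values. -/
lemma lintegral_infVal_stop_le (h : IsBM 𝒢 P W) (hp : p.Standing) (ha1 : p.a ≤ 1)
    (hr : BaseRate p r q) (hν : IsPathLaw P ν) [SFinite ν] (hZ : Measurable[𝒢 0] Z)
    (hZ1 : ∀ ω, 0 < (Z ω).1) (hZ2 : ∀ ω, 0 < (Z ω).2) (hA : IsControl p 𝒢 A) {S : Ω → ℝ≥0}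
    (hS : IsStop 𝒢 S) {ζ : Ω → ℝ≥0∞} (hζ : Measurable[shiftFilt 𝒢 hS 0] ζ) :
    ∫⁻ ω, ζ ω * (disc p (S ω) * infVal p ν r q
        (statePath p (Z ω) (A · ω) (W · ω) (S ω))) ∂P ≤
      ∫⁻ ω, ζ ω * runCost p (Z ω) (A · ω) (W · ω) (Set.Ici (S ω)) ∂P := by
  have hpos := fun ω => hA.state_pos hp.ρ_pos.le hZ1 hZ2 (W · ω) ω (S ω)
  have h1 := lintegral_infVal_le (h.shift hS) hp ha1 hr hν
    (hζ.mul ((measurable_disc p).comp hS.measurable_shiftFilt)) (hA.measurable_state_stop h hZ hS)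
    (fun ω => (hpos ω).1) (fun ω => (hpos ω).2) (hA.shift hS)
  simp only [Pi.mul_apply, Function.comp_apply, mul_assoc] at h1
  refine h1.trans (le_of_eq (lintegral_congr fun ω => ?_))
  rw [runCost_Ici (hA.locInt ω) (h.continuous ω)]

/-- Stopping with the infimum of the discrete values as terminal loss lowers the losses. -/
theorem lintegral_stopped_le (h : IsBM 𝒢 P W) (hp : p.Standing) (ha1 : p.a ≤ 1)
    (hr : BaseRate p r q) (hν : IsPathLaw P ν) [SFinite ν] (hZ : Measurable[𝒢 0] Z)
    (hZ1 : ∀ ω, 0 < (Z ω).1) (hZ2 : ∀ ω, 0 < (Z ω).2) (hA : IsControl p 𝒢 A)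
    (hτ : IsStoppingTime 𝒢 τ) :
    ∫⁻ ω, (runCost p (Z ω) (A · ω) (W · ω) {t | (t : WithTop ℝ≥0) < τ ω} +
        termLoss p (infVal p ν r q) (τ ω)
          (fun t => statePath p (Z ω) (A · ω) (W · ω) t)) ∂P ≤
      ∫⁻ ω, runCost p (Z ω) (A · ω) (W · ω) Set.univ ∂P := by
  have hZ' : Measurable Z := hZ.mono (𝒢.le 0) le_rfl
  have hX := measurable_runCost_joint hA h hZ' (measurableSet_lt_joint hτ)
  simp only [Set.mem_ofPred_eq] at hX
  have e : ∀ ω, runCost p (Z ω) (A · ω) (W · ω) Set.univ =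
      runCost p (Z ω) (A · ω) (W · ω) {t | (t : WithTop ℝ≥0) < τ ω} +
      runCost p (Z ω) (A · ω) (W · ω) {t | (t : WithTop ℝ≥0) < τ ω}ᶜ := fun ω => by
    rw [← runCost_add _ _ (measurableSet_lt_time _).compl disjoint_compl_right, Set.union_compl_self]
  simp_rw [e]
  rw [lintegral_add_left hX, lintegral_add_left hX]
  refine add_le_add le_rfl ?_
  set Y : Ω → ℝ≥0∞ := fun ω => termLoss p (infVal p ν r q) (τ ω)
    (fun t => statePath p (Z ω) (A · ω) (W · ω) t) with hY
  -- The terminal loss vanishes where `τ = ⊤`, so by monotone convergence it is enough to work on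
  -- `{τ ≤ n}`. There `τ` is the finite stopping time `cut τ n`, and the event is known at that
  -- time.
  have hYU : Y = (⋃ n : ℕ, {ω | τ ω ≤ ((n : ℝ≥0) : WithTop ℝ≥0)}).indicator Y := by
    ext ω
    rw [iUnion_le_nat]
    by_cases hω : τ ω = ⊤
    · rw [Set.indicator_of_notMem (by simpa using hω), hY]
      simp only [hω, termLoss_top]
    · rw [Set.indicator_of_mem hω]
  have hdir : Directed (· ⊆ ·) fun n : ℕ => {ω | τ ω ≤ ((n : ℝ≥0) : WithTop ℝ≥0)} :=
    Monotone.directed_le fun a b hab ω (hω : τ ω ≤ _) =>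
      hω.trans (WithTop.coe_le_coe.2 (Nat.cast_le.2 hab))
  rw [hYU, lintegral_indicator (MeasurableSet.iUnion (measurableSet_le_nat hτ)),
    setLIntegral_iUnion_of_directed _ hdir]
  refine iSup_le fun n => ?_
  have hD := measurableSet_le_nat hτ n
  have hD' : Measurable[shiftFilt 𝒢 (isStop_cut hτ n) 0]
      ({ω | τ ω ≤ ((n : ℝ≥0) : WithTop ℝ≥0)}.indicator fun _ => (1 : ℝ≥0∞)) :=
    measurable_const.indicator (measurableSet_le_cut hτ le_rfl)
  have h1 := lintegral_infVal_stop_le h hp ha1 hr hν hZ hZ1 hZ2 hA (isStop_cut hτ n) hD'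
  rw [← lintegral_indicator hD]
  refine le_trans (le_of_eq (lintegral_congr fun ω => ?_)) (h1.trans (lintegral_mono fun ω => ?_))
  · by_cases hω : τ ω ≤ ((n : ℝ≥0) : WithTop ℝ≥0)
    · rw [Set.indicator_of_mem (by exact hω), Set.indicator_of_mem (by exact hω), one_mul, hY]
      exact termLoss_of_le hω
    · rw [Set.indicator_of_notMem (by exact hω), Set.indicator_of_notMem (by exact hω), zero_mul]
  · by_cases hω : τ ω ≤ ((n : ℝ≥0) : WithTop ℝ≥0)
    · dsimp only
      rw [Set.indicator_of_mem (by exact hω), one_mul]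
      refine lintegral_mono_set fun t (ht : cut τ n ω ≤ t) => ?_
      rw [Set.mem_compl_iff, Set.mem_ofPred_eq, not_lt, ← coe_cut_of_le hω]
      exact WithTop.coe_le_coe.2 ht
    · dsimp only
      rw [Set.indicator_of_notMem (by exact hω), zero_mul]
      exact zero_le

end control

section control

variable {p : Params} {𝒢 : Filtration ℝ≥0 mΩ} {P : Measure Ω} [IsProbabilityMeasure P]
  {W : ℝ≥0 → Ω → ℝ × ℝ} {A : ℝ≥0 → Ω → ℝ} {Z : Ω → ℝ × ℝ} {r q : ℝ} {ν : Measure PathSpace}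
  {τ : Ω → WithTop ℝ≥0}

/-- The weight of the state at time `n`, before a stopping time, is dominated by the losses of the
stopped problem after time `n`. -/
lemma exists_tail_bound (h : IsBM 𝒢 P W) (hp : p.Standing) (ha1 : p.a ≤ 1)
    (hr : BaseRate p r q) (hν : IsPathLaw P ν) [SFinite ν] (hZ : Measurable[𝒢 0] Z)
    (hZ1 : ∀ ω, 0 < (Z ω).1) (hZ2 : ∀ ω, 0 < (Z ω).2) (hA : IsControl p 𝒢 A)
    (hτ : IsStoppingTime 𝒢 τ) : ∃ C : ℝ≥0∞, C ≠ ∞ ∧ ∀ n : ℕ,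
    ∫⁻ ω, {ω | τ ω ≤ ((n : ℝ≥0) : WithTop ℝ≥0)}ᶜ.indicator (fun ω => disc p n *
        psi p (statePath p (Z ω) (A · ω) (W · ω) n)) ω ∂P ≤
      C * (∫⁻ ω, runCost p (Z ω) (A · ω) (W · ω)
          ({t | (t : WithTop ℝ≥0) < τ ω} ∩ Set.Ici (n : ℝ≥0)) ∂P +
        ∫⁻ ω, {ω | τ ω ≤ ((n : ℝ≥0) : WithTop ℝ≥0)}ᶜ.indicator (fun ω =>
          termLoss p (fun z => infVal p ν r q z + 1) (τ ω)
            (fun t => statePath p (Z ω) (A · ω) (W · ω) t)) ω ∂P) := by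
  obtain ⟨C, hC, hlow⟩ := exists_lower_bound (Ω := Ω) (P := P) hp
  refine ⟨C, hC, fun n => ?_⟩
  have hZ' : Measurable Z := hZ.mono (𝒢.le 0) le_rfl
  have hS := isStop_cut hτ (n + 1)
  set S := cut τ (n + 1) with hSdef
  set D : Set Ω := {ω | τ ω ≤ ((n : ℝ≥0) : WithTop ℝ≥0)} with hD
  set D₁ : Set Ω := {ω | τ ω ≤ (((n + 1 : ℕ) : ℝ≥0) : WithTop ℝ≥0)} with hD₁
  -- The lower bound over `[n, n + 1]` may look beyond `τ`, where the losses of `A` do not belong to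
  -- the stopped problem. It is therefore applied to a control that follows `A` until `τ ∧ (n + 1)`
  -- and is nearly optimal afterwards; if `τ` falls into that interval, the later losses are at most
  -- the terminal loss with `infVal + 1`.
  obtain ⟨A', hA', hlt, hcost⟩ := hA.exists_continuation h hp ha1 hr hν hZ hZ1 hZ2 hS one_ne_zero
  have hn := isStop_const 𝒢 (n : ℝ≥0)
  have hDn : MeasurableSet[shiftFilt 𝒢 hn 0] D := by
    have := le_shiftFilt_const 𝒢 (n : ℝ≥0) 0
    rw [add_zero] at this
    exact this _ (hτ n)
  have hnS : ∀ ω ∈ Dᶜ, (n : ℝ≥0) < S ω := fun ω hω => by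
    rw [← WithTop.coe_lt_coe, hSdef, coe_cut]
    exact lt_min (not_le.1 hω) (WithTop.coe_lt_coe.2 (Nat.cast_lt.2 n.lt_succ_self))
  have hpos := fun ω => hA'.state_pos hp.ρ_pos.le hZ1 hZ2 (W · ω) ω (n : ℝ≥0)
  have hζ : Measurable[shiftFilt 𝒢 hn 0] (Dᶜ.indicator fun _ => disc p n) :=
    measurable_const.indicator hDn.compl
  have h1 := hlow (h.shift hn) hζ (hA'.measurable_state_stop h hZ hn) (fun ω => (hpos ω).1)
    (fun ω => (hpos ω).2) (hA'.shift hn)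
  have hζ' : Measurable[shiftFilt 𝒢 hS 0] ((D₁ ∩ Dᶜ).indicator fun _ => (1 : ℝ≥0∞)) :=
    measurable_const.indicator ((measurableSet_le_cut hτ le_rfl).inter
      (measurableSet_le_cut hτ n.le_succ).compl)
  refine le_trans (le_of_eq (lintegral_congr fun ω => ?_)) (h1.trans (mul_le_mul_right ?_ _))
  · by_cases hω : ω ∈ Dᶜ
    · rw [Set.indicator_of_mem hω, Set.indicator_of_mem hω,
        statePath_congr (.of_forall fun s hs => (hlt ω s hs).symm) (hnS ω hω).le]
    · rw [Set.indicator_of_notMem hω, Set.indicator_of_notMem hω, zero_mul]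
  have hX : Measurable fun ω => runCost p (Z ω) (A · ω) (W · ω)
      ({t | (t : WithTop ℝ≥0) < τ ω} ∩ Set.Ici (n : ℝ≥0)) :=
    measurable_runCost_joint hA h hZ' ((measurableSet_lt_joint hτ).inter
      (measurable_fst (measurableSet_Ici (a := (n : ℝ≥0)))))
  calc _ ≤ ∫⁻ ω, (runCost p (Z ω) (A · ω) (W · ω)
          ({t | (t : WithTop ℝ≥0) < τ ω} ∩ Set.Ici (n : ℝ≥0)) +
        (D₁ ∩ Dᶜ).indicator (fun _ => (1 : ℝ≥0∞)) ω *
          runCost p (Z ω) (A' · ω) (W · ω) (Set.Ici (S ω))) ∂P := by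
        refine lintegral_mono fun ω => ?_
        dsimp only
        by_cases hω : ω ∈ Dᶜ
        · rw [Set.indicator_of_mem hω, ← runCost_Ico (hA'.locInt ω) (h.continuous ω)]
          have hlt' : ∀ t, t < S ω → (t : WithTop ℝ≥0) < τ ω := fun t ht => by
            rw [← WithTop.coe_lt_coe, hSdef, coe_cut] at ht
            exact ht.trans_le (min_le_left _ _)
          have h2 : runCost p (Z ω) (A' · ω) (W · ω) (Set.Ico n (S ω)) ≤
              runCost p (Z ω) (A · ω) (W · ω)
                ({t | (t : WithTop ℝ≥0) < τ ω} ∩ Set.Ici (n : ℝ≥0)) := by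
            rw [runCost_congr (.of_forall (hlt ω)) measurableSet_Ico
              Set.Ico_subset_Iio_self]
            exact lintegral_mono_set fun t ht => ⟨hlt' t ht.2, ht.1⟩
          by_cases hω₁ : ω ∈ D₁
          · rw [Set.indicator_of_mem (s := D₁ ∩ Dᶜ) ⟨hω₁, hω⟩, one_mul]
            refine le_trans ?_ (add_le_add h2 le_rfl)
            refine (lintegral_mono_set ?_).trans (lintegral_union_le _ _ _)
            intro t ht
            rcases lt_or_ge t (S ω) with h3 | h3
            exacts [Or.inl ⟨ht.1, h3⟩, Or.inr h3]
          · have h3 : S ω = n + 1 := by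
              rw [hSdef, cut_of_lt (not_le.1 hω₁)]; push_cast; rfl
            rw [← h3]
            exact h2.trans le_self_add
        · rw [Set.indicator_of_notMem hω, zero_mul]
          exact zero_le
    _ ≤ _ := by
        rw [lintegral_add_left hX]
        refine add_le_add le_rfl ((hcost hζ').trans (lintegral_mono fun ω => ?_))
        dsimp only
        by_cases hω : ω ∈ D₁ ∩ Dᶜ
        · rw [Set.indicator_of_mem hω, Set.indicator_of_mem hω.2, one_mul, termLoss_of_le hω.1]
        · rw [Set.indicator_of_notMem hω, zero_mul]
          exact zero_le

/-- The infimum of the discrete values is at most the losses of the stopped problem. -/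
theorem infVal_le_lintegral_stopped (h : IsBM 𝒢 P W) (hp : p.Standing) (ha1 : p.a ≤ 1)
    (hr : BaseRate p r q) (hν : IsPathLaw P ν) [SFinite ν] {z : ℝ × ℝ} (hz1 : 0 < z.1)
    (hz2 : 0 < z.2) (hA : IsControl p 𝒢 A) (hτ : IsStoppingTime 𝒢 τ) :
    infVal p ν r q z ≤
      ∫⁻ ω, (runCost p z (A · ω) (W · ω) {t | (t : WithTop ℝ≥0) < τ ω} +
        termLoss p (infVal p ν r q) (τ ω)
          (fun t => statePath p z (A · ω) (W · ω) t)) ∂P := by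
  have hZ : Measurable[𝒢 0] fun _ : Ω => z := measurable_const
  have hZ' : Measurable fun _ : Ω => z := measurable_const
  set X : Ω → ℝ≥0∞ := fun ω =>
    runCost p z (A · ω) (W · ω) {t | (t : WithTop ℝ≥0) < τ ω} with hXdef
  set Y : (ℝ × ℝ → ℝ≥0∞) → Ω → ℝ≥0∞ := fun v ω => termLoss p v (τ ω)
    (fun t => statePath p z (A · ω) (W · ω) t) with hYdef
  have hX : Measurable X := measurable_runCost_joint hA h hZ' (measurableSet_lt_joint hτ)
  have hU : Measurable (infVal p ν r q) := measurable_infVal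
  have hY : ∀ {v}, Measurable v → Measurable (Y v) := fun hv =>
    measurable_termLoss hτ hA h hZ' hv
  change _ ≤ ∫⁻ ω, (X ω + Y (infVal p ν r q) ω) ∂P
  rw [lintegral_add_left hX]
  by_cases hfin : ∫⁻ ω, X ω ∂P = ∞ ∨ ∫⁻ ω, Y (infVal p ν r q) ω ∂P = ∞
  · rcases hfin with h1 | h1 <;> simp [h1]
  push Not at hfin
  have hdisc := disc_le_one (p := p) hp.θ_pos.le
  have hY1 : ∀ ω, Y (fun z => infVal p ν r q z + 1) ω ≤ Y (infVal p ν r q) ω + 1 := fun ω => by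
    simp only [hYdef]
    induction τ ω using WithTop.recTopCoe with
    | top => rw [termLoss_top]; exact zero_le
    | coe t =>
      rw [termLoss_coe, termLoss_coe, mul_add, mul_one]
      exact add_le_add le_rfl (hdisc t)
  set D : ℕ → Set Ω := fun n => {ω | τ ω ≤ ((n : ℝ≥0) : WithTop ℝ≥0)} with hD
  have hDm : ∀ n, MeasurableSet (D n) := measurableSet_le_nat hτ
  obtain ⟨C, hC, htail⟩ := exists_tail_bound h hp ha1 hr hν hZ (fun _ => hz1) (fun _ => hz2) hA hτ
  have hT1 : Tendsto (fun n : ℕ => ∫⁻ ω, runCost p z (A · ω) (W · ω)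
      ({t | (t : WithTop ℝ≥0) < τ ω} ∩ Set.Ici (n : ℝ≥0)) ∂P) atTop (nhds 0) := by
    rw [← lintegral_zero (μ := P)]
    refine tendsto_lintegral_of_dominated_convergence X (fun n => measurable_runCost_joint hA h hZ'
      ((measurableSet_lt_joint hτ).inter (measurable_fst (measurableSet_Ici (a := (n : ℝ≥0))))))
      (fun n => .of_forall fun ω => lintegral_mono_set Set.inter_subset_left)
      hfin.1 ?_
    filter_upwards [ae_lt_top hX hfin.1] with ω hω
    have h1 : Measurable fun t : ℝ≥0 => (t, ω) := measurable_prodMk_right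
    exact tendsto_setLIntegral_inter_Ici ((measurable_flowLoss hA.measurable hA.locInt h.continuous
      h.measurable hZ').comp h1) (measurableSet_lt_time _) hω.ne
  have hT2 : Tendsto (fun n : ℕ => ∫⁻ ω, (D n)ᶜ.indicator
      (Y fun z => infVal p ν r q z + 1) ω ∂P) atTop (nhds 0) := by
    rw [← lintegral_zero (μ := P)]
    refine tendsto_lintegral_of_dominated_convergence (fun ω => Y (infVal p ν r q) ω + 1)
      (fun n => (hY (hU.add_const 1)).indicator (hDm n).compl)
      (fun n => .of_forall fun ω => (Set.indicator_le_self _ _ ω).trans (hY1 ω)) ?_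
      (.of_forall fun ω => tendsto_const_nhds.congr' ?_)
    · rw [lintegral_add_right _ measurable_const]
      exact ENNReal.add_ne_top.2 ⟨hfin.2, by simp⟩
    · by_cases hω : τ ω = ⊤
      · refine .of_forall fun n => ?_
        have : Y (fun z => infVal p ν r q z + 1) ω = 0 := by
          simp only [hYdef, hω, termLoss_top]
        exact (Set.indicator_apply_eq_zero.2 fun _ => this).symm
      · have h1 : ω ∈ ⋃ n, D n := by rw [hD, iUnion_le_nat]; exact hω
        obtain ⟨N, hN⟩ := Set.mem_iUnion.1 h1
        filter_upwards [eventually_ge_atTop N] with n hn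
        have hN' : τ ω ≤ ((N : ℝ≥0) : WithTop ℝ≥0) := hN
        have h2 : ω ∈ D n := hN'.trans (WithTop.coe_le_coe.2 (Nat.cast_le.2 hn))
        rw [Set.indicator_of_notMem (by simpa using h2)]
  have hK : baseConst p r q ≠ ∞ := baseConst_ne_top
  -- Follow `A` until `τ ∧ n` and continue within `ε` of the optimum. On `{τ ≤ n}` the continuation
  -- costs the terminal loss up to `ε`; on `{τ > n}` the problem without steps bounds `infVal` by
  -- `baseConst` times `psi`, and the tail bound applies.
  have key : ∀ ε : ℝ≥0∞, ε ≠ 0 → ∀ n : ℕ, infVal p ν r q z ≤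
      ∫⁻ ω, X ω ∂P + ∫⁻ ω, Y (infVal p ν r q) ω ∂P + ε + baseConst p r q *
        (C * (∫⁻ ω, runCost p z (A · ω) (W · ω)
          ({t | (t : WithTop ℝ≥0) < τ ω} ∩ Set.Ici (n : ℝ≥0)) ∂P +
          ∫⁻ ω, (D n)ᶜ.indicator (Y fun z => infVal p ν r q z + 1) ω ∂P)) := by
    intro ε hε n
    have hS := isStop_cut hτ n
    obtain ⟨A', hA', hlt, hcost⟩ := hA.exists_continuation h hp ha1 hr hν hZ (fun _ => hz1)
      (fun _ => hz2) hS hε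
    have h1 := lintegral_infVal_le (ζ := fun _ => 1) h hp ha1 hr hν measurable_const hZ
      (fun _ => hz1) (fun _ => hz2) hA'
    have h2 := hcost (ζ := fun _ => 1) measurable_const
    simp only [one_mul] at h1 h2
    rw [lintegral_const, measure_univ, mul_one] at h1
    have hm : Measurable fun ω => runCost p z (A' · ω) (W · ω)
        (Set.Iio (cut τ n ω)) := measurable_runCost_joint (D := {x | x.1 < cut τ n x.2}) hA' h hZ'
        (measurableSet_lt measurable_fst (hS.measurable.comp measurable_snd))
    have h3 : ∫⁻ ω, runCost p z (A' · ω) (W · ω) (Set.Iio (cut τ n ω)) ∂P ≤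
        ∫⁻ ω, X ω ∂P := lintegral_mono fun ω => by
      rw [runCost_Iio_congr (.of_forall (hlt ω))]
      refine lintegral_mono_set fun t (ht : t < cut τ n ω) => ?_
      rw [← WithTop.coe_lt_coe, coe_cut] at ht
      exact ht.trans_le (min_le_left _ _)
    have h4 : ∫⁻ ω, disc p (cut τ n ω) * (infVal p ν r q
        (statePath p z (A · ω) (W · ω) (cut τ n ω)) + ε) ∂P ≤
        ∫⁻ ω, Y (infVal p ν r q) ω ∂P + (ε + baseConst p r q * ∫⁻ ω, (D n)ᶜ.indicator (fun ω =>
          disc p n * psi p (statePath p z (A · ω) (W · ω) n)) ω ∂P) := by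
      have e1 : ε = ∫⁻ _, ε ∂P := by rw [lintegral_const, measure_univ, mul_one]
      nth_rewrite 2 [e1]
      rw [← lintegral_const_mul' _ _ hK, ← lintegral_add_left measurable_const,
        ← lintegral_add_left (hY hU)]
      refine lintegral_mono fun ω => ?_
      dsimp only
      have h5 : disc p (cut τ n ω) * ε ≤ ε := mul_le_of_le_one_left zero_le (hdisc _)
      rw [mul_add]
      by_cases hω : ω ∈ D n
      · refine add_le_add (le_of_eq ?_) (h5.trans le_self_add)
        simp only [hYdef]
        rw [termLoss_of_le hω]
      · rw [Set.indicator_of_mem (by exact hω)]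
        refine le_trans ?_ le_add_self
        rw [add_comm]
        refine add_le_add h5 ?_
        rw [cut_of_lt (not_le.1 hω), mul_left_comm]
        exact mul_le_mul_right (iInf₂_le 0 0) _
    calc infVal p ν r q z ≤ _ := h1
      _ = ∫⁻ ω, runCost p z (A' · ω) (W · ω) (Set.Iio (cut τ n ω)) ∂P +
          ∫⁻ ω, runCost p z (A' · ω) (W · ω) (Set.Ici (cut τ n ω)) ∂P := by
          rw [← lintegral_add_left hm]
          exact lintegral_congr fun ω => runCost_univ_split _
      _ ≤ ∫⁻ ω, X ω ∂P + (∫⁻ ω, Y (infVal p ν r q) ω ∂P + (ε + baseConst p r q *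
          ∫⁻ ω, (D n)ᶜ.indicator (fun ω => disc p n *
            psi p (statePath p z (A · ω) (W · ω) n)) ω ∂P)) :=
          add_le_add h3 (h2.trans h4)
      _ ≤ ∫⁻ ω, X ω ∂P + (∫⁻ ω, Y (infVal p ν r q) ω ∂P + (ε + baseConst p r q * _)) :=
          add_le_add le_rfl (add_le_add le_rfl (add_le_add le_rfl
            (mul_le_mul_right (htail n) _)))
      _ = _ := by simp only [add_assoc]; rfl
  refine ENNReal.le_of_forall_pos_le_add fun ε hε _ => ?_
  have hlim := (ENNReal.Tendsto.const_mul (ENNReal.Tendsto.const_mul (hT1.add hT2) (Or.inr hC))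
    (Or.inr hK)).const_add (∫⁻ ω, X ω ∂P + ∫⁻ ω, Y (infVal p ν r q) ω ∂P + ε)
  simp only [add_zero, mul_zero] at hlim
  exact ge_of_tendsto' hlim (key ε (by exact_mod_cast hε.ne'))

end control

/-! ### The value function -/

section payoff

variable {p : Params} {ℱ : Filtration ℝ≥0 mΩ} {P : Measure Ω} {W₁ W₂ : ℝ≥0 → Ω → ℝ}
  {W : ℝ≥0 → Ω → ℝ × ℝ} {A : ℝ≥0 → Ω → ℝ} {c k h : ℝ≥0 → Ω → ℝ} {x y : ℝ} {r q : ℝ}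
  {ν : Measure PathSpace}

lemma lintegral_discountedUtility {ω : Ω} (hs : ∀ t, (k t ω, h t ω) =
      statePath p (x, y) (A · ω) (W · ω) t)
    (hcA : ∀ᵐ t ∂timeMeasure, c t ω = A t ω * k t ω) (D : Set ℝ≥0) :
    ∫⁻ t in D, ENNReal.ofReal (-discountedUtility p c h t ω) ∂timeMeasure =
      runCost p (x, y) (A · ω) (W · ω) D := by
  refine lintegral_congr_ae (ae_restrict_of_ae (hcA.mono fun t ht => ?_))
  have h1 := hs t
  simp only [statePath, Prod.mk.injEq] at h1
  dsimp only
  rw [flowLoss, disc, lossRate, ← ENNReal.ofReal_mul (Real.exp_pos _).le, discountedUtility, ht,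
    ← h1.1, ← h1.2]
  congr 1
  have : 1 - p.σ = -(p.σ - 1) := by ring
  rw [mul_comm, ← mul_neg, ← neg_mul, this, one_div_neg_eq_neg_one_div, neg_neg]

lemma J_eq (hcA : ∀ᵐ ω ∂P,
      (∀ t, (k t ω, h t ω) = statePath p (x, y) (A · ω) (W · ω) t) ∧
      ∀ᵐ t ∂timeMeasure, c t ω = A t ω * k t ω) :
    J p P c h = -((∫⁻ ω, runCost p (x, y) (A · ω) (W · ω) Set.univ ∂P : ℝ≥0∞)
      : EReal) := by
  rw [J]
  congr 2
  refine lintegral_congr_ae (hcA.mono fun ω hω => ?_)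
  dsimp only
  rw [← lintegral_discountedUtility hω.1 hω.2, Measure.restrict_univ]

variable [IsProbabilityMeasure P]

/-- The value function is minus the infimum of the discrete values. -/
theorem V_eq (hℱ : UsualHypotheses ℱ P) (hW : IsBM ℱ P W)
    (hWW : ∀ᵐ ω ∂P, ∀ t, W t ω = (W₁ t ω, W₂ t ω)) (hp : p.Standing) (ha1 : p.a ≤ 1)
    (hr : BaseRate p r q) (hν : IsPathLaw P ν) [SFinite ν] (hx : 0 < x) (hy : 0 < y) :
    V p ℱ P W₁ W₂ x y = -((infVal p ν r q (x, y) : ℝ≥0∞) : EReal) := by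
  refine le_antisymm (iSup_le fun c => iSup_le fun k => iSup_le fun h => iSup_le fun hc => ?_) ?_
  · obtain ⟨A, hA, hcA⟩ := hc.exists_control hℱ hW hWW hp
    have h1 := lintegral_infVal_le (ζ := fun _ => 1) (Z := fun _ => (x, y)) hW hp ha1 hr hν
      measurable_const measurable_const (fun _ => hx) (fun _ => hy) hA
    simp only [one_mul] at h1
    rw [lintegral_const, measure_univ, mul_one] at h1
    rw [J_eq hcA, EReal.neg_le_neg_iff]
    exact EReal.coe_ennreal_le_coe_ennreal_iff.2 h1
  · have h1 : Tendsto (fun n : ℕ => -((infVal p ν r q (x, y) + (n : ℝ≥0∞)⁻¹ : ℝ≥0∞) : EReal)) atTop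
        (nhds (-((infVal p ν r q (x, y) : ℝ≥0∞) : EReal))) := by
      have h2 := ENNReal.tendsto_inv_nat_nhds_zero.const_add (infVal p ν r q (x, y))
      rw [add_zero] at h2
      exact (continuous_neg.tendsto _).comp
        ((continuous_coe_ennreal_ereal.tendsto _).comp h2)
    -- For `n = 0` the tolerance is infinite and the bound is trivial.
    refine le_of_tendsto' h1 fun n => ?_
    obtain ⟨A, hA, hcost⟩ := exists_control_infVal (Z := fun _ => (x, y)) hW hp ha1 hr hν
      measurable_const (fun _ => hx) (fun _ => hy)
      (ENNReal.inv_ne_zero.2 (ENNReal.natCast_ne_top n))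
    obtain ⟨c, k, h, hc, hcA⟩ := hA.exists_admissible hW hWW hp hx hy
    have h2 := hcost (ζ := fun _ => 1) measurable_const
    simp only [one_mul] at h2
    rw [lintegral_const, measure_univ, mul_one] at h2
    refine le_trans ?_ (le_iSup_of_le c (le_iSup_of_le k (le_iSup_of_le h (le_iSup_of_le hc le_rfl))))
    rw [J_eq (.of_forall hcA), EReal.neg_le_neg_iff]
    exact EReal.coe_ennreal_le_coe_ennreal_iff.2 h2

/-- The running loss includes the time `τ` on one side and not on the other, a null set. The value
function may be replaced by `infVal` along the path because the state stays positive almost surely.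
-/
lemma stoppedPayoff_eq (hℱ : UsualHypotheses ℱ P) (hW : IsBM ℱ P W)
    (hWW : ∀ᵐ ω ∂P, ∀ t, W t ω = (W₁ t ω, W₂ t ω)) (hp : p.Standing) (ha1 : p.a ≤ 1)
    (hr : BaseRate p r q) (hν : IsPathLaw P ν) [SFinite ν]
    (hc : IsAdmissible p ℱ P W₁ W₂ x y c k h) (hcA : ∀ᵐ ω ∂P,
      (∀ t, (k t ω, h t ω) = statePath p (x, y) (A · ω) (W · ω) t) ∧
      ∀ᵐ t ∂timeMeasure, c t ω = A t ω * k t ω) (τ : Ω → WithTop ℝ≥0) :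
    stoppedPayoff p P (V p ℱ P W₁ W₂) τ c k h = -((∫⁻ ω,
      (runCost p (x, y) (A · ω) (W · ω) {t | (t : WithTop ℝ≥0) < τ ω} +
        termLoss p (infVal p ν r q) (τ ω)
          (fun t => statePath p (x, y) (A · ω) (W · ω) t)) ∂P : ℝ≥0∞)
        : EReal) := by
  rw [stoppedPayoff]
  congr 2
  refine lintegral_congr_ae ?_
  filter_upwards [hcA, hc.state_pos] with ω hω hpos
  rw [lintegral_discountedUtility hω.1 hω.2, discountedTerminalLoss]
  congr 1
  · refine setLIntegral_congr ?_
    induction τ ω using WithTop.recTopCoe with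
    | top => simp only [le_top, WithTop.coe_lt_top]; rfl
    | coe t => simp only [WithTop.coe_le_coe, WithTop.coe_lt_coe]; exact Iio_ae_eq_Iic.symm
  · split_ifs with hτ
    · rw [hτ, termLoss_top]
    · obtain ⟨t, ht⟩ := WithTop.ne_top_iff_exists.1 hτ
      have h1 : (τ ω).untop hτ = t := (WithTop.untop_eq_iff _).2 ht.symm
      rw [h1, ← ht, termLoss_coe, V_eq hℱ hW hWW hp ha1 hr hν (hpos t).1 (hpos t).2, neg_neg,
        EReal.toENNReal_coe, hω.1 t, disc]

end payoff

end

end HabitModel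

/-! ### The dynamic programming principle -/

theorem proposition4p5 {Ω : Type*} {mΩ : MeasurableSpace Ω} (P : Measure Ω)
    [IsProbabilityMeasure P] (ℱ : Filtration ℝ≥0 mΩ) (hℱ : HabitModel.UsualHypotheses ℱ P)
    (W₁ W₂ : ℝ≥0 → Ω → ℝ) (hW : HabitModel.IsBrownianPair ℱ P W₁ W₂)
    (p : HabitModel.Params) (hp : p.Standing) (hγσ : p.γ * (p.σ - 1) ≤ 1)
    (k₀ h₀ : ℝ) (hk₀ : 0 < k₀) (hh₀ : 0 < h₀)
    (τ : (ℝ≥0 → Ω → ℝ) → Ω → WithTop ℝ≥0)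
    (hτ : ∀ c ∈ HabitModel.admissibleControls p ℱ P W₁ W₂ k₀ h₀, IsStoppingTime ℱ (τ c)) :
    HabitModel.V p ℱ P W₁ W₂ k₀ h₀ =
      ⨆ (c : ℝ≥0 → Ω → ℝ) (k : ℝ≥0 → Ω → ℝ) (h : ℝ≥0 → Ω → ℝ)
        (_ : HabitModel.IsAdmissible p ℱ P W₁ W₂ k₀ h₀ c k h),
        HabitModel.stoppedPayoff p P (HabitModel.V p ℱ P W₁ W₂) (τ c) c k h := by
  obtain ⟨W, hBM, hWW⟩ := hW.exists_isBM hℱ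
  obtain ⟨r, q, hr⟩ := HabitModel.exists_baseRate hp
  have hν := hBM.isPathLaw
  have ha1 : p.a ≤ 1 := hγσ
  -- Both inequalities are proved one control at a time: the payoff of `c` is at most its stopped
  -- payoff, and each stopped payoff is at most the value. Hence `τ` may depend on the control.
  refine le_antisymm (iSup_mono fun c => iSup_mono fun k => iSup_mono fun h => iSup_mono fun hc => ?_)
    (iSup_le fun c => iSup_le fun k => iSup_le fun h => iSup_le fun hc => ?_)
  · obtain ⟨A, hA, hcA⟩ := hc.exists_control hℱ hBM hWW hp
    rw [HabitModel.stoppedPayoff_eq hℱ hBM hWW hp ha1 hr hν hc hcA, HabitModel.J_eq hcA,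
      EReal.neg_le_neg_iff, EReal.coe_ennreal_le_coe_ennreal_iff]
    exact HabitModel.lintegral_stopped_le (Z := fun _ => (k₀, h₀)) hBM hp ha1 hr hν measurable_const
      (fun _ => hk₀) (fun _ => hh₀) hA (hτ c ⟨k, h, hc⟩)
  · obtain ⟨A, hA, hcA⟩ := hc.exists_control hℱ hBM hWW hp
    rw [HabitModel.stoppedPayoff_eq hℱ hBM hWW hp ha1 hr hν hc hcA,
      HabitModel.V_eq hℱ hBM hWW hp ha1 hr hν hk₀ hh₀, EReal.neg_le_neg_iff,
      EReal.coe_ennreal_le_coe_ennreal_iff]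
    exact HabitModel.infVal_le_lintegral_stopped hBM hp ha1 hr hν hk₀ hh₀ hA (hτ c ⟨k, h, hc⟩)
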